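/- **Setting.** Let $N\ge 2$, let $\hbar\in\mathbb C$ be such that $q=e^{\hbar}$ is not a root of unity ($q^a:=e^{\hbar a}$), and let $p$ be an indeterminate. Let $\bar{\mathfrak h}^*=\{\sum_j a_j\epsilon_j\mid a_j\in\mathbb C,\ \sum_j a_j=0\}$ with the form $(\epsilon_j,\epsilon_k)=\delta_{jk}$, $\bar\epsilon_j=\epsilon_j-\frac1N\sum_k\epsilon_k$ and $\alpha_j=\bar\epsilon_j-\bar\epsilon_{j+1}$. Let $\mathcal M$ be the field of meromorphic functions on $\bar{\mathfrak h}^*$, and $\mathbb F$ the field of meromorphic functions $g(P+h,P)$ on $\bar{\mathfrak h}^*\times\bar{\mathfrak h}^*$; the coordinates of the two factors are $(P+h)_{\bar\epsilon_j}$ and $P_{\bar\epsilon_j}$, and for $X\in\mathbb C^N$ we put $P_X=\sum_j X_jP_{\bar\epsilon_j}$, $(P+h)_X=\sum_jX_j(P+h)_{\bar\epsilon_j}$, $\langle\alpha,(P+h)_X\rangle=\langle\alpha,P_X\rangle=\sum_jX_j\alpha_j$, $(P+h)_{j,l}=(P+h)_{\bar\epsilon_j}-(P+h)_{\bar\epsilon_l}$,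 $P_{j,l}=P_{\bar\epsilon_j}-P_{\bar\epsilon_l}$ and $h=(P+h)-P$. Let $p^*=pq^{-2c}$, where $q^{\pm c/2}$ is a central generator, $(x;t_1,\dots,t_k)_\infty=\prod_{n_i\ge0}(1-xt_1^{n_1}\cdots t_k^{n_k})$ (its expansion coefficients being continued as rational functions of $q$), $\{z\}=(z;p,q^{2N})_\infty$, $\Theta_p(z)=(z;p)_\infty(p/z;p)_\infty(p;p)_\infty$ and $\delta(z)=\sum_{n\in\mathbb Z}z^n$; a star on a function replaces $p$ by $p^*$. Both algebras below are $p$-adically complete and separated $\mathbb C[[p]]$-algebras, namely the quotient of the $p$-adically completed free algebra by the closed two-sided ideal of the relations. Both contain among their generators the functions in $\mathbb F$ (with the relations of the $\mathbb C$-algebra $\mathbb F$), the central invertible element $q^{c/2}$, and $\widehat d$ with $[\widehat d,\mathbb F]=0$. A generator $x$ is said to have weight $(\alpha,\beta)$ and degree $m$ if $g(P+h,P)\,x=x\,g(P+h+\alpha,P+\beta)$ for all $g\in\mathbb F$, and $[\widehat d,x]=m\,x$. All relations are between formal Laurent series, coefficient by coefficient. **The algebra $\mathcal U=U_{q,p}(\widehat{\mathfrak{gl}}_N)$.**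 Further generators: $e_{j,m}$ of weight $(0,-\alpha_j)$, $f_{j,m}$ of weight $(-\alpha_j,0)$ ($1\le j\le N-1$), and $k_{l,m}$ of weight $(-\bar\epsilon_l,-\bar\epsilon_l)$ ($1\le l\le N$), $m\in\mathbb Z$, all of degree $m$, with $k_{l,0}$ invertible. Put $e_j(z)=\sum_m e_{j,m}z^{-m}$, $f_j(z)=\sum_m f_{j,m}z^{-m}$, $k_l^+(z)=\sum_{m\ge0}k_{l,-m}z^m+\sum_{m>0}k_{l,m}p^mz^{-m}$, $k_l^-(z)=q^{2h_{\bar\epsilon_l}}k_l^+(zp^*q^c)$ and $$\rho_+^+(z)=\frac{\{q^2z\}^*\{q^{2N-2}z\}^*\{z\}\{q^{2N}z\}}{\{z\}^*\{q^{2N}z\}^*\{q^2z\}\{q^{2N-2}z\}},\qquad \kappa=\frac{(p;p)_\infty(p^*q^2;p^*)_\infty}{(p^*;p^*)_\infty(pq^2;p)_\infty}.$$ For series $a,b$ and $P\in\{p,p^*\}$ write $\left[\begin{smallmatrix}a\\ b\end{smallmatrix}\right]_P=(a;P)_\infty/(b;P)_\infty$, expanded in nonnegative powers of the ratio of variables that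 occurs in it, and put $x=z_1/z_2$, $y=z_2/z_1$. The relations are * $\rho_+^+(y)k_l^+(z_1)k_l^+(z_2)=\rho_+^+(x)k_l^+(z_2)k_l^+(z_1)$; * $\rho_+^+(y)\left[\begin{smallmatrix}p^*y\\p^*q^2y\end{smallmatrix}\right]_{p^*}\left[\begin{smallmatrix}pq^2y\\py\end{smallmatrix}\right]_{p}k_j^+(z_1)k_l^+(z_2)=\rho_+^+(x)\left[\begin{smallmatrix}q^{-2}x\\x\end{smallmatrix}\right]_{p^*}\left[\begin{smallmatrix}x\\q^{-2}x\end{smallmatrix}\right]_{p}k_l^+(z_2)k_j^+(z_1)$ for $j<l$; * $\left[\begin{smallmatrix}p^*q^{c+2-j}y\\p^*q^{c-j}y\end{smallmatrix}\right]_{p^*}k_j^+(z_1)e_j(z_2)=q^{-1}\left[\begin{smallmatrix}q^{-c+j}x\\q^{-c-2+j}x\end{smallmatrix}\right]_{p^*}e_j(z_2)k_j^+(z_1)$; * $\left[\begin{smallmatrix}p^*q^{c-2-j}y\\p^*q^{c-j}y\end{smallmatrix}\right]_{p^*}k_{j+1}^+(z_1)e_j(z_2)=q\left[\begin{smallmatrix}q^{-c+j}x\\q^{-c+2+j}x\end{smallmatrix}\right]_{p^*}e_j(z_2)k_{j+1}^+(z_1)$;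 * $\left[\begin{smallmatrix}pq^{-j}y\\pq^{2-j}y\end{smallmatrix}\right]_{p}k_j^+(z_1)f_j(z_2)=q\left[\begin{smallmatrix}q^{-2+j}x\\q^{j}x\end{smallmatrix}\right]_{p}f_j(z_2)k_j^+(z_1)$; * $\left[\begin{smallmatrix}pq^{-j}y\\pq^{-2-j}y\end{smallmatrix}\right]_{p}k_{j+1}^+(z_1)f_j(z_2)=q^{-1}\left[\begin{smallmatrix}q^{2+j}x\\q^{j}x\end{smallmatrix}\right]_{p}f_j(z_2)k_{j+1}^+(z_1)$; * $k_l^+(z_1)$ commutes with $e_j(z_2)$ and $f_j(z_2)$ if $l\ne j,j+1$; * $z_1\left[\begin{smallmatrix}q^{2}y\\p^*q^{-2}y\end{smallmatrix}\right]_{p^*}e_j(z_1)e_j(z_2)=-z_2\left[\begin{smallmatrix}q^{2}x\\p^*q^{-2}x\end{smallmatrix}\right]_{p^*}e_j(z_2)e_j(z_1)$; * $z_1\left[\begin{smallmatrix}q^{-1}y\\p^*qy\end{smallmatrix}\right]_{p^*}e_j(z_1)e_{j+1}(z_2)=-z_2\left[\begin{smallmatrix}q^{-1}x\\p^*qx\end{smallmatrix}\right]_{p^*}e_{j+1}(z_2)e_j(z_1)$;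 * $z_1\left[\begin{smallmatrix}q^{-2}y\\pq^{2}y\end{smallmatrix}\right]_{p}f_j(z_1)f_j(z_2)=-z_2\left[\begin{smallmatrix}q^{-2}x\\pq^{2}x\end{smallmatrix}\right]_{p}f_j(z_2)f_j(z_1)$; * $z_1\left[\begin{smallmatrix}qy\\pq^{-1}y\end{smallmatrix}\right]_{p}f_j(z_1)f_{j+1}(z_2)=-z_2\left[\begin{smallmatrix}qx\\pq^{-1}x\end{smallmatrix}\right]_{p}f_{j+1}(z_2)f_j(z_1)$; * $[e_i(z_1),e_j(z_2)]=0=[f_i(z_1),f_j(z_2)]$ for $|i-j|>1$; * $[e_i(z_1),f_j(z_2)]=\frac{\delta_{ij}\kappa}{q-q^{-1}}\bigl(\delta(q^{-c}x)k_j^-(q^{-j}z_1)k_{j+1}^-(q^{-j}z_1)^{-1}-\delta(q^{c}x)k_j^+(q^{-j}z_2)k_{j+1}^+(q^{-j}z_2)^{-1}\bigr)$; * for $|i-j|=1$, with $H(u)=\left[\begin{smallmatrix}p^*q^{-1}u\\p^*qu\end{smallmatrix}\right]_{p^*}$: $\left[\begin{smallmatrix}p^*q^{2}y\\p^*q^{-2}y\end{smallmatrix}\right]_{p^*}\bigl\{H(\tfrac{z_1}w)H(\tfrac{z_2}w)e_j(w)e_i(z_1)e_i(z_2)-(q+q^{-1})H(\tfrac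 w{z_1})H(\tfrac{z_2}w)e_i(z_1)e_j(w)e_i(z_2)+H(\tfrac w{z_1})H(\tfrac w{z_2})e_i(z_1)e_i(z_2)e_j(w)\bigr\}+(z_1\leftrightarrow z_2)=0$, and the same with $e,p^*,q^{\pm1},q^{\pm2}$ replaced by $f,p,q^{\mp1},q^{\mp2}$ in the infinite products. **The algebra $\mathcal E=E_{q,p}(\widehat{\mathfrak{gl}}_N)$.** Further generators: $\bar L_{ij,m}$ ($1\le i,j\le N$, $m\in\mathbb Z$) of weight $(-\bar\epsilon_i,-\bar\epsilon_j)$ and degree $m$. With $L^+_{ij}(z)=\sum_m p^{\max(m,0)}\bar L_{ij,m}z^{-m}$ the relations are $$R^{+(12)}(z_1/z_2,P+h)L^{+(1)}(z_1)L^{+(2)}(z_2)=L^{+(2)}(z_2)L^{+(1)}(z_1)R^{+*(12)}(z_1/z_2,P),$$ where $R^+(z,s)=\rho^+(z)\bigl(\sum_jE_{jj}\otimes E_{jj}+\sum_{j<l}(b(z,s_{j,l})E_{jj}\otimes E_{ll}+\bar b(z)E_{ll}\otimes E_{jj}+c(z,s_{j,l})E_{jl}\otimes E_{lj}+c(z,-s_{j,l})E_{lj}\otimes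 E_{jl})\bigr)$, $$\rho^+(z)=q^{-\frac{N-1}N}\frac{\{q^2z\}\{q^{2N-2}z\}\{p/z\}\{pq^{2N}/z\}}{\{z\}\{q^{2N}z\}\{pq^2/z\}\{pq^{2N-2}/z\}},\quad b(z,s)=q\frac{\Theta_p(q^{2}q^{2s})\Theta_p(q^{-2}q^{2s})\Theta_p(z)}{\Theta_p(q^{2s})^2\Theta_p(q^2z)},\quad \bar b(z)=q\frac{\Theta_p(z)}{\Theta_p(q^2z)},\quad c(z,s)=\frac{\Theta_p(q^2)\Theta_p(q^{2s}z)}{\Theta_p(q^{2s})\Theta_p(q^2z)},$$ expanded as power series in $z$ and $p/z$. **Theorem.** Let $\mathcal A$ be $\mathcal U$ or $\mathcal E$. For $\alpha,\beta\in\bar{\mathfrak h}^*$ put $$\mathcal A_{\alpha\beta}=\{a\in\mathcal A\mid q^{(P+h)_X}aq^{-(P+h)_X}=q^{\langle\alpha,(P+h)_X\rangle}a,\ q^{P_X}aq^{-P_X}=q^{\langle\beta,P_X\rangle}a\ \ \forall X\in\mathbb C^N\}.$$ Then $\mathcal A$ is a topological $H$-algebra: 1. $1\in\mathcal A_{00}$,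 $\mathcal A_{\alpha\beta}\mathcal A_{\gamma\delta}\subseteq\mathcal A_{\alpha+\gamma,\beta+\delta}$, and $\mathcal A$ is the $p$-adically completed direct sum of the $\mathcal A_{\alpha\beta}$: every $a\in\mathcal A$ is the $p$-adically convergent sum of a unique family of components $a_{\alpha\beta}\in\mathcal A_{\alpha\beta}$; 2. the moment maps $\mu_l(f)=f(P+h,p)=\sum_nf_n(P+h)p^n$ and $\mu_r(f)=f(P,p^*)=\sum_nf_n(P)p^{*n}$, for $f=\sum_nf_np^n\in\mathcal M[[p]]$, are injective $\mathbb C$-algebra homomorphisms $\mathcal M[[p]]\to\mathcal A_{00}$; 3. $\mu_l(f)a=a\,\mu_l(T_\alpha f)$ and $\mu_r(f)a=a\,\mu_r(T_\beta f)$ for $a\in\mathcal A_{\alpha\beta}$ and $f\in\mathcal M[[p]]$, where $(T_\alpha f)(\lambda)=f(\lambda+\alpha)$ coefficientwise. Moreover $\bar L_{ij,m}\in\mathcal E_{-\bar\epsilon_i,-\bar\epsilon_j}$ for all $i,j,m$. -/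

import Mathlib

noncomputable section

namespace EllQG

/-! ### Meromorphic functions

On a finite dimensional complex vector space every meromorphic function is a global quotient of
two entire functions, so the field of meromorphic functions is the fraction field of the domain of
entire functions. -/

section Meromorphic

/-- The algebra of entire functions on the complex vector space `V`. -/
def Entire (V : Type*) [NormedAddCommGroup V] [NormedSpace ℂ V] : Subalgebra ℂ (V → ℂ) where
  carrier := {f | AnalyticOnNhd ℂ f Set.univ}
  mul_mem' := fun ha hb => ha.mul hb
  add_mem' := fun ha hb => ha.add hb
  algebraMap_mem' := fun _ => analyticOnNhd_const

variable {V W : Type*} [NormedAddCommGroup V] [NormedSpace ℂ V]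
  [NormedAddCommGroup W] [NormedSpace ℂ W]

theorem Entire.analytic (f : Entire V) : AnalyticOnNhd ℂ (f : V → ℂ) Set.univ := f.2

instance Entire.instIsDomain : IsDomain (Entire V) := by
  have : Nontrivial (Entire V) := by
    refine ⟨⟨0, 1, fun h => ?_⟩⟩
    have := congrFun (congrArg Subtype.val h) 0
    simp at this
  have : NoZeroDivisors (Entire V) := by
    refine ⟨fun {f g} hfg => ?_⟩
    by_cases hf : f = 0
    · exact Or.inl hf
    refine Or.inr ?_
    have hx : ∃ x, (f : V → ℂ) x ≠ 0 := by
      by_contra hcon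
      push Not at hcon
      exact hf (Subtype.ext (funext hcon))
    obtain ⟨x, hx⟩ := hx
    have hcont : ContinuousAt (f : V → ℂ) x := (Entire.analytic f x (Set.mem_univ x)).continuousAt
    have hev : (g : V → ℂ) =ᶠ[nhds x] fun _ => 0 := by
      filter_upwards [hcont.eventually_ne hx] with y hy
      have := congrFun (congrArg Subtype.val hfg) y
      exact (mul_eq_zero.mp this).resolve_left hy
    exact Subtype.ext ((Entire.analytic g).eq_of_eventuallyEq analyticOnNhd_const hev)
  exact NoZeroDivisors.to_isDomain _

/-- The field of meromorphic functions on `V`. -/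
def Mero (V : Type*) [NormedAddCommGroup V] [NormedSpace ℂ V] : Type _ :=
  FractionRing (Entire V)

instance Mero.instField : Field (Mero V) := inferInstanceAs (Field (FractionRing (Entire V)))

instance Mero.instAlgebraEntire : Algebra (Entire V) (Mero V) :=
  inferInstanceAs (Algebra (Entire V) (FractionRing (Entire V)))

instance Mero.instIsFractionRing : IsFractionRing (Entire V) (Mero V) :=
  inferInstanceAs (IsFractionRing (Entire V) (FractionRing (Entire V)))

instance Mero.instAlgebra : Algebra ℂ (Mero V) :=
  ((algebraMap (Entire V) (Mero V)).comp (algebraMap ℂ (Entire V))).toAlgebra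

instance Mero.instIsScalarTower : IsScalarTower ℂ (Entire V) (Mero V) :=
  IsScalarTower.of_algebraMap_eq fun _ => rfl

/-- Pullback of entire functions along an analytic map. -/
def Entire.comap (φ : W → V) (hφ : AnalyticOnNhd ℂ φ Set.univ) : Entire V →ₐ[ℂ] Entire W where
  toFun f := ⟨fun w => (f : V → ℂ) (φ w), (Entire.analytic f).comp hφ (fun _ _ => Set.mem_univ _)⟩
  map_one' := rfl
  map_mul' _ _ := rfl
  map_zero' := rfl
  map_add' _ _ := rfl
  commutes' _ := rfl

theorem Entire.comap_injective (φ : W → V) (hφ : AnalyticOnNhd ℂ φ Set.univ)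
    (hs : Function.Surjective φ) : Function.Injective (Entire.comap φ hφ) := by
  intro f g h
  refine Subtype.ext (funext fun v => ?_)
  obtain ⟨w, rfl⟩ := hs v
  exact congrFun (congrArg Subtype.val h) w

/-- Pullback of meromorphic functions along a surjective analytic map. -/
def Mero.comap (φ : W → V) (hφ : AnalyticOnNhd ℂ φ Set.univ) (hs : Function.Surjective φ) :
    Mero V →+* Mero W :=
  IsFractionRing.map (j := (Entire.comap φ hφ : Entire V →+* Entire W))
    (Entire.comap_injective φ hφ hs)

/-- The shift automorphism `(T_α f)(λ) = f(λ + α)`. -/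
def Mero.shift (α : V) : Mero V →+* Mero V :=
  Mero.comap (fun v => v + α) (analyticOnNhd_id.add analyticOnNhd_const)
    (fun v => ⟨v - α, sub_add_cancel v α⟩)

/-- A function of the first variable, regarded as a function of both variables. -/
def Mero.fst : Mero V →+* Mero (V × V) :=
  Mero.comap Prod.fst (fun _ _ => analyticAt_fst) Prod.fst_surjective

/-- A function of the second variable, regarded as a function of both variables. -/
def Mero.snd : Mero V →+* Mero (V × V) :=
  Mero.comap Prod.snd (fun _ _ => analyticAt_snd) Prod.snd_surjective

end Meromorphic

/-! ### `𝓗`-algebras in the `p`-adic topology -/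

section HAlgebra

/-- The family `c` sums to `a` in the `p`-adic topology of `A` (`p` central). -/
def HasPadicSum {A ι : Type*} [Ring A] (p : A) (c : ι → A) (a : A) : Prop :=
  ∀ n : ℕ, ∃ F₀ : Finset ι, ∀ F : Finset ι, F₀ ⊆ F → ∃ y : A, a - ∑ i ∈ F, c i = p ^ n * y

/-- The structure of a topological `𝓗`-algebra on the `ℂ`-algebra `A` with its `p`-adic topology:
a bigrading over `V = 𝓗*` (every element is the `p`-adically convergent sum of a unique family of
bihomogeneous components), and two embeddings `μl`, `μr` (the moment maps) into the component of
bidegree `(0, 0)`. The source of the moment maps is the ring `𝓜[[p]]` of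
formal power series `f(λ, p)` in `p` with meromorphic coefficients on `𝓗*`; the constant power
series form the field `𝓜` itself. -/
structure HAlgebra (V A : Type*) [NormedAddCommGroup V] [NormedSpace ℂ V] [Ring A] [Algebra ℂ A]
    (p : A) where
  comp : V → V → Submodule ℂ A
  one_mem : (1 : A) ∈ comp 0 0
  mul_mem : ∀ {α β γ δ : V} {a b : A}, a ∈ comp α β → b ∈ comp γ δ →
    a * b ∈ comp (α + γ) (β + δ)
  decomp : ∀ a : A, ∃! c : V × V → A, (∀ w, c w ∈ comp w.1 w.2) ∧ HasPadicSum p c a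
  μl : PowerSeries (Mero V) →ₐ[ℂ] A
  μr : PowerSeries (Mero V) →ₐ[ℂ] A
  μl_mem : ∀ f, μl f ∈ comp 0 0
  μr_mem : ∀ f, μr f ∈ comp 0 0
  μl_injective : Function.Injective μl
  μr_injective : Function.Injective μr
  μl_mul : ∀ {α β : V} {a : A}, a ∈ comp α β → ∀ f,
    μl f * a = a * μl (PowerSeries.map (Mero.shift α) f)
  μr_mul : ∀ {α β : V} {a : A}, a ∈ comp α β → ∀ f,
    μr f * a = a * μr (PowerSeries.map (Mero.shift β) f)

end HAlgebra

/-! ### Weights and dynamical parameters -/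

section Weights

/-- The space `𝔥̄* = {∑ a_j ε_j | ∑ a_j = 0}` spanned by the `ε̄_j`. -/
def sumZero (N : ℕ) : Submodule ℂ (Fin N → ℂ) where
  carrier := {a | ∑ i, a i = 0}
  add_mem' := fun {a b} ha hb => by
    simp only [Set.mem_ofPred_eq, Pi.add_apply, Finset.sum_add_distrib] at *
    rw [ha, hb, add_zero]
  zero_mem' := by simp
  smul_mem' := fun c a ha => by
    simp only [Set.mem_ofPred_eq, Pi.smul_apply, smul_eq_mul] at *
    rw [← Finset.mul_sum, ha, mul_zero]

/-- `𝔥̄*`. -/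
abbrev Wt (N : ℕ) : Type := sumZero N

/-- `ε̄_j = ε_j - (1/N) ∑_k ε_k`. -/
def epsBar {N : ℕ} (j : Fin N) : Wt N :=
  ⟨fun i => (if i = j then 1 else 0) - 1 / (N : ℂ), by
    have hN : (N : ℂ) ≠ 0 := by
      have := j.pos
      exact_mod_cast this.ne'
    change ∑ i, ((if i = j then (1 : ℂ) else 0) - 1 / (N : ℂ)) = 0
    simp [Finset.sum_sub_distrib, hN]⟩

/-- The field `𝓕` of meromorphic functions `g(P+h, P)` of the dynamical parameters. A point is a
pair `(x, y)`, with `(P+h)_{ε̄_j}` taking the value `x_j` and `P_{ε̄_j}` the value `y_j`. -/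
abbrev FF (N : ℕ) : Type := Mero (Wt N × Wt N)

/-- `q^{(P+h)_X + P_Y}`, `q = e^ħ`, where `(P+h)_X = ∑_j X_j (P+h)_{ε̄_j}`, `P_Y = ∑_j Y_j P_{ε̄_j}`. -/
def expFn {N : ℕ} (ħ : ℂ) (X Y : Fin N → ℂ) : FF N :=
  algebraMap (Entire (Wt N × Wt N)) (FF N)
    ⟨fun v => Complex.exp (ħ * (∑ i, X i * (v.1 : Fin N → ℂ) i + ∑ i, Y i * (v.2 : Fin N → ℂ) i)),
      by
        have h1 : ∀ i : Fin N, AnalyticOnNhd ℂ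
            (fun v : Wt N × Wt N => (v.1 : Fin N → ℂ) i) Set.univ := fun i =>
          (((ContinuousLinearMap.proj (R := ℂ) (φ := fun _ : Fin N => ℂ) i).comp
            (sumZero N).subtypeL).comp (ContinuousLinearMap.fst ℂ (Wt N) (Wt N))).analyticOnNhd _
        have h2 : ∀ i : Fin N, AnalyticOnNhd ℂ
            (fun v : Wt N × Wt N => (v.2 : Fin N → ℂ) i) Set.univ := fun i =>
          (((ContinuousLinearMap.proj (R := ℂ) (φ := fun _ : Fin N => ℂ) i).comp
            (sumZero N).subtypeL).comp (ContinuousLinearMap.snd ℂ (Wt N) (Wt N))).analyticOnNhd _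
        have h3 : AnalyticOnNhd ℂ (fun v : Wt N × Wt N =>
            ħ * (∑ i, X i * (v.1 : Fin N → ℂ) i + ∑ i, Y i * (v.2 : Fin N → ℂ) i)) Set.univ :=
          analyticOnNhd_const.mul
            ((Finset.analyticOnNhd_fun_sum _ fun i _ => analyticOnNhd_const.mul (h1 i)).add
              (Finset.analyticOnNhd_fun_sum _ fun i _ => analyticOnNhd_const.mul (h2 i)))
        exact h3.cexp⟩

/-- The coordinate vector `X` with `P_X = P_{ε̄_j}`. -/
def unitVec {N : ℕ} (j : Fin N) : Fin N → ℂ := Pi.single j 1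

end Weights

/-! ### The dynamical free algebra -/

section Dynamical

/-- Generators: the functions `g(P+h, P)`, `q^{±c/2}`, the grading operator `d̂`, and `G`. -/
inductive DynGen (N : ℕ) (G : Type) : Type
  | fn (g : FF N) : DynGen N G
  | cHalf : DynGen N G
  | cHalfInv : DynGen N G
  | dHat : DynGen N G
  | gen (x : G) : DynGen N G

variable {N : ℕ} {G : Type}

/-- Relations: `𝓕` is embedded as a `ℂ`-algebra, `q^{c/2}` is central and invertible, `d̂` commutes
with `𝓕`, a generator `x ∈ G` of weight `(α, β)` and degree `m` satisfies
`g(P+h, P) x = x g(P+h+⟨α,P+h⟩, P+⟨β,P⟩)` and `[d̂, x] = m x`, and `x y = 1` for `inv x y`. -/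
inductive DynRel (wt : G → Wt N × Wt N) (deg : G → ℤ) (inv : G → G → Prop) :
    FreeAlgebra ℂ (DynGen N G) → FreeAlgebra ℂ (DynGen N G) → Prop
  | fn_add (f g : FF N) : DynRel wt deg inv (FreeAlgebra.ι ℂ (.fn (f + g)))
      (FreeAlgebra.ι ℂ (.fn f) + FreeAlgebra.ι ℂ (.fn g))
  | fn_mul (f g : FF N) : DynRel wt deg inv (FreeAlgebra.ι ℂ (.fn (f * g)))
      (FreeAlgebra.ι ℂ (.fn f) * FreeAlgebra.ι ℂ (.fn g))
  | fn_const (a : ℂ) : DynRel wt deg inv (FreeAlgebra.ι ℂ (.fn (algebraMap ℂ (FF N) a)))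
      (algebraMap ℂ _ a)
  | c_mul_inv : DynRel wt deg inv (FreeAlgebra.ι ℂ .cHalf * FreeAlgebra.ι ℂ .cHalfInv) 1
  | c_inv_mul : DynRel wt deg inv (FreeAlgebra.ι ℂ .cHalfInv * FreeAlgebra.ι ℂ .cHalf) 1
  | c_central (x : DynGen N G) : DynRel wt deg inv
      (FreeAlgebra.ι ℂ .cHalf * FreeAlgebra.ι ℂ x) (FreeAlgebra.ι ℂ x * FreeAlgebra.ι ℂ .cHalf)
  | d_fn (g : FF N) : DynRel wt deg inv
      (FreeAlgebra.ι ℂ .dHat * FreeAlgebra.ι ℂ (.fn g))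
      (FreeAlgebra.ι ℂ (.fn g) * FreeAlgebra.ι ℂ .dHat)
  | shift (g : FF N) (x : G) : DynRel wt deg inv
      (FreeAlgebra.ι ℂ (.fn g) * FreeAlgebra.ι ℂ (.gen x))
      (FreeAlgebra.ι ℂ (.gen x) * FreeAlgebra.ι ℂ (.fn (Mero.shift (wt x) g)))
  | d_gen (x : G) : DynRel wt deg inv
      (FreeAlgebra.ι ℂ .dHat * FreeAlgebra.ι ℂ (.gen x))
      (FreeAlgebra.ι ℂ (.gen x) * FreeAlgebra.ι ℂ .dHat + deg x • FreeAlgebra.ι ℂ (.gen x))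
  | inverse (x y : G) (h : inv x y) : DynRel wt deg inv
      (FreeAlgebra.ι ℂ (.gen x) * FreeAlgebra.ι ℂ (.gen y)) 1

/-- The `ℂ`-algebra with the above generators and relations. -/
abbrev DynAlg (wt : G → Wt N × Wt N) (deg : G → ℤ) (inv : G → G → Prop) : Type :=
  RingQuot (DynRel wt deg inv)

variable (wt : G → Wt N × Wt N) (deg : G → ℤ) (inv : G → G → Prop)

/-- The image of a generator. -/
def dyn (x : DynGen N G) : DynAlg wt deg inv :=
  RingQuot.mkAlgHom ℂ (DynRel wt deg inv) (FreeAlgebra.ι ℂ x)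

/-- The element `g(P+h, P)` of the dynamical algebra. -/
def dynFn : FF N →+* DynAlg wt deg inv where
  toFun g := dyn wt deg inv (.fn g)
  map_one' := by
    have h := RingQuot.mkAlgHom_rel ℂ (DynRel.fn_const (wt := wt) (deg := deg) (inv := inv) 1)
    rw [map_one, map_one, map_one] at h
    exact h
  map_mul' f g := by
    have h := RingQuot.mkAlgHom_rel ℂ (DynRel.fn_mul (wt := wt) (deg := deg) (inv := inv) f g)
    rw [map_mul] at h
    exact h
  map_zero' := by
    have h := RingQuot.mkAlgHom_rel ℂ (DynRel.fn_const (wt := wt) (deg := deg) (inv := inv) 0)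
    rw [map_zero, map_zero, map_zero] at h
    exact h
  map_add' f g := by
    have h := RingQuot.mkAlgHom_rel ℂ (DynRel.fn_add (wt := wt) (deg := deg) (inv := inv) f g)
    rw [map_add] at h
    exact h

/-- The central unit `q^{c/2}`. -/
def dynC : (DynAlg wt deg inv)ˣ where
  val := dyn wt deg inv .cHalf
  inv := dyn wt deg inv .cHalfInv
  val_inv := by
    have h := RingQuot.mkAlgHom_rel ℂ (DynRel.c_mul_inv (wt := wt) (deg := deg) (inv := inv))
    rw [map_mul, map_one] at h
    exact h
  inv_val := by
    have h := RingQuot.mkAlgHom_rel ℂ (DynRel.c_inv_mul (wt := wt) (deg := deg) (inv := inv))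
    rw [map_mul, map_one] at h
    exact h

/-- Evaluation of Laurent polynomials at `T = q^{c/2}`. -/
def dynLaurent : LaurentPolynomial ℂ →ₐ[ℂ] DynAlg wt deg inv :=
  AddMonoidAlgebra.lift ℂ (DynAlg wt deg inv) ℤ
    ((Units.coeHom (DynAlg wt deg inv)).comp (zpowersHom (DynAlg wt deg inv)ˣ (dynC wt deg inv)))

end Dynamical

/-! ### Formal calculus -/

section Formal

/-- Exponent `(a, b)` of a monomial in the two variables `X 0`, `X 1`. -/
def bideg (a b : ℕ) : Fin 2 →₀ ℕ := Finsupp.single 0 a + Finsupp.single 1 b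

variable {R : Type*}

/-- The infinite product `∏_{i ≥ 0} F i`, for factors with `F i ≡ 1` modulo total degree `i`
(so that the factors with `i > |d|` do not contribute to the coefficient at `d`). -/
def infProd [CommRing R] (F : ℕ → MvPowerSeries (Fin 2) R) : MvPowerSeries (Fin 2) R :=
  fun d => MvPowerSeries.coeff d (∏ i ∈ Finset.range (d.degree + 1), F i)

/-- `(a; P)_∞ = ∏_{i ≥ 0} (1 - a P^i)`, for `P` without constant term. -/
def qPoch [CommRing R] (a P : MvPowerSeries (Fin 2) R) : MvPowerSeries (Fin 2) R :=
  infProd fun i => 1 - a * P ^ i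

/-- The coefficient of `x^m` in `(x; t)_∞ = ∏_{i ≥ 0} (1 - x t^i)`, by Euler's formula (as a
rational function of `t`; see `tendsto_eulerCoeff` for `|t| < 1`). -/
def eulerCoeff (t : ℂ) (m : ℕ) : ℂ :=
  (-1) ^ m * t ^ (m * (m - 1) / 2) / ∏ i ∈ Finset.range m, (1 - t ^ (i + 1))

/-- `(y; t)_∞` for a complex number `t` and a power series `y` without constant term. -/
def numPoch [CommRing R] [Algebra ℂ R] (y : MvPowerSeries (Fin 2) R) (t : ℂ) :
    MvPowerSeries (Fin 2) R :=
  fun d => MvPowerSeries.coeff d (∑ m ∈ Finset.range (d.degree + 1), eulerCoeff t m • y ^ m)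

/-- `(a; P, t)_∞ = ∏_{i, k ≥ 0} (1 - a P^i t^k)` for a complex number `t` and power series `a`, `P`
without constant term. -/
def dPoch [CommRing R] [Algebra ℂ R] (a P : MvPowerSeries (Fin 2) R) (t : ℂ) :
    MvPowerSeries (Fin 2) R :=
  infProd fun i => numPoch (a * P ^ i) t

/-- `f / g` for `g` with constant term `1`. -/
def sdiv [CommRing R] (f g : MvPowerSeries (Fin 2) R) : MvPowerSeries (Fin 2) R :=
  f * MvPowerSeries.invOfUnit g 1

/-- The sum of a family of power series in `p` of which, for each `n`, only finitely many have a
nonzero coefficient at `p^n`. -/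
def psum [Ring R] {ι : Type*} (F : ι → PowerSeries R) : PowerSeries R :=
  PowerSeries.mk fun n => ∑ᶠ i, PowerSeries.coeff n (F i)

/-- For a power series `φ` in `X 0 = z` and `X 1 = p/z`: the coefficient of `z^r`, a power series
in `p`. -/
def laurent [Ring R] (φ : MvPowerSeries (Fin 2) R) (r : ℤ) : PowerSeries R :=
  PowerSeries.mk fun n =>
    if 0 ≤ (n : ℤ) + r then MvPowerSeries.coeff (bideg ((n : ℤ) + r).toNat n) φ else 0

/-- For a power series `φ` in `X 0 = p u` and `X 1 = u⁻¹`: the coefficient of `u^r`, a power series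
in `p`. -/
def laurentMinus [Ring R] (φ : MvPowerSeries (Fin 2) R) (r : ℤ) : PowerSeries R :=
  PowerSeries.mk fun n =>
    if 0 ≤ (n : ℤ) - r then MvPowerSeries.coeff (bideg n ((n : ℤ) - r).toNat) φ else 0

/-- Multiplication of the formal series `∑ A n z^n` by `z`. -/
def zmul (A : ℤ → R) : ℤ → R := fun n => A (n - 1)

/-- For `|t| < 1` Euler's formula gives the coefficients of the infinite product. -/
theorem tendsto_eulerCoeff (t : ℂ) (ht : ‖t‖ < 1) (m : ℕ) :
    Filter.Tendsto (fun K : ℕ => PowerSeries.coeff m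
      (∏ k ∈ Finset.range K, (1 - PowerSeries.C (t ^ k) * PowerSeries.X)))
      Filter.atTop (nhds (eulerCoeff t m)) := by
  set p : ℕ → PowerSeries ℂ := fun K =>
    ∏ k ∈ Finset.range K, (1 - PowerSeries.C (t ^ k) * PowerSeries.X) with hp
  have hcoef : ∀ (f : PowerSeries ℂ) (a : ℂ) (i : ℕ),
      PowerSeries.coeff (i + 1) (f * (1 - PowerSeries.C a * PowerSeries.X)) =
        PowerSeries.coeff (i + 1) f - a * PowerSeries.coeff i f := by
    intro f a i
    rw [mul_sub, mul_one, map_sub, mul_left_comm, PowerSeries.coeff_C_mul,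
      PowerSeries.coeff_succ_mul_X]
  have h1 : ∀ K i, PowerSeries.coeff (i + 1) (p (K + 1)) =
      PowerSeries.coeff (i + 1) (p K) - t ^ K * PowerSeries.coeff i (p K) := by
    intro K i
    rw [hp]
    simp only [Finset.prod_range_succ]
    exact hcoef _ _ _
  have hre : ∀ K, ∏ k ∈ Finset.range K, (1 - PowerSeries.C (t ^ (k + 1)) * PowerSeries.X) =
      PowerSeries.rescale t (p K) := by
    intro K
    rw [hp]
    simp only [map_prod, map_sub, map_one, map_mul, PowerSeries.rescale_X]
    refine Finset.prod_congr rfl fun k _ => ?_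
    have : PowerSeries.rescale t (PowerSeries.C (t ^ k)) = PowerSeries.C (t ^ k) := by
      ext i
      rw [PowerSeries.coeff_rescale, PowerSeries.coeff_C]
      split_ifs with h
      · simp [h]
      · simp
    rw [this, ← mul_assoc, ← map_mul, pow_succ]
  have h2 : ∀ K i, PowerSeries.coeff (i + 1) (p (K + 1)) =
      t ^ (i + 1) * PowerSeries.coeff (i + 1) (p K) - t ^ i * PowerSeries.coeff i (p K) := by
    intro K i
    have : p (K + 1) = PowerSeries.rescale t (p K) *
        (1 - PowerSeries.C (1 : ℂ) * PowerSeries.X) := by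
      rw [← hre, hp]
      simp only [Finset.prod_range_succ', pow_zero]
    rw [this, hcoef, PowerSeries.coeff_rescale, PowerSeries.coeff_rescale, one_mul]
  have hne : ∀ i : ℕ, (1 - t ^ (i + 1)) ≠ 0 := by
    intro i h
    have h' : ‖t ^ (i + 1)‖ = 1 := by rw [← sub_eq_zero.mp h, norm_one]
    rw [norm_pow] at h'
    exact absurd h' (pow_lt_one₀ (norm_nonneg t) ht (Nat.succ_ne_zero i)).ne
  have h3 : ∀ K i, PowerSeries.coeff (i + 1) (p K) =
      (t ^ K - t ^ i) * PowerSeries.coeff i (p K) / (1 - t ^ (i + 1)) := by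
    intro K i
    rw [eq_div_iff (hne i)]
    linear_combination (h1 K i).symm.trans (h2 K i)
  have ht0 : Filter.Tendsto (fun K : ℕ => t ^ K) Filter.atTop (nhds 0) :=
    tendsto_pow_atTop_nhds_zero_of_norm_lt_one ht
  change Filter.Tendsto (fun K : ℕ => PowerSeries.coeff m (p K)) Filter.atTop (nhds (eulerCoeff t m))
  induction m with
  | zero =>
    have : ∀ K, PowerSeries.coeff 0 (p K) = 1 := by
      intro K
      rw [hp]
      simp [PowerSeries.coeff_zero_eq_constantCoeff, map_prod]
    rw [show (fun K => PowerSeries.coeff 0 (p K)) = fun _ => (1 : ℂ) from funext this]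
    simp [eulerCoeff]
  | succ i ih =>
    have he : eulerCoeff t (i + 1) = (0 - t ^ i) * eulerCoeff t i / (1 - t ^ (i + 1)) := by
      have hexp : (i + 1) * (i + 1 - 1) / 2 = i * (i - 1) / 2 + i := Nat.triangle_succ i
      unfold eulerCoeff
      rw [hexp, Finset.prod_range_succ, pow_add, pow_succ, ← div_div]
      ring
    rw [he]
    exact (funext fun K => h3 K i) ▸ ((ht0.sub tendsto_const_nhds).mul ih).div_const _

end Formal

/-! ### Central structure functions

Power series in `x = X 0` and `p = X 1` whose coefficients are Laurent polynomials in
`T = q^{c/2}`. -/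

section Structure

/-- `ℂ[T, T⁻¹][[x, p]]`. -/
abbrev SF : Type := MvPowerSeries (Fin 2) (LaurentPolynomial ℂ)

/-- The variable `x`. -/
def sx : SF := MvPowerSeries.X 0

/-- `p`. -/
def sp : SF := MvPowerSeries.X 1

/-- `q^{k c}`. -/
def sc (k : ℤ) : SF := MvPowerSeries.C (LaurentPolynomial.T (2 * k))

/-- `p* = p q^{-2c}`. -/
def spStar : SF := sp * sc (-2)

/-- A complex number as a constant. -/
def sk (a : ℂ) : SF := MvPowerSeries.C (LaurentPolynomial.C a)

/-- `q^a = e^{ħ a}`. -/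
def qpow (ħ : ℂ) (a : ℂ) : ℂ := Complex.exp (ħ * a)

/-- `q^a` as a constant. -/
def sq (ħ a : ℂ) : SF := sk (qpow ħ a)

/-- `(a x; P)_∞ / (b x; P)_∞` as a power series in `x`. -/
def ratio (a b P : SF) : SF := sdiv (qPoch (a * sx) P) (qPoch (b * sx) P)

/-- `{a x} = (a x; p, q^{2N})_∞`. -/
def brace (ħ : ℂ) (N : ℕ) (P : SF) (a : ℂ) : SF := dPoch (sq ħ a * sx) P (qpow ħ (2 * N))

/-- `ρ⁺₊(x) = {q²x}*{q^{-2}q^{2N}x}*{x}{q^{2N}x} / ({x}*{q^{2N}x}*{q²x}{q^{-2}q^{2N}x})`. -/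
def rhoPP (ħ : ℂ) (N : ℕ) : SF :=
  sdiv (brace ħ N spStar 2 * brace ħ N spStar (-2 + 2 * N) * brace ħ N sp 0 * brace ħ N sp (2 * N))
    (brace ħ N spStar 0 * brace ħ N spStar (2 * N) * brace ħ N sp 2 * brace ħ N sp (-2 + 2 * N))

/-- `κ = (p;p)_∞ (p*q²;p*)_∞ / ((p*;p*)_∞ (pq²;p)_∞)`. -/
def kappa (ħ : ℂ) : SF :=
  sdiv (qPoch sp sp * qPoch (spStar * sq ħ 2) spStar)
    (qPoch spStar spStar * qPoch (sp * sq ħ 2) sp)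

variable {N : ℕ} {G : Type} (wt : G → Wt N × Wt N) (deg : G → ℤ) (inv : G → G → Prop)

/-- The coefficient of `x^m` of a structure function, as a power series in `p` with coefficients in
the dynamical algebra. -/
def sfCoeff (S : SF) (m : ℕ) : PowerSeries (DynAlg wt deg inv) :=
  PowerSeries.mk fun n => dynLaurent wt deg inv (MvPowerSeries.coeff (bideg m n) S)

/-- The coefficient of `z₁^a z₂^b` in `S₁(z₂/z₁) A(z₁) B(z₂) - S₂(z₁/z₂) C(z₂) D(z₁)`. -/
def exchange (S₁ S₂ : SF) (A B C D : ℤ → PowerSeries (DynAlg wt deg inv)) (a b : ℤ) :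
    PowerSeries (DynAlg wt deg inv) :=
  psum (fun m : ℕ => sfCoeff wt deg inv S₁ m * A (a + m) * B (b - m)) -
    psum (fun m : ℕ => sfCoeff wt deg inv S₂ m * C (b + m) * D (a - m))

/-- The coefficient of `z₁^a z₂^b w^c` in
`S(z₂/z₁) { H(z₁/w) H(z₂/w) Y(w) X(z₁) X(z₂) - [2]_q H(w/z₁) H(z₂/w) X(z₁) Y(w) X(z₂)
  + H(w/z₁) H(w/z₂) X(z₁) X(z₂) Y(w) }`. -/
def serreTerm (ħ : ℂ) (S H : SF) (X Y : ℤ → PowerSeries (DynAlg wt deg inv)) (a b c : ℤ) :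
    PowerSeries (DynAlg wt deg inv) :=
  psum (fun k : ℕ × ℕ × ℕ => sfCoeff wt deg inv S k.1 * sfCoeff wt deg inv H k.2.1 *
      sfCoeff wt deg inv H k.2.2 * Y (c + k.2.1 + k.2.2) * X (a + k.1 - k.2.1) *
      X (b - k.1 - k.2.2)) -
    (qpow ħ 1 + qpow ħ (-1)) •
      psum (fun k : ℕ × ℕ × ℕ => sfCoeff wt deg inv S k.1 * sfCoeff wt deg inv H k.2.1 *
        sfCoeff wt deg inv H k.2.2 * X (a + k.1 + k.2.1) * Y (c - k.2.1 + k.2.2) *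
        X (b - k.1 - k.2.2)) +
    psum (fun k : ℕ × ℕ × ℕ => sfCoeff wt deg inv S k.1 * sfCoeff wt deg inv H k.2.1 *
      sfCoeff wt deg inv H k.2.2 * X (a + k.1 + k.2.1) * X (b - k.1 + k.2.2) *
      Y (c - k.2.1 - k.2.2))

end Structure

/-! ### Topological algebras with given relations -/

section Quotient

variable {N : ℕ} {G : Type} (wt : G → Wt N × Wt N) (deg : G → ℤ) (inv : G → G → Prop)

/-- The `p`-adic closure of the two-sided ideal generated by `rel`. -/
def closedIdeal {R : Type} [Ring R] (rel : Set (PowerSeries R)) : TwoSidedIdeal (PowerSeries R) :=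
  ⨅ n : ℕ, TwoSidedIdeal.span (rel ∪ {PowerSeries.X ^ n})

variable (rel : Set (PowerSeries (DynAlg wt deg inv)))

/-- The topological algebra (complete and separated for the `p`-adic topology) with the generators
and relations of the dynamical algebra and the further relations `r = 0`, `r ∈ rel`. -/
abbrev TopAlg : Type := (closedIdeal rel).ringCon.Quotient

/-- The image in the topological algebra. -/
def TopAlg.mk : PowerSeries (DynAlg wt deg inv) →+* TopAlg wt deg inv rel :=
  (closedIdeal rel).ringCon.mk'

/-- `p`. -/
def TopAlg.p : TopAlg wt deg inv rel := TopAlg.mk wt deg inv rel PowerSeries.X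

/-- The image of a generator. -/
def TopAlg.gen (x : DynGen N G) : TopAlg wt deg inv rel :=
  TopAlg.mk wt deg inv rel (PowerSeries.C (dyn wt deg inv x))

/-- `f(P+h, p) = ∑ f_n(P+h) p^n` for `f = ∑ f_n p^n`. -/
def TopAlg.left (f : PowerSeries (Mero (Wt N))) : TopAlg wt deg inv rel :=
  TopAlg.mk wt deg inv rel (PowerSeries.mk fun n =>
    dynFn wt deg inv (Mero.fst (PowerSeries.coeff n f)))

/-- `f(P, p*) = ∑ f_n(P) p*^n`, `p* = p q^{-2c}`, for `f = ∑ f_n p^n`. -/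
def TopAlg.right (f : PowerSeries (Mero (Wt N))) : TopAlg wt deg inv rel :=
  TopAlg.mk wt deg inv rel (PowerSeries.mk fun n =>
    dynFn wt deg inv (Mero.snd (PowerSeries.coeff n f)) *
      ((dynC wt deg inv ^ (-4 * (n : ℤ)) : (DynAlg wt deg inv)ˣ) : DynAlg wt deg inv))

/-- The elements `a` with `q^{(P+h)_X} a q^{-(P+h)_X} = q^{⟨α, (P+h)_X⟩} a` and
`q^{P_X} a q^{-P_X} = q^{⟨β, P_X⟩} a` for all `X`. -/
def TopAlg.weightSpace (ħ : ℂ) (α β : Wt N) : Submodule ℂ (TopAlg wt deg inv rel) where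
  carrier := {a | ∀ X : Fin N → ℂ,
    TopAlg.gen wt deg inv rel (.fn (expFn ħ X 0)) * a *
        TopAlg.gen wt deg inv rel (.fn (expFn ħ (-X) 0)) =
      qpow ħ (∑ i, X i * (α : Fin N → ℂ) i) • a ∧
    TopAlg.gen wt deg inv rel (.fn (expFn ħ 0 X)) * a *
        TopAlg.gen wt deg inv rel (.fn (expFn ħ 0 (-X))) =
      qpow ħ (∑ i, X i * (β : Fin N → ℂ) i) • a}
  add_mem' := fun {a b} ha hb X => by
    refine ⟨?_, ?_⟩
    · rw [mul_add, add_mul, (ha X).1, (hb X).1, smul_add]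
    · rw [mul_add, add_mul, (ha X).2, (hb X).2, smul_add]
  zero_mem' := fun X => by simp
  smul_mem' := fun r a ha X => by
    refine ⟨?_, ?_⟩
    · rw [mul_smul_comm, smul_mul_assoc, (ha X).1, smul_comm]
    · rw [mul_smul_comm, smul_mul_assoc, (ha X).2, smul_comm]

end Quotient

/-! ### The elliptic algebra `U_{q,p}(gl_N^)`, `N = n + 1` -/

section Uqp

/-- The generators `e_{j,m}`, `f_{j,m}` (`j : Fin n` stands for the node `j + 1`), `k_{l,m}`
(`l : Fin (n + 1)` stands for `l + 1`), and the inverse of `k_{l,0}`. -/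
inductive UGen (n : ℕ) : Type
  | e (j : Fin n) (m : ℤ) : UGen n
  | f (j : Fin n) (m : ℤ) : UGen n
  | k (l : Fin (n + 1)) (m : ℤ) : UGen n
  | kZeroInv (l : Fin (n + 1)) : UGen n

/-- The simple root `α_j = ε̄_j - ε̄_{j+1}`. -/
def simpleRoot {n : ℕ} (j : Fin n) : Wt (n + 1) := epsBar j.castSucc - epsBar j.succ

/-- The weights of the generators. -/
def uWt {n : ℕ} : UGen n → Wt (n + 1) × Wt (n + 1)
  | .e j _ => (0, -simpleRoot j)
  | .f j _ => (-simpleRoot j, 0)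
  | .k l _ => (-epsBar l, -epsBar l)
  | .kZeroInv l => (epsBar l, epsBar l)

/-- The degrees of the generators. -/
def uDeg {n : ℕ} : UGen n → ℤ
  | .e _ m => m
  | .f _ m => m
  | .k _ m => m
  | .kZeroInv _ => 0

/-- `k_{l,0}` and `k_{l,0}⁻¹` are mutually inverse. -/
inductive UInv {n : ℕ} : UGen n → UGen n → Prop
  | mul_inv (l : Fin (n + 1)) : UInv (.k l 0) (.kZeroInv l)
  | inv_mul (l : Fin (n + 1)) : UInv (.kZeroInv l) (.k l 0)

/-- The dynamical algebra generated by the `e_{j,m}`, `f_{j,m}`, `k_{l,m}`. -/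
abbrev UDyn (n : ℕ) : Type := DynAlg (N := n + 1) (G := UGen n) uWt uDeg UInv

/-- A generator. -/
def ugen {n : ℕ} (x : UGen n) : UDyn n := dyn uWt uDeg UInv (.gen x)

/-- The unit `k_{l,0}`. -/
def ukZero {n : ℕ} (l : Fin (n + 1)) : (UDyn n)ˣ where
  val := ugen (.k l 0)
  inv := ugen (.kZeroInv l)
  val_inv := by
    have h := RingQuot.mkAlgHom_rel ℂ (DynRel.inverse (wt := uWt (n := n)) (deg := uDeg)
      (inv := UInv) _ _ (UInv.mul_inv l))
    rw [map_mul, map_one] at h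
    exact h
  inv_val := by
    have h := RingQuot.mkAlgHom_rel ℂ (DynRel.inverse (wt := uWt (n := n)) (deg := uDeg)
      (inv := UInv) _ _ (UInv.inv_mul l))
    rw [map_mul, map_one] at h
    exact h

variable {n : ℕ}

/-- The coefficients of `e_j(z) = ∑ e_{j,m} z^{-m}`. -/
def eCur (j : Fin n) (r : ℤ) : PowerSeries (UDyn n) := PowerSeries.C (ugen (.e j (-r)))

/-- The coefficients of `f_j(z) = ∑ f_{j,m} z^{-m}`. -/
def fCur (j : Fin n) (r : ℤ) : PowerSeries (UDyn n) := PowerSeries.C (ugen (.f j (-r)))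

/-- `k_l⁺(z) = ∑_{m ≥ 0} k_{l,-m} z^m + ∑_{m > 0} k_{l,m} p^m z^{-m}` as a power series in `z` and
`p/z`. -/
def kSer (l : Fin (n + 1)) : MvPowerSeries (Fin 2) (UDyn n) := fun d =>
  if d 1 = 0 then ugen (.k l (-(d 0 : ℤ))) else if d 0 = 0 then ugen (.k l (d 1 : ℤ)) else 0

/-- The coefficients of `k_l⁺(z)`. -/
def kCur (l : Fin (n + 1)) (r : ℤ) : PowerSeries (UDyn n) := laurent (kSer l) r

/-- `k_j⁺(z) k_{j+1}⁺(z)⁻¹` as a power series in `z` and `p/z`. -/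
def psiSer (j : Fin n) : MvPowerSeries (Fin 2) (UDyn n) :=
  kSer j.castSucc * MvPowerSeries.invOfUnit (kSer j.succ) (ukZero j.succ)

/-- A power `q^{k c}` in the algebra. -/
def uc (k : ℤ) : PowerSeries (UDyn n) :=
  PowerSeries.C (((dynC (N := n + 1) uWt uDeg UInv) ^ (2 * k) : (UDyn n)ˣ) : UDyn n)

/-- The coefficients of `k_j⁺(z) k_{j+1}⁺(z)⁻¹`. -/
def psiPlus (j : Fin n) (r : ℤ) : PowerSeries (UDyn n) := laurent (psiSer j) r

/-- `q^{2 h_{ε̄_l}}` and its inverse (`s = ±1`), `h = (P + h) - P`. -/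
def qTwoH (ħ : ℂ) (s : ℂ) (l : Fin (n + 1)) : PowerSeries (UDyn n) :=
  PowerSeries.C (dynFn uWt uDeg UInv
    (expFn ħ ((2 * s) • unitVec l) (-((2 * s) • unitVec l))))

/-- The coefficients of `k_j⁻(z) k_{j+1}⁻(z)⁻¹`, where
`k_l⁻(z) = q^{2 h_{ε̄_l}} k_l⁺(z p* q^c) = q^{2 h_{ε̄_l}} k_l⁺(p q^{-c} z)`. -/
def psiMinus (ħ : ℂ) (j : Fin n) (r : ℤ) : PowerSeries (UDyn n) :=
  qTwoH ħ 1 j.castSucc * (uc (-r) * laurentMinus (psiSer j) r) * qTwoH ħ (-1) j.succ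

/-- The node number `j ∈ {1, …, N - 1}`. -/
def node (j : Fin n) : ℂ := (j : ℂ) + 1

/-- The right hand side of the relation for `[e_j(z₁), f_j(z₂)]`, at `z₁^a z₂^b`:
`κ/(q - q⁻¹) · ( δ(q^{-c} z₁/z₂) k_j⁻(q^{-j} z₁) k_{j+1}⁻(q^{-j} z₁)⁻¹
  - δ(q^c z₁/z₂) k_j⁺(q^{-j} z₂) k_{j+1}⁺(q^{-j} z₂)⁻¹ )`. -/
def efRhs (ħ : ℂ) (j : Fin n) (a b : ℤ) : PowerSeries (UDyn n) :=
  (qpow ħ 1 - qpow ħ (-1))⁻¹ • (sfCoeff uWt uDeg UInv (kappa ħ) 0 *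
    (qpow ħ (-node j * (a + b)) • (uc b * psiMinus ħ j (a + b) - uc a * psiPlus j (a + b))))

/-- The defining relations `r = 0` of `U_{q,p}(gl_N^)` among the currents. -/
inductive URel (n : ℕ) (ħ : ℂ) : PowerSeries (UDyn n) → Prop
  | kk (l : Fin (n + 1)) (a b : ℤ) : URel n ħ
      (exchange uWt uDeg UInv (rhoPP ħ (n + 1)) (rhoPP ħ (n + 1))
        (kCur l) (kCur l) (kCur l) (kCur l) a b)
  | kk_lt (j l : Fin (n + 1)) (h : j < l) (a b : ℤ) : URel n ħ
      (exchange uWt uDeg UInv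
        (rhoPP ħ (n + 1) * ratio spStar (spStar * sq ħ 2) spStar * ratio (sp * sq ħ 2) sp sp)
        (rhoPP ħ (n + 1) * ratio (sq ħ (-2)) 1 spStar * ratio 1 (sq ħ (-2)) sp)
        (kCur j) (kCur l) (kCur l) (kCur j) a b)
  | ke (j : Fin n) (a b : ℤ) : URel n ħ
      (exchange uWt uDeg UInv
        (ratio (spStar * sc 1 * sq ħ (2 - node j)) (spStar * sc 1 * sq ħ (-node j)) spStar)
        (sq ħ (-1) * ratio (sc (-1) * sq ħ (node j)) (sc (-1) * sq ħ (-2 + node j)) spStar)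
        (kCur j.castSucc) (eCur j) (eCur j) (kCur j.castSucc) a b)
  | ke_succ (j : Fin n) (a b : ℤ) : URel n ħ
      (exchange uWt uDeg UInv
        (ratio (spStar * sc 1 * sq ħ (-2 - node j)) (spStar * sc 1 * sq ħ (-node j)) spStar)
        (sq ħ 1 * ratio (sc (-1) * sq ħ (node j)) (sc (-1) * sq ħ (2 + node j)) spStar)
        (kCur j.succ) (eCur j) (eCur j) (kCur j.succ) a b)
  | ke_far (j : Fin n) (l : Fin (n + 1)) (h : l ≠ j.castSucc) (h' : l ≠ j.succ) (a b : ℤ) :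
      URel n ħ (kCur l a * eCur j b - eCur j b * kCur l a)
  | kf (j : Fin n) (a b : ℤ) : URel n ħ
      (exchange uWt uDeg UInv
        (ratio (sp * sq ħ (-node j)) (sp * sq ħ (2 - node j)) sp)
        (sq ħ 1 * ratio (sq ħ (-2 + node j)) (sq ħ (node j)) sp)
        (kCur j.castSucc) (fCur j) (fCur j) (kCur j.castSucc) a b)
  | kf_succ (j : Fin n) (a b : ℤ) : URel n ħ
      (exchange uWt uDeg UInv
        (ratio (sp * sq ħ (-node j)) (sp * sq ħ (-2 - node j)) sp)
        (sq ħ (-1) * ratio (sq ħ (2 + node j)) (sq ħ (node j)) sp)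
        (kCur j.succ) (fCur j) (fCur j) (kCur j.succ) a b)
  | kf_far (j : Fin n) (l : Fin (n + 1)) (h : l ≠ j.castSucc) (h' : l ≠ j.succ) (a b : ℤ) :
      URel n ħ (kCur l a * fCur j b - fCur j b * kCur l a)
  | ee (j : Fin n) (a b : ℤ) : URel n ħ
      (exchange uWt uDeg UInv
        (ratio (sq ħ 2) (spStar * sq ħ (-2)) spStar) (-ratio (sq ħ 2) (spStar * sq ħ (-2)) spStar)
        (zmul (eCur j)) (eCur j) (zmul (eCur j)) (eCur j) a b)
  | ee_succ (i j : Fin n) (h : (j : ℕ) = i + 1) (a b : ℤ) : URel n ħ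
      (exchange uWt uDeg UInv
        (ratio (sq ħ (-1)) (spStar * sq ħ 1) spStar) (-ratio (sq ħ (-1)) (spStar * sq ħ 1) spStar)
        (zmul (eCur i)) (eCur j) (zmul (eCur j)) (eCur i) a b)
  | ee_far (i j : Fin n) (h : (i : ℕ) + 1 < j ∨ (j : ℕ) + 1 < i) (a b : ℤ) :
      URel n ħ (eCur i a * eCur j b - eCur j b * eCur i a)
  | ff (j : Fin n) (a b : ℤ) : URel n ħ
      (exchange uWt uDeg UInv
        (ratio (sq ħ (-2)) (sp * sq ħ 2) sp) (-ratio (sq ħ (-2)) (sp * sq ħ 2) sp)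
        (zmul (fCur j)) (fCur j) (zmul (fCur j)) (fCur j) a b)
  | ff_succ (i j : Fin n) (h : (j : ℕ) = i + 1) (a b : ℤ) : URel n ħ
      (exchange uWt uDeg UInv
        (ratio (sq ħ 1) (sp * sq ħ (-1)) sp) (-ratio (sq ħ 1) (sp * sq ħ (-1)) sp)
        (zmul (fCur i)) (fCur j) (zmul (fCur j)) (fCur i) a b)
  | ff_far (i j : Fin n) (h : (i : ℕ) + 1 < j ∨ (j : ℕ) + 1 < i) (a b : ℤ) :
      URel n ħ (fCur i a * fCur j b - fCur j b * fCur i a)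
  | ef_ne (i j : Fin n) (h : i ≠ j) (a b : ℤ) :
      URel n ħ (eCur i a * fCur j b - fCur j b * eCur i a)
  | ef (j : Fin n) (a b : ℤ) :
      URel n ħ (eCur j a * fCur j b - fCur j b * eCur j a - efRhs ħ j a b)
  | serre_e (i j : Fin n) (h : (j : ℕ) = i + 1 ∨ (i : ℕ) = j + 1) (a b c : ℤ) : URel n ħ
      (serreTerm uWt uDeg UInv ħ (ratio (spStar * sq ħ 2) (spStar * sq ħ (-2)) spStar)
          (ratio (spStar * sq ħ (-1)) (spStar * sq ħ 1) spStar) (eCur i) (eCur j) a b c +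
        serreTerm uWt uDeg UInv ħ (ratio (spStar * sq ħ 2) (spStar * sq ħ (-2)) spStar)
          (ratio (spStar * sq ħ (-1)) (spStar * sq ħ 1) spStar) (eCur i) (eCur j) b a c)
  | serre_f (i j : Fin n) (h : (j : ℕ) = i + 1 ∨ (i : ℕ) = j + 1) (a b c : ℤ) : URel n ħ
      (serreTerm uWt uDeg UInv ħ (ratio (sp * sq ħ (-2)) (sp * sq ħ 2) sp)
          (ratio (sp * sq ħ 1) (sp * sq ħ (-1)) sp) (fCur i) (fCur j) a b c +
        serreTerm uWt uDeg UInv ħ (ratio (sp * sq ħ (-2)) (sp * sq ħ 2) sp)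
          (ratio (sp * sq ħ 1) (sp * sq ħ (-1)) sp) (fCur i) (fCur j) b a c)

/-- The set of defining relations. -/
def uRels (n : ℕ) (ħ : ℂ) : Set (PowerSeries (UDyn n)) := {r | URel n ħ r}

/-- The elliptic algebra `U_{q,p}(gl_N^)`, `N = n + 1`, `q = e^ħ`. -/
abbrev Uqp (n : ℕ) (ħ : ℂ) : Type := TopAlg (N := n + 1) (G := UGen n) uWt uDeg UInv (uRels n ħ)

end Uqp

/-! ### The elliptic algebra `E_{q,p}(gl_N^)` -/

section Eqp

/-- `𝓕[[z, w]]` with `z = X 0`, `w = X 1 = p/z`, and `p = z w`; it is the ring of formal Laurent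
series in `z` over `𝓕[[p]]` whose coefficient at `z^{-m}` is divisible by `p^m` for `m > 0`. -/
abbrev RS (N : ℕ) : Type := MvPowerSeries (Fin 2) (FF N)

variable {N : ℕ}

/-- `z`. -/
def rz : RS N := MvPowerSeries.X 0

/-- `p/z`. -/
def rw' : RS N := MvPowerSeries.X 1

/-- `p`. -/
def rp : RS N := rz * rw'

/-- A meromorphic function as a constant. -/
def rk (a : FF N) : RS N := MvPowerSeries.C a

/-- `q^a` as a constant function. -/
def rq (ħ a : ℂ) : FF N := algebraMap ℂ (FF N) (qpow ħ a)

/-- `Θ_p(a) = (a;p)_∞ (p/a;p)_∞ (p;p)_∞` for `a` independent of `z`. -/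
def thetaConst (a : FF N) : RS N := qPoch (rk a) rp * qPoch (rk a⁻¹ * rp) rp * qPoch rp rp

/-- `Θ_p(a z) = (a z;p)_∞ (p/(a z);p)_∞ (p;p)_∞`. -/
def thetaZ (a : FF N) : RS N := qPoch (rk a * rz) rp * qPoch (rk a⁻¹ * rw') rp * qPoch rp rp

/-- `{q^a z} = (q^a z; p, q^{2N})_∞`. -/
def braceZ (ħ : ℂ) (a : ℂ) : RS N := dPoch (rk (rq ħ a) * rz) rp (qpow ħ (2 * N))

/-- `{p q^a / z} = (p q^a / z; p, q^{2N})_∞`. -/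
def braceW (ħ : ℂ) (a : ℂ) : RS N := dPoch (rk (rq ħ a) * rw') rp (qpow ħ (2 * N))

/-- `ρ⁺(z)`. -/
def rhoPlus (ħ : ℂ) : RS N :=
  rk (rq ħ (-((N : ℂ) - 1) / N)) *
    sdiv (braceZ ħ 2 * braceZ ħ (2 * N - 2) * braceW ħ 0 * braceW ħ (2 * N))
      (braceZ ħ 0 * braceZ ħ (2 * N) * braceW ħ 2 * braceW ħ (2 * N - 2))

/-- `b(z, s)` with `A = q^{2s}`. -/
def rb (ħ : ℂ) (A : FF N) : RS N :=
  rk (rq ħ 1) * (thetaConst (rq ħ 2 * A) * thetaConst (rq ħ (-2) * A) * thetaZ 1) *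
    (thetaConst A ^ 2 * thetaZ (rq ħ 2))⁻¹

/-- `b̄(z)`. -/
def rbBar (ħ : ℂ) : RS N := rk (rq ħ 1) * thetaZ 1 * (thetaZ (rq ħ 2))⁻¹

/-- `c(z, s)` with `A = q^{2s}`. -/
def rc (ħ : ℂ) (A : FF N) : RS N :=
  thetaConst (rq ħ 2) * thetaZ A * (thetaConst A * thetaZ (rq ħ 2))⁻¹

/-- The matrix element of `R⁺(z, s)` in row `(i, j)` and column `(i', j')` (the coefficient of
`E_{i i'} ⊗ E_{j j'}`), where `A j l = q^{2 s_{j,l}}`. -/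
def Rplus (ħ : ℂ) (A : Fin N → Fin N → FF N) (i j i' j' : Fin N) : RS N :=
  if i = j then (if i' = i ∧ j' = i then rhoPlus ħ else 0)
  else if i' = i ∧ j' = j then
    (if i < j then rhoPlus ħ * rb ħ (A i j) else rhoPlus ħ * rbBar ħ)
  else if i' = j ∧ j' = i then
    (if i < j then rhoPlus ħ * rc ħ (A i j) else rhoPlus ħ * rc ħ (A j i)⁻¹)
  else 0

/-- `q^{2 (P+h)_{j,l}}`. -/
def qTwoPh (ħ : ℂ) (j l : Fin N) : FF N := expFn ħ ((2 : ℂ) • (unitVec j - unitVec l)) 0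

/-- `q^{2 P_{j,l}}`. -/
def qTwoP (ħ : ℂ) (j l : Fin N) : FF N := expFn ħ 0 ((2 : ℂ) • (unitVec j - unitVec l))

/-- The generators `L̄_{ij,m}`. -/
structure LGen (N : ℕ) : Type where
  i : Fin N
  j : Fin N
  m : ℤ

/-- The weights of the generators. -/
def lWt (x : LGen N) : Wt N × Wt N := (-epsBar x.i, -epsBar x.j)

/-- The degrees of the generators. -/
def lDeg (x : LGen N) : ℤ := x.m

/-- No further inverses. -/
def lInv (_ _ : LGen N) : Prop := False

/-- The dynamical algebra generated by the `L̄_{ij,m}`. -/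
abbrev LDyn (N : ℕ) : Type := DynAlg (N := N) (G := LGen N) lWt lDeg lInv

/-- The coefficients of `L⁺_{ij}(z) = ∑ p^{max(m,0)} L̄_{ij,m} z^{-m}`. -/
def lCur (i j : Fin N) (r : ℤ) : PowerSeries (LDyn N) :=
  PowerSeries.C (dyn lWt lDeg lInv (.gen ⟨i, j, -r⟩)) * PowerSeries.X ^ (-r).toNat

/-- The coefficient of `z^r` in the matrix element of `R⁺(z, P+h)`. -/
def RLeft (ħ : ℂ) (i j i' j' : Fin N) (r : ℤ) : PowerSeries (LDyn N) :=
  PowerSeries.mk fun n => dynFn lWt lDeg lInv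
    (PowerSeries.coeff n (laurent (Rplus ħ (qTwoPh ħ) i j i' j') r))

/-- The coefficient of `z^r` in the matrix element of `R^{+*}(z, P)`, obtained from `R⁺(z, P)` by
replacing `p` with `p* = p q^{-2c}`. -/
def RRight (ħ : ℂ) (i j i' j' : Fin N) (r : ℤ) : PowerSeries (LDyn N) :=
  PowerSeries.mk fun n => dynFn lWt lDeg lInv
    (PowerSeries.coeff n (laurent (Rplus ħ (qTwoP ħ) i j i' j') r)) *
      ((dynC (N := N) lWt lDeg lInv ^ (-4 * (n : ℤ)) : (LDyn N)ˣ) : LDyn N)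

/-- The coefficient of `z₁^a z₂^b` in the `(i, j), (i'', j'')` component of
`R⁺(z₁/z₂, P+h) L⁺⁽¹⁾(z₁) L⁺⁽²⁾(z₂) - L⁺⁽²⁾(z₂) L⁺⁽¹⁾(z₁) R^{+*}(z₁/z₂, P)`. -/
def rll (ħ : ℂ) (i j i'' j'' : Fin N) (a b : ℤ) : PowerSeries (LDyn N) :=
  ∑ i', ∑ j', (psum (fun r : ℤ => RLeft ħ i j i' j' r * lCur i' i'' (a - r) * lCur j' j'' (b + r)) -
    psum (fun r : ℤ => lCur j j' (b + r) * lCur i i' (a - r) * RRight ħ i' j' i'' j'' r))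

/-- The `RLL` relations. -/
def eRels (N : ℕ) (ħ : ℂ) : Set (PowerSeries (LDyn N)) :=
  {r | ∃ (i j i'' j'' : Fin N) (a b : ℤ), r = rll ħ i j i'' j'' a b}

/-- The elliptic algebra `E_{q,p}(gl_N^)`, `q = e^ħ`. -/
abbrev Eqp (N : ℕ) (ħ : ℂ) : Type := TopAlg (N := N) (G := LGen N) lWt lDeg lInv (eRels N ħ)

end Eqp

end EllQG

end

/-! Write `D` for the dynamical algebra, generated by functions of the dynamical parameters,
`q^{c/2}`, `d̂` and the remaining generators. The completed algebra is a quotient of `PowerSeries D`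
by the intersection of the ideals generated by the relations and `p ^ n`, so separatedness is built
in.

Grading. Every relation of `D` itself is homogeneous for the weight, so `D` has a coaction of the
weight group and each element is a finite sum of components. Applied to each coefficient this
decomposes a power series (`TopAlg.hasPadicSum_compPS`). Uniqueness requires no knowledge of the
further relations: the weight spaces are joint eigenspaces of conjugations by exponentials, these
separate weights since `ħ ≠ 0`, and a finite product of conjugations minus scalars isolates one
member of a family modulo any given power of `p` (`TopAlg.eq_zero_of_hasPadicSum`). It follows that
a weight vector lifts to a series whose coefficients pass every meromorphic function by the shift
rule (`TopAlg.exists_hasWeight`), which is the exchange rule for the moment maps.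

Injectivity. A nonzero power series over a field is `p ^ k` times a unit, and `p*` is `p` times a
central unit, so only `p ^ k ≠ 0` is needed. This is the substantial point, because the relations
might collapse the quotient. For each `k` it suffices to satisfy the relations in a ring where `p`
acts by a central `ε` with `ε ^ (k + 1) = 0` and `ε ^ k ≠ 0` (`TopAlg.p_pow_ne_zero`).

For `E` every term of a relation is quadratic in the `L̄`, so sending them to zero is enough
(`eRels_p_pow_ne_zero`). For `U` the `k_{l,0}` are invertible and a genuine representation is
required. It has level zero (`q^{c/2} = 1`, hence `p* = p`) and acts on functions on weights times
`ℤ`, over `𝓕[ε]/(ε ^ M)`. With nodes counted from zero, let `Y_l` be the value of `q^{h_l}` and `W_m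
= ∏_{i<m} Y_i² / q`. Then `k_l(z)` has the eigenvalue `Y_l⁻¹ θ(q^{l+2} z / W_l) / θ(q^{l+1} z /
W_{l+1})`, while `e_j` and `f_j` act by theta function amplitudes times delta functions at `q⁻²
W_{j+1}` and `W_{j+1}`. A step by `e_j` or `f_j` moves only `W_{j+1}`, by `q^{∓2}`.

Because `ε` is nilpotent, infinite products become finite ones, and `θ(u)` is `1 - u` times a unit,
so the relations become polynomial identities. The structure functions of the `kk` relations become
`1`. The `ke` and `kf` relations record how a step changes a theta quotient. Those of a current with
itself hold at a zero of the structure function. Neighbouring currents and the Serre relations need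
short theta identities, the Serre expressions vanishing even before symmetrisation. The relation for
`[e_j, f_j]` is the partial fraction expansion of a theta quotient with two poles: its expansions at
zero and infinity differ by two delta functions (`theta_partial_fractions`), and the free constant
`C₀` fixes the scalar. -/

noncomputable section
namespace EllQG

/-! ### Power series evaluated at a central nilpotent element. -/

section TruncEval

variable {D R : Type*} [Ring D] [Ring R]

/-- Evaluation of a power series at a central nilpotent element. -/
def truncEval (φ : D →+* R) (e : R) (he : ∀ r, Commute e r) (n : ℕ) (hn : e ^ n = 0) :
    PowerSeries D →+* R where
  toFun F := ∑ m ∈ Finset.range n, φ (PowerSeries.coeff m F) * e ^ m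
  map_zero' := by simp
  map_add' F G := by simp [add_mul, Finset.sum_add_distrib]
  map_one' := by
    -- For exponent `0` the hypothesis `hn` says `1 = 0`, so the target ring is trivial; the same
    -- case is split off in the evaluations at constants and at `X`.
    rcases n with _ | n
    · simpa using hn.symm
    · rw [Finset.sum_range_succ']
      simp [PowerSeries.coeff_one]
  map_mul' F G := by
    have key : ∀ a b : ℕ, φ (PowerSeries.coeff a F) * e ^ a * (φ (PowerSeries.coeff b G) * e ^ b) =
        φ (PowerSeries.coeff a F) * φ (PowerSeries.coeff b G) * e ^ (a + b) := by
      intro a b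
      rw [pow_add, mul_assoc, ← mul_assoc (e ^ a), ((he _).pow_left a).eq]
      simp only [mul_assoc]
    have hz : ∀ m, n ≤ m → e ^ m = 0 := fun m hm => by
      rw [← Nat.sub_add_cancel hm, pow_add, hn, mul_zero]
    -- The coefficients of the product fill the triangle `a + b < n`, the product of the two sums
    -- the whole square; outside the triangle `e ^ (a + b) = 0`.
    rw [Finset.sum_mul_sum, ← Finset.sum_product']
    have h1 : ∀ m ∈ Finset.range n, φ (PowerSeries.coeff m (F * G)) * e ^ m =
        ∑ p ∈ (Finset.range n ×ˢ Finset.range n) with p.1 + p.2 = m,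
          φ (PowerSeries.coeff p.1 F) * e ^ p.1 * (φ (PowerSeries.coeff p.2 G) * e ^ p.2) := by
      intro m hm
      rw [PowerSeries.coeff_mul, map_sum, Finset.sum_mul]
      refine Finset.sum_congr ?_ fun p hp => ?_
      · ext p
        rw [Finset.mem_range] at hm
        rw [Finset.HasAntidiagonal.mem_antidiagonal, Finset.mem_filter, Finset.mem_product, Finset.mem_range,
          Finset.mem_range]
        omega
      · rw [key, map_mul]
        simp only [Finset.mem_filter] at hp
        rw [hp.2]
    rw [Finset.sum_congr rfl h1, Finset.sum_fiberwise_eq_sum_filter]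
    refine Finset.sum_filter_of_ne fun p _ hp => ?_
    rw [Finset.mem_range]
    by_contra hcon
    exact hp (by rw [key, hz _ (not_lt.mp hcon), mul_zero])

variable (φ : D →+* R) (e : R) (he : ∀ r, Commute e r) (n : ℕ) (hn : e ^ n = 0)

theorem truncEval_apply (F : PowerSeries D) : truncEval φ e he n hn F =
    ∑ m ∈ Finset.range n, φ (PowerSeries.coeff m F) * e ^ m := rfl

theorem truncEval_C (d : D) : truncEval φ e he n hn (PowerSeries.C d) = φ d := by
  rw [truncEval_apply]
  rcases n with _ | n
  · have : (1 : R) = 0 := by simpa using hn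
    rw [← mul_one (φ d), this]
    simp
  · rw [Finset.sum_range_succ']
    simp [PowerSeries.coeff_C]

theorem truncEval_X : truncEval φ e he n hn PowerSeries.X = e := by
  rw [truncEval_apply]
  rcases n with _ | _ | n
  · have : (1 : R) = 0 := by simpa using hn
    rw [← mul_one e, this]
    simp
  · simpa using hn.symm
  · rw [Finset.sum_range_succ', Finset.sum_range_succ']
    simp [PowerSeries.coeff_X]

theorem truncEval_eq_zero (F : PowerSeries D) (h : ∀ m, φ (PowerSeries.coeff m F) = 0) :
    truncEval φ e he n hn F = 0 := by
  rw [truncEval_apply]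
  exact Finset.sum_eq_zero fun m _ => by rw [h, zero_mul]

/-- Evaluation commutes with sums which are finite in each degree. -/
theorem truncEval_psum {ι : Type*} (F : ι → PowerSeries D)
    (hF : ∀ m, {i | PowerSeries.coeff m (F i) ≠ 0}.Finite) :
    ∃ T₀ : Finset ι, ∀ T, T₀ ⊆ T →
      truncEval φ e he n hn (psum F) = ∑ i ∈ T, truncEval φ e he n hn (F i) := by
  classical
  -- Only degrees below `n` survive, so finitely many finite supports suffice. Allowing every larger
  -- finite set lets several sums be compared over a common index set.
  refine ⟨(Finset.range n).biUnion fun m => (hF m).toFinset, fun T hT => ?_⟩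
  simp only [truncEval_apply]
  rw [Finset.sum_comm]
  refine Finset.sum_congr rfl fun m hm => ?_
  have : PowerSeries.coeff m (psum F) = ∑ i ∈ T, PowerSeries.coeff m (F i) := by
    rw [psum, PowerSeries.coeff_mk]
    refine finsum_eq_sum_of_support_subset _ fun i hi => ?_
    exact hT (Finset.mem_biUnion.mpr ⟨m, hm, (hF m).mem_toFinset.mpr hi⟩)
  rw [this, map_sum, Finset.sum_mul]

end TruncEval

/-! ### The weight grading of the dynamical algebra. -/

section Weight

variable {N : ℕ} {G : Type} (wt : G → Wt N × Wt N) (deg : G → ℤ) (inv : G → G → Prop)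

section Lift

variable {B : Type*} [Ring B] [Algebra ℂ B]

/-- Homomorphisms out of the dynamical algebra. -/
def dynLift (F : DynGen N G → B)
    (h : ∀ ⦃x y⦄, DynRel wt deg inv x y → FreeAlgebra.lift ℂ F x = FreeAlgebra.lift ℂ F y) :
    DynAlg wt deg inv →ₐ[ℂ] B :=
  RingQuot.liftAlgHom ℂ ⟨FreeAlgebra.lift ℂ F, h⟩

theorem dynLift_dyn (F : DynGen N G → B)
    (h : ∀ ⦃x y⦄, DynRel wt deg inv x y → FreeAlgebra.lift ℂ F x = FreeAlgebra.lift ℂ F y)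
    (x : DynGen N G) : dynLift wt deg inv F h (dyn wt deg inv x) = F x := by
  rw [dynLift, dyn, RingQuot.liftAlgHom_mkAlgHom_apply, FreeAlgebra.lift_ι_apply]

end Lift

variable {wt deg inv}

theorem dyn_induction {motive : DynAlg wt deg inv → Prop}
    (const : ∀ r : ℂ, motive (algebraMap ℂ _ r)) (gen : ∀ x, motive (dyn wt deg inv x))
    (mul : ∀ a b, motive a → motive b → motive (a * b))
    (add : ∀ a b, motive a → motive b → motive (a + b)) (a : DynAlg wt deg inv) : motive a := by
  obtain ⟨b, rfl⟩ := RingQuot.mkAlgHom_surjective ℂ (DynRel wt deg inv) a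
  induction b using FreeAlgebra.induction with
  | grade0 r => rw [AlgHom.commutes]; exact const r
  | grade1 x => exact gen x
  | mul a b ha hb => rw [map_mul]; exact mul _ _ ha hb
  | add a b ha hb => rw [map_add]; exact add _ _ ha hb

theorem dynFn_apply (g : FF N) : dynFn wt deg inv g = dyn wt deg inv (.fn g) := rfl

theorem dynFn_algebraMap (r : ℂ) :
    dynFn wt deg inv (algebraMap ℂ (FF N) r) = algebraMap ℂ _ r := by
  have h := RingQuot.mkAlgHom_rel ℂ (DynRel.fn_const (wt := wt) (deg := deg) (inv := inv) r)
  rwa [AlgHom.commutes] at h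

theorem dyn_fn_mul_gen (g : FF N) (x : G) :
    dynFn wt deg inv g * dyn wt deg inv (.gen x) =
      dyn wt deg inv (.gen x) * dynFn wt deg inv (Mero.shift (wt x) g) := by
  have h := RingQuot.mkAlgHom_rel ℂ (DynRel.shift (wt := wt) (deg := deg) (inv := inv) g x)
  rwa [map_mul, map_mul] at h

theorem dyn_d_mul_fn (g : FF N) :
    dyn wt deg inv .dHat * dynFn wt deg inv g = dynFn wt deg inv g * dyn wt deg inv .dHat := by
  have h := RingQuot.mkAlgHom_rel ℂ (DynRel.d_fn (wt := wt) (deg := deg) (inv := inv) g)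
  rwa [map_mul, map_mul] at h

theorem dyn_c_central (x : DynAlg wt deg inv) : Commute (dyn wt deg inv .cHalf) x := by
  induction x using dyn_induction with
  | const r => exact Algebra.commute_algebraMap_right r _
  | gen x =>
    have h := RingQuot.mkAlgHom_rel ℂ (DynRel.c_central (wt := wt) (deg := deg) (inv := inv) x)
    rwa [map_mul, map_mul] at h
  | mul a b ha hb => exact ha.mul_right hb
  | add a b ha hb => exact ha.add_right hb

theorem dynC_central (x : DynAlg wt deg inv) : Commute (dynC wt deg inv : DynAlg wt deg inv) x :=
  dyn_c_central x

theorem dynC_zpow_central (k : ℤ) (x : DynAlg wt deg inv) :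
    Commute ((dynC wt deg inv ^ k : (DynAlg wt deg inv)ˣ) : DynAlg wt deg inv) x := by
  rcases k with k | k
  · rw [Int.ofNat_eq_natCast, zpow_natCast, Units.val_pow_eq_pow_val]
    exact (dynC_central x).pow_left k
  · rw [zpow_negSucc, ← Nat.succ_eq_add_one]
    have : Commute ((dynC wt deg inv ^ (k + 1) : (DynAlg wt deg inv)ˣ) : DynAlg wt deg inv) x := by
      rw [Units.val_pow_eq_pow_val]
      exact (dynC_central x).pow_left (k + 1)
    exact this.units_inv_left

/-! #### Shifts -/

theorem Mero.comap_algebraMap {V W : Type*} [NormedAddCommGroup V] [NormedSpace ℂ V]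
    [NormedAddCommGroup W] [NormedSpace ℂ W] (φ : W → V) (hφ : AnalyticOnNhd ℂ φ Set.univ)
    (hs : Function.Surjective φ) (f : Entire V) :
    Mero.comap φ hφ hs (algebraMap (Entire V) (Mero V) f) =
      algebraMap (Entire W) (Mero W) (Entire.comap φ hφ f) := by
  rw [Mero.comap]
  exact IsLocalization.map_eq _ f

/-- A homomorphism from a fraction field is determined on the entire functions, so the identities
between shifts and pullbacks can be checked pointwise. -/
theorem Mero.hom_ext {V K : Type*} [NormedAddCommGroup V] [NormedSpace ℂ V] [Field K]
    {a b : Mero V →+* K}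
    (h : ∀ f : Entire V, a (algebraMap (Entire V) (Mero V) f) = b (algebraMap (Entire V) (Mero V) f)) :
    a = b :=
  IsLocalization.ringHom_ext (nonZeroDivisors (Entire V)) (RingHom.ext h)

theorem Mero.shift_algebraMap {V : Type*} [NormedAddCommGroup V] [NormedSpace ℂ V] (α : V)
    (f : Entire V) : Mero.shift α (algebraMap (Entire V) (Mero V) f) =
      algebraMap (Entire V) (Mero V) (Entire.comap (fun v => v + α)
        (analyticOnNhd_id.add analyticOnNhd_const) f) :=
  Mero.comap_algebraMap _ _ _ f

theorem Mero.fst_algebraMap {V : Type*} [NormedAddCommGroup V] [NormedSpace ℂ V]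
    (f : Entire V) : Mero.fst (algebraMap (Entire V) (Mero V) f) =
      algebraMap (Entire (V × V)) (Mero (V × V))
        (Entire.comap Prod.fst (fun _ _ => analyticAt_fst) f) :=
  Mero.comap_algebraMap _ _ _ f

theorem Mero.snd_algebraMap {V : Type*} [NormedAddCommGroup V] [NormedSpace ℂ V]
    (f : Entire V) : Mero.snd (algebraMap (Entire V) (Mero V) f) =
      algebraMap (Entire (V × V)) (Mero (V × V))
        (Entire.comap Prod.snd (fun _ _ => analyticAt_snd) f) :=
  Mero.comap_algebraMap _ _ _ f

theorem Mero.shift_const {V : Type*} [NormedAddCommGroup V] [NormedSpace ℂ V] (α : V)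
    (r : ℂ) : Mero.shift α (algebraMap ℂ (Mero V) r) = algebraMap ℂ (Mero V) r := by
  rw [IsScalarTower.algebraMap_apply ℂ (Entire V) (Mero V), Mero.shift_algebraMap]
  rfl

theorem Mero.comap_const {V W : Type*} [NormedAddCommGroup V] [NormedSpace ℂ V]
    [NormedAddCommGroup W] [NormedSpace ℂ W] (φ : W → V) (hφ : AnalyticOnNhd ℂ φ Set.univ)
    (hs : Function.Surjective φ) (r : ℂ) :
    Mero.comap φ hφ hs (algebraMap ℂ (Mero V) r) = algebraMap ℂ (Mero W) r := by
  rw [IsScalarTower.algebraMap_apply ℂ (Entire V) (Mero V), Mero.comap_algebraMap]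
  rfl

theorem Mero.shift_shift {V : Type*} [NormedAddCommGroup V] [NormedSpace ℂ V] (α β : V)
    (f : Mero V) : Mero.shift α (Mero.shift β f) = Mero.shift (α + β) f := by
  suffices h : (Mero.shift α).comp (Mero.shift β) = Mero.shift (α + β) from
    congrArg (fun a : Mero V →+* Mero V => a f) h
  refine Mero.hom_ext fun f => ?_
  rw [RingHom.comp_apply, Mero.shift_algebraMap, Mero.shift_algebraMap, Mero.shift_algebraMap]
  congr 1
  refine Subtype.ext (funext fun v => ?_)
  change (f : V → ℂ) (v + α + β) = (f : V → ℂ) (v + (α + β))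
  rw [add_assoc]

theorem Mero.shift_zero {V : Type*} [NormedAddCommGroup V] [NormedSpace ℂ V]
    (f : Mero V) : Mero.shift 0 f = f := by
  suffices h : Mero.shift (0 : V) = RingHom.id (Mero V) from
    congrArg (fun a : Mero V →+* Mero V => a f) h
  refine Mero.hom_ext fun f => ?_
  rw [Mero.shift_algebraMap]
  change _ = algebraMap (Entire V) (Mero V) f
  congr 1
  refine Subtype.ext (funext fun v => ?_)
  change (f : V → ℂ) (v + 0) = (f : V → ℂ) v
  rw [add_zero]

theorem Mero.shift_fst {V : Type*} [NormedAddCommGroup V] [NormedSpace ℂ V] (w : V × V)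
    (f : Mero V) : Mero.shift w (Mero.fst f) = Mero.fst (Mero.shift w.1 f) := by
  suffices h : (Mero.shift w).comp Mero.fst = Mero.fst.comp (Mero.shift w.1) from
    congrArg (fun a : Mero V →+* Mero (V × V) => a f) h
  refine Mero.hom_ext fun f => ?_
  rw [RingHom.comp_apply, RingHom.comp_apply, Mero.shift_algebraMap, Mero.fst_algebraMap,
    Mero.fst_algebraMap, Mero.shift_algebraMap]
  rfl

theorem Mero.shift_snd {V : Type*} [NormedAddCommGroup V] [NormedSpace ℂ V] (w : V × V)
    (f : Mero V) : Mero.shift w (Mero.snd f) = Mero.snd (Mero.shift w.2 f) := by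
  suffices h : (Mero.shift w).comp Mero.snd = Mero.snd.comp (Mero.shift w.2) from
    congrArg (fun a : Mero V →+* Mero (V × V) => a f) h
  refine Mero.hom_ext fun f => ?_
  rw [RingHom.comp_apply, RingHom.comp_apply, Mero.shift_algebraMap, Mero.snd_algebraMap,
    Mero.snd_algebraMap, Mero.shift_algebraMap]
  rfl

theorem expFn_add (ħ : ℂ) (X Y X' Y' : Fin N → ℂ) :
    expFn ħ X Y * expFn ħ X' Y' = expFn ħ (X + X') (Y + Y') := by
  rw [expFn, expFn, expFn, ← map_mul]
  congr 1
  refine Subtype.ext (funext fun v => ?_)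
  change Complex.exp _ * Complex.exp _ = Complex.exp _
  rw [← Complex.exp_add, ← mul_add]
  congr 2
  simp only [Pi.add_apply, add_mul, Finset.sum_add_distrib]
  ring

theorem expFn_zero (ħ : ℂ) : expFn ħ (0 : Fin N → ℂ) 0 = 1 := by
  rw [expFn, ← map_one (algebraMap (Entire (Wt N × Wt N)) (FF N))]
  congr 1
  refine Subtype.ext (funext fun v => ?_)
  change Complex.exp _ = 1
  simp

theorem expFn_ne_zero (ħ : ℂ) (X Y : Fin N → ℂ) : expFn ħ X Y ≠ 0 := by
  intro h
  have := expFn_add ħ X Y (-X) (-Y)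
  rw [h, zero_mul, add_neg_cancel, add_neg_cancel, expFn_zero] at this
  exact zero_ne_one this

/-- `⟨X, α⟩ + ⟨Y, β⟩`. -/
def pairing (X Y : Fin N → ℂ) (w : Wt N × Wt N) : ℂ :=
  ∑ i, X i * (w.1 : Fin N → ℂ) i + ∑ i, Y i * (w.2 : Fin N → ℂ) i

/-- Exponentials are eigenvectors of every shift. This turns the shift rule of a generator into an
eigenvalue equation for conjugation. -/
theorem shift_expFn (ħ : ℂ) (X Y : Fin N → ℂ) (w : Wt N × Wt N) :
    Mero.shift w (expFn ħ X Y) =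
      algebraMap ℂ (FF N) (qpow ħ (pairing X Y w)) * expFn ħ X Y := by
  rw [expFn, Mero.shift_algebraMap,
    IsScalarTower.algebraMap_apply ℂ (Entire (Wt N × Wt N)) (FF N), ← map_mul]
  congr 1
  refine Subtype.ext (funext fun v => ?_)
  change Complex.exp _ = Complex.exp _ * Complex.exp _
  rw [← Complex.exp_add, ← mul_add]
  congr 2
  change ∑ i, X i * ((v.1 : Fin N → ℂ) i + (w.1 : Fin N → ℂ) i) +
    ∑ i, Y i * ((v.2 : Fin N → ℂ) i + (w.2 : Fin N → ℂ) i) = _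
  simp only [mul_add, Finset.sum_add_distrib, pairing]
  ring

/-! #### The weight grading -/

/-- `d` transforms with weight `w` under the functions of the dynamical parameters. -/
def HasWeight (w : Wt N × Wt N) (d : DynAlg wt deg inv) : Prop :=
  ∀ g, dynFn wt deg inv g * d = d * dynFn wt deg inv (Mero.shift w g)

theorem HasWeight.mul {u v : Wt N × Wt N} {a b : DynAlg wt deg inv} (ha : HasWeight u a)
    (hb : HasWeight v b) : HasWeight (u + v) (a * b) := fun g => by
  rw [← mul_assoc, ha g, mul_assoc, hb, Mero.shift_shift, ← mul_assoc, add_comm]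

theorem HasWeight.add {u : Wt N × Wt N} {a b : DynAlg wt deg inv} (ha : HasWeight u a)
    (hb : HasWeight u b) : HasWeight u (a + b) := fun g => by
  rw [mul_add, add_mul, ha g, hb g]

theorem HasWeight.zero {u : Wt N × Wt N} : HasWeight u (0 : DynAlg wt deg inv) := fun g => by
  rw [mul_zero, zero_mul]

theorem HasWeight.sum {ι : Type*} {u : Wt N × Wt N} (s : Finset ι) (f : ι → DynAlg wt deg inv)
    (hf : ∀ i ∈ s, HasWeight u (f i)) : HasWeight u (∑ i ∈ s, f i) := fun g => by
  rw [Finset.mul_sum, Finset.sum_mul]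
  exact Finset.sum_congr rfl fun i hi => hf i hi g

theorem hasWeight_algebraMap (r : ℂ) : HasWeight 0 (algebraMap ℂ (DynAlg wt deg inv) r) :=
  fun g => by rw [Mero.shift_zero, Algebra.commutes]

/-- The weight of a generator of the dynamical algebra. -/
def genWt (wt : G → Wt N × Wt N) : DynGen N G → Wt N × Wt N
  | .gen x => wt x
  | _ => 0

theorem hasWeight_dyn (x : DynGen N G) : HasWeight (genWt wt x) (dyn wt deg inv x) := by
  rcases x with g | _ | _ | _ | x
  · intro f
    rw [← dynFn_apply, ← map_mul, ← map_mul]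
    simp only [genWt, Mero.shift_zero, mul_comm]
  · intro f
    simp only [genWt, Mero.shift_zero]
    exact (dyn_c_central _).eq.symm
  · intro f
    simp only [genWt, Mero.shift_zero]
    exact (Commute.units_inv_left (u := dynC wt deg inv) (dynC_central _)).eq.symm
  · intro f
    simp only [genWt, Mero.shift_zero]
    exact (dyn_d_mul_fn f).symm
  · exact fun g => dyn_fn_mul_gen g x

variable (deg) in
/-- The coaction defining the weight grading. -/
def coact (hinv : ∀ x y, inv x y → wt x + wt y = 0) :
    DynAlg wt deg inv →ₐ[ℂ] AddMonoidAlgebra (DynAlg wt deg inv) (Wt N × Wt N) :=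
  dynLift wt deg inv (fun x => AddMonoidAlgebra.single (genWt wt x) (dyn wt deg inv x)) (by
    intro x y h
    have rel := RingQuot.mkAlgHom_rel ℂ h
    have hd : ∀ x, RingQuot.mkAlgHom ℂ (DynRel wt deg inv) (FreeAlgebra.ι ℂ x) =
      dyn wt deg inv x := fun _ => rfl
    have hone : (1 : AddMonoidAlgebra (DynAlg wt deg inv) (Wt N × Wt N)) =
      AddMonoidAlgebra.single 0 1 := rfl
    -- The two sides of each relation agree in the dynamical algebra and carry the same weight, so
    -- their one-term images agree. For mutually inverse generators the balance of weights is
    -- `hinv`.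
    rcases h with ⟨f, g⟩ | ⟨f, g⟩ | a | _ | _ | x | g | ⟨g, x⟩ | x | ⟨x, y, h⟩ <;>
    simp only [map_mul, map_add, FreeAlgebra.lift_ι_apply, AddMonoidAlgebra.single_mul_single,
      map_one, hone, AlgHom.commutes, map_zsmul, hd] at rel ⊢
    · rw [rel, AddMonoidAlgebra.single_add]; rfl
    · rw [rel]; simp only [genWt, add_zero]
    · rw [rel]; rfl
    · rw [rel]; simp only [genWt, add_zero]
    · rw [rel]; simp only [genWt, add_zero]
    · rw [rel]; simp only [genWt, add_zero, zero_add]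
    · rw [rel]; simp only [genWt, add_zero]
    · rw [rel]; simp only [genWt, add_zero, zero_add]
    · rw [rel]
      simp only [genWt, add_zero, zero_add]
      rw [AddMonoidAlgebra.single_add, AddMonoidAlgebra.smul_single]
    · rw [rel]
      simp only [genWt]
      rw [hinv x y h])

variable (hinv : ∀ x y, inv x y → wt x + wt y = 0)

theorem coact_dyn (x : DynGen N G) : coact deg hinv (dyn wt deg inv x) =
    AddMonoidAlgebra.single (genWt wt x) (dyn wt deg inv x) := dynLift_dyn _ _ _ _ _ x

/-- The component of weight `w`. -/
def wtComp (w : Wt N × Wt N) (d : DynAlg wt deg inv) : DynAlg wt deg inv :=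
  (coact deg hinv d).coeff w

theorem wtComp_add (w : Wt N × Wt N) (a b : DynAlg wt deg inv) :
    wtComp hinv w (a + b) = wtComp hinv w a + wtComp hinv w b := by
  rw [wtComp, map_add, AddMonoidAlgebra.coeff_add]; rfl

/-- The coaction is multiplicative, so a component of a product is a sum of products of components
whose weights add up correctly; the generators start the induction. -/
theorem hasWeight_wtComp (d : DynAlg wt deg inv) (w : Wt N × Wt N) :
    HasWeight w (wtComp hinv w d) := by
  classical
  induction d using dyn_induction generalizing w with
  | const r =>
    rw [wtComp, AlgHom.commutes]
    change HasWeight w ((AddMonoidAlgebra.single 0 (algebraMap ℂ (DynAlg wt deg inv) r)).coeff w)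
    rw [AddMonoidAlgebra.coeff_single, Finsupp.single_apply]
    split_ifs with h
    · rw [← h]; exact hasWeight_algebraMap r
    · exact HasWeight.zero
  | gen x =>
    rw [wtComp, coact_dyn, AddMonoidAlgebra.coeff_single, Finsupp.single_apply]
    split_ifs with h
    · rw [← h]; exact hasWeight_dyn x
    · exact HasWeight.zero
  | mul a b ha hb =>
    rw [wtComp, map_mul, AddMonoidAlgebra.coeff_mul]
    refine HasWeight.sum _ _ fun u _ => HasWeight.sum _ _ fun v _ => ?_
    dsimp only
    split_ifs with h
    · rw [← h]; exact (ha u).mul (hb v)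
    · exact HasWeight.zero
  | add a b ha hb => rw [wtComp_add]; exact (ha w).add (hb w)

/-- The sum of all components. -/
def totalHom (R W : Type*) [Ring R] [AddMonoid W] : AddMonoidAlgebra R W →+* R :=
  AddMonoidAlgebra.liftNCRingHom (RingHom.id R) (1 : Multiplicative W →* R)
    (fun _ _ => Commute.one_right _)

theorem totalHom_single {R W : Type*} [Ring R] [AddMonoid W] (w : W) (r : R) :
    totalHom R W (AddMonoidAlgebra.single w r) = r := by
  simp [totalHom]

theorem totalHom_apply {R W : Type*} [Ring R] [AddMonoid W] (x : AddMonoidAlgebra R W) :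
    totalHom R W x = x.coeff.sum fun _ r => r := by
  conv_lhs => rw [← AddMonoidAlgebra.sum_coeff_single x]
  rw [Finsupp.sum, map_sum]
  exact Finset.sum_congr rfl fun w _ => totalHom_single w _

/-- The counit axiom: forgetting the weights is a ring homomorphism that undoes the coaction on
generators, hence everywhere. Thus the components of an element add up to it. -/
theorem totalHom_coact (d : DynAlg wt deg inv) : totalHom _ _ (coact deg hinv d) = d := by
  induction d using dyn_induction with
  | const r =>
    rw [AlgHom.commutes]
    exact totalHom_single 0 _
  | gen x => rw [coact_dyn, totalHom_single]
  | mul a b ha hb => rw [map_mul, map_mul, ha, hb]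
  | add a b ha hb => rw [map_add, map_add, ha, hb]

/-- Any finite set containing the support is allowed, so that a single set can serve several
coefficients of a power series. -/
theorem sum_wtComp (d : DynAlg wt deg inv) (s : Finset (Wt N × Wt N))
    (hs : (coact deg hinv d).coeff.support ⊆ s) : ∑ w ∈ s, wtComp hinv w d = d := by
  conv_rhs => rw [← totalHom_coact hinv d, totalHom_apply, Finsupp.sum]
  refine (Finset.sum_subset hs fun w _ hw => ?_).symm
  exact Finsupp.notMem_support_iff.mp hw

end Weight

/-! ### Separatedness and weight decompositions of the completed quotient. -/

section TopAlgebra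

variable {N : ℕ} {G : Type} {wt : G → Wt N × Wt N} {deg : G → ℤ} {inv : G → G → Prop}

theorem PowerSeries_exists_X_pow_mul {R : Type*} [Ring R] (n : ℕ) (F : PowerSeries R)
    (h : ∀ m < n, PowerSeries.coeff m F = 0) : ∃ H, F = PowerSeries.X ^ n * H := by
  refine ⟨PowerSeries.mk fun m => PowerSeries.coeff (m + n) F, ?_⟩
  ext m
  rw [PowerSeries.coeff_X_pow_mul']
  split_ifs with hm
  · rw [PowerSeries.coeff_mk, Nat.sub_add_cancel hm]
  · exact h m (not_le.mp hm)

theorem mk'_eq_zero {R : Type*} [Ring R] (I : TwoSidedIdeal R) (x : R) :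
    I.ringCon.mk' x = 0 ↔ x ∈ I := by
  rw [I.mem_iff]
  exact I.ringCon.eq

theorem mem_closedIdeal {R : Type} [Ring R] (rel : Set (PowerSeries R)) (x : PowerSeries R) :
    x ∈ closedIdeal rel ↔ ∀ n : ℕ, x ∈ TwoSidedIdeal.span (rel ∪ {PowerSeries.X ^ n}) := by
  rw [closedIdeal, TwoSidedIdeal.mem_iInf]

variable (rel : Set (PowerSeries (DynAlg wt deg inv)))

theorem TopAlg.mk_surjective : Function.Surjective (TopAlg.mk wt deg inv rel) :=
  RingCon.mk'_surjective _

theorem TopAlg.mk_eq_zero (F : PowerSeries (DynAlg wt deg inv)) :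
    TopAlg.mk wt deg inv rel F = 0 ↔ F ∈ closedIdeal rel := mk'_eq_zero _ _

theorem TopAlg.mk_smul (r : ℂ) (F : PowerSeries (DynAlg wt deg inv)) :
    TopAlg.mk wt deg inv rel (r • F) = r • TopAlg.mk wt deg inv rel F := rfl

theorem TopAlg.p_commute (a : TopAlg wt deg inv rel) : Commute (TopAlg.p wt deg inv rel) a := by
  obtain ⟨F, rfl⟩ := TopAlg.mk_surjective rel a
  exact ((PowerSeries.commute_X F).symm).map (TopAlg.mk wt deg inv rel)

/-- The topological algebra is separated. -/
theorem TopAlg.separated (a : TopAlg wt deg inv rel)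
    (h : ∀ n : ℕ, ∃ y, a = TopAlg.p wt deg inv rel ^ n * y) : a = 0 := by
  obtain ⟨F, rfl⟩ := TopAlg.mk_surjective rel a
  rw [TopAlg.mk_eq_zero, mem_closedIdeal]
  -- Against the `n`-th ideal of the intersection, which contains `X ^ n`, only divisibility by `p ^
  -- n` is used.
  intro n
  obtain ⟨y, hy⟩ := h n
  obtain ⟨H, rfl⟩ := TopAlg.mk_surjective rel y
  rw [TopAlg.p, ← map_pow, ← map_mul, ← sub_eq_zero, ← map_sub, TopAlg.mk_eq_zero,
    mem_closedIdeal] at hy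
  have h1 := hy n
  have h2 : PowerSeries.X ^ n * H ∈ TwoSidedIdeal.span (rel ∪ {PowerSeries.X ^ n}) :=
    TwoSidedIdeal.mul_mem_right _ _ _ (TwoSidedIdeal.subset_span (Or.inr rfl))
  have := TwoSidedIdeal.add_mem _ h1 h2
  rwa [sub_add_cancel] at this

/-! #### Components -/

variable (hinv : ∀ x y, inv x y → wt x + wt y = 0)

/-- The component of weight `w` of a power series. -/
def compPS (w : Wt N × Wt N) (F : PowerSeries (DynAlg wt deg inv)) :
    PowerSeries (DynAlg wt deg inv) :=
  PowerSeries.mk fun n => wtComp hinv w (PowerSeries.coeff n F)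

/-! #### Weight spaces -/

theorem TopAlg.gen_mul_gen (f g : FF N) :
    TopAlg.gen wt deg inv rel (.fn f) * TopAlg.gen wt deg inv rel (.fn g) =
      TopAlg.gen wt deg inv rel (.fn (f * g)) := by
  rw [TopAlg.gen, TopAlg.gen, TopAlg.gen, ← map_mul, ← map_mul, ← dynFn_apply, ← dynFn_apply,
    ← map_mul]
  rfl

theorem TopAlg.gen_fn_one : TopAlg.gen wt deg inv rel (.fn 1) = 1 := by
  rw [TopAlg.gen, ← dynFn_apply, map_one, map_one, map_one]

theorem TopAlg.gen_const_mul (r : ℂ) (f : FF N) :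
    TopAlg.gen wt deg inv rel (.fn (algebraMap ℂ (FF N) r * f)) =
      r • TopAlg.gen wt deg inv rel (.fn f) := by
  rw [TopAlg.gen, TopAlg.gen, ← TopAlg.mk_smul, ← dynFn_apply, map_mul, dynFn_algebraMap,
    ← Algebra.smul_def]
  congr 1
  ext n
  rw [PowerSeries.coeff_smul, PowerSeries.coeff_C, PowerSeries.coeff_C]
  split_ifs
  · rfl
  · rw [smul_zero]

/-- The coefficients of `F` transform with weight `w`. -/
theorem TopAlg.gen_mul_mk {w : Wt N × Wt N} {F : PowerSeries (DynAlg wt deg inv)}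
    (hF : ∀ n, HasWeight w (PowerSeries.coeff n F)) (g : FF N) :
    TopAlg.gen wt deg inv rel (.fn g) * TopAlg.mk wt deg inv rel F =
      TopAlg.mk wt deg inv rel F * TopAlg.gen wt deg inv rel (.fn (Mero.shift w g)) := by
  rw [TopAlg.gen, TopAlg.gen, ← map_mul, ← map_mul]
  congr 1
  ext n
  rw [PowerSeries.coeff_C_mul, PowerSeries.coeff_mul_C]
  exact hF n g

/-- Moved across `F`, the exponential is shifted by `w`, which produces only a scalar; the two
opposite exponentials then cancel. -/
theorem TopAlg.conj_mk (ħ : ℂ) {w : Wt N × Wt N} {F : PowerSeries (DynAlg wt deg inv)}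
    (hF : ∀ n, HasWeight w (PowerSeries.coeff n F)) (X Y X' Y' : Fin N → ℂ)
    (hX : X + X' = 0) (hY : Y + Y' = 0) :
    TopAlg.gen wt deg inv rel (.fn (expFn ħ X Y)) * TopAlg.mk wt deg inv rel F *
      TopAlg.gen wt deg inv rel (.fn (expFn ħ X' Y')) =
      qpow ħ (pairing X Y w) • TopAlg.mk wt deg inv rel F := by
  rw [TopAlg.gen_mul_mk rel hF, shift_expFn, mul_assoc, TopAlg.gen_mul_gen, mul_assoc, expFn_add,
    hX, hY, expFn_zero, TopAlg.gen_const_mul, TopAlg.gen_fn_one, mul_smul_comm, mul_one]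

theorem TopAlg.mk_mem_weightSpace (ħ : ℂ) {w : Wt N × Wt N} {F : PowerSeries (DynAlg wt deg inv)}
    (hF : ∀ n, HasWeight w (PowerSeries.coeff n F)) :
    TopAlg.mk wt deg inv rel F ∈ TopAlg.weightSpace wt deg inv rel ħ w.1 w.2 := by
  intro X
  refine ⟨?_, ?_⟩
  · rw [TopAlg.conj_mk rel ħ hF X 0 (-X) 0 (add_neg_cancel X) (add_zero 0)]
    simp [pairing]
  · rw [TopAlg.conj_mk rel ħ hF 0 X 0 (-X) (add_zero 0) (add_neg_cancel X)]
    simp [pairing]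

theorem compPS_hasWeight (w : Wt N × Wt N) (F : PowerSeries (DynAlg wt deg inv)) (n : ℕ) :
    HasWeight w (PowerSeries.coeff n (compPS hinv w F)) := by
  rw [compPS, PowerSeries.coeff_mk]
  exact hasWeight_wtComp hinv _ w

theorem TopAlg.one_mem_weightSpace (ħ : ℂ) :
    (1 : TopAlg wt deg inv rel) ∈ TopAlg.weightSpace wt deg inv rel ħ 0 0 := by
  intro X
  refine ⟨?_, ?_⟩
  · rw [mul_one, TopAlg.gen_mul_gen, expFn_add, add_neg_cancel, add_zero, expFn_zero,
      TopAlg.gen_fn_one]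
    simp [qpow]
  · rw [mul_one, TopAlg.gen_mul_gen, expFn_add, add_neg_cancel, add_zero, expFn_zero,
      TopAlg.gen_fn_one]
    simp [qpow]

theorem conj_mul {A : Type*} [Ring A] [Algebra ℂ A] {u v a b : A} {r s : ℂ} (h : v * u = 1)
    (ha : u * a * v = r • a) (hb : u * b * v = s • b) :
    u * (a * b) * v = (r * s) • (a * b) := by
  have : u * (a * b) * v = (u * a * v) * (u * b * v) := by
    calc u * (a * b) * v = u * a * 1 * b * v := by rw [mul_one, mul_assoc u a b]
      _ = _ := by rw [← h]; simp only [mul_assoc]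
  rw [this, ha, hb, smul_mul_smul_comm]

theorem TopAlg.mul_mem_weightSpace (ħ : ℂ) {α β γ δ : Wt N} {a b : TopAlg wt deg inv rel}
    (ha : a ∈ TopAlg.weightSpace wt deg inv rel ħ α β)
    (hb : b ∈ TopAlg.weightSpace wt deg inv rel ħ γ δ) :
    a * b ∈ TopAlg.weightSpace wt deg inv rel ħ (α + γ) (β + δ) := by
  have hq : ∀ (X : Fin N → ℂ) (α γ : Wt N), qpow ħ (∑ i, X i * ((α + γ : Wt N) : Fin N → ℂ) i) =
      qpow ħ (∑ i, X i * (α : Fin N → ℂ) i) * qpow ħ (∑ i, X i * (γ : Fin N → ℂ) i) := by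
    intro X α γ
    rw [qpow, qpow, qpow, ← Complex.exp_add, ← mul_add, ← Finset.sum_add_distrib]
    congr 2
    exact Finset.sum_congr rfl fun i _ => mul_add _ _ _
  intro X
  refine ⟨?_, ?_⟩
  · rw [hq]
    refine conj_mul ?_ (ha X).1 (hb X).1
    rw [TopAlg.gen_mul_gen, expFn_add, neg_add_cancel, add_zero, expFn_zero, TopAlg.gen_fn_one]
  · rw [hq]
    refine conj_mul ?_ (ha X).2 (hb X).2
    rw [TopAlg.gen_mul_gen, expFn_add, neg_add_cancel, add_zero, expFn_zero, TopAlg.gen_fn_one]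

/-- A linear operator commuting with `p` and acting by the scalar `χ w` on the weight space `w`. -/
def TopAlg.IsDiag (ħ : ℂ) (T : TopAlg wt deg inv rel →ₗ[ℂ] TopAlg wt deg inv rel)
    (χ : Wt N × Wt N → ℂ) : Prop :=
  (∀ n y, ∃ y', T (TopAlg.p wt deg inv rel ^ n * y) = TopAlg.p wt deg inv rel ^ n * y') ∧
    ∀ w, ∀ a ∈ TopAlg.weightSpace wt deg inv rel ħ w.1 w.2, T a = χ w • a

theorem TopAlg.IsDiag.sub_const {ħ : ℂ} {T : TopAlg wt deg inv rel →ₗ[ℂ] TopAlg wt deg inv rel}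
    {χ : Wt N × Wt N → ℂ} (h : TopAlg.IsDiag rel ħ T χ) (r : ℂ) :
    TopAlg.IsDiag rel ħ (T - r • LinearMap.id) (fun w => χ w - r) := by
  refine ⟨fun n y => ?_, fun w a ha => ?_⟩
  · obtain ⟨y', hy'⟩ := h.1 n y
    refine ⟨y' - r • y, ?_⟩
    rw [LinearMap.sub_apply, hy', LinearMap.smul_apply, LinearMap.id_apply, mul_sub, mul_smul_comm]
  · rw [LinearMap.sub_apply, h.2 w a ha, LinearMap.smul_apply, LinearMap.id_apply, sub_smul]

theorem TopAlg.IsDiag.comp {ħ : ℂ} {T T' : TopAlg wt deg inv rel →ₗ[ℂ] TopAlg wt deg inv rel}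
    {χ χ' : Wt N × Wt N → ℂ} (h : TopAlg.IsDiag rel ħ T χ) (h' : TopAlg.IsDiag rel ħ T' χ') :
    TopAlg.IsDiag rel ħ (T ∘ₗ T') (fun w => χ w * χ' w) := by
  refine ⟨fun n y => ?_, fun w a ha => ?_⟩
  · obtain ⟨y', hy'⟩ := h'.1 n y
    obtain ⟨y'', hy''⟩ := h.1 n y'
    exact ⟨y'', by rw [LinearMap.comp_apply, hy', hy'']⟩
  · rw [LinearMap.comp_apply, h'.2 w a ha, map_smul, h.2 w a ha, smul_smul, mul_comm]

theorem TopAlg.isDiag_mul (ħ : ℂ) (u v : TopAlg wt deg inv rel) (χ : Wt N × Wt N → ℂ)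
    (h : ∀ w, ∀ a ∈ TopAlg.weightSpace wt deg inv rel ħ w.1 w.2, u * a * v = χ w • a) :
    TopAlg.IsDiag rel ħ (LinearMap.mulRight ℂ v ∘ₗ LinearMap.mulLeft ℂ u) χ := by
  refine ⟨fun n y => ⟨u * y * v, ?_⟩, fun w a ha => h w a ha⟩
  change u * (_ * y) * v = _
  rw [← mul_assoc u, ← ((TopAlg.p_commute rel u).pow_left n).eq]
  simp only [mul_assoc]

/-- A coordinate in which the weights differ is scaled so that the two exponents differ by exactly
`1`. Equal exponentials would then force `e = 1`. -/
theorem exists_pairing_ne {N : ℕ} {ħ : ℂ} (hħ : ħ ≠ 0) {α β : Wt N} (h : α ≠ β) :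
    ∃ X : Fin N → ℂ, qpow ħ (∑ i, X i * (α : Fin N → ℂ) i) ≠
      qpow ħ (∑ i, X i * (β : Fin N → ℂ) i) := by
  have : ∃ i, (α : Fin N → ℂ) i ≠ (β : Fin N → ℂ) i := by
    by_contra hcon
    push Not at hcon
    exact h (Subtype.ext (funext hcon))
  obtain ⟨i, hi⟩ := this
  have hd : (α : Fin N → ℂ) i - (β : Fin N → ℂ) i ≠ 0 := sub_ne_zero.mpr hi
  refine ⟨Pi.single i (1 / (ħ * ((α : Fin N → ℂ) i - (β : Fin N → ℂ) i))), fun hcon => ?_⟩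
  have hs : ∀ (x : ℂ) (γ : Wt N), ∑ j, (Pi.single i x : Fin N → ℂ) j * (γ : Fin N → ℂ) j =
      x * (γ : Fin N → ℂ) i := by
    intro x γ
    rw [Finset.sum_eq_single i]
    · rw [Pi.single_eq_same]
    · intro j _ hj
      rw [Pi.single_eq_of_ne hj, zero_mul]
    · intro hcon
      exact absurd (Finset.mem_univ i) hcon
  rw [hs, hs, qpow, qpow, Complex.exp_eq_exp_iff_exists_int] at hcon
  obtain ⟨m, hm⟩ := hcon
  have h1 : ħ * (1 / (ħ * ((α : Fin N → ℂ) i - (β : Fin N → ℂ) i)) * (α : Fin N → ℂ) i) -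
      ħ * (1 / (ħ * ((α : Fin N → ℂ) i - (β : Fin N → ℂ) i)) * (β : Fin N → ℂ) i) = 1 := by
    field_simp
  rw [hm, add_sub_cancel_left] at h1
  have h2 : Complex.exp 1 = 1 := by
    have := Complex.exp_int_mul_two_pi_mul_I m
    rwa [h1] at this
  have h3 := congrArg norm h2
  rw [Complex.norm_exp, norm_one, Complex.one_re] at h3
  exact absurd h3 (Real.one_lt_exp_iff.mpr one_pos).ne'

/-- A conjugation that separates the two weights, minus its eigenvalue at `w`. The exponential is
taken in `P + h` or in `P` according to the component in which the weights differ. -/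
theorem TopAlg.exists_isDiag_ne {ħ : ℂ} (hħ : ħ ≠ 0) {w₀ w : Wt N × Wt N} (h : w ≠ w₀) :
    ∃ T χ, TopAlg.IsDiag rel ħ T χ ∧ χ w = 0 ∧ χ w₀ ≠ 0 := by
  by_cases h1 : w.1 = w₀.1
  · have h2 : w₀.2 ≠ w.2 := fun h2 => h (Prod.ext h1 h2.symm)
    obtain ⟨X, hX⟩ := exists_pairing_ne hħ h2
    exact ⟨_, _, (TopAlg.isDiag_mul rel ħ _ _ _ fun w a ha => (ha X).2).sub_const rel
      (qpow ħ (∑ i, X i * (w.2 : Fin N → ℂ) i)), sub_self _, sub_ne_zero.mpr hX⟩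
  · obtain ⟨X, hX⟩ := exists_pairing_ne hħ (Ne.symm h1)
    exact ⟨_, _, (TopAlg.isDiag_mul rel ħ _ _ _ fun w a ha => (ha X).1).sub_const rel
      (qpow ħ (∑ i, X i * (w.1 : Fin N → ℂ) i)), sub_self _, sub_ne_zero.mpr hX⟩

/-- As in Lagrange interpolation, operators killing one unwanted weight each are composed; the
eigenvalue at `w₀` is a product of nonzero numbers. -/
theorem TopAlg.exists_isDiag_finset {ħ : ℂ} (hħ : ħ ≠ 0) (w₀ : Wt N × Wt N)
    (s : Finset (Wt N × Wt N)) :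
    ∃ T χ, TopAlg.IsDiag rel ħ T χ ∧ χ w₀ ≠ 0 ∧ ∀ w ∈ s, w ≠ w₀ → χ w = 0 := by
  classical
  induction s using Finset.induction with
  | empty =>
    refine ⟨LinearMap.id, fun _ => 1, ⟨fun n y => ⟨y, rfl⟩, fun w a _ => (one_smul _ a).symm⟩,
      one_ne_zero, fun w hw => absurd hw (Finset.notMem_empty w)⟩
  | insert w s _ ih =>
    obtain ⟨T, χ, hT, h0, hs⟩ := ih
    by_cases hw : w = w₀
    · refine ⟨T, χ, hT, h0, fun v hv hne => ?_⟩
      rcases Finset.mem_insert.mp hv with rfl | hv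
      · exact absurd hw hne
      · exact hs v hv hne
    · obtain ⟨T', χ', hT', h1, h2⟩ := TopAlg.exists_isDiag_ne rel hħ hw
      refine ⟨_, _, hT.comp rel hT', mul_ne_zero h0 h2, fun v hv hne => ?_⟩
      rcases Finset.mem_insert.mp hv with rfl | hv
      · rw [h1, mul_zero]
      · rw [hs v hv hne, zero_mul]

/-- A family of weight vectors with sum zero vanishes. -/
theorem TopAlg.eq_zero_of_hasPadicSum {ħ : ℂ} (hħ : ħ ≠ 0)
    (c : Wt N × Wt N → TopAlg wt deg inv rel)
    (hc : ∀ w, c w ∈ TopAlg.weightSpace wt deg inv rel ħ w.1 w.2)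
    (h : HasPadicSum (TopAlg.p wt deg inv rel) c 0) : c = 0 := by
  classical
  funext w₀
  refine TopAlg.separated rel _ fun n => ?_
  obtain ⟨F₀, hF⟩ := h n
  -- With `w₀` in the finite set, the isolating operator leaves precisely a nonzero multiple of `c
  -- w₀`. As it preserves divisibility by `p ^ n`, the vector `c w₀` is divisible by `p ^ n`.
  obtain ⟨y, hy⟩ := hF (insert w₀ F₀) (Finset.subset_insert _ _)
  obtain ⟨T, χ, hT, h0, hs⟩ := TopAlg.exists_isDiag_finset rel hħ w₀ (insert w₀ F₀)
  obtain ⟨y', hy'⟩ := hT.1 n y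
  have h1 : T (∑ i ∈ insert w₀ F₀, c i) = χ w₀ • c w₀ := by
    rw [map_sum, Finset.sum_eq_single w₀]
    · exact hT.2 _ _ (hc w₀)
    · intro v hv hne
      rw [hT.2 _ _ (hc v), hs v hv hne, zero_smul]
    · intro hcon
      exact absurd (Finset.mem_insert_self _ _) hcon
  rw [← hy, zero_sub, map_neg, h1] at hy'
  refine ⟨-((χ w₀)⁻¹ • y'), ?_⟩
  rw [mul_neg, mul_smul_comm, ← hy', smul_neg, neg_neg, smul_smul, inv_mul_cancel₀ h0, one_smul]

theorem HasPadicSum.sub {A ι : Type*} [Ring A] {p : A} {c d : ι → A} {a b : A}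
    (hc : HasPadicSum p c a) (hd : HasPadicSum p d b) : HasPadicSum p (c - d) (a - b) := by
  classical
  intro n
  obtain ⟨F, hF⟩ := hc n
  obtain ⟨F', hF'⟩ := hd n
  refine ⟨F ∪ F', fun s hs => ?_⟩
  obtain ⟨y, hy⟩ := hF s (Finset.union_subset_left hs)
  obtain ⟨z, hz⟩ := hF' s (Finset.union_subset_right hs)
  refine ⟨y - z, ?_⟩
  simp only [Pi.sub_apply, Finset.sum_sub_distrib]
  rw [mul_sub, ← hy, ← hz]
  abel

/-- The coefficients below degree `n` involve finitely many weights. Once a finite set contains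
these, the error starts in degree `n`. -/
theorem TopAlg.hasPadicSum_compPS (F : PowerSeries (DynAlg wt deg inv)) :
    HasPadicSum (TopAlg.p wt deg inv rel)
      (fun w => TopAlg.mk wt deg inv rel (compPS hinv w F)) (TopAlg.mk wt deg inv rel F) := by
  classical
  intro n
  refine ⟨(Finset.range n).biUnion fun k => (coact deg hinv (PowerSeries.coeff k F)).coeff.support,
    fun s hs => ?_⟩
  obtain ⟨H, hH⟩ := PowerSeries_exists_X_pow_mul n (F - ∑ w ∈ s, compPS hinv w F) (by
    intro k hk
    rw [map_sub, map_sum]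
    simp only [compPS, PowerSeries.coeff_mk]
    rw [sum_wtComp, sub_self]
    exact (Finset.subset_biUnion_of_mem _ (Finset.mem_range.mpr hk)).trans hs)
  refine ⟨TopAlg.mk wt deg inv rel H, ?_⟩
  rw [← map_sum, ← map_sub, hH, map_mul, map_pow]
  rfl

include hinv in
/-- Existence and uniqueness of weight decompositions. -/
theorem TopAlg.decomp {ħ : ℂ} (hħ : ħ ≠ 0) (a : TopAlg wt deg inv rel) :
    ∃! c : Wt N × Wt N → TopAlg wt deg inv rel,
      (∀ w, c w ∈ TopAlg.weightSpace wt deg inv rel ħ w.1 w.2) ∧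
        HasPadicSum (TopAlg.p wt deg inv rel) c a := by
  obtain ⟨F, rfl⟩ := TopAlg.mk_surjective rel a
  refine ⟨fun w => TopAlg.mk wt deg inv rel (compPS hinv w F),
    ⟨fun w => TopAlg.mk_mem_weightSpace rel ħ (compPS_hasWeight hinv w F),
      TopAlg.hasPadicSum_compPS rel hinv F⟩, fun c hc => ?_⟩
  rw [← sub_eq_zero]
  refine TopAlg.eq_zero_of_hasPadicSum rel hħ _ (fun w => ?_) ?_
  · exact Submodule.sub_mem _ (hc.1 w)
      (TopAlg.mk_mem_weightSpace rel ħ (compPS_hasWeight hinv w F))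
  · have := hc.2.sub (TopAlg.hasPadicSum_compPS rel hinv F)
    rwa [sub_self] at this

include hinv in
/-- Weight vectors are represented by power series with coefficients of the given weight. -/
theorem TopAlg.exists_hasWeight {ħ : ℂ} (hħ : ħ ≠ 0) {w : Wt N × Wt N} {a : TopAlg wt deg inv rel}
    (ha : a ∈ TopAlg.weightSpace wt deg inv rel ħ w.1 w.2) :
    ∃ F, TopAlg.mk wt deg inv rel F = a ∧ ∀ n, HasWeight w (PowerSeries.coeff n F) := by
  classical
  obtain ⟨F, rfl⟩ := TopAlg.mk_surjective rel a
  refine ⟨compPS hinv w F, ?_, compPS_hasWeight hinv w F⟩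
  -- The family concentrated at `w` is another decomposition of the same weight vector. Uniqueness
  -- identifies the vector with the `w`-component of any lift.
  have h1 : HasPadicSum (TopAlg.p wt deg inv rel)
      (Pi.single w (TopAlg.mk wt deg inv rel F)) (TopAlg.mk wt deg inv rel F) := by
    intro n
    refine ⟨{w}, fun s hs => ⟨0, ?_⟩⟩
    rw [Finset.sum_pi_single', if_pos (hs (Finset.mem_singleton_self w)), sub_self, mul_zero]
  have h2 := (TopAlg.hasPadicSum_compPS rel hinv F).sub h1
  rw [sub_self] at h2
  have h3 := TopAlg.eq_zero_of_hasPadicSum rel hħ _ (fun v => ?_) h2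
  · have h4 := congrFun h3 w
    rw [Pi.sub_apply, Pi.single_eq_same] at h4
    exact sub_eq_zero.mp h4
  · refine Submodule.sub_mem _ (TopAlg.mk_mem_weightSpace rel ħ (compPS_hasWeight hinv v F)) ?_
    by_cases hv : v = w
    · subst hv
      rw [Pi.single_eq_same]
      exact ha
    · rw [Pi.single_eq_of_ne hv]
      exact Submodule.zero_mem _

end TopAlgebra

/-! ### The moment maps and a criterion for `p` not to be nilpotent. -/

section MomentMaps

variable {N : ℕ} {G : Type} {wt : G → Wt N × Wt N} {deg : G → ℤ} {inv : G → G → Prop}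

theorem PowerSeries_mul_swap {R : Type*} [Ring R] {A B F : PowerSeries R}
    (h : ∀ i j, PowerSeries.coeff i A * PowerSeries.coeff j F =
      PowerSeries.coeff j F * PowerSeries.coeff i B) : A * F = F * B := by
  ext n
  rw [PowerSeries.coeff_mul, PowerSeries.coeff_mul, ← Finset.Nat.sum_antidiagonal_swap]
  exact Finset.sum_congr rfl fun p _ => h _ _

variable (wt deg inv) in
/-- `f(P+h, p)` as a power series over the dynamical algebra. -/
def leftPS : PowerSeries (Mero (Wt N)) →+* PowerSeries (DynAlg wt deg inv) :=
  PowerSeries.map ((dynFn wt deg inv).comp Mero.fst)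

variable (wt deg inv) in
/-- `f(P, p*)` as a power series over the dynamical algebra. -/
def rightPS : PowerSeries (Mero (Wt N)) →+* PowerSeries (DynAlg wt deg inv) where
  toFun f := PowerSeries.mk fun n =>
    dynFn wt deg inv (Mero.snd (PowerSeries.coeff n f)) *
      ((dynC wt deg inv ^ (-4 * (n : ℤ)) : (DynAlg wt deg inv)ˣ) : DynAlg wt deg inv)
  map_zero' := by
    ext n
    rw [PowerSeries.coeff_mk, map_zero, map_zero, map_zero, zero_mul, map_zero]
  map_one' := by
    ext n
    rw [PowerSeries.coeff_mk, PowerSeries.coeff_one, PowerSeries.coeff_one]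
    split_ifs with h
    · subst h
      simp
    · simp
  map_add' f g := by
    ext n
    simp only [PowerSeries.coeff_mk, map_add, add_mul]
  map_mul' f g := by
    ext n
    rw [PowerSeries.coeff_mk, PowerSeries.coeff_mul, PowerSeries.coeff_mul, map_sum, map_sum,
      Finset.sum_mul]
    refine Finset.sum_congr rfl fun p hp => ?_
    rw [PowerSeries.coeff_mk, PowerSeries.coeff_mk, map_mul, map_mul, mul_assoc, mul_assoc,
      ← mul_assoc (Units.val _), (dynC_zpow_central (-4 * (p.1 : ℤ)) _).eq, mul_assoc,
      ← Units.val_mul, ← zpow_add]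
    congr 4
    have : p.1 + p.2 = n := Finset.HasAntidiagonal.mem_antidiagonal.mp hp
    rw [← this]
    push_cast
    ring

theorem coeff_leftPS (f : PowerSeries (Mero (Wt N))) (n : ℕ) :
    PowerSeries.coeff n (leftPS wt deg inv f) =
      dynFn wt deg inv (Mero.fst (PowerSeries.coeff n f)) := by
  rw [leftPS, PowerSeries.coeff_map, RingHom.comp_apply]

theorem coeff_rightPS (f : PowerSeries (Mero (Wt N))) (n : ℕ) :
    PowerSeries.coeff n (rightPS wt deg inv f) =
      dynFn wt deg inv (Mero.snd (PowerSeries.coeff n f)) *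
      ((dynC wt deg inv ^ (-4 * (n : ℤ)) : (DynAlg wt deg inv)ˣ) : DynAlg wt deg inv) := by
  rw [rightPS, RingHom.coe_mk, MonoidHom.coe_mk, OneHom.coe_mk, PowerSeries.coeff_mk]

theorem Mero.fst_const {V : Type*} [NormedAddCommGroup V] [NormedSpace ℂ V] (r : ℂ) :
    Mero.fst (algebraMap ℂ (Mero V) r) = algebraMap ℂ (Mero (V × V)) r := Mero.comap_const _ _ _ r

theorem Mero.snd_const {V : Type*} [NormedAddCommGroup V] [NormedSpace ℂ V] (r : ℂ) :
    Mero.snd (algebraMap ℂ (Mero V) r) = algebraMap ℂ (Mero (V × V)) r := Mero.comap_const _ _ _ r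

variable (rel : Set (PowerSeries (DynAlg wt deg inv)))

theorem TopAlg.left_eq (f : PowerSeries (Mero (Wt N))) :
    TopAlg.left wt deg inv rel f = TopAlg.mk wt deg inv rel (leftPS wt deg inv f) := by
  rw [TopAlg.left]
  congr 1
  ext n
  rw [PowerSeries.coeff_mk, leftPS, PowerSeries.coeff_map]
  rfl

theorem TopAlg.right_eq (f : PowerSeries (Mero (Wt N))) :
    TopAlg.right wt deg inv rel f = TopAlg.mk wt deg inv rel (rightPS wt deg inv f) := by
  rw [TopAlg.right]
  congr 1

/-- The left moment map. -/
def TopAlg.leftHom : PowerSeries (Mero (Wt N)) →ₐ[ℂ] TopAlg wt deg inv rel where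
  __ := (TopAlg.mk wt deg inv rel).comp (leftPS wt deg inv)
  commutes' r := by
    change TopAlg.mk wt deg inv rel (leftPS wt deg inv (algebraMap ℂ _ r)) =
      TopAlg.mk wt deg inv rel (algebraMap ℂ _ r)
    congr 1
    rw [PowerSeries.algebraMap_apply, PowerSeries.algebraMap_apply, leftPS, PowerSeries.map_C,
      RingHom.comp_apply, Mero.fst_const, dynFn_algebraMap]

/-- The right moment map. -/
def TopAlg.rightHom : PowerSeries (Mero (Wt N)) →ₐ[ℂ] TopAlg wt deg inv rel where
  __ := (TopAlg.mk wt deg inv rel).comp (rightPS wt deg inv)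
  commutes' r := by
    change TopAlg.mk wt deg inv rel (rightPS wt deg inv (algebraMap ℂ _ r)) =
      TopAlg.mk wt deg inv rel (algebraMap ℂ _ r)
    congr 1
    ext n
    rw [coeff_rightPS, PowerSeries.algebraMap_apply, PowerSeries.algebraMap_apply,
      PowerSeries.coeff_C, PowerSeries.coeff_C]
    split_ifs with h
    · subst h
      rw [Mero.snd_const, dynFn_algebraMap]
      simp
    · simp

theorem hasWeight_dynFn (g : FF N) : HasWeight 0 (dynFn wt deg inv g) := hasWeight_dyn (.fn g)

theorem hasWeight_of_central {x : DynAlg wt deg inv} (h : ∀ y, Commute x y) : HasWeight 0 x :=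
  fun g => by rw [Mero.shift_zero]; exact (h _).eq.symm

theorem TopAlg.leftHom_mem (ħ : ℂ) (f : PowerSeries (Mero (Wt N))) :
    TopAlg.leftHom rel f ∈ TopAlg.weightSpace wt deg inv rel ħ 0 0 :=
  TopAlg.mk_mem_weightSpace rel ħ (w := 0) (F := leftPS wt deg inv f) fun _ => hasWeight_dynFn _

theorem TopAlg.rightHom_mem (ħ : ℂ) (f : PowerSeries (Mero (Wt N))) :
    TopAlg.rightHom rel f ∈ TopAlg.weightSpace wt deg inv rel ħ 0 0 :=
  TopAlg.mk_mem_weightSpace rel ħ (w := 0) (F := rightPS wt deg inv f) fun n => by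
    rw [coeff_rightPS, ← add_zero (0 : Wt N × Wt N)]
    exact (hasWeight_dynFn _).mul (hasWeight_of_central (dynC_zpow_central _))

theorem leftPS_mul {w : Wt N × Wt N} {F : PowerSeries (DynAlg wt deg inv)}
    (hF : ∀ n, HasWeight w (PowerSeries.coeff n F)) (f : PowerSeries (Mero (Wt N))) :
    leftPS wt deg inv f * F = F * leftPS wt deg inv (PowerSeries.map (Mero.shift w.1) f) := by
  refine PowerSeries_mul_swap fun i j => ?_
  rw [coeff_leftPS, coeff_leftPS, hF j, Mero.shift_fst, PowerSeries.coeff_map]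

/-- The powers of `q^{c/2}` that turn `p` into `p*` are central, so only the meromorphic coefficient
feels the weight. -/
theorem rightPS_mul {w : Wt N × Wt N} {F : PowerSeries (DynAlg wt deg inv)}
    (hF : ∀ n, HasWeight w (PowerSeries.coeff n F)) (f : PowerSeries (Mero (Wt N))) :
    rightPS wt deg inv f * F = F * rightPS wt deg inv (PowerSeries.map (Mero.shift w.2) f) := by
  refine PowerSeries_mul_swap fun i j => ?_
  rw [coeff_rightPS, coeff_rightPS, mul_assoc, (dynC_zpow_central _ _).eq, ← mul_assoc, hF j,
    Mero.shift_snd, PowerSeries.coeff_map, mul_assoc]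

theorem PowerSeries_eq_X_pow_mul_unit {K : Type*} [Field K] {f : PowerSeries K} (hf : f ≠ 0) :
    ∃ (k : ℕ) (u : PowerSeries K), IsUnit u ∧ f = PowerSeries.X ^ k * u := by
  classical
  have h : ∃ k, PowerSeries.coeff k f ≠ 0 := by
    by_contra hcon
    push Not at hcon
    exact hf (PowerSeries.ext fun n => by rw [hcon n, map_zero])
  obtain ⟨H, hH⟩ := PowerSeries_exists_X_pow_mul (Nat.find h) f
    (fun m hm => not_not.mp (Nat.find_min h hm))
  refine ⟨Nat.find h, H, ?_, hH⟩
  rw [PowerSeries.isUnit_iff_constantCoeff, isUnit_iff_ne_zero]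
  have h1 := Nat.find_spec h
  have h2 := PowerSeries.coeff_X_pow_mul H (Nat.find h) 0
  rw [← hH, zero_add, PowerSeries.coeff_zero_eq_constantCoeff_apply] at h2
  rwa [h2] at h1

/-- Over a field a nonzero series is `X ^ k` times a unit, so a nonzero kernel element would kill a
power of the image of `X`. For both moment maps injectivity thus reduces to non-nilpotency of `p`.
-/
theorem injective_of_X {K A : Type*} [Field K] [Ring A] (φ : PowerSeries K →+* A)
    (h : ∀ k, φ PowerSeries.X ^ k ≠ 0) : Function.Injective φ := by
  rw [injective_iff_map_eq_zero]
  intro f hf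
  by_contra hne
  obtain ⟨k, u, hu, rfl⟩ := PowerSeries_eq_X_pow_mul_unit hne
  rw [map_mul, map_pow] at hf
  exact h k ((hu.map φ).mul_left_eq_zero.mp hf)

theorem TopAlg.leftHom_X : TopAlg.leftHom rel PowerSeries.X = TopAlg.p wt deg inv rel := by
  change TopAlg.mk wt deg inv rel (leftPS wt deg inv PowerSeries.X) = _
  rw [leftPS, PowerSeries.map_X]; rfl

theorem TopAlg.rightHom_X : TopAlg.rightHom rel PowerSeries.X = TopAlg.p wt deg inv rel *
    TopAlg.mk wt deg inv rel (PowerSeries.C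
      ((dynC wt deg inv ^ (-4 : ℤ) : (DynAlg wt deg inv)ˣ) : DynAlg wt deg inv)) := by
  change TopAlg.mk wt deg inv rel (rightPS wt deg inv PowerSeries.X) = _
  rw [TopAlg.p, ← map_mul]
  congr 1
  ext n
  rw [coeff_rightPS, PowerSeries.coeff_mul_C, PowerSeries.coeff_X, PowerSeries.coeff_X]
  split_ifs with h
  · subst h
    simp
  · simp

/-- The topological `𝓗`-algebra structure. -/
def TopAlg.hAlgebra {ħ : ℂ} (hħ : ħ ≠ 0) (hinv : ∀ x y, inv x y → wt x + wt y = 0)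
    (hp : ∀ k, TopAlg.p wt deg inv rel ^ k ≠ 0) :
    HAlgebra (Wt N) (TopAlg wt deg inv rel) (TopAlg.p wt deg inv rel) where
  comp := TopAlg.weightSpace wt deg inv rel ħ
  one_mem := TopAlg.one_mem_weightSpace rel ħ
  mul_mem := TopAlg.mul_mem_weightSpace rel ħ
  decomp := TopAlg.decomp rel hinv hħ
  μl := TopAlg.leftHom rel
  μr := TopAlg.rightHom rel
  μl_mem := TopAlg.leftHom_mem rel ħ
  μr_mem := TopAlg.rightHom_mem rel ħ
  μl_injective := injective_of_X (TopAlg.leftHom rel).toRingHom fun k h => hp k (by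
    rw [← TopAlg.leftHom_X]; exact h)
  μr_injective := injective_of_X (TopAlg.rightHom rel).toRingHom fun k h => hp k (by
    have h' : TopAlg.rightHom rel PowerSeries.X ^ k = 0 := h
    -- The image of the variable is `p* = p q^{-2c}`, which differs from `p` by a unit.
    rw [TopAlg.rightHom_X, (TopAlg.p_commute rel _).mul_pow] at h'
    refine IsUnit.mul_left_eq_zero (IsUnit.pow k ?_) |>.mp h'
    exact ((Units.isUnit _).map PowerSeries.C).map (TopAlg.mk wt deg inv rel))
  μl_mul := by
    intro α β a ha f
    -- The weight space only tests conjugation by exponentials. A lift with homogeneous coefficients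
    -- supplies the shift rule for all meromorphic functions.
    obtain ⟨F, rfl, hF⟩ := TopAlg.exists_hasWeight rel hinv hħ (w := (α, β)) ha
    change TopAlg.mk wt deg inv rel (leftPS wt deg inv f) * _ =
      _ * TopAlg.mk wt deg inv rel (leftPS wt deg inv _)
    rw [← map_mul, leftPS_mul hF, map_mul]
  μr_mul := by
    intro α β a ha f
    obtain ⟨F, rfl, hF⟩ := TopAlg.exists_hasWeight rel hinv hħ (w := (α, β)) ha
    change TopAlg.mk wt deg inv rel (rightPS wt deg inv f) * _ =
      _ * TopAlg.mk wt deg inv rel (rightPS wt deg inv _)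
    rw [← map_mul, rightPS_mul hF, map_mul]

theorem TopAlg.leftHom_apply (f : PowerSeries (Mero (Wt N))) :
    TopAlg.leftHom rel f = TopAlg.left wt deg inv rel f := (TopAlg.left_eq rel f).symm

theorem TopAlg.rightHom_apply (f : PowerSeries (Mero (Wt N))) :
    TopAlg.rightHom rel f = TopAlg.right wt deg inv rel f := (TopAlg.right_eq rel f).symm

theorem TopAlg.exists_hAlgebra {ħ : ℂ} (hħ : ħ ≠ 0) (hinv : ∀ x y, inv x y → wt x + wt y = 0)
    (hp : ∀ k, TopAlg.p wt deg inv rel ^ k ≠ 0) :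
    ∃ S : HAlgebra (Wt N) (TopAlg wt deg inv rel) (TopAlg.p wt deg inv rel),
      (∀ α β, S.comp α β = TopAlg.weightSpace wt deg inv rel ħ α β) ∧
      (∀ f, S.μl f = TopAlg.left wt deg inv rel f) ∧
      (∀ f, S.μr f = TopAlg.right wt deg inv rel f) :=
  ⟨TopAlg.hAlgebra rel hħ hinv hp, fun _ _ => rfl, TopAlg.leftHom_apply rel,
    TopAlg.rightHom_apply rel⟩

theorem TopAlg.gen_mem_weightSpace (ħ : ℂ) (x : G) :
    TopAlg.gen wt deg inv rel (.gen x) ∈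
      TopAlg.weightSpace wt deg inv rel ħ (wt x).1 (wt x).2 := by
  refine TopAlg.mk_mem_weightSpace rel ħ fun n => ?_
  rw [PowerSeries.coeff_C]
  split_ifs
  · exact hasWeight_dyn (.gen x)
  · exact HasWeight.zero

/-- `p` is not nilpotent if the relations hold in rings with a nilpotent element of high order. -/
theorem TopAlg.p_pow_ne_zero (k : ℕ) {R : Type*} [Ring R] (φ : DynAlg wt deg inv →+* R) (e : R)
    (he : ∀ r, Commute e r) (hn : e ^ (k + 1) = 0) (hk : e ^ k ≠ 0)
    (hrel : ∀ r ∈ rel, truncEval φ e he (k + 1) hn r = 0) :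
    TopAlg.p wt deg inv rel ^ k ≠ 0 := by
  intro h
  rw [TopAlg.p, ← map_pow, TopAlg.mk_eq_zero, mem_closedIdeal] at h
  -- Of the ideals in the intersection only the one containing `X ^ (k + 1)` is used, so a target
  -- with an element of nilpotency order exactly `k + 1` is enough.
  have hle : TwoSidedIdeal.span (rel ∪ {PowerSeries.X ^ (k + 1)}) ≤
      TwoSidedIdeal.ker (truncEval φ e he (k + 1) hn) := by
    rw [TwoSidedIdeal.span_le]
    intro r hr
    rw [SetLike.mem_coe, TwoSidedIdeal.mem_ker]
    rcases hr with hr | hr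
    · exact hrel r hr
    · rw [Set.mem_singleton_iff.mp hr, map_pow, truncEval_X, hn]
  have h0 := hle (h (k + 1))
  rw [TwoSidedIdeal.mem_ker, map_pow, truncEval_X] at h0
  exact hk h0

end MomentMaps

/-! ### A ring with a nilpotent element of prescribed order. -/

section TruncRing

/-- The ring `K[ε] / (ε ^ n)`. -/
abbrev TruncRing (K : Type*) [Field K] (n : ℕ) : Type _ :=
  Polynomial K ⧸ Ideal.span {(Polynomial.X : Polynomial K) ^ n}

/-- The nilpotent generator of `K[ε] / (ε ^ n)`. -/
def truncX (K : Type*) [Field K] (n : ℕ) : TruncRing K n :=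
  Ideal.Quotient.mk _ Polynomial.X

theorem truncX_pow_self (K : Type*) [Field K] (n : ℕ) : truncX K n ^ n = 0 := by
  rw [truncX, ← map_pow, Ideal.Quotient.eq_zero_iff_mem]
  exact Ideal.mem_span_singleton_self _

theorem truncX_pow_ne_zero (K : Type*) [Field K] (n : ℕ) : truncX K (n + 1) ^ n ≠ 0 := by
  rw [truncX, ← map_pow, Ne, Ideal.Quotient.eq_zero_iff_mem, Ideal.mem_span_singleton,
    pow_dvd_pow_iff Polynomial.X_ne_zero Polynomial.not_isUnit_X]
  omega

end TruncRing

/-! ### Non-nilpotency of `p` in `E_{q,p}`. -/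

section Eqp

/-- An infinite `finsum` is zero by convention, so no finiteness hypothesis is needed when every
term is killed. -/
theorem map_psum_eq_zero {D R ι : Type*} [Ring D] [Ring R] (φ : D →+* R) (F : ι → PowerSeries D)
    (h : ∀ i, PowerSeries.map φ (F i) = 0) : PowerSeries.map φ (psum F) = 0 := by
  ext n
  rw [PowerSeries.coeff_map, psum, PowerSeries.coeff_mk, map_zero]
  refine finsum_induction (fun x => φ x = 0) (map_zero φ) (fun x y hx hy => ?_) fun i => ?_
  · rw [map_add, hx, hy, add_zero]
  · rw [← PowerSeries.coeff_map, h, map_zero]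

/-- The homomorphism which kills all the generators `L̄_{ij,m}`. -/
def lEval (N n : ℕ) : LDyn N →ₐ[ℂ] TruncRing (FF N) n :=
  dynLift lWt lDeg lInv (fun x => match x with
    | .fn g => algebraMap (FF N) (TruncRing (FF N) n) g
    | .cHalf => 1
    | .cHalfInv => 1
    | .dHat => 0
    | .gen _ => 0) (by
    intro x y h
    rcases h with ⟨f, g⟩ | ⟨f, g⟩ | a | _ | _ | x | g | ⟨g, x⟩ | x | ⟨x, y, h⟩ <;>
    simp only [map_mul, map_add, FreeAlgebra.lift_ι_apply, AlgHom.commutes, map_one, map_zsmul,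
      mul_one, one_mul, mul_zero, zero_mul, smul_zero, add_zero]
    · rfl
    · exact h.elim)

/-- Every term of an `RLL` relation contains the series `L⁺`. The homomorphism sending the `L̄` to
zero and keeping the functions therefore satisfies all relations, with `p` acting as the nilpotent
generator. -/
theorem eRels_p_pow_ne_zero (N : ℕ) (ħ : ℂ) (k : ℕ) :
    TopAlg.p lWt lDeg lInv (eRels N ħ) ^ k ≠ 0 := by
  refine TopAlg.p_pow_ne_zero _ k (lEval N (k + 1)).toRingHom (truncX (FF N) (k + 1))
    (fun r => Commute.all _ r) (truncX_pow_self _ _) (truncX_pow_ne_zero _ _) ?_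
  have hcur : ∀ i j r, PowerSeries.map (lEval N (k + 1)).toRingHom (lCur i j r) = 0 := by
    intro i j r
    have h0 : (lEval N (k + 1)).toRingHom (dyn lWt lDeg lInv (.gen ⟨i, j, -r⟩)) = 0 :=
      dynLift_dyn _ _ _ _ _ _
    rw [lCur, map_mul, PowerSeries.map_C, h0, map_zero, zero_mul]
  rintro r ⟨i, j, i'', j'', a, b, rfl⟩
  refine truncEval_eq_zero _ _ _ _ _ _ fun m => ?_
  rw [← PowerSeries.coeff_map, rll, map_sum, Finset.sum_eq_zero, map_zero]
  intro i' _
  rw [map_sum]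
  refine Finset.sum_eq_zero fun j' _ => ?_
  rw [map_sub, map_psum_eq_zero, map_psum_eq_zero, sub_zero]
  · intro r
    rw [map_mul, map_mul, hcur, zero_mul, zero_mul]
  · intro r
    rw [map_mul, hcur, mul_zero]

theorem lGen_mem_weightSpace (N : ℕ) (ħ : ℂ) (i j : Fin N) (m : ℤ) :
    TopAlg.gen lWt lDeg lInv (eRels N ħ) (.gen ⟨i, j, m⟩) ∈
      TopAlg.weightSpace lWt lDeg lInv (eRels N ħ) ħ (-epsBar i) (-epsBar j) :=
  TopAlg.gen_mem_weightSpace (wt := lWt) (eRels N ħ) ħ ⟨i, j, m⟩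

end Eqp

/-! ### Finite `q`-products -/

section QProd

variable {R : Type*} [CommRing R]

/-- The finite product `∏_{i < n} (1 - e ^ i u)`, which equals `(u; e)_∞` if `e ^ n = 0`. -/
def qprod (n : ℕ) (e u : R) : R := ∏ i ∈ Finset.range n, (1 - e ^ i * u)

theorem map_qprod {S : Type*} [CommRing S] (f : R →+* S) (n : ℕ) (e u : R) :
    f (qprod n e u) = qprod n (f e) (f u) := by
  simp [qprod, map_prod]

/-- The functional equation `(u; e)_∞ = (1 - u) (e u; e)_∞`; the truncated product may be lengthened
by one factor because `e ^ n = 0`. -/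
theorem qprod_eq {n : ℕ} {e : R} (he : e ^ n = 0) (u : R) :
    qprod n e u = (1 - u) * qprod n e (e * u) := by
  have h : qprod (n + 1) e u = qprod n e u := by
    rw [qprod, Finset.prod_range_succ, he, zero_mul, sub_zero, mul_one, qprod]
  rw [← h, qprod, Finset.prod_range_succ', pow_zero, one_mul, mul_comm, qprod]
  simp only [pow_succ, mul_assoc]

/-- Each factor is `1` minus a nilpotent. Hence the only possibly noninvertible factor of `(u; e)_∞`
is `1 - u`. -/
theorem isUnit_qprod {n : ℕ} {e : R} (he : e ^ n = 0) (u : R) : IsUnit (qprod n e (e * u)) := by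
  rw [qprod]
  refine IsUnit.prod_iff.mpr fun i _ => ?_
  refine IsNilpotent.isUnit_one_sub ⟨n, ?_⟩
  rw [← mul_assoc, ← pow_succ, mul_pow, ← pow_mul, mul_comm (i + 1), pow_mul, he,
    zero_pow (Nat.succ_ne_zero i), zero_mul]

end QProd

/-! ### Iterated power series -/

section Iter

variable {R : Type*} [Ring R]

theorem exp_fin_two {u v : Fin 2} (huv : u ≠ v) (d : Fin 2 →₀ ℕ) :
    d = Finsupp.single u (d u) + Finsupp.single v (d v) := by
  ext i
  rw [Finsupp.add_apply, Finsupp.single_apply, Finsupp.single_apply]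
  have : i = u ∨ i = v := by omega
  rcases this with rfl | rfl
  · rw [if_pos rfl, if_neg (Ne.symm huv), add_zero]
  · rw [if_neg huv, if_pos rfl, zero_add]

/-- A power series in the two variables `X u`, `X v` as a power series in `X v` whose coefficients
are power series in `X u`. -/
def iterHom (R : Type*) [Ring R] {u v : Fin 2} (huv : u ≠ v) :
    MvPowerSeries (Fin 2) R →+* PowerSeries (PowerSeries R) where
  toFun f := PowerSeries.mk fun k => PowerSeries.mk fun m =>
    MvPowerSeries.coeff (Finsupp.single u m + Finsupp.single v k) f
  map_zero' := by
    ext k m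
    simp
  map_one' := by
    classical
    ext k m
    rw [PowerSeries.coeff_mk, PowerSeries.coeff_mk, MvPowerSeries.coeff_one, PowerSeries.coeff_one]
    have h : Finsupp.single u m + Finsupp.single v k = 0 ↔ k = 0 ∧ m = 0 := by
      constructor
      · intro h
        have h1 := DFunLike.congr_fun h u
        have h2 := DFunLike.congr_fun h v
        simp [huv, Ne.symm huv] at h1 h2
        exact ⟨h2, h1⟩
      · rintro ⟨rfl, rfl⟩
        simp
    by_cases hk : k = 0
    · by_cases hm : m = 0
      · simp [hk, hm]
      · simp [hk, hm]
    · rw [if_neg (fun hc => hk (h.mp hc).1), if_neg hk, map_zero]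
  map_add' f g := by
    ext k m
    simp
  map_mul' f g := by
    classical
    ext k m
    rw [PowerSeries.coeff_mk, PowerSeries.coeff_mk, MvPowerSeries.coeff_mul, PowerSeries.coeff_mul,
      map_sum]
    simp only [PowerSeries.coeff_mul, PowerSeries.coeff_mk]
    rw [← Finset.sum_product']
    -- The antidiagonal of a two-variable exponent is the product of the antidiagonals of its
    -- coordinates.
    refine Finset.sum_nbij' (fun p => ((p.1 v, p.2 v), (p.1 u, p.2 u)))
      (fun p => (Finsupp.single u p.2.1 + Finsupp.single v p.1.1,
        Finsupp.single u p.2.2 + Finsupp.single v p.1.2)) ?_ ?_ ?_ ?_ ?_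
    · intro p hp
      have hp' : p.1 + p.2 = _ := Finset.HasAntidiagonal.mem_antidiagonal.mp hp
      have h1 := DFunLike.congr_fun hp' u
      have h2 := DFunLike.congr_fun hp' v
      simp [huv, Ne.symm huv] at h1 h2
      rw [Finset.mem_product, Finset.HasAntidiagonal.mem_antidiagonal,
        Finset.HasAntidiagonal.mem_antidiagonal]
      exact ⟨h2, h1⟩
    · intro p hp
      rw [Finset.mem_product, Finset.HasAntidiagonal.mem_antidiagonal,
        Finset.HasAntidiagonal.mem_antidiagonal] at hp
      rw [Finset.HasAntidiagonal.mem_antidiagonal, ← hp.1, ← hp.2, Finsupp.single_add,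
        Finsupp.single_add, add_add_add_comm]
    · intro p _
      exact Prod.ext (exp_fin_two huv _).symm (exp_fin_two huv _).symm
    · intro p _
      simp [huv, Ne.symm huv]
    · intro p _
      rw [← exp_fin_two huv, ← exp_fin_two huv]

theorem coeff_coeff_iterHom {u v : Fin 2} (huv : u ≠ v) (f : MvPowerSeries (Fin 2) R) (k m : ℕ) :
    PowerSeries.coeff m (PowerSeries.coeff k (iterHom R huv f)) =
      MvPowerSeries.coeff (Finsupp.single u m + Finsupp.single v k) f := by
  rw [iterHom, RingHom.coe_mk, MonoidHom.coe_mk, OneHom.coe_mk, PowerSeries.coeff_mk,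
    PowerSeries.coeff_mk]

end Iter

/-! ### Evaluation of structure functions at level zero -/

section Structure

/-- The specialization `q^{c/2} = 1`. -/
def levelZero : LaurentPolynomial ℂ →ₐ[ℂ] ℂ := AddMonoidAlgebra.lift ℂ ℂ ℤ 1

theorem levelZero_T (k : ℤ) : levelZero (LaurentPolynomial.T k) = 1 := by
  rw [levelZero, LaurentPolynomial.T]
  erw [AddMonoidAlgebra.lift_single]
  simp

theorem levelZero_C (a : ℂ) : levelZero (LaurentPolynomial.C a) = a :=
  levelZero.commutes a

theorem C_pow_eq_zero {L : Type*} [CommRing L] {n : ℕ} {ε : L} (hε : ε ^ n = 0) :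
    (PowerSeries.C ε : PowerSeries L) ^ n = 0 := by
  rw [← map_pow, hε, map_zero]

variable {L : Type*} [CommRing L] [Algebra ℂ L] {n : ℕ} {ε : L} (hε : ε ^ n = 0)

/-- Evaluation at `p = ε`. -/
def nilEval : MvPowerSeries (Fin 2) ℂ →+* PowerSeries L :=
  (truncEval (PowerSeries.map (algebraMap ℂ L)) (PowerSeries.C ε) (fun _ => Commute.all _ _) n
    (C_pow_eq_zero hε)).comp (iterHom ℂ (u := 0) (v := 1) (by decide))

/-- Evaluation of a structure function at `q^{c/2} = 1`, `p = ε`. -/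
def sfEval : SF →+* PowerSeries L :=
  (nilEval hε).comp (MvPowerSeries.map (σ := Fin 2) levelZero.toRingHom)

theorem bideg_eq (m k : ℕ) : bideg m k = Finsupp.single 0 m + Finsupp.single 1 k := rfl

theorem coeff_nilEval (f : MvPowerSeries (Fin 2) ℂ) (m : ℕ) :
    PowerSeries.coeff m (nilEval hε f) = ∑ k ∈ Finset.range n,
      algebraMap ℂ L (MvPowerSeries.coeff (bideg m k) f) * ε ^ k := by
  rw [nilEval, RingHom.comp_apply, truncEval_apply, map_sum]
  refine Finset.sum_congr rfl fun k _ => ?_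
  rw [← map_pow, PowerSeries.coeff_mul_C, PowerSeries.coeff_map, coeff_coeff_iterHom, bideg_eq]

theorem coeff_sfEval (S : SF) (m : ℕ) :
    PowerSeries.coeff m (sfEval hε S) = ∑ k ∈ Finset.range n,
      algebraMap ℂ L (levelZero (MvPowerSeries.coeff (bideg m k) S)) * ε ^ k := by
  rw [sfEval, RingHom.comp_apply, coeff_nilEval]
  simp only [MvPowerSeries.coeff_map]
  rfl

theorem iterHom_X_inner {R : Type*} [Ring R] {u v : Fin 2} (huv : u ≠ v) :
    iterHom R huv (MvPowerSeries.X u) = PowerSeries.C PowerSeries.X := by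
  classical
  ext k m
  rw [coeff_coeff_iterHom, MvPowerSeries.coeff_X, PowerSeries.coeff_C]
  have h : Finsupp.single u m + Finsupp.single v k = Finsupp.single u 1 ↔ k = 0 ∧ m = 1 := by
    constructor
    · intro h
      have h1 := DFunLike.congr_fun h u
      have h2 := DFunLike.congr_fun h v
      simp [huv, Ne.symm huv] at h1 h2
      exact ⟨h2, h1⟩
    · rintro ⟨rfl, rfl⟩
      simp
  rw [if_congr h rfl rfl]
  by_cases hk : k = 0
  · simp [hk, PowerSeries.coeff_X]
  · simp [hk]

theorem iterHom_X_outer {R : Type*} [Ring R] {u v : Fin 2} (huv : u ≠ v) :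
    iterHom R huv (MvPowerSeries.X v) = PowerSeries.X := by
  classical
  ext k m
  rw [coeff_coeff_iterHom, MvPowerSeries.coeff_X, PowerSeries.coeff_X]
  have h : Finsupp.single u m + Finsupp.single v k = Finsupp.single v 1 ↔ k = 1 ∧ m = 0 := by
    constructor
    · intro h
      have h1 := DFunLike.congr_fun h u
      have h2 := DFunLike.congr_fun h v
      simp [huv, Ne.symm huv] at h1 h2
      exact ⟨h2, h1⟩
    · rintro ⟨rfl, rfl⟩
      simp
  rw [if_congr h rfl rfl]
  by_cases hk : k = 1
  · simp [hk, PowerSeries.coeff_one]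
  · simp [hk]

theorem iterHom_C {R : Type*} [Ring R] {u v : Fin 2} (huv : u ≠ v) (r : R) :
    iterHom R huv (MvPowerSeries.C r) = PowerSeries.C (PowerSeries.C r) := by
  classical
  ext k m
  rw [coeff_coeff_iterHom, MvPowerSeries.coeff_C, PowerSeries.coeff_C]
  have h : Finsupp.single u m + Finsupp.single v k = 0 ↔ k = 0 ∧ m = 0 := by
    constructor
    · intro h
      have h1 := DFunLike.congr_fun h u
      have h2 := DFunLike.congr_fun h v
      simp [huv, Ne.symm huv] at h1 h2
      exact ⟨h2, h1⟩
    · rintro ⟨rfl, rfl⟩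
      simp
  rw [if_congr h rfl rfl]
  by_cases hk : k = 0
  · simp [hk, PowerSeries.coeff_C]
  · simp [hk]

theorem sfEval_sx : sfEval hε sx = PowerSeries.X := by
  rw [sfEval, RingHom.comp_apply, sx, MvPowerSeries.map_X, nilEval, RingHom.comp_apply,
    iterHom_X_inner, truncEval_C, PowerSeries.map_X]

theorem sfEval_sp : sfEval hε sp = PowerSeries.C ε := by
  rw [sfEval, RingHom.comp_apply, sp, MvPowerSeries.map_X, nilEval, RingHom.comp_apply,
    iterHom_X_outer, truncEval_X]

theorem sfEval_C (a : LaurentPolynomial ℂ) : sfEval hε (MvPowerSeries.C a) =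
    PowerSeries.C (algebraMap ℂ L (levelZero a)) := by
  rw [sfEval, RingHom.comp_apply, MvPowerSeries.map_C, nilEval, RingHom.comp_apply,
    iterHom_C, truncEval_C, PowerSeries.map_C]
  rfl

theorem sfEval_sc (k : ℤ) : sfEval hε (sc k) = 1 := by
  rw [sc, sfEval_C, levelZero_T, map_one, map_one]

theorem sfEval_sq (ħ a : ℂ) : sfEval hε (sq ħ a) = PowerSeries.C (algebraMap ℂ L (qpow ħ a)) := by
  rw [sq, sk, sfEval_C, levelZero_C]

theorem sfEval_spStar : sfEval hε spStar = PowerSeries.C ε := by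
  rw [spStar, map_mul, sfEval_sp, sfEval_sc, mul_one]

theorem sfEval_congr (S S' : SF) (h : ∀ m, ∀ k < n, MvPowerSeries.coeff (bideg m k) S =
    MvPowerSeries.coeff (bideg m k) S') : sfEval hε S = sfEval hε S' := by
  ext m
  rw [coeff_sfEval, coeff_sfEval]
  exact Finset.sum_congr rfl fun k hk => by rw [h m k (Finset.mem_range.mp hk)]

theorem coeff_eq_zero_of_dvd {R : Type*} [CommRing R] {f : MvPowerSeries (Fin 2) R} {M : ℕ}
    (h : (MvPowerSeries.X 1) ^ M ∣ f) {m k : ℕ} (hk : k < M) :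
    MvPowerSeries.coeff (bideg m k) f = 0 := by
  rw [MvPowerSeries.X_pow_dvd_iff] at h
  refine h _ ?_
  simpa [bideg] using hk

/-- When `X 1` divides `P`, the factors of index greater than `k` do not affect exponent `k` of `X
1`. The cut-off can thus depend on the `p`-degree alone, instead of the total degree as in the
definition. -/
theorem coeff_qPoch {R : Type*} [CommRing R] (a : MvPowerSeries (Fin 2) R)
    {P : MvPowerSeries (Fin 2) R} (hP : MvPowerSeries.X 1 ∣ P) {m k M : ℕ} (hk : k < M) :
    MvPowerSeries.coeff (bideg m k) (qPoch a P) =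
      MvPowerSeries.coeff (bideg m k) (∏ i ∈ Finset.range M, (1 - a * P ^ i)) := by
  have step : ∀ M, k < M → MvPowerSeries.coeff (bideg m k)
      (∏ i ∈ Finset.range M, (1 - a * P ^ i)) =
      MvPowerSeries.coeff (bideg m k) (∏ i ∈ Finset.range (k + 1), (1 - a * P ^ i)) := by
    intro M hM
    induction M, hM using Nat.le_induction with
    | base => rfl
    | succ M hM ih =>
      have h0 : MvPowerSeries.coeff (bideg m k)
          ((∏ i ∈ Finset.range M, (1 - a * P ^ i)) * (a * P ^ M)) = 0 :=
        coeff_eq_zero_of_dvd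
          (Dvd.dvd.mul_left (Dvd.dvd.mul_left (pow_dvd_pow_of_dvd hP M) _) _) hM
      rw [Finset.prod_range_succ, mul_sub, mul_one, map_sub, ih, h0, sub_zero]
  have hd : (bideg m k).degree = m + k := by
    rw [bideg, map_add, Finsupp.degree_single, Finsupp.degree_single]
  have : MvPowerSeries.coeff (bideg m k) (qPoch a P) = MvPowerSeries.coeff (bideg m k)
      (∏ i ∈ Finset.range ((bideg m k).degree + 1), (1 - a * P ^ i)) := rfl
  rw [this, hd, step _ hk, step]
  omega

theorem sp_dvd_spStar : sp ∣ spStar := Dvd.intro _ rfl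

theorem sfEval_qPoch (a : SF) {P : SF} (hP : sp ∣ P) (hP' : sfEval hε P = PowerSeries.C ε) :
    sfEval hε (qPoch a P) = qprod n (PowerSeries.C ε) (sfEval hε a) := by
  rw [sfEval_congr hε _ _ fun m k hk => coeff_qPoch a hP hk, map_prod, qprod]
  refine Finset.prod_congr rfl fun i _ => ?_
  rw [map_sub, map_one, map_mul, map_pow, hP', mul_comm]

theorem constantCoeff_infProd {R : Type*} [CommRing R] (F : ℕ → MvPowerSeries (Fin 2) R) :
    MvPowerSeries.constantCoeff (infProd F) = MvPowerSeries.constantCoeff (F 0) := by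
  rw [← MvPowerSeries.coeff_zero_eq_constantCoeff_apply,
    ← MvPowerSeries.coeff_zero_eq_constantCoeff_apply]
  change MvPowerSeries.coeff 0 (∏ i ∈ Finset.range ((0 : Fin 2 →₀ ℕ).degree + 1), F i) = _
  rw [map_zero, zero_add, Finset.prod_range_one]

theorem constantCoeff_qPoch {R : Type*} [CommRing R] {a P : MvPowerSeries (Fin 2) R}
    (ha : MvPowerSeries.constantCoeff a = 0) : MvPowerSeries.constantCoeff (qPoch a P) = 1 := by
  rw [qPoch, constantCoeff_infProd, map_sub, map_one, pow_zero, mul_one, ha, sub_zero]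

theorem constantCoeff_numPoch {R : Type*} [CommRing R] [Algebra ℂ R]
    (y : MvPowerSeries (Fin 2) R) (t : ℂ) : MvPowerSeries.constantCoeff (numPoch y t) = 1 := by
  rw [← MvPowerSeries.coeff_zero_eq_constantCoeff_apply]
  change MvPowerSeries.coeff 0 (∑ m ∈ Finset.range ((0 : Fin 2 →₀ ℕ).degree + 1), _) = _
  rw [map_zero, zero_add, Finset.sum_range_one]
  simp [eulerCoeff]

theorem constantCoeff_brace (ħ : ℂ) (N : ℕ) (P : SF) (a : ℂ) :
    MvPowerSeries.constantCoeff (brace ħ N P a) = 1 := by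
  rw [brace, dPoch, constantCoeff_infProd, constantCoeff_numPoch]

theorem sdiv_mul_self {R : Type*} [CommRing R] (f : MvPowerSeries (Fin 2) R)
    {g : MvPowerSeries (Fin 2) R} (hg : MvPowerSeries.constantCoeff g = 1) : sdiv f g * g = f := by
  rw [sdiv, mul_assoc, MvPowerSeries.invOfUnit_mul _ _ (by rw [hg, Units.val_one]), mul_one]

theorem isUnit_of_constantCoeff {R : Type*} [CommRing R]
    {g : MvPowerSeries (Fin 2) R} (hg : MvPowerSeries.constantCoeff g = 1) : IsUnit g :=
  MvPowerSeries.isUnit_iff_constantCoeff.mpr (by rw [hg]; exact isUnit_one)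

/-- The denominator has constant term `1`, so its evaluation is a unit and can be cancelled. -/
theorem sfEval_sdiv_eq_one {f g : SF} (hg : MvPowerSeries.constantCoeff g = 1)
    (h : sfEval hε f = sfEval hε g) : sfEval hε (sdiv f g) = 1 := by
  have h1 := congrArg (sfEval hε) (sdiv_mul_self f hg)
  rw [map_mul, h] at h1
  exact ((isUnit_of_constantCoeff hg).map (sfEval hε)).mul_right_cancel (by rw [h1, one_mul])

theorem map_infProd {R R' : Type*} [CommRing R] [CommRing R'] (f : R →+* R')
    (F : ℕ → MvPowerSeries (Fin 2) R) : MvPowerSeries.map (σ := Fin 2) f (infProd F) =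
      infProd fun i => MvPowerSeries.map (σ := Fin 2) f (F i) := by
  ext d
  rw [MvPowerSeries.coeff_map]
  change f (MvPowerSeries.coeff d (∏ i ∈ Finset.range (d.degree + 1), F i)) =
    MvPowerSeries.coeff d (∏ i ∈ Finset.range (d.degree + 1), MvPowerSeries.map (σ := Fin 2) f (F i))
  rw [← MvPowerSeries.coeff_map, map_prod]

theorem map_numPoch {R R' : Type*} [CommRing R] [CommRing R'] [Algebra ℂ R] [Algebra ℂ R']
    (f : R →ₐ[ℂ] R') (y : MvPowerSeries (Fin 2) R) (t : ℂ) :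
    MvPowerSeries.map (σ := Fin 2) f.toRingHom (numPoch y t) =
      numPoch (MvPowerSeries.map (σ := Fin 2) f.toRingHom y) t := by
  ext d
  rw [MvPowerSeries.coeff_map]
  change f.toRingHom (MvPowerSeries.coeff d
    (∑ m ∈ Finset.range (d.degree + 1), eulerCoeff t m • y ^ m)) =
    MvPowerSeries.coeff d (∑ m ∈ Finset.range (d.degree + 1), eulerCoeff t m •
      (MvPowerSeries.map (σ := Fin 2) f.toRingHom y) ^ m)
  rw [map_sum, map_sum, map_sum]
  refine Finset.sum_congr rfl fun m _ => ?_
  rw [← map_pow]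
  exact map_smul f (eulerCoeff t m) (MvPowerSeries.coeff d (y ^ m))

theorem map_dPoch {R R' : Type*} [CommRing R] [CommRing R'] [Algebra ℂ R] [Algebra ℂ R']
    (f : R →ₐ[ℂ] R') (a P : MvPowerSeries (Fin 2) R) (t : ℂ) :
    MvPowerSeries.map (σ := Fin 2) f.toRingHom (dPoch a P t) =
      dPoch (MvPowerSeries.map (σ := Fin 2) f.toRingHom a)
        (MvPowerSeries.map (σ := Fin 2) f.toRingHom P) t := by
  rw [dPoch, map_infProd, dPoch]
  congr 1
  funext i
  rw [map_numPoch, map_mul, map_pow]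

theorem map_levelZero_spStar : MvPowerSeries.map (σ := Fin 2) levelZero.toRingHom spStar =
    MvPowerSeries.map (σ := Fin 2) levelZero.toRingHom sp := by
  have h : MvPowerSeries.map (σ := Fin 2) levelZero.toRingHom (sc (-2)) = 1 := by
    rw [sc, MvPowerSeries.map_C]
    change MvPowerSeries.C (levelZero _) = 1
    rw [levelZero_T, map_one]
  rw [spStar, map_mul, h, mul_one]

theorem map_levelZero_brace (ħ : ℂ) (N : ℕ) (a : ℂ) :
    MvPowerSeries.map (σ := Fin 2) levelZero.toRingHom (brace ħ N spStar a) =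
      MvPowerSeries.map (σ := Fin 2) levelZero.toRingHom (brace ħ N sp a) := by
  rw [brace, map_dPoch, map_levelZero_spStar, ← map_dPoch, brace]

theorem sfEval_brace (ħ : ℂ) (N : ℕ) (a : ℂ) :
    sfEval hε (brace ħ N spStar a) = sfEval hε (brace ħ N sp a) := by
  rw [sfEval, RingHom.comp_apply, map_levelZero_brace, RingHom.comp_apply]

/-- At level zero `p* = p`, so each starred factor has the same image as the unstarred one and
numerator and denominator coincide. -/
theorem sfEval_rhoPP (ħ : ℂ) (N : ℕ) : sfEval hε (rhoPP ħ N) = 1 := by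
  refine sfEval_sdiv_eq_one hε ?_ ?_
  · simp only [map_mul, constantCoeff_brace, mul_one]
  · simp only [map_mul, sfEval_brace]
    ring

theorem sfEval_kappa (ħ : ℂ) : sfEval hε (kappa ħ) = 1 := by
  have hs : MvPowerSeries.constantCoeff sp = 0 := MvPowerSeries.constantCoeff_X _
  have hs' : MvPowerSeries.constantCoeff spStar = 0 := by rw [spStar, map_mul, hs, zero_mul]
  refine sfEval_sdiv_eq_one hε ?_ ?_
  · rw [map_mul, constantCoeff_qPoch hs', constantCoeff_qPoch (by rw [map_mul, hs, zero_mul]),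
      one_mul]
  · rw [map_mul, map_mul, sfEval_qPoch hε _ dvd_rfl (sfEval_sp hε),
      sfEval_qPoch hε _ dvd_rfl (sfEval_sp hε), sfEval_qPoch hε _ sp_dvd_spStar (sfEval_spStar hε),
      sfEval_qPoch hε _ sp_dvd_spStar (sfEval_spStar hε), map_mul, map_mul, sfEval_sp,
      sfEval_spStar]

theorem constantCoeff_qPoch_sx (b P : SF) :
    MvPowerSeries.constantCoeff (qPoch (b * sx) P) = 1 := by
  refine constantCoeff_qPoch ?_
  rw [map_mul, sx, MvPowerSeries.constantCoeff_X, mul_zero]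

/-- The evaluation of `(a x; P)_∞ / (b x; P)_∞` for `P` evaluating to `ε`. -/
theorem sfEval_ratio_mul {a b P : SF} {α β : L} (hP : sp ∣ P)
    (hP' : sfEval hε P = PowerSeries.C ε) (ha : sfEval hε a = PowerSeries.C α)
    (hb : sfEval hε b = PowerSeries.C β) :
    sfEval hε (ratio a b P) * qprod n (PowerSeries.C ε) (PowerSeries.C β * PowerSeries.X) =
      qprod n (PowerSeries.C ε) (PowerSeries.C α * PowerSeries.X) := by
  have h1 := congrArg (sfEval hε) (sdiv_mul_self (qPoch (a * sx) P) (constantCoeff_qPoch_sx b P))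
  rwa [map_mul, sfEval_qPoch hε _ hP hP', sfEval_qPoch hε _ hP hP', map_mul, map_mul, sfEval_sx,
    ha, hb] at h1

end Structure

/-! ### Weighted shift operators -/

section Op

variable {W L : Type*} [AddCommGroup W] [CommRing L]

/-- The operator `f ↦ ((γ, t) ↦ c γ * f (γ - w, t - m))`. -/
def op (c : W → L) (w : W) (m : ℤ) : Module.End L (W × ℤ → L) where
  toFun f x := c x.1 * f (x.1 - w, x.2 - m)
  map_add' f g := by
    funext x
    exact mul_add _ _ _
  map_smul' a f := by
    funext x
    exact mul_left_comm _ _ _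

theorem op_apply (c : W → L) (w : W) (m : ℤ) (f : W × ℤ → L) (x : W × ℤ) :
    op c w m f x = c x.1 * f (x.1 - w, x.2 - m) := rfl

theorem op_mul_op (c c' : W → L) (w w' : W) (m m' : ℤ) :
    op c w m * op c' w' m' = op (fun γ => c γ * c' (γ - w)) (w + w') (m + m') := by
  refine LinearMap.ext fun f => funext fun x => ?_
  rw [Module.End.mul_apply, op_apply, op_apply, op_apply, mul_assoc, sub_sub, sub_sub]

theorem op_add (c c' : W → L) (w : W) (m : ℤ) : op c w m + op c' w m = op (c + c') w m :=
  LinearMap.ext fun f => funext fun x => (add_mul (c x.1) (c' x.1) (f (x.1 - w, x.2 - m))).symm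

theorem op_sub (c c' : W → L) (w : W) (m : ℤ) : op c w m - op c' w m = op (c - c') w m :=
  LinearMap.ext fun f => funext fun x => (sub_mul (c x.1) (c' x.1) (f (x.1 - w, x.2 - m))).symm

theorem op_zero (w : W) (m : ℤ) : op (0 : W → L) w m = 0 :=
  LinearMap.ext fun _ => funext fun _ => zero_mul _

theorem op_sum {ι : Type*} (s : Finset ι) (c : ι → W → L) (w : W) (m : ℤ) :
    ∑ i ∈ s, op (c i) w m = op (fun γ => ∑ i ∈ s, c i γ) w m := by
  refine LinearMap.ext fun f => funext fun x => ?_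
  rw [LinearMap.sum_apply, Finset.sum_apply, op_apply, Finset.sum_mul]
  rfl

theorem algebraMap_eq_op (a : L) :
    algebraMap L (Module.End L (W × ℤ → L)) a = op (fun _ => a) 0 0 := by
  refine LinearMap.ext fun f => funext fun x => ?_
  rw [op_apply, sub_zero, sub_zero]
  rfl

theorem one_eq_op : (1 : Module.End L (W × ℤ → L)) = op (fun _ => 1) 0 0 := by
  rw [← map_one (algebraMap L (Module.End L (W × ℤ → L))), algebraMap_eq_op]

theorem algebraMap_mul_op (a : L) (c : W → L) (w : W) (m : ℤ) :
    algebraMap L (Module.End L (W × ℤ → L)) a * op c w m = op (fun γ => a * c γ) w m := by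
  rw [algebraMap_eq_op, op_mul_op]
  simp only [sub_zero, zero_add]

theorem op_congr {c c' : W → L} {w w' : W} {m m' : ℤ} (hc : ∀ γ, c γ = c' γ) (hw : w = w')
    (hm : m = m') : op c w m = op c' w' m' := by
  rw [funext hc, hw, hm]

/-- Multiplication by the degree. -/
def degOp (W L : Type*) [CommRing L] : Module.End L (W × ℤ → L) where
  toFun f x := (x.2 : L) * f x
  map_add' f g := by
    funext x
    exact mul_add _ _ _
  map_smul' a f := by
    funext x
    exact mul_left_comm _ _ _

theorem degOp_mul_op (c : W → L) (w : W) (m : ℤ) :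
    degOp W L * op c w m = op c w m * degOp W L + m • op c w m := by
  refine LinearMap.ext fun f => funext fun x => ?_
  change (x.2 : L) * (c x.1 * f (x.1 - w, x.2 - m)) =
    c x.1 * (((x.2 - m : ℤ) : L) * f (x.1 - w, x.2 - m)) + m • (c x.1 * f (x.1 - w, x.2 - m))
  rw [zsmul_eq_mul]
  push_cast
  ring

end Op

theorem commute_algebraMap_op {W L : Type*} [CommRing L] (a : L) (r : Module.End L (W × ℤ → L)) :
    Commute (algebraMap L (Module.End L (W × ℤ → L)) a) r :=
  Algebra.commute_algebraMap_left a r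

theorem algebraMap_pow_eq_zero (W : Type*) {L : Type*} [CommRing L] {ε : L} {n : ℕ} (hε : ε ^ n = 0) :
    algebraMap L (Module.End L (W × ℤ → L)) ε ^ n = 0 := by
  rw [← map_pow, hε, map_zero]

/-! ### Representations of the dynamical algebra by weighted shifts. -/

section Rep

variable {N : ℕ} {G : Type} {wt : G → Wt N × Wt N} {deg : G → ℤ} {inv : G → G → Prop}
  {L : Type*} [CommRing L] [Algebra (FF N) L] [Algebra ℂ L] [IsScalarTower ℂ (FF N) L]
  (cf : G → Wt N × Wt N → L)

/-- The operators by which the generators act. -/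
def repGen (wt : G → Wt N × Wt N) (deg : G → ℤ) (cf : G → Wt N × Wt N → L) :
    DynGen N G → Module.End L ((Wt N × Wt N) × ℤ → L)
  | .fn g => op (fun γ => algebraMap (FF N) L (Mero.shift γ g)) 0 0
  | .cHalf => 1
  | .cHalfInv => 1
  | .dHat => degOp _ L
  | .gen x => op (cf x) (wt x) (deg x)

/-- The representation of the dynamical algebra by weighted shift operators. -/
def dynRep (hwt : ∀ x y, inv x y → wt x + wt y = 0) (hdeg : ∀ x y, inv x y → deg x + deg y = 0)
    (hcf : ∀ x y, inv x y → ∀ γ, cf x γ * cf y (γ - wt x) = 1) :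
    DynAlg wt deg inv →ₐ[ℂ] Module.End L ((Wt N × Wt N) × ℤ → L) :=
  dynLift wt deg inv (repGen wt deg cf) (by
    intro x y h
    rcases h with ⟨f, g⟩ | ⟨f, g⟩ | a | _ | _ | x | g | ⟨g, x⟩ | x | ⟨x, y, h⟩ <;>
    simp only [map_mul, map_add, FreeAlgebra.lift_ι_apply, AlgHom.commutes, map_one, map_zsmul,
      mul_one, one_mul, repGen, degOp_mul_op, zero_smul, add_zero]
    · rw [op_add]; rfl
    · rw [op_mul_op]
      simp only [sub_zero, add_zero]
    · simp only [Mero.shift_const]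
      rw [IsScalarTower.algebraMap_apply ℂ L (Module.End L ((Wt N × Wt N) × ℤ → L)),
        algebraMap_eq_op, IsScalarTower.algebraMap_apply ℂ (FF N) L]
    -- The shift relation: a generator moves the base point from `γ` to `γ - wt x`, and translating
    -- by `wt x` compensates.
    · rw [op_mul_op, op_mul_op]
      simp only [sub_zero, add_zero, zero_add, Mero.shift_shift, sub_add_cancel, mul_comm]
    · rw [op_mul_op, one_eq_op]
      exact op_congr (hcf x y h) (hwt x y h) (hdeg x y h))

end Rep

/-! ### Evaluation of relations when `q^{c/2}` acts as `1`. -/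

section RepEval

variable {N : ℕ} {G : Type} {wt : G → Wt N × Wt N} {deg : G → ℤ} {inv : G → G → Prop}
  {L : Type*} [CommRing L] [Algebra ℂ L] {ε : L} {n : ℕ} (hε : ε ^ n = 0)
  (φ : DynAlg wt deg inv →ₐ[ℂ] Module.End L ((Wt N × Wt N) × ℤ → L))

/-- Evaluation at `p = ε` of power series in `p` with operator coefficients. -/
def repEval : PowerSeries (DynAlg wt deg inv) →+* Module.End L ((Wt N × Wt N) × ℤ → L) :=
  truncEval φ.toRingHom (algebraMap L _ ε) (commute_algebraMap_op ε) n (algebraMap_pow_eq_zero _ hε)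

theorem repEval_C (d : DynAlg wt deg inv) : repEval hε φ (PowerSeries.C d) = φ d :=
  truncEval_C _ _ _ _ _ d

theorem repEval_apply (F : PowerSeries (DynAlg wt deg inv)) : repEval hε φ F =
    ∑ m ∈ Finset.range n, φ (PowerSeries.coeff m F) * algebraMap L _ (ε ^ m) := by
  rw [repEval, truncEval_apply]
  exact Finset.sum_congr rfl fun m _ => by rw [map_pow]; rfl

theorem repEval_smul (a : ℂ) (F : PowerSeries (DynAlg wt deg inv)) :
    repEval hε φ (a • F) = a • repEval hε φ F := by
  rw [repEval_apply, repEval_apply, Finset.smul_sum]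
  refine Finset.sum_congr rfl fun m _ => ?_
  rw [← smul_mul_assoc, ← map_smul]
  rfl

theorem smul_op (a : ℂ) (c : Wt N × Wt N → L) (w : Wt N × Wt N) (m : ℤ) :
    a • op c w m = op (fun γ => algebraMap ℂ L a * c γ) w m := by
  rw [← algebraMap_mul_op]
  refine LinearMap.ext fun f => funext fun x => ?_
  exact Algebra.smul_def a (op c w m f x)

variable (hc : φ (dyn wt deg inv .cHalf) = 1)

include hc in
theorem rep_dynC_zpow (k : ℤ) :
    φ ((dynC wt deg inv ^ k : (DynAlg wt deg inv)ˣ) : DynAlg wt deg inv) = 1 := by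
  have h1 : Units.map φ.toRingHom.toMonoidHom (dynC wt deg inv) = 1 := Units.ext hc
  have h2 := congrArg Units.val (congrArg (· ^ k) h1)
  simp only [one_zpow, ← map_zpow] at h2
  exact h2

include hc in
theorem rep_dynLaurent (a : LaurentPolynomial ℂ) :
    φ (dynLaurent wt deg inv a) = algebraMap L _ (algebraMap ℂ L (levelZero a)) := by
  induction a using LaurentPolynomial.induction_on' with
  | add p q hp hq => rw [map_add, map_add, hp, hq, map_add, map_add, map_add]
  | C_mul_T k a =>
    have h1 : dynLaurent wt deg inv (LaurentPolynomial.T k) =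
        ((dynC wt deg inv ^ k : (DynAlg wt deg inv)ˣ) : DynAlg wt deg inv) := by
      rw [dynLaurent, LaurentPolynomial.T]
      erw [AddMonoidAlgebra.lift_single]
      rw [one_smul]
      rfl
    have h2 : dynLaurent wt deg inv (LaurentPolynomial.C a) = algebraMap ℂ _ a :=
      (dynLaurent wt deg inv).commutes a
    rw [map_mul, map_mul, h1, h2, rep_dynC_zpow φ hc, mul_one, AlgHom.commutes, map_mul,
      levelZero_C, levelZero_T, mul_one]
    exact IsScalarTower.algebraMap_apply ℂ L _ a

include hc in
-- Because `q^{c/2}` acts as `1`, structure functions act through scalars. This is what reduces the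
-- operator relations to identities in `L`.
theorem repEval_sfCoeff (S : SF) (m : ℕ) : repEval hε φ (sfCoeff wt deg inv S m) =
    algebraMap L _ (PowerSeries.coeff m (sfEval hε S)) := by
  rw [repEval_apply, coeff_sfEval, map_sum]
  refine Finset.sum_congr rfl fun k _ => ?_
  rw [sfCoeff, PowerSeries.coeff_mk, rep_dynLaurent φ hc, map_mul]

/-- The current `A(z) = ∑ A r z^r` acts by operators of weight `w` and degree `s - r`. -/
def IsCurrent (A : ℤ → PowerSeries (DynAlg wt deg inv)) (w : Wt N × Wt N) (s : ℤ)
    (c : ℤ → Wt N × Wt N → L) : Prop :=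
  ∀ r, repEval hε φ (A r) = op (c r) w (s - r)

variable {hε φ}

theorem IsCurrent.zmul {A : ℤ → PowerSeries (DynAlg wt deg inv)} {w : Wt N × Wt N} {s : ℤ}
    {c : ℤ → Wt N × Wt N → L} (hA : IsCurrent hε φ A w s c) :
    IsCurrent hε φ (EllQG.zmul A) w (s + 1) (fun r => c (r - 1)) := fun r => by
  rw [EllQG.zmul, hA]
  exact op_congr (fun _ => rfl) rfl (by ring)

variable {A B C D : ℤ → PowerSeries (DynAlg wt deg inv)} {wA wB wC wD : Wt N × Wt N}
  {sA sB sC sD : ℤ} {cA cB cC cD : ℤ → Wt N × Wt N → L}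

include hc in
theorem IsCurrent.repEval_sf_mul_mul (hA : IsCurrent hε φ A wA sA cA)
    (hB : IsCurrent hε φ B wB sB cB) (S : SF) (m : ℕ) (a b : ℤ) :
    repEval hε φ (sfCoeff wt deg inv S m * A a * B b) =
      op (fun γ => PowerSeries.coeff m (sfEval hε S) * cA a γ * cB b (γ - wA)) (wA + wB)
        (sA + sB - (a + b)) := by
  rw [map_mul, map_mul, repEval_sfCoeff hε φ hc, hA, hB, algebraMap_mul_op, op_mul_op]
  exact op_congr (fun _ => rfl) rfl (by ring)

include hc in
/-- A criterion for an exchange relation to hold in the representation. -/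
theorem IsCurrent.repEval_exchange (hA : IsCurrent hε φ A wA sA cA)
    (hB : IsCurrent hε φ B wB sB cB) (hC : IsCurrent hε φ C wC sC cC)
    (hD : IsCurrent hε φ D wD sD cD) (hw : wC + wD = wA + wB) (hs : sC + sD = sA + sB)
    (S₁ S₂ : SF) (a b : ℤ)
    (h₁ : ∀ k, {m : ℕ | PowerSeries.coeff k
      (sfCoeff wt deg inv S₁ m * A (a + m) * B (b - m)) ≠ 0}.Finite)
    (h₂ : ∀ k, {m : ℕ | PowerSeries.coeff k
      (sfCoeff wt deg inv S₂ m * C (b + m) * D (a - m)) ≠ 0}.Finite)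
    (h : ∀ γ, ∃ T₀ : Finset ℕ, ∀ T, T₀ ⊆ T →
      ∑ m ∈ T, PowerSeries.coeff m (sfEval hε S₁) * cA (a + m) γ * cB (b - m) (γ - wA) =
      ∑ m ∈ T, PowerSeries.coeff m (sfEval hε S₂) * cC (b + m) γ * cD (a - m) (γ - wC)) :
    repEval hε φ (exchange wt deg inv S₁ S₂ A B C D a b) = 0 := by
  classical
  obtain ⟨T₁, hT₁⟩ := truncEval_psum φ.toRingHom (algebraMap L _ ε) (commute_algebraMap_op ε) n
    (algebraMap_pow_eq_zero _ hε) _ h₁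
  obtain ⟨T₂, hT₂⟩ := truncEval_psum φ.toRingHom (algebraMap L _ ε) (commute_algebraMap_op ε) n
    (algebraMap_pow_eq_zero _ hε) _ h₂
  change ∀ T, T₁ ⊆ T → repEval hε φ _ = ∑ m ∈ T, repEval hε φ _ at hT₁
  change ∀ T, T₂ ⊆ T → repEval hε φ _ = ∑ m ∈ T, repEval hε φ _ at hT₂
  refine LinearMap.ext fun f => funext fun x => ?_
  -- The index set `T₀` may depend on the weight, so the operators are compared at one point at a
  -- time; the three finite sets are then merged.
  obtain ⟨T₀, hT₀⟩ := h x.1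
  have e₁ : ∀ m : ℕ, sA + sB - (a + m + (b - m)) = sA + sB - (a + b) := fun m => by ring
  have e₂ : ∀ m : ℕ, sC + sD - (b + m + (a - m)) = sA + sB - (a + b) := fun m => by
    rw [hs]; ring
  have h' := hT₀ (T₀ ∪ T₁ ∪ T₂) (Finset.subset_union_left.trans Finset.subset_union_left)
  rw [exchange, map_sub, hT₁ (T₀ ∪ T₁ ∪ T₂)
    (Finset.subset_union_right.trans Finset.subset_union_left),
    hT₂ (T₀ ∪ T₁ ∪ T₂) Finset.subset_union_right]
  simp only [hA.repEval_sf_mul_mul hc hB, hC.repEval_sf_mul_mul hc hD, e₁, e₂, hw, op_sum, op_sub]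
  rw [op_apply, Pi.sub_apply, h', sub_self, zero_mul]
  rfl

theorem IsCurrent.repEval_commutator (hA : IsCurrent hε φ A wA sA cA)
    (hB : IsCurrent hε φ B wB sB cB) (a b : ℤ)
    (h : ∀ γ, cA a γ * cB b (γ - wA) = cB b γ * cA a (γ - wB)) :
    repEval hε φ (A a * B b - B b * A a) = 0 := by
  rw [map_sub, map_mul, map_mul, hA, hB, op_mul_op, op_mul_op, sub_eq_zero]
  exact op_congr h (add_comm _ _) (add_comm _ _)

end RepEval

/-! ### Finiteness of the sums in the relations -/

section Supp

/-- The coefficient of `x^m p^k` vanishes for `m > k + c`. -/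
def SuppLe {R : Type*} [CommRing R] (c : ℕ) (S : MvPowerSeries (Fin 2) R) : Prop :=
  ∀ m k, k + c < m → MvPowerSeries.coeff (bideg m k) S = 0

variable {R : Type*} [CommRing R]

theorem SuppLe.mul {c d : ℕ} {S T : MvPowerSeries (Fin 2) R} (hS : SuppLe c S) (hT : SuppLe d T) :
    SuppLe (c + d) (S * T) := by
  classical
  intro m k hmk
  rw [MvPowerSeries.coeff_mul]
  refine Finset.sum_eq_zero fun p hp => ?_
  have hp' : p.1 + p.2 = bideg m k := Finset.HasAntidiagonal.mem_antidiagonal.mp hp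
  have h0 := DFunLike.congr_fun hp' 0
  have h1 := DFunLike.congr_fun hp' 1
  simp [bideg] at h0 h1
  have e1 : p.1 = bideg (p.1 0) (p.1 1) := exp_fin_two (by decide) _
  have e2 : p.2 = bideg (p.2 0) (p.2 1) := exp_fin_two (by decide) _
  by_cases h : p.1 1 + c < p.1 0
  · rw [e1, hS _ _ h, zero_mul]
  · rw [e2, hT _ _ (by omega), mul_zero]

theorem SuppLe.sub {c : ℕ} {S T : MvPowerSeries (Fin 2) R} (hS : SuppLe c S) (hT : SuppLe c T) :
    SuppLe c (S - T) := fun m k h => by rw [map_sub, hS m k h, hT m k h, sub_zero]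

theorem SuppLe.neg {c : ℕ} {S : MvPowerSeries (Fin 2) R} (hS : SuppLe c S) :
    SuppLe c (-S) := fun m k h => by rw [map_neg, hS m k h, neg_zero]

theorem SuppLe.mono {c d : ℕ} {S : MvPowerSeries (Fin 2) R} (hS : SuppLe c S) (h : c ≤ d) :
    SuppLe d S := fun m k h' => hS m k (by omega)

theorem suppLe_C (a : R) : SuppLe 0 (MvPowerSeries.C a : MvPowerSeries (Fin 2) R) := by
  classical
  intro m k h
  rw [MvPowerSeries.coeff_C, if_neg]
  intro hc
  have := DFunLike.congr_fun hc 0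
  simp [bideg] at this
  omega

theorem suppLe_one : SuppLe 0 (1 : MvPowerSeries (Fin 2) R) := suppLe_C 1

theorem SuppLe.pow {S : MvPowerSeries (Fin 2) R} (hS : SuppLe 0 S) (i : ℕ) : SuppLe 0 (S ^ i) := by
  induction i with
  | zero => rw [pow_zero]; exact suppLe_one
  | succ i ih => rw [pow_succ]; exact ih.mul hS

theorem SuppLe.prod {ι : Type*} (s : Finset ι) {F : ι → MvPowerSeries (Fin 2) R}
    (h : ∀ i ∈ s, SuppLe 0 (F i)) : SuppLe 0 (∏ i ∈ s, F i) := by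
  classical
  induction s using Finset.induction_on with
  | empty => rw [Finset.prod_empty]; exact suppLe_one
  | insert a s ha ih =>
    rw [Finset.prod_insert ha]
    exact (h a (Finset.mem_insert_self _ _)).mul
      (ih fun i hi => h i (Finset.mem_insert_of_mem hi))

theorem suppLe_X_one : SuppLe 0 (MvPowerSeries.X 1 : MvPowerSeries (Fin 2) R) := by
  classical
  intro m k h
  rw [MvPowerSeries.coeff_X, if_neg]
  intro hc
  have := DFunLike.congr_fun hc 0
  simp [bideg] at this
  omega

theorem suppLe_X_zero : SuppLe 1 (MvPowerSeries.X 0 : MvPowerSeries (Fin 2) R) := by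
  classical
  intro m k h
  rw [MvPowerSeries.coeff_X, if_neg]
  intro hc
  have := DFunLike.congr_fun hc 0
  simp [bideg] at this
  omega

theorem suppLe_X_one_mul_X_zero :
    SuppLe 0 (MvPowerSeries.X 1 * MvPowerSeries.X 0 : MvPowerSeries (Fin 2) R) := by
  classical
  intro m k h
  rw [MvPowerSeries.X, MvPowerSeries.X, MvPowerSeries.monomial_mul_monomial,
    MvPowerSeries.coeff_monomial, if_neg]
  intro hc
  have h0 := DFunLike.congr_fun hc 0
  have h1 := DFunLike.congr_fun hc 1
  simp [bideg] at h0 h1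
  omega

theorem suppLe_qPoch {a P : MvPowerSeries (Fin 2) R} (ha : SuppLe 0 a) (hP : SuppLe 0 P) :
    SuppLe 0 (qPoch a P) := by
  intro m k h
  exact SuppLe.prod (Finset.range ((bideg m k).degree + 1))
    (fun i _ => suppLe_one.sub (ha.mul (hP.pow i))) m k h

/-- By induction on the total degree. In a coefficient of `S * T` the constant term of `T` isolates
the wanted coefficient of `S`; every other term contains a vanishing coefficient of `T` or a
coefficient of `S` of smaller degree that also violates the bound. -/
theorem SuppLe.of_mul_right {S T : MvPowerSeries (Fin 2) R} {c : ℕ} (hT : SuppLe 0 T)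
    (hT' : MvPowerSeries.constantCoeff T = 1) (h : SuppLe c (S * T)) : SuppLe c S := by
  classical
  suffices H : ∀ t m k, m + k = t → k + c < m → MvPowerSeries.coeff (bideg m k) S = 0 from
    fun m k hk => H _ m k rfl hk
  intro t
  induction t using Nat.strong_induction_on with
  | _ t ih =>
    intro m k ht hmk
    have h0 := h m k hmk
    rw [MvPowerSeries.coeff_mul, Finset.sum_eq_single (bideg m k, 0)] at h0
    · rwa [MvPowerSeries.coeff_zero_eq_constantCoeff_apply, hT', mul_one] at h0
    · intro p hp hne
      have hp' : p.1 + p.2 = bideg m k := Finset.HasAntidiagonal.mem_antidiagonal.mp hp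
      have h0 := DFunLike.congr_fun hp' 0
      have h1 := DFunLike.congr_fun hp' 1
      simp [bideg] at h0 h1
      have e1 : p.1 = bideg (p.1 0) (p.1 1) := exp_fin_two (by decide) _
      have e2 : p.2 = bideg (p.2 0) (p.2 1) := exp_fin_two (by decide) _
      by_cases h2 : p.2 1 < p.2 0
      · rw [e2, hT (p.2 0) (p.2 1) (by omega), mul_zero]
      by_cases h3 : p.2 0 = 0 ∧ p.2 1 = 0
      · refine absurd (Prod.ext ?_ ?_) hne
        · change p.1 = bideg m k
          rw [e1]
          congr 1 <;> omega
        · change p.2 = 0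
          rw [e2, h3.1, h3.2]
          simp [bideg]
      · rw [e1, ih (p.1 0 + p.1 1) (by omega) _ _ rfl (by omega), zero_mul]
    · intro hn
      exact absurd (Finset.HasAntidiagonal.mem_antidiagonal.mpr (add_zero _)) hn

theorem suppLe_ratio {a b P : SF} (ha : SuppLe 0 (a * sx)) (hb : SuppLe 0 (b * sx))
    (hP : SuppLe 0 P) : SuppLe 0 (ratio a b P) := by
  refine SuppLe.of_mul_right (suppLe_qPoch hb hP) (constantCoeff_qPoch_sx b P) ?_
  rw [ratio, sdiv_mul_self _ (constantCoeff_qPoch_sx b P)]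
  exact suppLe_qPoch ha hP

/-- Splitting off the factor of index `0`, the only one without a power of `P`. For a numerator `(a
x; P)_∞` it is the factor in which `x` may occur without a `p`. -/
theorem qPoch_eq {a P : MvPowerSeries (Fin 2) R} (hP : MvPowerSeries.X 1 ∣ P) :
    qPoch a P = (1 - a) * qPoch (a * P) P := by
  have key : ∀ (b f : MvPowerSeries (Fin 2) R) (m k M : ℕ), k < M →
      MvPowerSeries.coeff (bideg m k) (f * qPoch b P) =
      MvPowerSeries.coeff (bideg m k) (f * ∏ i ∈ Finset.range M, (1 - b * P ^ i)) := by
    classical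
    intro b f m k M hM
    rw [MvPowerSeries.coeff_mul, MvPowerSeries.coeff_mul]
    refine Finset.sum_congr rfl fun p hp => ?_
    have hp' : p.1 + p.2 = bideg m k := Finset.HasAntidiagonal.mem_antidiagonal.mp hp
    have h1 := DFunLike.congr_fun hp' 1
    simp [bideg] at h1
    have e2 : p.2 = bideg (p.2 0) (p.2 1) := exp_fin_two (by decide) _
    rw [e2, coeff_qPoch b hP (M := M) (by omega)]
  ext d
  have e : d = bideg (d 0) (d 1) := exp_fin_two (by decide) _
  -- The left product is cut one factor later than the right one, since its first factor becomes the
  -- separate `1 - a`.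
  rw [e, key _ _ _ _ (d 1 + 1) (Nat.lt_succ_self _), coeff_qPoch a hP (M := d 1 + 2) (by omega),
    Finset.prod_range_succ', pow_zero, mul_one, mul_comm]
  simp only [pow_succ, mul_assoc, mul_comm P]

theorem suppLe_sp : SuppLe 0 sp := suppLe_X_one

theorem suppLe_spStar : SuppLe 0 spStar := suppLe_sp.mul (suppLe_C _)

theorem suppLe_sp_mul (a : LaurentPolynomial ℂ) : SuppLe 0 (sp * MvPowerSeries.C a * sx) := by
  rw [mul_right_comm]
  exact suppLe_X_one_mul_X_zero.mul (suppLe_C a)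

end Supp

/-! ### States and amplitudes of the level zero representation -/

section Scalars

variable {L : Type*} [CommRing L] {ε : L} {n : ℕ} (hε : ε ^ n = 0)

/-- The unit `(ε u; ε)_∞`. -/
def gPoch (u : Lˣ) : Lˣ := (isUnit_qprod hε (u : L)).unit

theorem coe_gPoch (u : Lˣ) : (gPoch hε u : L) = qprod n ε (ε * u) := rfl

/-- The unit `(ε u; ε)_∞ (ε / u; ε)_∞`. -/
def gTheta (u : Lˣ) : Lˣ := gPoch hε u * gPoch hε u⁻¹

/-- The theta function `(u; ε)_∞ (ε / u; ε)_∞`. -/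
def thetaU (u : Lˣ) : L := (1 - u) * gTheta hε u

theorem thetaU_eq (u : Lˣ) :
    thetaU hε u = (1 - (u : L)) * ((gPoch hε u : L) * (gPoch hε u⁻¹ : L)) := by
  rw [thetaU, gTheta, Units.val_mul]

/-- The effect on the state `Y` of the step by which `Y j` is multiplied by `R⁻¹` and `Y (j + 1)` by
`R`. -/
def low (R : Lˣ) (j : ℕ) (Y : ℕ → Lˣ) (l : ℕ) : Lˣ :=
  if l = j then Y l * R⁻¹ else if l = j + 1 then Y l * R else Y l

/-- The partial products `∏_{i < m} Y_i ^ 2 / Q`. -/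
def wState (Q : Lˣ) (Y : ℕ → Lˣ) : ℕ → Lˣ
  | 0 => 1
  | m + 1 => wState Q Y m * Y m ^ 2 * Q⁻¹

/-- Beyond index `j + 1` the changes of `Y j` and `Y (j + 1)` cancel, so a step moves a single
partial product. This locality makes distant currents commute. -/
theorem wState_low (Q R : Lˣ) (j : ℕ) (Y : ℕ → Lˣ) (m : ℕ) :
    wState Q (low R j Y) m = if m = j + 1 then wState Q Y m * R⁻¹ ^ 2 else wState Q Y m := by
  induction m with
  | zero => rfl
  | succ m ih =>
    rw [wState, ih, wState, low]
    rcases eq_or_ne m j with rfl | h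
    · rw [if_neg (by omega), if_pos rfl, if_pos rfl, mul_pow]
      -- Monomial identities between units are linear in additive notation. The same device is used
      -- throughout.
      exact Additive.ofMul.injective (by simp only [ofMul_mul, ofMul_inv, ofMul_pow]; abel)
    rcases eq_or_ne m (j + 1) with rfl | h'
    · rw [if_pos rfl, if_neg h, if_pos rfl, if_neg (by omega)]
      exact Additive.ofMul.injective (by simp only [ofMul_mul, ofMul_inv, ofMul_pow]; abel)
    · rw [if_neg h', if_neg h, if_neg h', if_neg (by omega)]

variable (Q : Lˣ) (Y : ℕ → Lˣ) (j : ℕ)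

/-- The support of the current `e_j`. -/
def eLoc : Lˣ := wState Q Y (j + 1) * Q⁻¹ ^ 2

/-- The amplitude of the current `e_j`. -/
def eAmp : L := (Y (j + 1) : L) * thetaU hε (Q⁻¹ * (wState Q Y (j + 1) / wState Q Y (j + 2)))

/-- The support of the current `f_j`. -/
def fLoc : Lˣ := wState Q Y (j + 1)

/-- The amplitude of the current `f_j`. -/
def fAmp (C₀ : L) : L :=
  C₀ * (((Y j)⁻¹ : Lˣ) : L) * thetaU hε (Q * (wState Q Y (j + 1) / wState Q Y j))

/-- The power series `(u z; ε)_∞`. -/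
def gSeries (n : ℕ) (ε : L) (u : Lˣ) : PowerSeries L :=
  qprod n (PowerSeries.C ε) (PowerSeries.C (u : L) * PowerSeries.X)

/-- The factor of `k_l` in nonnegative powers of `z`. -/
def kPos (n : ℕ) (ε : L) (l : ℕ) : PowerSeries L :=
  PowerSeries.C (((Y l)⁻¹ : Lˣ) : L) * gSeries n ε (Q ^ (l + 2) / wState Q Y l) *
    Ring.inverse (gSeries n ε (Q ^ (l + 1) / wState Q Y (l + 1)))

/-- The factor of `k_l` in nonnegative powers of `p / z`. -/
def kNeg (n : ℕ) (ε : L) (l : ℕ) : PowerSeries L :=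
  gSeries n ε (Q ^ (l + 2) / wState Q Y l)⁻¹ *
    Ring.inverse (gSeries n ε (Q ^ (l + 1) / wState Q Y (l + 1))⁻¹)

/-- The coefficient of `z ^ r` in `f(z) g(ε / z)`. -/
def pairCoeff (n : ℕ) (ε : L) (f g : PowerSeries L) (r : ℤ) : L :=
  ∑ k ∈ Finset.range n, if 0 ≤ r + k then
    PowerSeries.coeff (r + k).toNat f * PowerSeries.coeff k g * ε ^ k else 0

/-- The coefficient of `z ^ r` in the eigenvalue of `k_l`. -/
def kAmp (n : ℕ) (ε : L) (l : ℕ) (r : ℤ) : L :=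
  pairCoeff n ε (kPos Q Y n ε l) (kNeg Q Y n ε l) r

end Scalars

/-! ### Finite sums of values of structure functions -/

section Sums

variable {L : Type*} [CommRing L]

theorem sum_coeff_mul_pow (P : Polynomial L) (u : L) {T : Finset ℕ} (hT : P.support ⊆ T) :
    ∑ m ∈ T, P.coeff m * u ^ m = P.eval u := by
  rw [Polynomial.eval_eq_sum, Polynomial.sum]
  refine (Finset.sum_subset hT fun m _ hm => ?_).symm
  rw [Polynomial.notMem_support_iff.mp hm, zero_mul]

theorem sum_coeff_mul_pow₃ (P Q R : Polynomial L) (u v w : L) {T : Finset (ℕ × ℕ × ℕ)}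
    (hT : P.support ×ˢ Q.support ×ˢ R.support ⊆ T) :
    ∑ m ∈ T, P.coeff m.1 * Q.coeff m.2.1 * R.coeff m.2.2 * (u ^ m.1 * v ^ m.2.1 * w ^ m.2.2) =
      P.eval u * Q.eval v * R.eval w := by
  rw [← Finset.sum_subset hT]
  · rw [← sum_coeff_mul_pow P u subset_rfl, ← sum_coeff_mul_pow Q v subset_rfl,
      ← sum_coeff_mul_pow R w subset_rfl, mul_assoc, Finset.sum_mul_sum, Finset.sum_mul_sum,
      Finset.sum_product]
    refine Finset.sum_congr rfl fun i _ => ?_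
    rw [Finset.sum_product]
    refine Finset.sum_congr rfl fun k _ => ?_
    rw [Finset.mul_sum]
    exact Finset.sum_congr rfl fun l _ => by ring
  · intro m _ hm
    simp only [Finset.mem_product, not_and_or, Polynomial.notMem_support_iff] at hm
    rcases hm with h | h | h <;> simp [h]

/-- The polynomial `∏_{i < n} (1 - ε ^ i a z)`. -/
def gPoly (n : ℕ) (ε a : L) : Polynomial L :=
  qprod n (Polynomial.C ε) (Polynomial.C a * Polynomial.X)

theorem eval_gPoly (n : ℕ) (ε a u : L) : (gPoly n ε a).eval u = qprod n ε (a * u) := by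
  rw [gPoly, ← Polynomial.coe_evalRingHom, map_qprod, map_mul]
  simp

theorem coe_gPoly (n : ℕ) (ε a : L) : (gPoly n ε a : PowerSeries L) =
    qprod n (PowerSeries.C ε) (PowerSeries.C a * PowerSeries.X) := by
  rw [gPoly, ← Polynomial.coeToPowerSeries.ringHom_apply, map_qprod, map_mul]
  simp

variable [Algebra ℂ L] {ε : L} {n : ℕ} (hε : ε ^ n = 0)

/-- Only `p`-degrees below `n` survive the evaluation, and the support bound then limits the degree
in `x`. As a polynomial, the structure function can be evaluated at the ratio of supports of two
delta functions. -/
theorem exists_polynomial {S : SF} {c : ℕ} (hS : SuppLe c S) :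
    ∃ P : Polynomial L, (P : PowerSeries L) = sfEval hε S := by
  refine ⟨PowerSeries.trunc (n + c) (sfEval hε S), ?_⟩
  ext m
  rw [Polynomial.coeff_coe, PowerSeries.coeff_trunc]
  split_ifs with h
  · rfl
  · rw [coeff_sfEval, Finset.sum_eq_zero]
    intro k hk
    rw [Finset.mem_range] at hk
    rw [hS m k (by omega), map_zero, map_zero, zero_mul]

/-- The value of a ratio of infinite products. -/
theorem exists_polynomial_ratio {a b P : SF} {α β : L} {c : ℕ} (hS : SuppLe c (ratio a b P))
    (hP : sp ∣ P) (hP' : sfEval hε P = PowerSeries.C ε) (ha : sfEval hε a = PowerSeries.C α)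
    (hb : sfEval hε b = PowerSeries.C β) :
    ∃ F : Polynomial L, (F : PowerSeries L) = sfEval hε (ratio a b P) ∧
      ∀ u, F.eval u * qprod n ε (β * u) = qprod n ε (α * u) := by
  obtain ⟨F, hF⟩ := exists_polynomial hε hS
  refine ⟨F, hF, fun u => ?_⟩
  have h := sfEval_ratio_mul hε hP hP' ha hb
  rw [← hF, ← coe_gPoly, ← coe_gPoly, ← Polynomial.coe_mul, Polynomial.coe_inj] at h
  rw [← eval_gPoly, ← eval_gPoly, ← Polynomial.eval_mul, h]

end Sums

/-! ### Support bounds for the structure functions. -/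

section SuppRatio

/-- After `1 - a x` is split off the numerator, every remaining `x` comes with a factor `P`; the
single free `x` accounts for the bound `1`. -/
theorem suppLe_ratio_one {a b P : SF} (ha : SuppLe 0 a) (hb : SuppLe 0 (b * sx))
    (hP : SuppLe 0 P) (hP' : SuppLe 0 (P * sx)) (hdvd : sp ∣ P) : SuppLe 1 (ratio a b P) := by
  refine SuppLe.of_mul_right (suppLe_qPoch hb hP) (constantCoeff_qPoch_sx b P) ?_
  rw [ratio, sdiv_mul_self _ (constantCoeff_qPoch_sx b P), qPoch_eq hdvd]
  have h1 : SuppLe 1 (1 - a * sx) :=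
    (suppLe_one.mono zero_le_one).sub (ha.mul suppLe_X_zero)
  refine h1.mul (suppLe_qPoch ?_ hP)
  rw [mul_assoc, mul_comm sx]
  exact ha.mul hP'

theorem suppLe_sq (ħ a : ℂ) : SuppLe 0 (sq ħ a) := suppLe_C _

theorem suppLe_sp_mul_sx : SuppLe 0 (sp * sx) := suppLe_X_one_mul_X_zero

theorem suppLe_spStar_mul_sx : SuppLe 0 (spStar * sx) := suppLe_sp_mul _

theorem suppLe_mul_sx {P S : SF} (hP : SuppLe 0 (P * sx)) (hS : SuppLe 0 S) :
    SuppLe 0 (P * S * sx) := by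
  rw [mul_right_comm]
  exact hP.mul hS

end SuppRatio

/-! ### Finiteness, in each power of `p`, of the exchange and Serre sums. -/

section Finiteness

variable {N : ℕ} {G : Type} {wt : G → Wt N × Wt N} {deg : G → ℤ} {inv : G → G → Prop}

theorem coeff_sfCoeff_eq_zero {S : SF} {c : ℕ} (hS : SuppLe c S) {m k : ℕ} (h : k + c < m) :
    PowerSeries.coeff k (sfCoeff wt deg inv S m) = 0 := by
  rw [sfCoeff, PowerSeries.coeff_mk, hS m k h, map_zero]

theorem coeff_mul_eq_zero_of_left {R : Type*} [Ring R] {A : PowerSeries R} {k : ℕ}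
    (hA : ∀ i ≤ k, PowerSeries.coeff i A = 0) (B : PowerSeries R) :
    PowerSeries.coeff k (A * B) = 0 := by
  rw [PowerSeries.coeff_mul]
  refine Finset.sum_eq_zero fun p hp => ?_
  rw [hA p.1 (by
    have : p.1 + p.2 = k := Finset.HasAntidiagonal.mem_antidiagonal.mp hp
    omega), zero_mul]

theorem coeff_mul_eq_zero_of_right {R : Type*} [Ring R] {B : PowerSeries R} {k : ℕ}
    (hB : ∀ i ≤ k, PowerSeries.coeff i B = 0) (A : PowerSeries R) :
    PowerSeries.coeff k (A * B) = 0 := by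
  rw [PowerSeries.coeff_mul]
  refine Finset.sum_eq_zero fun p hp => ?_
  rw [hB p.2 (by
    have : p.1 + p.2 = k := Finset.HasAntidiagonal.mem_antidiagonal.mp hp
    omega), mul_zero]

theorem finite_of_suppLe {S : SF} {c : ℕ} (hS : SuppLe c S)
    (A B : ℕ → PowerSeries (DynAlg wt deg inv)) (k : ℕ) :
    {m : ℕ | PowerSeries.coeff k (sfCoeff wt deg inv S m * A m * B m) ≠ 0}.Finite := by
  refine (Set.finite_Iic (k + c)).subset fun m hm => ?_
  by_contra h
  rw [Set.mem_Iic, not_le] at h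
  refine hm ?_
  rw [mul_assoc]
  exact coeff_mul_eq_zero_of_left (fun i hi => coeff_sfCoeff_eq_zero hS (by omega)) _

theorem finite_of_suppLe₃ {S H : SF} (hS : SuppLe 0 S) (hH : SuppLe 0 H)
    (A B C : ℕ × ℕ × ℕ → PowerSeries (DynAlg wt deg inv)) (k : ℕ) :
    {m : ℕ × ℕ × ℕ | PowerSeries.coeff k (sfCoeff wt deg inv S m.1 * sfCoeff wt deg inv H m.2.1 *
      sfCoeff wt deg inv H m.2.2 * A m * B m * C m) ≠ 0}.Finite := by
  refine ((Set.finite_Iic k).prod ((Set.finite_Iic k).prod (Set.finite_Iic k))).subset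
    fun m hm => ?_
  rw [Set.mem_prod, Set.mem_prod, Set.mem_Iic, Set.mem_Iic, Set.mem_Iic]
  simp only [mul_assoc] at hm
  refine ⟨?_, ?_, ?_⟩ <;> by_contra h <;> refine hm ?_
  · exact coeff_mul_eq_zero_of_left (fun i hi => coeff_sfCoeff_eq_zero hS (by omega)) _
  · exact coeff_mul_eq_zero_of_right (fun i hi => coeff_mul_eq_zero_of_left
      (fun i' hi' => coeff_sfCoeff_eq_zero hH (by omega)) _) _
  · exact coeff_mul_eq_zero_of_right (fun i hi => coeff_mul_eq_zero_of_right
      (fun i' hi' => coeff_mul_eq_zero_of_left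
        (fun i'' hi'' => coeff_sfCoeff_eq_zero hH (by omega)) _) _) _

end Finiteness

/-! ### Powers of the supports of delta functions. -/

section ZPow

variable {L : Type*} [CommRing L]

theorem zpow_shift_add (x : Lˣ) (a : ℤ) (m : ℕ) :
    ((x ^ (-(a + m)) : Lˣ) : L) = ((x ^ (-a) : Lˣ) : L) * ((x⁻¹ : Lˣ) : L) ^ m := by
  rw [← Units.val_pow_eq_pow_val, ← Units.val_mul, neg_add, zpow_add, zpow_neg x (m : ℤ),
    zpow_natCast, inv_pow]

theorem zpow_shift_sub (x : Lˣ) (b : ℤ) (m : ℕ) :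
    ((x ^ (-(b - m)) : Lˣ) : L) = ((x ^ (-b) : Lˣ) : L) * (x : L) ^ m := by
  rw [← Units.val_pow_eq_pow_val, ← Units.val_mul, neg_sub, sub_eq_neg_add, zpow_add, zpow_natCast]

theorem zpow_one_sub (x : Lˣ) (a : ℤ) :
    ((x ^ (-(a - 1)) : Lˣ) : L) = x * ((x ^ (-a) : Lˣ) : L) := by
  rw [← Units.val_mul, neg_sub, sub_eq_add_neg, zpow_add, zpow_one]

end ZPow

/-! ### Relations between delta function currents. -/

section DeltaCurrents

variable {N : ℕ} {G : Type} {wt : G → Wt N × Wt N} {deg : G → ℤ} {inv : G → G → Prop}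
  {L : Type*} [CommRing L] [Algebra ℂ L] {ε : L} {n : ℕ} {hε : ε ^ n = 0}
  {φ : DynAlg wt deg inv →ₐ[ℂ] Module.End L ((Wt N × Wt N) × ℤ → L)}

variable (hε φ) in
/-- The current acts by `α(γ) δ(z / ω(γ))`. -/
def IsDelta (A : ℤ → PowerSeries (DynAlg wt deg inv)) (w : Wt N × Wt N)
    (α : Wt N × Wt N → L) (ω : Wt N × Wt N → Lˣ) : Prop :=
  IsCurrent hε φ A w 0 fun r γ => α γ * ((ω γ ^ (-r) : Lˣ) : L)

variable (hc : φ (dyn wt deg inv .cHalf) = 1)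
  {A B : ℤ → PowerSeries (DynAlg wt deg inv)} {wA wB : Wt N × Wt N}
  {α β : Wt N × Wt N → L} {ωA ωB : Wt N × Wt N → Lˣ}

include hc in
/-- A criterion for an exchange relation between two delta function currents. -/
theorem IsDelta.repEval_exchange (hA : IsDelta hε φ A wA α ωA) (hB : IsDelta hε φ B wB β ωB)
    {S : SF} {c : ℕ} (hS : SuppLe c S) {F : Polynomial L} (hF : (F : PowerSeries L) = sfEval hε S)
    (a b : ℤ) (hωA : ∀ γ, ωA (γ - wB) = ωA γ) (hωB : ∀ γ, ωB (γ - wA) = ωB γ)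
    (h : ∀ γ, ωA γ * α γ * β (γ - wA) * F.eval ((ωB γ / ωA γ : Lˣ) : L) =
      -(ωB γ * β γ * α (γ - wB) * F.eval ((ωA γ / ωB γ : Lˣ) : L))) :
    repEval hε φ (exchange wt deg inv S (-S) (EllQG.zmul A) B (EllQG.zmul B) A a b) = 0 := by
  refine IsCurrent.repEval_exchange hc hA.zmul hB hB.zmul hA (add_comm _ _) (by ring) S (-S) a b
    (finite_of_suppLe hS _ _) (finite_of_suppLe hS.neg _ _) fun γ => ⟨F.support, fun T hT => ?_⟩
  have e : ∀ m, PowerSeries.coeff m (sfEval hε S) = F.coeff m := fun m => by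
    rw [← hF, Polynomial.coeff_coe]
  have h1 : ∀ m : ℕ, a + m - 1 = a - 1 + m := fun m => by ring
  have h2 : ∀ m : ℕ, b + m - 1 = b - 1 + m := fun m => by ring
  have h3 := h γ
  -- A product of delta functions evaluates a function of `z₂ / z₁` at the ratio of the supports. In
  -- coefficients this is the sum for `F.eval`, times `ωA ^ (-a) ωB ^ (-b)`.
  rw [← sum_coeff_mul_pow F _ hT, ← sum_coeff_mul_pow F _ hT] at h3
  simp only [map_neg, e, h1, h2, zpow_shift_add, zpow_shift_sub, zpow_one_sub, hωA, hωB]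
  rw [Finset.mul_sum, Finset.mul_sum, ← Finset.sum_neg_distrib] at h3
  have h4 := congrArg (· * (((ωA γ ^ (-a) : Lˣ) : L) * ((ωB γ ^ (-b) : Lˣ) : L))) h3
  simp only [Finset.sum_mul] at h4
  refine Eq.trans (Finset.sum_congr rfl fun m _ => ?_) (h4.trans (Finset.sum_congr rfl fun m _ => ?_))
  · rw [div_eq_mul_inv, Units.val_mul, mul_pow]
    ring
  · rw [div_eq_mul_inv, Units.val_mul, mul_pow]
    ring

include hc in
/-- An exchange relation of a delta function current with itself. -/
theorem IsDelta.repEval_exchange_self (hA : IsDelta hε φ A wA α ωA)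
    {S : SF} {c : ℕ} (hS : SuppLe c S) {F : Polynomial L} (hF : (F : PowerSeries L) = sfEval hε S)
    (a b : ℤ) (R : Lˣ) (hωA : ∀ γ, ωA (γ - wA) = ωA γ * R) (h : F.eval (R : L) = 0) :
    repEval hε φ (exchange wt deg inv S (-S) (EllQG.zmul A) A (EllQG.zmul A) A a b) = 0 := by
  have e : ∀ m, PowerSeries.coeff m (sfEval hε S) = F.coeff m := fun m => by
    rw [← hF, Polynomial.coeff_coe]
  -- Both orders vanish separately: two successive actions have supports of ratio `R`, where the
  -- structure function is zero.
  have key : ∀ γ (a b : ℤ) (T : Finset ℕ), F.support ⊆ T →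
      ∑ m ∈ T, F.coeff m * (α γ * ((ωA γ ^ (-(a + m - 1)) : Lˣ) : L)) *
        (α (γ - wA) * ((ωA (γ - wA) ^ (-(b - m)) : Lˣ) : L)) = 0 := by
    intro γ a b T hT
    have h1 : ∀ m : ℕ, a + m - 1 = a - 1 + m := fun m => by ring
    have h3 := congrArg (· * (α γ * α (γ - wA) * ((ωA γ ^ (-(a - 1)) : Lˣ) : L) *
      (((ωA γ * R) ^ (-b) : Lˣ) : L))) h
    rw [← sum_coeff_mul_pow F _ hT] at h3
    simp only [zero_mul, Finset.sum_mul] at h3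
    rw [← h3]
    refine Finset.sum_congr rfl fun m _ => ?_
    have h5 : ((ωA γ * R : Lˣ) : L) ^ m * (((ωA γ)⁻¹ : Lˣ) : L) ^ m = (R : L) ^ m := by
      rw [← mul_pow, ← Units.val_mul, mul_comm, inv_mul_cancel_left]
    rw [h1, zpow_shift_add, hωA, zpow_shift_sub, ← h5]
    ring
  refine IsCurrent.repEval_exchange hc hA.zmul hA hA.zmul hA (add_comm _ _) (by ring) S (-S) a b
    (finite_of_suppLe hS _ _) (finite_of_suppLe hS.neg _ _) fun γ => ⟨F.support, fun T hT => ?_⟩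
  simp only [map_neg, e, neg_mul, Finset.sum_neg_distrib]
  rw [key γ a b T hT, key γ b a T hT, neg_zero]

include hc in
theorem IsCurrent.repEval_sf₃ {A B C : ℤ → PowerSeries (DynAlg wt deg inv)}
    {wA wB wC : Wt N × Wt N} {sA sB sC : ℤ} {cA cB cC : ℤ → Wt N × Wt N → L}
    (hA : IsCurrent hε φ A wA sA cA) (hB : IsCurrent hε φ B wB sB cB)
    (hC : IsCurrent hε φ C wC sC cC) (S H : SF) (m : ℕ × ℕ × ℕ) (a b c : ℤ) :
    repEval hε φ (sfCoeff wt deg inv S m.1 * sfCoeff wt deg inv H m.2.1 *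
        sfCoeff wt deg inv H m.2.2 * A a * B b * C c) =
      op (fun γ => PowerSeries.coeff m.1 (sfEval hε S) * PowerSeries.coeff m.2.1 (sfEval hε H) *
        PowerSeries.coeff m.2.2 (sfEval hε H) * (cA a γ * cB b (γ - wA) * cC c (γ - wA - wB)))
        (wA + wB + wC) (sA + sB + sC - (a + b + c)) := by
  rw [map_mul, map_mul, map_mul, map_mul, map_mul, repEval_sfCoeff hε φ hc,
    repEval_sfCoeff hε φ hc, repEval_sfCoeff hε φ hc, hA, hB, hC, ← map_mul, ← map_mul,
    mul_assoc, mul_assoc, ← mul_assoc (op _ _ _), op_mul_op, op_mul_op, algebraMap_mul_op]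
  refine op_congr (fun γ => ?_) rfl (by ring)
  rw [sub_sub]

include hc in
/-- A criterion for the Serre relations between delta function currents. -/
theorem IsDelta.repEval_serre (ħ : ℂ) (hX : IsDelta hε φ A wA α ωA) (hY : IsDelta hε φ B wB β ωB)
    {S H : SF} (hS : SuppLe 0 S) (hH : SuppLe 0 H) {E : Polynomial L}
    (hE : (E : PowerSeries L) = sfEval hε H)
    (R : Lˣ) (hωA : ∀ γ, ωA (γ - wA) = ωA γ * R) (hωA' : ∀ γ, ωA (γ - wB) = ωA γ)
    (hωB : ∀ γ, ωB (γ - wA) = ωB γ) (a b c : ℤ)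
    (h : ∀ γ, β γ * α (γ - wB) * α (γ - wB - wA) * E.eval ((ωA γ / ωB γ : Lˣ) : L) *
          E.eval ((ωA γ * R / ωB γ : Lˣ) : L) -
        algebraMap ℂ L (qpow ħ 1 + qpow ħ (-1)) * (α γ * β (γ - wA) * α (γ - wA - wB) *
          E.eval ((ωB γ / ωA γ : Lˣ) : L) * E.eval ((ωA γ * R / ωB γ : Lˣ) : L)) +
        α γ * α (γ - wA) * β (γ - wA - wA) * E.eval ((ωB γ / ωA γ : Lˣ) : L) *
          E.eval ((ωB γ / (ωA γ * R) : Lˣ) : L) = 0) :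
    repEval hε φ (serreTerm wt deg inv ħ S H A B a b c) = 0 := by
  classical
  obtain ⟨P, hP⟩ := exists_polynomial hε hS
  have eS : ∀ m, PowerSeries.coeff m (sfEval hε S) = P.coeff m := fun m => by
    rw [← hP, Polynomial.coeff_coe]
  have eH : ∀ m, PowerSeries.coeff m (sfEval hε H) = E.coeff m := fun m => by
    rw [← hE, Polynomial.coeff_coe]
  rw [serreTerm, map_add, map_sub, repEval_smul]
  obtain ⟨T₁, hT₁⟩ := truncEval_psum φ.toRingHom (algebraMap L _ ε) (commute_algebraMap_op ε) n
    (algebraMap_pow_eq_zero _ hε) _ (finite_of_suppLe₃ hS hH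
      (fun k => B (c + k.2.1 + k.2.2)) (fun k => A (a + k.1 - k.2.1)) fun k => A (b - k.1 - k.2.2))
  obtain ⟨T₂, hT₂⟩ := truncEval_psum φ.toRingHom (algebraMap L _ ε) (commute_algebraMap_op ε) n
    (algebraMap_pow_eq_zero _ hε) _ (finite_of_suppLe₃ hS hH
      (fun k => A (a + k.1 + k.2.1)) (fun k => B (c - k.2.1 + k.2.2)) fun k => A (b - k.1 - k.2.2))
  obtain ⟨T₃, hT₃⟩ := truncEval_psum φ.toRingHom (algebraMap L _ ε) (commute_algebraMap_op ε) n
    (algebraMap_pow_eq_zero _ hε) _ (finite_of_suppLe₃ hS hH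
      (fun k => A (a + k.1 + k.2.1)) (fun k => A (b - k.1 + k.2.2)) fun k => B (c - k.2.1 - k.2.2))
  change ∀ T, T₁ ⊆ T → repEval hε φ _ = ∑ m ∈ T, repEval hε φ _ at hT₁
  change ∀ T, T₂ ⊆ T → repEval hε φ _ = ∑ m ∈ T, repEval hε φ _ at hT₂
  change ∀ T, T₃ ⊆ T → repEval hε φ _ = ∑ m ∈ T, repEval hε φ _ at hT₃
  set T := P.support ×ˢ E.support ×ˢ E.support ∪ T₁ ∪ T₂ ∪ T₃ with hT
  have hsub : P.support ×ˢ E.support ×ˢ E.support ⊆ T := fun x hx => by simp [hT, hx]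
  rw [hT₁ T (fun x hx => by simp [hT, hx]), hT₂ T (fun x hx => by simp [hT, hx]),
    hT₃ T (fun x hx => by simp [hT, hx])]
  have d₁ : ∀ k : ℕ × ℕ × ℕ, (0 : ℤ) + 0 + 0 -
      (c + k.2.1 + k.2.2 + (a + k.1 - k.2.1) + (b - k.1 - k.2.2)) = -(a + b + c) := fun k => by ring
  have d₂ : ∀ k : ℕ × ℕ × ℕ, (0 : ℤ) + 0 + 0 -
      (a + k.1 + k.2.1 + (c - k.2.1 + k.2.2) + (b - k.1 - k.2.2)) = -(a + b + c) := fun k => by ring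
  have d₃ : ∀ k : ℕ × ℕ × ℕ, (0 : ℤ) + 0 + 0 -
      (a + k.1 + k.2.1 + (b - k.1 + k.2.2) + (c - k.2.1 - k.2.2)) = -(a + b + c) := fun k => by ring
  have w₁ : wB + wA + wA = wA + wA + wB := by abel
  have w₂ : wA + wB + wA = wA + wA + wB := by abel
  simp only [IsCurrent.repEval_sf₃ hc hY hX hX, IsCurrent.repEval_sf₃ hc hX hY hX,
    IsCurrent.repEval_sf₃ hc hX hX hY, d₁, d₂, d₃, w₁, w₂, op_sum, smul_op, op_sub, op_add]
  rw [← op_zero]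
  refine op_congr (fun γ => ?_) rfl rfl
  simp only [Pi.add_apply, Pi.sub_apply, Pi.zero_apply, eS, eH, hωA, hωA', hωB]
  have cancel : ∀ (x : Lˣ) (k : ℕ), (x : L) ^ k * ((x⁻¹ : Lˣ) : L) ^ k = 1 := fun x k => by
    rw [← mul_pow, Units.mul_inv, one_pow]
  have z₁ : ∀ (x : Lˣ) (a : ℤ) (k l : ℕ), ((x ^ (-(a + k + l)) : Lˣ) : L) =
      ((x ^ (-a) : Lˣ) : L) * (((x⁻¹ : Lˣ) : L) ^ k * ((x⁻¹ : Lˣ) : L) ^ l) := fun x a k l => by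
    rw [zpow_shift_add, zpow_shift_add, mul_assoc]
  have z₂ : ∀ (x : Lˣ) (a : ℤ) (k l : ℕ), ((x ^ (-(a + k - l)) : Lˣ) : L) =
      ((x ^ (-a) : Lˣ) : L) * (((x⁻¹ : Lˣ) : L) ^ k * (x : L) ^ l) := fun x a k l => by
    rw [zpow_shift_sub, zpow_shift_add, mul_assoc]
  have z₃ : ∀ (x : Lˣ) (a : ℤ) (k l : ℕ), ((x ^ (-(a - k + l)) : Lˣ) : L) =
      ((x ^ (-a) : Lˣ) : L) * ((x : L) ^ k * ((x⁻¹ : Lˣ) : L) ^ l) := fun x a k l => by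
    rw [zpow_shift_add, zpow_shift_sub, mul_assoc]
  have z₄ : ∀ (x : Lˣ) (a : ℤ) (k l : ℕ), ((x ^ (-(a - k - l)) : Lˣ) : L) =
      ((x ^ (-a) : Lˣ) : L) * ((x : L) ^ k * (x : L) ^ l) := fun x a k l => by
    rw [zpow_shift_sub, zpow_shift_sub, mul_assoc]
  simp only [z₁, z₂, z₃, z₄]
  have dv : ∀ (x y : Lˣ) (m : ℕ), ((x / y : Lˣ) : L) ^ m = (x : L) ^ m * ((y⁻¹ : Lˣ) : L) ^ m :=
    fun x y m => by rw [div_eq_mul_inv, Units.val_mul, mul_pow]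
  have r : ∀ m : ℕ, (R : L) ^ m = (((ωA γ)⁻¹ : Lˣ) : L) ^ m * ((ωA γ * R : Lˣ) : L) ^ m := by
    intro m
    rw [← mul_pow, ← Units.val_mul, inv_mul_cancel_left]
  -- `κ` gathers the powers free of summation indices. The two `X` currents always act at points of
  -- ratio `R`, so the prefactor contributes the same value `P.eval R` to all three terms.
  set κ := ((ωA γ ^ (-a) : Lˣ) : L) * (((ωA γ * R) ^ (-b) : Lˣ) : L) *
    ((ωB γ ^ (-c) : Lˣ) : L) with hκ
  have s₁ := sum_coeff_mul_pow₃ P E E (R : L) ((ωA γ / ωB γ : Lˣ) : L)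
    ((ωA γ * R / ωB γ : Lˣ) : L) hsub
  have s₂ := sum_coeff_mul_pow₃ P E E (R : L) ((ωB γ / ωA γ : Lˣ) : L)
    ((ωA γ * R / ωB γ : Lˣ) : L) hsub
  have s₃ := sum_coeff_mul_pow₃ P E E (R : L) ((ωB γ / ωA γ : Lˣ) : L)
    ((ωB γ / (ωA γ * R) : Lˣ) : L) hsub
  have h' := congrArg (κ * P.eval (R : L) * ·) (h γ)
  simp only [mul_zero] at h'
  refine (congrArg₂ (· + ·) (congrArg₂ (· - ·)
    (?_ : _ = β γ * α (γ - wB) * α (γ - wB - wA) * κ * (P.eval (R : L) *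
      E.eval ((ωA γ / ωB γ : Lˣ) : L) * E.eval ((ωA γ * R / ωB γ : Lˣ) : L)))
    (congrArg (algebraMap ℂ L (qpow ħ 1 + qpow ħ (-1)) * ·)
    (?_ : _ = α γ * β (γ - wA) * α (γ - wA - wB) * κ * (P.eval (R : L) *
      E.eval ((ωB γ / ωA γ : Lˣ) : L) * E.eval ((ωA γ * R / ωB γ : Lˣ) : L)))))
    (?_ : _ = α γ * α (γ - wA) * β (γ - wA - wA) * κ * (P.eval (R : L) *
      E.eval ((ωB γ / ωA γ : Lˣ) : L) * E.eval ((ωB γ / (ωA γ * R) : Lˣ) : L)))).trans ?_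
  · rw [← s₁, Finset.mul_sum]
    refine Finset.sum_congr rfl fun m _ => ?_
    rw [r, dv, dv, hκ]
    ring
  · rw [← s₂, Finset.mul_sum]
    refine Finset.sum_congr rfl fun m _ => ?_
    rw [r, dv, dv, hκ]
    ring
  · rw [← s₃, Finset.mul_sum]
    refine Finset.sum_congr rfl fun m _ => ?_
    rw [r, dv, dv, hκ]
    ring
  · linear_combination h'

end DeltaCurrents

/-! ### Theta function identities as polynomial identities. -/

section ThetaIdentities

variable {L : Type*} [CommRing L] {ε : L} {M : ℕ} (hε : ε ^ M = 0) (Q t : Lˣ)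

/-- `(ε Q^k t^s; ε)_∞`. -/
def gMono (k s : ℤ) : L := (gPoch hε (Q ^ k * t ^ s) : L)

/-- Every argument met below is a monomial in `Q` and `t`, so a theta function splits into an
elementary factor and two values of `gMono` with opposite exponents. -/
theorem thetaU_mono (k s : ℤ) : thetaU hε (Q ^ k * t ^ s) =
    (1 - ((Q ^ k * t ^ s : Lˣ) : L)) * (gMono hε Q t k s * gMono hε Q t (-k) (-s)) := by
  rw [thetaU_eq, gMono, gMono, mul_inv, zpow_neg, zpow_neg]

/-- Each value of `H` cancels one `gMono` factor of a theta function, after which both sides share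
the remaining `gMono` factors and `1 - t / Q`. What is left is `t (1 - 1 / (Q t)) = -Q⁻¹ (1 - Q t)`.
-/
theorem ee_succ_identity {H : L → L}
    (hH : ∀ k s, H ((Q ^ k * t ^ s : Lˣ) : L) * gMono hε Q t (k + 1) s =
      (1 - ((Q ^ (k - 1) * t ^ s : Lˣ) : L)) * gMono hε Q t (k - 1) s) :
    (t : L) * thetaU hε (Q ^ (-1 : ℤ) * t ^ (1 : ℤ)) * H ((Q ^ (0 : ℤ) * t ^ (-1 : ℤ) : Lˣ) : L) =
      -((Q⁻¹ : Lˣ) : L) * thetaU hε (Q ^ (1 : ℤ) * t ^ (1 : ℤ)) *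
        H ((Q ^ (0 : ℤ) * t ^ (1 : ℤ) : Lˣ) : L) := by
  have h1 := hH 0 (-1)
  have h2 := hH 0 1
  rw [thetaU_mono, thetaU_mono]
  have hq : (Q : L) * ((Q⁻¹ : Lˣ) : L) = 1 := Q.mul_inv
  have ht : (t : L) * ((t⁻¹ : Lˣ) : L) = 1 := t.mul_inv
  simp only [zero_add, zero_sub, neg_neg, zpow_neg, zpow_one, Units.val_mul, zpow_zero] at h1 h2 ⊢
  -- Inverses become independent variables tied only by `hq` and `ht`, so that a polynomial
  -- certificate can conclude.
  generalize ((Q⁻¹ : Lˣ) : L) = qi at *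
  generalize ((t⁻¹ : Lˣ) : L) = ti at *
  generalize (Q : L) = q at *
  generalize (t : L) = u at *
  linear_combination u * (1 - qi * u) * gMono hε Q t (-1) 1 * h1 +
    qi * (1 - q * u) * gMono hε Q t (-1) (-1) * h2 +
    gMono hε Q t (-1) 1 * gMono hε Q t (-1) (-1) * (1 - qi * u) * (-qi * ht - u * hq)

theorem ff_succ_identity {H : L → L}
    (hH : ∀ k s, H ((Q ^ k * t ^ s : Lˣ) : L) * gMono hε Q t (k - 1) s =
      (1 - ((Q ^ (k + 1) * t ^ s : Lˣ) : L)) * gMono hε Q t (k + 1) s) :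
    (t : L) * (Q : L) * thetaU hε (Q ^ (-1 : ℤ) * t ^ (-1 : ℤ)) *
        H ((Q ^ (0 : ℤ) * t ^ (-1 : ℤ) : Lˣ) : L) =
      -(thetaU hε (Q ^ (1 : ℤ) * t ^ (-1 : ℤ)) * H ((Q ^ (0 : ℤ) * t ^ (1 : ℤ) : Lˣ) : L)) := by
  have h1 := hH 0 (-1)
  have h2 := hH 0 1
  rw [thetaU_mono, thetaU_mono]
  have hq : (Q : L) * ((Q⁻¹ : Lˣ) : L) = 1 := Q.mul_inv
  have ht : (t : L) * ((t⁻¹ : Lˣ) : L) = 1 := t.mul_inv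
  simp only [zero_add, zero_sub, neg_neg, zpow_neg, zpow_one, Units.val_mul, zpow_zero] at h1 h2 ⊢
  generalize ((Q⁻¹ : Lˣ) : L) = qi at *
  generalize ((t⁻¹ : Lˣ) : L) = ti at *
  generalize (Q : L) = q at *
  generalize (t : L) = u at *
  linear_combination u * q * (1 - qi * ti) * gMono hε Q t 1 1 * h1 +
    (1 - q * ti) * gMono hε Q t 1 (-1) * h2 +
    gMono hε Q t 1 1 * gMono hε Q t 1 (-1) * (1 - q * ti) * (-u * ti * hq - ht)

/-- The inversion formula `θ(1/x) = -x⁻¹ θ(x)` used for both factors; the two multipliers combine to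
`Q⁻²`. -/
theorem ef_ne_identity :
    ((Q⁻¹ : Lˣ) : L) * thetaU hε (Q ^ (-1 : ℤ) * t ^ (1 : ℤ)) *
        thetaU hε (Q ^ (3 : ℤ) * t ^ (-1 : ℤ)) =
      (Q : L) * thetaU hε (Q ^ (1 : ℤ) * t ^ (-1 : ℤ)) * thetaU hε (Q ^ (-3 : ℤ) * t ^ (1 : ℤ)) := by
  simp only [thetaU_mono]
  have hq : (Q : L) * ((Q⁻¹ : Lˣ) : L) = 1 := Q.mul_inv
  have ht : (t : L) * ((t⁻¹ : Lˣ) : L) = 1 := t.mul_inv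
  simp only [neg_neg, zpow_neg, Units.val_mul, zpow_ofNat, ← inv_pow,
    Units.val_pow_eq_pow_val]
  generalize ((Q⁻¹ : Lˣ) : L) = qi at *
  generalize ((t⁻¹ : Lˣ) : L) = ti at *
  generalize (Q : L) = q at *
  generalize (t : L) = u at *
  have key : qi * (1 - qi * u) * (1 - q ^ 3 * ti) = q * (1 - q * ti) * (1 - qi ^ 3 * u) := by
    linear_combination (-q ^ 2 * ti + qi ^ 2 * u + q ^ 2 * qi * u * ti - q * qi ^ 2 * u * ti
      + q * u * ti - qi * u * ti) * hq + (q - qi) * ht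
  linear_combination gMono hε Q t (-1) 1 * gMono hε Q t 1 (-1) * gMono hε Q t 3 (-1) *
    gMono hε Q t (-3) 1 * key

/-- With `u = t`, cancelling the `gMono` factors through `hH` leaves `1 - q⁻¹ u` times `q⁻¹ (1 - q
u) - (q + q⁻¹)(1 - q⁻¹ u) + q (1 - q⁻³ u)`, and the latter is zero. -/
theorem serre_e_succ_identity {H : L → L}
    (hH : ∀ k s, H ((Q ^ k * t ^ s : Lˣ) : L) * gMono hε Q t (k + 1) s = gMono hε Q t (k - 1) s) :
    ((Q⁻¹ : Lˣ) : L) *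
        thetaU hε (Q ^ (1 : ℤ) * t ^ (1 : ℤ)) *
        thetaU hε (Q ^ (-1 : ℤ) * t ^ (1 : ℤ)) *
        H ((Q ^ (0 : ℤ) * t ^ (1 : ℤ)) : Lˣ) *
        H ((Q ^ (-2 : ℤ) * t ^ (1 : ℤ)) : Lˣ) -
      (Q + ((Q⁻¹ : Lˣ) : L)) * (thetaU hε (Q ^ (-1 : ℤ) * t ^ (1 : ℤ)) *
        thetaU hε (Q ^ (-1 : ℤ) * t ^ (1 : ℤ)) *
        H ((Q ^ (0 : ℤ) * t ^ (-1 : ℤ)) : Lˣ) *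
        H ((Q ^ (-2 : ℤ) * t ^ (1 : ℤ)) : Lˣ)) +
      (Q : L) *
        thetaU hε (Q ^ (-1 : ℤ) * t ^ (1 : ℤ)) *
        thetaU hε (Q ^ (-3 : ℤ) * t ^ (1 : ℤ)) *
        H ((Q ^ (0 : ℤ) * t ^ (-1 : ℤ)) : Lˣ) *
        H ((Q ^ (2 : ℤ) * t ^ (-1 : ℤ)) : Lˣ) = 0 := by
  have h1 := hH (0) (1)
  have h2 := hH (-2) (1)
  have h3 := hH (0) (-1)
  have h4 := hH (2) (-1)
  simp only [thetaU_mono]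
  have hq : (Q : L) * ((Q⁻¹ : Lˣ) : L) = 1 := Q.mul_inv
  generalize H ((Q ^ (0 : ℤ) * t ^ (1 : ℤ)) : Lˣ) = x1 at *
  generalize H ((Q ^ (-2 : ℤ) * t ^ (1 : ℤ)) : Lˣ) = x2 at *
  generalize H ((Q ^ (0 : ℤ) * t ^ (-1 : ℤ)) : Lˣ) = x3 at *
  generalize H ((Q ^ (2 : ℤ) * t ^ (-1 : ℤ)) : Lˣ) = x4 at *
  norm_num at h1 h2 h3 h4
  simp only [neg_neg, zpow_neg, Units.val_mul, zpow_ofNat, ← inv_pow,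
    Units.val_pow_eq_pow_val]
  generalize ((Q⁻¹ : Lˣ) : L) = qi at *
  generalize ((t⁻¹ : Lˣ) : L) = ti at *
  generalize (Q : L) = q at *
  generalize (t : L) = u at *
  have e1 : x1 * gMono hε Q t 1 1 * (x2 * gMono hε Q t (-1) 1) = gMono hε Q t (-1) 1 * gMono hε Q t (-3) 1 := by
    rw [h1, h2]
  have e2 : x3 * gMono hε Q t 1 (-1) * (x2 * gMono hε Q t (-1) 1) = gMono hε Q t (-1) (-1) * gMono hε Q t (-3) 1 := by
    rw [h3, h2]
  have e3 : x3 * gMono hε Q t 1 (-1) * (x4 * gMono hε Q t 3 (-1)) = gMono hε Q t (-1) (-1) * gMono hε Q t 1 (-1) := by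
    rw [h3, h4]
  linear_combination qi * (1 - q * u) * (1 - qi * u) * gMono hε Q t (-1) (-1) * gMono hε Q t 1 (-1) * e1 -
    (q + qi) * ((1 - qi * u) * (1 - qi * u) * gMono hε Q t (-1) 1 * gMono hε Q t 1 (-1)) * e2 +
    q * (1 - qi * u) * (1 - qi ^ 3 * u) * gMono hε Q t (-1) 1 * gMono hε Q t (-3) 1 * e3 +
    gMono hε Q t (-3) 1 * gMono hε Q t (-1) (-1) * gMono hε Q t (-1) 1 * gMono hε Q t 1 (-1) * (-(1 - qi * u) * qi ^ 2 * u) * hq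

/-- The two values of `H` in each outer term telescope. There remains `(1 - q⁻¹ u) - (q + q⁻¹) q⁻¹
(1 - q u) + q⁻² (1 - q³ u) = 0` with `u = t`. -/
theorem serre_e_pred_identity {H : L → L}
    (hH : ∀ k s, H ((Q ^ k * t ^ s : Lˣ) : L) * gMono hε Q t (k + 1) s = gMono hε Q t (k - 1) s) :
    thetaU hε (Q ^ (-1 : ℤ) * t ^ (1 : ℤ)) *
        H ((Q ^ (0 : ℤ) * t ^ (-1 : ℤ)) : Lˣ) *
        H ((Q ^ (-2 : ℤ) * t ^ (-1 : ℤ)) : Lˣ) -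
      (Q + ((Q⁻¹ : Lˣ) : L)) * (((Q⁻¹ : Lˣ) : L) *
        thetaU hε (Q ^ (1 : ℤ) * t ^ (1 : ℤ)) *
        H ((Q ^ (0 : ℤ) * t ^ (1 : ℤ)) : Lˣ) *
        H ((Q ^ (-2 : ℤ) * t ^ (-1 : ℤ)) : Lˣ)) +
      ((Q⁻¹ : Lˣ) : L) ^ 2 *
        thetaU hε (Q ^ (3 : ℤ) * t ^ (1 : ℤ)) *
        H ((Q ^ (0 : ℤ) * t ^ (1 : ℤ)) : Lˣ) *
        H ((Q ^ (2 : ℤ) * t ^ (1 : ℤ)) : Lˣ) = 0 := by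
  have h1 := hH (0) (-1)
  have h2 := hH (-2) (-1)
  have h3 := hH (0) (1)
  have h4 := hH (2) (1)
  simp only [thetaU_mono]
  have hq : (Q : L) * ((Q⁻¹ : Lˣ) : L) = 1 := Q.mul_inv
  generalize H ((Q ^ (0 : ℤ) * t ^ (-1 : ℤ)) : Lˣ) = x1 at *
  generalize H ((Q ^ (-2 : ℤ) * t ^ (-1 : ℤ)) : Lˣ) = x2 at *
  generalize H ((Q ^ (0 : ℤ) * t ^ (1 : ℤ)) : Lˣ) = x3 at *
  generalize H ((Q ^ (2 : ℤ) * t ^ (1 : ℤ)) : Lˣ) = x4 at *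
  norm_num at h1 h2 h3 h4
  simp only [neg_neg, zpow_neg, Units.val_mul, zpow_ofNat, ← inv_pow,
    Units.val_pow_eq_pow_val]
  generalize ((Q⁻¹ : Lˣ) : L) = qi at *
  generalize ((t⁻¹ : Lˣ) : L) = ti at *
  generalize (Q : L) = q at *
  generalize (t : L) = u at *
  have e1 : x2 * (x1 * gMono hε Q t 1 (-1)) = gMono hε Q t (-3) (-1) := by
    rw [h1, h2]
  have e2 : x3 * gMono hε Q t 1 1 * (x2 * gMono hε Q t (-1) (-1)) = gMono hε Q t (-1) 1 * gMono hε Q t (-3) (-1) := by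
    rw [h3, h2]
  have e3 : x3 * (x4 * gMono hε Q t 3 1) = gMono hε Q t (-1) 1 := by
    rw [h4, h3]
  linear_combination (1 - qi * u) * gMono hε Q t (-1) 1 * e1 -
    (q + qi) * (qi * (1 - q * u)) * e2 +
    qi ^ 2 * (1 - q ^ 3 * u) * gMono hε Q t (-3) (-1) * e3 +
    gMono hε Q t (-3) (-1) * gMono hε Q t (-1) 1 * (-(1 + u * (-qi + q ^ 2 * qi))) * hq

/-- This is `serre_e_pred_identity` with both `Q` and `t` inverted: passing from `e` to `f`
exchanges the roles of the two neighbours. -/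
theorem serre_f_succ_identity {H : L → L}
    (hH : ∀ k s, H ((Q ^ k * t ^ s : Lˣ) : L) * gMono hε Q t (k - 1) s = gMono hε Q t (k + 1) s) :
    thetaU hε (Q ^ (1 : ℤ) * t ^ (-1 : ℤ)) *
        H ((Q ^ (0 : ℤ) * t ^ (1 : ℤ)) : Lˣ) *
        H ((Q ^ (2 : ℤ) * t ^ (1 : ℤ)) : Lˣ) -
      (Q + ((Q⁻¹ : Lˣ) : L)) * ((Q : L) *
        thetaU hε (Q ^ (-1 : ℤ) * t ^ (-1 : ℤ)) *
        H ((Q ^ (0 : ℤ) * t ^ (-1 : ℤ)) : Lˣ) *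
        H ((Q ^ (2 : ℤ) * t ^ (1 : ℤ)) : Lˣ)) +
      (Q : L) ^ 2 *
        thetaU hε (Q ^ (-3 : ℤ) * t ^ (-1 : ℤ)) *
        H ((Q ^ (0 : ℤ) * t ^ (-1 : ℤ)) : Lˣ) *
        H ((Q ^ (-2 : ℤ) * t ^ (-1 : ℤ)) : Lˣ) = 0 := by
  have h1 := hH (0) (1)
  have h2 := hH (2) (1)
  have h3 := hH (0) (-1)
  have h4 := hH (-2) (-1)
  simp only [thetaU_mono]
  have hq : (Q : L) * ((Q⁻¹ : Lˣ) : L) = 1 := Q.mul_inv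
  generalize H ((Q ^ (0 : ℤ) * t ^ (1 : ℤ)) : Lˣ) = x1 at *
  generalize H ((Q ^ (2 : ℤ) * t ^ (1 : ℤ)) : Lˣ) = x2 at *
  generalize H ((Q ^ (0 : ℤ) * t ^ (-1 : ℤ)) : Lˣ) = x3 at *
  generalize H ((Q ^ (-2 : ℤ) * t ^ (-1 : ℤ)) : Lˣ) = x4 at *
  norm_num at h1 h2 h3 h4
  simp only [neg_neg, zpow_neg, Units.val_mul, zpow_ofNat, ← inv_pow,
    Units.val_pow_eq_pow_val]
  generalize ((Q⁻¹ : Lˣ) : L) = qi at *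
  generalize ((t⁻¹ : Lˣ) : L) = ti at *
  generalize (Q : L) = q at *
  generalize (t : L) = u at *
  have e1 : x2 * (x1 * gMono hε Q t (-1) 1) = gMono hε Q t 3 1 := by
    rw [h1, h2]
  have e2 : x3 * gMono hε Q t (-1) (-1) * (x2 * gMono hε Q t 1 1) = gMono hε Q t 1 (-1) * gMono hε Q t 3 1 := by
    rw [h3, h2]
  have e3 : x3 * (x4 * gMono hε Q t (-3) (-1)) = gMono hε Q t 1 (-1) := by
    rw [h4, h3]
  linear_combination (1 - q * ti) * gMono hε Q t 1 (-1) * e1 -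
    (q + qi) * (q * (1 - qi * ti)) * e2 +
    q ^ 2 * (1 - qi ^ 3 * ti) * gMono hε Q t 3 1 * e3 +
    gMono hε Q t 1 (-1) * gMono hε Q t 3 1 * (-(1 + ti * (-q + q * qi ^ 2))) * hq

/-- This is `serre_e_succ_identity` with `Q` alone inverted. -/
theorem serre_f_pred_identity {H : L → L}
    (hH : ∀ k s, H ((Q ^ k * t ^ s : Lˣ) : L) * gMono hε Q t (k - 1) s = gMono hε Q t (k + 1) s) :
    (Q : L) *
        thetaU hε (Q ^ (-1 : ℤ) * t ^ (1 : ℤ)) *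
        thetaU hε (Q ^ (1 : ℤ) * t ^ (1 : ℤ)) *
        H ((Q ^ (0 : ℤ) * t ^ (1 : ℤ)) : Lˣ) *
        H ((Q ^ (2 : ℤ) * t ^ (1 : ℤ)) : Lˣ) -
      (Q + ((Q⁻¹ : Lˣ) : L)) * (thetaU hε (Q ^ (1 : ℤ) * t ^ (1 : ℤ)) *
        thetaU hε (Q ^ (1 : ℤ) * t ^ (1 : ℤ)) *
        H ((Q ^ (0 : ℤ) * t ^ (-1 : ℤ)) : Lˣ) *
        H ((Q ^ (2 : ℤ) * t ^ (1 : ℤ)) : Lˣ)) +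
      ((Q⁻¹ : Lˣ) : L) *
        thetaU hε (Q ^ (1 : ℤ) * t ^ (1 : ℤ)) *
        thetaU hε (Q ^ (3 : ℤ) * t ^ (1 : ℤ)) *
        H ((Q ^ (0 : ℤ) * t ^ (-1 : ℤ)) : Lˣ) *
        H ((Q ^ (-2 : ℤ) * t ^ (-1 : ℤ)) : Lˣ) = 0 := by
  have h1 := hH (0) (1)
  have h2 := hH (2) (1)
  have h3 := hH (0) (-1)
  have h4 := hH (-2) (-1)
  simp only [thetaU_mono]
  have hq : (Q : L) * ((Q⁻¹ : Lˣ) : L) = 1 := Q.mul_inv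
  generalize H ((Q ^ (0 : ℤ) * t ^ (1 : ℤ)) : Lˣ) = x1 at *
  generalize H ((Q ^ (2 : ℤ) * t ^ (1 : ℤ)) : Lˣ) = x2 at *
  generalize H ((Q ^ (0 : ℤ) * t ^ (-1 : ℤ)) : Lˣ) = x3 at *
  generalize H ((Q ^ (-2 : ℤ) * t ^ (-1 : ℤ)) : Lˣ) = x4 at *
  norm_num at h1 h2 h3 h4
  simp only [neg_neg, zpow_neg, Units.val_mul, zpow_ofNat, ← inv_pow,
    Units.val_pow_eq_pow_val]
  generalize ((Q⁻¹ : Lˣ) : L) = qi at *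
  generalize ((t⁻¹ : Lˣ) : L) = ti at *
  generalize (Q : L) = q at *
  generalize (t : L) = u at *
  have e1 : x1 * gMono hε Q t (-1) 1 * (x2 * gMono hε Q t 1 1) = gMono hε Q t 1 1 * gMono hε Q t 3 1 := by
    rw [h1, h2]
  have e2 : x3 * gMono hε Q t (-1) (-1) * (x2 * gMono hε Q t 1 1) = gMono hε Q t 1 (-1) * gMono hε Q t 3 1 := by
    rw [h3, h2]
  have e3 : x3 * gMono hε Q t (-1) (-1) * (x4 * gMono hε Q t (-3) (-1)) = gMono hε Q t 1 (-1) * gMono hε Q t (-1) (-1) := by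
    rw [h3, h4]
  linear_combination q * (1 - qi * u) * (1 - q * u) * gMono hε Q t 1 (-1) * gMono hε Q t (-1) (-1) * e1 -
    (q + qi) * ((1 - q * u) * (1 - q * u) * gMono hε Q t 1 1 * gMono hε Q t (-1) (-1)) * e2 +
    qi * (1 - q * u) * (1 - q ^ 3 * u) * gMono hε Q t 1 1 * gMono hε Q t 3 1 * e3 +
    gMono hε Q t (-1) (-1) * gMono hε Q t 1 (-1) * gMono hε Q t 1 1 * gMono hε Q t 3 1 * (-(1 - q * u) * q ^ 2 * u) * hq

end ThetaIdentities

/-! ### The effect of a step on supports and amplitudes. -/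

section StateSteps

variable {L : Type*} [CommRing L] {ε : L} {M : ℕ} (hε : ε ^ M = 0) (Q R : Lˣ) (Y : ℕ → Lˣ)

/-- The ratio on which the amplitude of `e_j` depends. -/
def eRat (j : ℕ) : Lˣ := wState Q Y (j + 1) / wState Q Y (j + 2)

/-- The ratio on which the amplitude of `f_j` depends. -/
def fRat (j : ℕ) : Lˣ := wState Q Y (j + 1) / wState Q Y j

theorem eAmp_eq (j : ℕ) : eAmp hε Q Y j = (Y (j + 1) : L) * thetaU hε (Q⁻¹ * eRat Q Y j) := rfl

theorem fAmp_eq (C₀ : L) (j : ℕ) : fAmp hε Q Y j C₀ =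
    C₀ * (((Y j)⁻¹ : Lˣ) : L) * thetaU hε (Q * fRat Q Y j) := rfl

theorem low_self (j : ℕ) : low R j Y j = Y j * R⁻¹ := if_pos rfl

theorem low_succ (j : ℕ) : low R j Y (j + 1) = Y (j + 1) * R := by
  rw [low, if_neg (Nat.succ_ne_self j), if_pos rfl]

theorem low_of_ne {i j : ℕ} (h : i ≠ j) (h' : i ≠ j + 1) : low R j Y i = Y i := by
  rw [low, if_neg h, if_neg h']

theorem eRat_low_self (j : ℕ) : eRat Q (low R j Y) j = eRat Q Y j * R⁻¹ ^ 2 := by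
  rw [eRat, wState_low, wState_low, if_pos rfl, if_neg (by omega), eRat, mul_div_right_comm]

theorem eRat_low_succ (j : ℕ) : eRat Q (low R (j + 1) Y) j = eRat Q Y j * R ^ 2 := by
  rw [eRat, wState_low, wState_low, if_neg (by omega), if_pos rfl, eRat]
  exact Additive.ofMul.injective (by simp only [ofMul_mul, ofMul_inv, ofMul_pow, ofMul_div]; abel)

theorem eRat_low_of_ne {i j : ℕ} (h : i ≠ j) (h' : i ≠ j + 1) :
    eRat Q (low R i Y) j = eRat Q Y j := by
  rw [eRat, wState_low, wState_low, if_neg (by omega), if_neg (by omega), eRat]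

theorem fRat_low_self (j : ℕ) : fRat Q (low R j Y) j = fRat Q Y j * R⁻¹ ^ 2 := by
  rw [fRat, wState_low, wState_low, if_pos rfl, if_neg (by omega), fRat, mul_div_right_comm]

theorem fRat_low_pred (i : ℕ) : fRat Q (low R i Y) (i + 1) = fRat Q Y (i + 1) * R ^ 2 := by
  rw [fRat, wState_low, wState_low, if_neg (by omega), if_pos rfl, fRat]
  exact Additive.ofMul.injective (by simp only [ofMul_mul, ofMul_inv, ofMul_pow, ofMul_div]; abel)

theorem fRat_low_of_ne {i j : ℕ} (h : i ≠ j) (h' : j ≠ i + 1) :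
    fRat Q (low R i Y) j = fRat Q Y j := by
  rw [fRat, wState_low, wState_low, if_neg (by omega), if_neg (by omega), fRat]

theorem eAmp_low_of_ne {i j : ℕ} (h : i ≠ j) (h' : i ≠ j + 1) :
    eAmp hε Q (low R i Y) j = eAmp hε Q Y j := by
  rw [eAmp_eq, eAmp_eq, eRat_low_of_ne Q R Y h h', low_of_ne R Y (by omega) (by omega)]

theorem fAmp_low_of_ne (C₀ : L) {i j : ℕ} (h : i ≠ j) (h' : j ≠ i + 1) :
    fAmp hε Q (low R i Y) j C₀ = fAmp hε Q Y j C₀ := by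
  rw [fAmp_eq, fAmp_eq, fRat_low_of_ne Q R Y h h', low_of_ne R Y (by omega) (by omega)]

theorem eLoc_low_self (j : ℕ) : eLoc Q (low R j Y) j = eLoc Q Y j * R⁻¹ ^ 2 := by
  rw [eLoc, wState_low, if_pos rfl, eLoc, mul_right_comm]

theorem eLoc_low_of_ne {i j : ℕ} (h : i ≠ j) : eLoc Q (low R i Y) j = eLoc Q Y j := by
  rw [eLoc, wState_low, if_neg (by omega), eLoc]

theorem fLoc_low_self (j : ℕ) : fLoc Q (low R j Y) j = fLoc Q Y j * R⁻¹ ^ 2 := by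
  rw [fLoc, wState_low, if_pos rfl, fLoc]

theorem fLoc_low_of_ne {i j : ℕ} (h : i ≠ j) : fLoc Q (low R i Y) j = fLoc Q Y j := by
  rw [fLoc, wState_low, if_neg (by omega), fLoc]

end StateSteps

/-! ### Quadratic relations among the currents `e_j` and `f_j`. -/

section LevelZero

variable {n : ℕ} {L : Type*} [CommRing L] [Algebra ℂ L] {ε : L} {M : ℕ}

/-- A representation in which the currents act by the level zero amplitudes depending on a state `Y`. -/
structure LevelZero (hε : ε ^ M = 0)
    (φ : UDyn n →ₐ[ℂ] Module.End L ((Wt (n + 1) × Wt (n + 1)) × ℤ → L)) (ħ : ℂ) (Q : Lˣ)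
    (Y : Wt (n + 1) × Wt (n + 1) → ℕ → Lˣ) (C₀ : L) : Prop where
  cHalf : φ (dyn uWt uDeg UInv .cHalf) = 1
  qpow_int : ∀ k : ℤ, algebraMap ℂ L (qpow ħ k) = ((Q ^ k : Lˣ) : L)
  e : ∀ j : Fin n, IsDelta hε φ (eCur j) (uWt (.e j 0)) (fun γ => eAmp hε Q (Y γ) j)
    fun γ => eLoc Q (Y γ) j
  f : ∀ j : Fin n, IsDelta hε φ (fCur j) (uWt (.f j 0)) (fun γ => fAmp hε Q (Y γ) j C₀)
    fun γ => fLoc Q (Y γ) j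
  k : ∀ l : Fin (n + 1), IsCurrent hε φ (kCur l) (uWt (.k l 0)) 0
    fun r γ => kAmp Q (Y γ) M ε l r
  state_e : ∀ (j : Fin n) γ, Y (γ - uWt (.e j 0)) = low Q j (Y γ)
  state_f : ∀ (j : Fin n) γ, Y (γ - uWt (.f j 0)) = low Q⁻¹ j (Y γ)
  state_k : ∀ (l : Fin (n + 1)) γ, Y (γ - uWt (.k l 0)) = Y γ

variable {hε : ε ^ M = 0}
  {φ : UDyn n →ₐ[ℂ] Module.End L ((Wt (n + 1) × Wt (n + 1)) × ℤ → L)} {ħ : ℂ} {Q : Lˣ}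
  {Y : Wt (n + 1) × Wt (n + 1) → ℕ → Lˣ} {C₀ : L} (hL : LevelZero hε φ ħ Q Y C₀)
include hL

theorem LevelZero.sfEval_sq {a : ℂ} (k : ℤ) (ha : a = k) :
    sfEval hε (sq ħ a) = PowerSeries.C ((Q ^ k : Lˣ) : L) := by
  rw [EllQG.sfEval_sq, ha, hL.qpow_int]

theorem LevelZero.algebraMap_two : algebraMap ℂ L (qpow ħ 1 + qpow ħ (-1)) =
    (Q : L) + ((Q⁻¹ : Lˣ) : L) := by
  have h1 := hL.qpow_int 1
  have h2 := hL.qpow_int (-1)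
  rw [zpow_one, Int.cast_one] at h1
  rw [zpow_neg, zpow_one, Int.cast_neg, Int.cast_one] at h2
  rw [map_add, h1, h2]

/-- The value of `(q^a x; P)_∞ / (P q^b x; P)_∞`. -/
theorem LevelZero.ratio_pole {P : SF} (hP : sp ∣ P) (hP' : sfEval hε P = PowerSeries.C ε)
    (hP₀ : SuppLe 0 P) (hP₁ : SuppLe 0 (P * sx)) {a b : ℂ} (k l : ℤ) (ha : a = k) (hb : b = l) :
    SuppLe 1 (ratio (sq ħ a) (P * sq ħ b) P) ∧
    ∃ F : Polynomial L, (F : PowerSeries L) = sfEval hε (ratio (sq ħ a) (P * sq ħ b) P) ∧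
      ∀ u : Lˣ, F.eval (u : L) * (gPoch hε (Q ^ l * u) : L) =
        (1 - ((Q ^ k * u : Lˣ) : L)) * (gPoch hε (Q ^ k * u) : L) := by
  have hS : SuppLe 1 (ratio (sq ħ a) (P * sq ħ b) P) :=
    suppLe_ratio_one (suppLe_sq _ _) (suppLe_mul_sx hP₁ (suppLe_sq _ _)) hP₀ hP₁ hP
  obtain ⟨F, hF, hF'⟩ := exists_polynomial_ratio hε hS hP hP' (hL.sfEval_sq k ha)
    (β := ε * ((Q ^ l : Lˣ) : L)) (by rw [map_mul, hP', hL.sfEval_sq l hb, map_mul])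
  refine ⟨hS, F, hF, fun u => ?_⟩
  rw [coe_gPoch, coe_gPoch, Units.val_mul, Units.val_mul, ← mul_assoc, hF', qprod_eq hε]

/-- The value of `(P q^a x; P)_∞ / (P q^b x; P)_∞`. -/
theorem LevelZero.ratio_regular {P : SF} (hP : sp ∣ P) (hP' : sfEval hε P = PowerSeries.C ε)
    (hP₀ : SuppLe 0 P) (hP₁ : SuppLe 0 (P * sx)) {a b : ℂ} (k l : ℤ) (ha : a = k) (hb : b = l) :
    SuppLe 0 (ratio (P * sq ħ a) (P * sq ħ b) P) ∧
    ∃ F : Polynomial L, (F : PowerSeries L) = sfEval hε (ratio (P * sq ħ a) (P * sq ħ b) P) ∧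
      ∀ u : Lˣ, F.eval (u : L) * (gPoch hε (Q ^ l * u) : L) = (gPoch hε (Q ^ k * u) : L) := by
  have hS : SuppLe 0 (ratio (P * sq ħ a) (P * sq ħ b) P) :=
    suppLe_ratio (suppLe_mul_sx hP₁ (suppLe_sq _ _)) (suppLe_mul_sx hP₁ (suppLe_sq _ _)) hP₀
  obtain ⟨F, hF, hF'⟩ := exists_polynomial_ratio hε hS hP hP'
    (α := ε * ((Q ^ k : Lˣ) : L)) (β := ε * ((Q ^ l : Lˣ) : L))
    (by rw [map_mul, hP', hL.sfEval_sq k ha, map_mul])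
    (by rw [map_mul, hP', hL.sfEval_sq l hb, map_mul])
  refine ⟨hS, F, hF, fun u => ?_⟩
  rw [coe_gPoch, coe_gPoch, Units.val_mul, Units.val_mul, ← mul_assoc, hF', ← mul_assoc]

/-- A step by `e_j` multiplies its own support by `Q⁻²`, which is the zero of the factor `1 - q² x`
of the structure function. -/
theorem LevelZero.ee (j : Fin n) (a b : ℤ) : repEval hε φ (exchange uWt uDeg UInv
      (ratio (sq ħ 2) (spStar * sq ħ (-2)) spStar) (-ratio (sq ħ 2) (spStar * sq ħ (-2)) spStar)
      (zmul (eCur j)) (eCur j) (zmul (eCur j)) (eCur j) a b) = 0 := by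
  obtain ⟨hS, F, hF, hF'⟩ := hL.ratio_pole sp_dvd_spStar (sfEval_spStar hε) suppLe_spStar
    suppLe_spStar_mul_sx (a := 2) (b := -2) 2 (-2) (by norm_num) (by norm_num)
  refine (hL.e j).repEval_exchange_self hL.cHalf hS hF a b (Q⁻¹ ^ 2) (fun γ => ?_) ?_
  · simp only [hL.state_e, eLoc_low_self]
  · have h := hF' (Q⁻¹ ^ 2)
    have e : Q ^ (2 : ℤ) * Q⁻¹ ^ 2 = 1 := by rw [inv_pow, zpow_ofNat, mul_inv_cancel]
    rw [e, Units.val_one, sub_self, zero_mul] at h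
    exact (Units.mul_left_eq_zero _).mp h

theorem LevelZero.ff (j : Fin n) (a b : ℤ) : repEval hε φ (exchange uWt uDeg UInv
      (ratio (sq ħ (-2)) (sp * sq ħ 2) sp) (-ratio (sq ħ (-2)) (sp * sq ħ 2) sp)
      (zmul (fCur j)) (fCur j) (zmul (fCur j)) (fCur j) a b) = 0 := by
  obtain ⟨hS, F, hF, hF'⟩ := hL.ratio_pole dvd_rfl (sfEval_sp hε) suppLe_sp
    suppLe_sp_mul_sx (a := -2) (b := 2) (-2) 2 (by norm_num) (by norm_num)
  refine (hL.f j).repEval_exchange_self hL.cHalf hS hF a b (Q ^ 2) (fun γ => ?_) ?_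
  · simp only [hL.state_f, fLoc_low_self, inv_inv]
  · have h := hF' (Q ^ 2)
    have e : Q ^ (-2 : ℤ) * Q ^ 2 = 1 := by rw [zpow_neg, zpow_ofNat, inv_mul_cancel]
    rw [e, Units.val_one, sub_self, zero_mul] at h
    exact (Units.mul_left_eq_zero _).mp h

theorem LevelZero.ee_far (i j : Fin n) (h : (i : ℕ) + 1 < j ∨ (j : ℕ) + 1 < i) (a b : ℤ) :
    repEval hε φ (eCur i a * eCur j b - eCur j b * eCur i a) = 0 := by
  refine (hL.e i).repEval_commutator (hL.e j) a b fun γ => ?_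
  simp only [hL.state_e]
  rw [eAmp_low_of_ne _ _ _ _ (by omega) (by omega), eAmp_low_of_ne _ _ _ _ (by omega) (by omega),
    eLoc_low_of_ne _ _ _ (by omega), eLoc_low_of_ne _ _ _ (by omega), mul_comm]

theorem LevelZero.ff_far (i j : Fin n) (h : (i : ℕ) + 1 < j ∨ (j : ℕ) + 1 < i) (a b : ℤ) :
    repEval hε φ (fCur i a * fCur j b - fCur j b * fCur i a) = 0 := by
  refine (hL.f i).repEval_commutator (hL.f j) a b fun γ => ?_
  simp only [hL.state_f]
  rw [fAmp_low_of_ne _ _ _ _ _ (by omega) (by omega), fAmp_low_of_ne _ _ _ _ _ (by omega) (by omega),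
    fLoc_low_of_ne _ _ _ (by omega), fLoc_low_of_ne _ _ _ (by omega), mul_comm]

/-- The amplitude of `e_i` reads the partial products `i + 1`, `i + 2`, that of `f_j` reads `j`, `j
+ 1`. For `i ≠ j` a step of one affects the other only if `j = i + 1`, and then the inversion
formula for theta functions balances the two orders. -/
theorem LevelZero.ef_ne (i j : Fin n) (h : i ≠ j) (a b : ℤ) :
    repEval hε φ (eCur i a * fCur j b - fCur j b * eCur i a) = 0 := by
  refine (hL.e i).repEval_commutator (hL.f j) a b fun γ => ?_
  have hij : (i : ℕ) ≠ j := fun hc => h (Fin.ext hc)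
  simp only [hL.state_e, hL.state_f]
  rw [fLoc_low_of_ne _ _ _ hij, eLoc_low_of_ne _ _ _ hij.symm]
  by_cases hj : (j : ℕ) = i + 1
  · rw [hj, eAmp_eq, eAmp_eq, fAmp_eq, fAmp_eq, eRat_low_succ, fRat_low_pred, low_succ, low_self,
      inv_inv]
    have ht : fRat Q (Y γ) (i + 1) = (eRat Q (Y γ) i)⁻¹ := (inv_div _ _).symm
    have key := ef_ne_identity hε Q (eRat Q (Y γ) i)
    have e1 : Q⁻¹ * eRat Q (Y γ) i = Q ^ (-1 : ℤ) * eRat Q (Y γ) i ^ (1 : ℤ) := by simp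
    have e2 : Q * ((eRat Q (Y γ) i)⁻¹ * Q ^ 2) = Q ^ (3 : ℤ) * eRat Q (Y γ) i ^ (-1 : ℤ) :=
      Additive.ofMul.injective (by simp only [ofMul_mul, ofMul_inv, ofMul_pow, ofMul_zpow]; abel)
    have e3 : Q * (eRat Q (Y γ) i)⁻¹ = Q ^ (1 : ℤ) * eRat Q (Y γ) i ^ (-1 : ℤ) := by simp
    have e4 : Q⁻¹ * (eRat Q (Y γ) i * Q⁻¹ ^ 2) = Q ^ (-3 : ℤ) * eRat Q (Y γ) i ^ (1 : ℤ) :=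
      Additive.ofMul.injective (by simp only [ofMul_mul, ofMul_inv, ofMul_pow, ofMul_zpow]; abel)
    rw [ht, e1, e2, e3, e4]
    have c : ((Y γ (i + 1) : Lˣ) : L) * (((Y γ (i + 1))⁻¹ : Lˣ) : L) = 1 := Units.mul_inv _
    simp only [mul_inv, Units.val_mul]
    linear_combination (C₀ * ((eLoc Q (Y γ) i ^ (-a) : Lˣ) : L) *
      ((fLoc Q (Y γ) (i + 1) ^ (-b) : Lˣ) : L) * ((Y γ (i + 1) : Lˣ) : L) *
      (((Y γ (i + 1))⁻¹ : Lˣ) : L)) * key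
  · rw [eAmp_low_of_ne _ _ _ _ hij.symm hj, fAmp_low_of_ne _ _ _ _ _ hij hj, mul_comm]

/-- A step by `e_{i+1}` changes the amplitude of `e_i`, but not conversely. The quotient of the
supports is the ratio in the amplitude of `e_i`, so a one-parameter theta identity compares the two
orders. -/
theorem LevelZero.ee_succ (i j : Fin n) (h : (j : ℕ) = i + 1) (a b : ℤ) :
    repEval hε φ (exchange uWt uDeg UInv
      (ratio (sq ħ (-1)) (spStar * sq ħ 1) spStar) (-ratio (sq ħ (-1)) (spStar * sq ħ 1) spStar)
      (zmul (eCur i)) (eCur j) (zmul (eCur j)) (eCur i) a b) = 0 := by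
  obtain ⟨hS, F, hF, hF'⟩ := hL.ratio_pole sp_dvd_spStar (sfEval_spStar hε) suppLe_spStar
    suppLe_spStar_mul_sx (a := -1) (b := 1) (-1) 1 (by norm_num) (by norm_num)
  refine (hL.e i).repEval_exchange hL.cHalf (hL.e j) hS hF a b (fun γ => ?_) (fun γ => ?_)
    fun γ => ?_
  · simp only [hL.state_e]
    exact eLoc_low_of_ne _ _ _ (by omega)
  · simp only [hL.state_e]
    exact eLoc_low_of_ne _ _ _ (by omega)
  simp only [hL.state_e]
  rw [eAmp_low_of_ne _ _ _ _ (by omega) (by omega)]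
  simp only [h]
  rw [eAmp_eq hε Q _ i, eAmp_eq hε Q _ i, eRat_low_succ, low_self]
  have hl : eLoc Q (Y γ) i / eLoc Q (Y γ) (i + 1) = eRat Q (Y γ) i := mul_div_mul_right_eq_div _ _ _
  have hl' : eLoc Q (Y γ) i = eRat Q (Y γ) i * eLoc Q (Y γ) (i + 1) := by rw [← hl, div_mul_cancel]
  have e1 : Q⁻¹ * eRat Q (Y γ) i = Q ^ (-1 : ℤ) * eRat Q (Y γ) i ^ (1 : ℤ) := by simp
  have e2 : Q⁻¹ * (eRat Q (Y γ) i * Q ^ 2) = Q ^ (1 : ℤ) * eRat Q (Y γ) i ^ (1 : ℤ) :=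
    Additive.ofMul.injective (by simp only [ofMul_mul, ofMul_inv, ofMul_pow, ofMul_zpow]; abel)
  have e3 : eLoc Q (Y γ) (i + 1) / eLoc Q (Y γ) i = Q ^ (0 : ℤ) * eRat Q (Y γ) i ^ (-1 : ℤ) := by
    rw [← inv_div, hl]; simp
  have e4 : eLoc Q (Y γ) i / eLoc Q (Y γ) (i + 1) = Q ^ (0 : ℤ) * eRat Q (Y γ) i ^ (1 : ℤ) := by
    rw [hl]; simp
  have key := ee_succ_identity hε Q (eRat Q (Y γ) i) (H := fun u => F.eval u) fun k s => by
    have := hF' (Q ^ k * eRat Q (Y γ) i ^ s)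
    rwa [← mul_assoc, ← mul_assoc, ← zpow_add, ← zpow_add, add_comm 1, neg_add_eq_sub] at this
  rw [e1, e2, e3, e4, hl']
  simp only [Units.val_mul]
  linear_combination ((eLoc Q (Y γ) (i + 1) : Lˣ) : L) * ((Y γ (i + 1) : Lˣ) : L) *
    eAmp hε Q (Y γ) (i + 1) * key

theorem LevelZero.ff_succ (i j : Fin n) (h : (j : ℕ) = i + 1) (a b : ℤ) :
    repEval hε φ (exchange uWt uDeg UInv
      (ratio (sq ħ 1) (sp * sq ħ (-1)) sp) (-ratio (sq ħ 1) (sp * sq ħ (-1)) sp)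
      (zmul (fCur i)) (fCur j) (zmul (fCur j)) (fCur i) a b) = 0 := by
  obtain ⟨hS, F, hF, hF'⟩ := hL.ratio_pole dvd_rfl (sfEval_sp hε) suppLe_sp
    suppLe_sp_mul_sx (a := 1) (b := -1) 1 (-1) (by norm_num) (by norm_num)
  refine (hL.f i).repEval_exchange hL.cHalf (hL.f j) hS hF a b (fun γ => ?_) (fun γ => ?_)
    fun γ => ?_
  · simp only [hL.state_f]
    exact fLoc_low_of_ne _ _ _ (by omega)
  · simp only [hL.state_f]
    exact fLoc_low_of_ne _ _ _ (by omega)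
  simp only [hL.state_f]
  rw [fAmp_low_of_ne hε Q Q⁻¹ (Y γ) C₀ (i := j) (j := i) (by omega) (by omega)]
  simp only [h]
  rw [fAmp_eq hε Q _ _ (i + 1), fAmp_eq hε Q _ _ (i + 1), fRat_low_pred, low_succ]
  set t := fLoc Q (Y γ) i / fLoc Q (Y γ) (i + 1) with ht
  have hr : fRat Q (Y γ) (i + 1) = t⁻¹ := (inv_div _ _).symm
  have hl' : fLoc Q (Y γ) i = t * fLoc Q (Y γ) (i + 1) := by rw [ht, div_mul_cancel]
  have e1 : Q * t⁻¹ = Q ^ (1 : ℤ) * t ^ (-1 : ℤ) := by simp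
  have e2 : Q * (t⁻¹ * Q⁻¹ ^ 2) = Q ^ (-1 : ℤ) * t ^ (-1 : ℤ) :=
    Additive.ofMul.injective (by simp only [ofMul_mul, ofMul_inv, ofMul_pow, ofMul_zpow]; abel)
  have e3 : fLoc Q (Y γ) (i + 1) / fLoc Q (Y γ) i = Q ^ (0 : ℤ) * t ^ (-1 : ℤ) := by
    rw [← inv_div, ← ht]; simp
  have e4 : t = Q ^ (0 : ℤ) * t ^ (1 : ℤ) := by simp
  have key := ff_succ_identity hε Q t (H := fun u => F.eval u) fun k s => by
    have := hF' (Q ^ k * t ^ s)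
    rwa [← mul_assoc, ← mul_assoc, ← zpow_add, ← zpow_add, add_comm 1, neg_add_eq_sub] at this
  rw [hr, e1, e2, e3, hl']
  have c : ((Q⁻¹⁻¹ : Lˣ) : L) = Q := by rw [inv_inv]
  simp only [Units.val_mul, mul_inv, c]
  rw [← e4] at key
  linear_combination ((fLoc Q (Y γ) (i + 1) : Lˣ) : L) * (((Y γ (i + 1))⁻¹ : Lˣ) : L) * C₀ *
    fAmp hε Q (Y γ) i C₀ * key

end LevelZero

/-! ### The Serre relations. -/

section Serre

variable {n : ℕ} {L : Type*} [CommRing L] [Algebra ℂ L] {ε : L} {M : ℕ} {hε : ε ^ M = 0}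
  {φ : UDyn n →ₐ[ℂ] Module.End L ((Wt (n + 1) × Wt (n + 1)) × ℤ → L)} {ħ : ℂ} {Q : Lˣ}
  {Y : Wt (n + 1) × Wt (n + 1) → ℕ → Lˣ} {C₀ : L} (hL : LevelZero hε φ ħ Q Y C₀)
include hL

/-- The expression vanishes before symmetrisation in `z₁`, `z₂`. The supports of two `e_i` have
ratio `Q⁻²`, so the prefactor is a common scalar and the brace is a theta identity in the ratio `t`
of neighbouring supports. Of two neighbours only the lower amplitude reacts to a step of the other,
whence two different identities. -/
theorem LevelZero.serre_e_term (i j : Fin n) (h : (j : ℕ) = i + 1 ∨ (i : ℕ) = j + 1) (a b c : ℤ) :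
    repEval hε φ (serreTerm uWt uDeg UInv ħ (ratio (spStar * sq ħ 2) (spStar * sq ħ (-2)) spStar)
      (ratio (spStar * sq ħ (-1)) (spStar * sq ħ 1) spStar) (eCur i) (eCur j) a b c) = 0 := by
  obtain ⟨hS, -⟩ := hL.ratio_regular sp_dvd_spStar (sfEval_spStar hε) suppLe_spStar
    suppLe_spStar_mul_sx (a := 2) (b := -2) 2 (-2) (by norm_num) (by norm_num)
  obtain ⟨hH, E, hE, hE'⟩ := hL.ratio_regular sp_dvd_spStar (sfEval_spStar hε) suppLe_spStar
    suppLe_spStar_mul_sx (a := -1) (b := 1) (-1) 1 (by norm_num) (by norm_num)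
  have hij : (i : ℕ) ≠ j := by omega
  refine (hL.e i).repEval_serre hL.cHalf ħ (hL.e j) hS hH hE (Q⁻¹ ^ 2) (fun γ => ?_) (fun γ => ?_)
    (fun γ => ?_) a b c fun γ => ?_
  · simp only [hL.state_e, eLoc_low_self]
  · simp only [hL.state_e]
    exact eLoc_low_of_ne _ _ _ hij.symm
  · simp only [hL.state_e]
    exact eLoc_low_of_ne _ _ _ hij
  have hH : ∀ (t : Lˣ) (k s : ℤ), E.eval ((Q ^ k * t ^ s : Lˣ) : L) * gMono hε Q t (k + 1) s =
      gMono hε Q t (k - 1) s := fun t k s => by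
    have := hE' (Q ^ k * t ^ s)
    rwa [← mul_assoc, ← mul_assoc, ← zpow_add, ← zpow_add, add_comm 1, neg_add_eq_sub] at this
  simp only [hL.state_e]
  rw [hL.algebraMap_two]
  have hQ : (Q : L) * ((Q⁻¹ : Lˣ) : L) = 1 := Q.mul_inv
  rcases h with h | h
  · rw [h]
    generalize (i : ℕ) = m
    set t := eRat Q (Y γ) m with ht
    have hl : eLoc Q (Y γ) m / eLoc Q (Y γ) (m + 1) = t := mul_div_mul_right_eq_div _ _ _
    have hl' : eLoc Q (Y γ) (m + 1) / eLoc Q (Y γ) m = t⁻¹ := by rw [← inv_div, hl]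
    have a1 : eLoc Q (Y γ) m / eLoc Q (Y γ) (m + 1) = Q ^ (0 : ℤ) * t ^ (1 : ℤ) := by simp [hl]
    have a2 : eLoc Q (Y γ) m * Q⁻¹ ^ 2 / eLoc Q (Y γ) (m + 1) = Q ^ (-2 : ℤ) * t ^ (1 : ℤ) := by
      rw [mul_div_right_comm, hl, mul_comm, zpow_one, zpow_neg, inv_pow]; rfl
    have a3 : eLoc Q (Y γ) (m + 1) / eLoc Q (Y γ) m = Q ^ (0 : ℤ) * t ^ (-1 : ℤ) := by simp [hl']
    have a4 : eLoc Q (Y γ) (m + 1) / (eLoc Q (Y γ) m * Q⁻¹ ^ 2) = Q ^ (2 : ℤ) * t ^ (-1 : ℤ) := by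
      rw [← inv_div, a2, mul_inv, ← zpow_neg, ← zpow_neg, neg_neg]
    have b1 : eAmp hε Q (low Q (m + 1) (Y γ)) m = ((Y γ (m + 1) * Q⁻¹ : Lˣ) : L) *
        thetaU hε (Q ^ (1 : ℤ) * t ^ (1 : ℤ)) := by
      rw [eAmp_eq, eRat_low_succ, low_self]
      congr 2
      exact Additive.ofMul.injective
        (by simp only [ofMul_mul, ofMul_inv, ofMul_pow, ofMul_zpow]; abel)
    have b2 : eAmp hε Q (low Q m (low Q (m + 1) (Y γ))) m = (Y γ (m + 1) : L) *
        thetaU hε (Q ^ (-1 : ℤ) * t ^ (1 : ℤ)) := by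
      rw [eAmp_eq, eRat_low_self, eRat_low_succ, low_succ, low_self, inv_mul_cancel_right]
      congr 2
      exact Additive.ofMul.injective
        (by simp only [ofMul_mul, ofMul_inv, ofMul_pow, ofMul_zpow]; abel)
    have b3 : eAmp hε Q (Y γ) m = (Y γ (m + 1) : L) *
        thetaU hε (Q ^ (-1 : ℤ) * t ^ (1 : ℤ)) := by
      rw [eAmp_eq, zpow_neg, zpow_one, zpow_one]
    have b4 : eAmp hε Q (low Q (m + 1) (low Q m (Y γ))) m = (Y γ (m + 1) : L) *
        thetaU hε (Q ^ (-1 : ℤ) * t ^ (1 : ℤ)) := by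
      rw [eAmp_eq, eRat_low_succ, eRat_low_self, low_self, low_succ, mul_inv_cancel_right]
      congr 2
      exact Additive.ofMul.injective
        (by simp only [ofMul_mul, ofMul_inv, ofMul_pow, ofMul_zpow]; abel)
    have b5 : eAmp hε Q (low Q m (Y γ)) m = ((Y γ (m + 1) * Q : Lˣ) : L) *
        thetaU hε (Q ^ (-3 : ℤ) * t ^ (1 : ℤ)) := by
      rw [eAmp_eq, eRat_low_self, low_succ]
      congr 2
      exact Additive.ofMul.injective
        (by simp only [ofMul_mul, ofMul_inv, ofMul_pow, ofMul_zpow]; abel)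
    have b6 : ∀ Z, eAmp hε Q (low Q m Z) (m + 1) = eAmp hε Q Z (m + 1) := fun Z =>
      eAmp_low_of_ne _ _ _ _ (by omega) (by omega)
    have key := serre_e_succ_identity hε Q t (H := fun u => E.eval u) (hH t)
    rw [b6, b6, b6, b1, b2, b3, b4, b5, a1, a2, a3, a4]
    simp only [Units.val_mul]
    linear_combination (eAmp hε Q (Y γ) (m + 1) * (Y γ (m + 1) : L) * (Y γ (m + 1) : L)) * key
  · rw [h]
    generalize (j : ℕ) = m
    set t := eRat Q (Y γ) m with ht
    have hl : eLoc Q (Y γ) m / eLoc Q (Y γ) (m + 1) = t := mul_div_mul_right_eq_div _ _ _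
    have hl' : eLoc Q (Y γ) (m + 1) / eLoc Q (Y γ) m = t⁻¹ := by rw [← inv_div, hl]
    have a1 : eLoc Q (Y γ) (m + 1) / eLoc Q (Y γ) m = Q ^ (0 : ℤ) * t ^ (-1 : ℤ) := by simp [hl']
    have a2 : eLoc Q (Y γ) (m + 1) * Q⁻¹ ^ 2 / eLoc Q (Y γ) m = Q ^ (-2 : ℤ) * t ^ (-1 : ℤ) := by
      rw [mul_div_right_comm, hl', mul_comm, zpow_neg t, zpow_one, zpow_neg, inv_pow]; rfl
    have a3 : eLoc Q (Y γ) m / eLoc Q (Y γ) (m + 1) = Q ^ (0 : ℤ) * t ^ (1 : ℤ) := by simp [hl]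
    have a4 : eLoc Q (Y γ) m / (eLoc Q (Y γ) (m + 1) * Q⁻¹ ^ 2) = Q ^ (2 : ℤ) * t ^ (1 : ℤ) := by
      rw [← inv_div, a2, mul_inv, ← zpow_neg, ← zpow_neg, neg_neg, neg_neg]
    have b1 : ∀ Z, eAmp hε Q (low Q m Z) (m + 1) = eAmp hε Q Z (m + 1) := fun Z =>
      eAmp_low_of_ne _ _ _ _ (by omega) (by omega)
    have b2 : eAmp hε Q (low Q (m + 1) (low Q m (Y γ))) (m + 1) =
        eAmp hε Q (low Q (m + 1) (Y γ)) (m + 1) := by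
      rw [eAmp_eq, eAmp_eq, eRat_low_self, eRat_low_self, low_succ, low_succ,
        eRat_low_of_ne _ _ _ (by omega) (by omega), low_of_ne Q (Y γ) (by omega) (by omega)]
    have b3 : eAmp hε Q (low Q (m + 1) (Y γ)) m = ((Y γ (m + 1) * Q⁻¹ : Lˣ) : L) *
        thetaU hε (Q ^ (1 : ℤ) * t ^ (1 : ℤ)) := by
      rw [eAmp_eq, eRat_low_succ, low_self]
      congr 2
      exact Additive.ofMul.injective
        (by simp only [ofMul_mul, ofMul_inv, ofMul_pow, ofMul_zpow]; abel)
    have b4 : eAmp hε Q (low Q (m + 1) (low Q (m + 1) (Y γ))) m =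
        ((Y γ (m + 1) * Q⁻¹ * Q⁻¹ : Lˣ) : L) * thetaU hε (Q ^ (3 : ℤ) * t ^ (1 : ℤ)) := by
      rw [eAmp_eq, eRat_low_succ, eRat_low_succ, low_self, low_self]
      congr 2
      exact Additive.ofMul.injective
        (by simp only [ofMul_mul, ofMul_inv, ofMul_pow, ofMul_zpow]; abel)
    have b5 : eAmp hε Q (Y γ) m = (Y γ (m + 1) : L) *
        thetaU hε (Q ^ (-1 : ℤ) * t ^ (1 : ℤ)) := by
      rw [eAmp_eq, zpow_neg, zpow_one, zpow_one]
    have key := serre_e_pred_identity hε Q t (H := fun u => E.eval u) (hH t)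
    rw [b2, b1, b1, b3, b4, b5, a1, a2, a3, a4]
    simp only [Units.val_mul]
    linear_combination (eAmp hε Q (Y γ) (m + 1) * eAmp hε Q (low Q (m + 1) (Y γ)) (m + 1) *
      (Y γ (m + 1) : L)) * key

theorem LevelZero.serre_f_term (i j : Fin n) (h : (j : ℕ) = i + 1 ∨ (i : ℕ) = j + 1) (a b c : ℤ) :
    repEval hε φ (serreTerm uWt uDeg UInv ħ (ratio (sp * sq ħ (-2)) (sp * sq ħ 2) sp)
      (ratio (sp * sq ħ 1) (sp * sq ħ (-1)) sp) (fCur i) (fCur j) a b c) = 0 := by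
  obtain ⟨hS, -⟩ := hL.ratio_regular dvd_rfl (sfEval_sp hε) suppLe_sp
    suppLe_sp_mul_sx (a := -2) (b := 2) (-2) 2 (by norm_num) (by norm_num)
  obtain ⟨hH, E, hE, hE'⟩ := hL.ratio_regular dvd_rfl (sfEval_sp hε) suppLe_sp
    suppLe_sp_mul_sx (a := 1) (b := -1) 1 (-1) (by norm_num) (by norm_num)
  have hij : (i : ℕ) ≠ j := by omega
  refine (hL.f i).repEval_serre hL.cHalf ħ (hL.f j) hS hH hE (Q ^ 2) (fun γ => ?_) (fun γ => ?_)
    (fun γ => ?_) a b c fun γ => ?_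
  · simp only [hL.state_f, fLoc_low_self, inv_inv]
  · simp only [hL.state_f]
    exact fLoc_low_of_ne _ _ _ hij.symm
  · simp only [hL.state_f]
    exact fLoc_low_of_ne _ _ _ hij
  have hH : ∀ (t : Lˣ) (k s : ℤ), E.eval ((Q ^ k * t ^ s : Lˣ) : L) * gMono hε Q t (k - 1) s =
      gMono hε Q t (k + 1) s := fun t k s => by
    have := hE' (Q ^ k * t ^ s)
    rwa [← mul_assoc, ← mul_assoc, ← zpow_add, ← zpow_add, add_comm 1, neg_add_eq_sub] at this
  simp only [hL.state_f]
  rw [hL.algebraMap_two]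
  have hQ : (Q : L) * ((Q⁻¹ : Lˣ) : L) = 1 := Q.mul_inv
  rcases h with h | h
  · rw [h]
    generalize (i : ℕ) = m
    set t := fLoc Q (Y γ) m / fLoc Q (Y γ) (m + 1) with ht
    have hl' : fLoc Q (Y γ) (m + 1) / fLoc Q (Y γ) m = t⁻¹ := by rw [ht, inv_div]
    have hr : fRat Q (Y γ) (m + 1) = t⁻¹ := hl'
    have a1 : t = Q ^ (0 : ℤ) * t ^ (1 : ℤ) := by simp
    have a2 : fLoc Q (Y γ) m * Q ^ 2 / fLoc Q (Y γ) (m + 1) = Q ^ (2 : ℤ) * t ^ (1 : ℤ) := by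
      rw [mul_div_right_comm, ← ht, mul_comm, zpow_one]; rfl
    have a3 : fLoc Q (Y γ) (m + 1) / fLoc Q (Y γ) m = Q ^ (0 : ℤ) * t ^ (-1 : ℤ) := by simp [hl']
    have a4 : fLoc Q (Y γ) (m + 1) / (fLoc Q (Y γ) m * Q ^ 2) = Q ^ (-2 : ℤ) * t ^ (-1 : ℤ) := by
      rw [← inv_div, a2, mul_inv, ← zpow_neg, ← zpow_neg]
    have b1 : ∀ Z, fAmp hε Q (low Q⁻¹ (m + 1) Z) m C₀ = fAmp hε Q Z m C₀ := fun Z =>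
      fAmp_low_of_ne _ _ _ _ _ (by omega) (by omega)
    have b2 : fAmp hε Q (low Q⁻¹ m (low Q⁻¹ (m + 1) (Y γ))) m C₀ =
        fAmp hε Q (low Q⁻¹ m (Y γ)) m C₀ := by
      rw [fAmp_eq, fAmp_eq, fRat_low_self, fRat_low_self, low_self, low_self,
        fRat_low_of_ne _ _ _ (by omega) (by omega), low_of_ne Q⁻¹ (Y γ) (by omega) (by omega)]
    have b3 : fAmp hε Q (low Q⁻¹ m (Y γ)) (m + 1) C₀ =
        C₀ * (((Y γ (m + 1))⁻¹ * Q : Lˣ) : L) * thetaU hε (Q ^ (-1 : ℤ) * t ^ (-1 : ℤ)) := by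
      rw [fAmp_eq, fRat_low_pred, low_succ, hr, mul_inv, inv_inv]
      congr 2
      exact Additive.ofMul.injective
        (by simp only [ofMul_mul, ofMul_inv, ofMul_pow, ofMul_zpow]; abel)
    have b4 : fAmp hε Q (low Q⁻¹ m (low Q⁻¹ m (Y γ))) (m + 1) C₀ =
        C₀ * (((Y γ (m + 1))⁻¹ * Q * Q : Lˣ) : L) * thetaU hε (Q ^ (-3 : ℤ) * t ^ (-1 : ℤ)) := by
      rw [fAmp_eq, fRat_low_pred, fRat_low_pred, low_succ, low_succ, hr, mul_inv, mul_inv, inv_inv]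
      congr 2
      exact Additive.ofMul.injective
        (by simp only [ofMul_mul, ofMul_inv, ofMul_pow, ofMul_zpow]; abel)
    have b5 : fAmp hε Q (Y γ) (m + 1) C₀ =
        C₀ * (((Y γ (m + 1))⁻¹ : Lˣ) : L) * thetaU hε (Q ^ (1 : ℤ) * t ^ (-1 : ℤ)) := by
      rw [fAmp_eq, hr, zpow_neg, zpow_one, zpow_one]
    have key := serre_f_succ_identity hε Q t (H := fun u => E.eval u) (hH t)
    rw [← a1] at key
    rw [b2, b1, b1, b3, b4, b5, a2, a3, a4]
    simp only [Units.val_mul]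
    linear_combination (fAmp hε Q (Y γ) m C₀ * fAmp hε Q (low Q⁻¹ m (Y γ)) m C₀ *
      C₀ * (((Y γ (m + 1))⁻¹ : Lˣ) : L)) * key
  · rw [h]
    generalize (j : ℕ) = m
    set t := fLoc Q (Y γ) (m + 1) / fLoc Q (Y γ) m with ht
    have hl' : fLoc Q (Y γ) m / fLoc Q (Y γ) (m + 1) = t⁻¹ := by rw [ht, inv_div]
    have hr : fRat Q (Y γ) (m + 1) = t := rfl
    have a1 : t = Q ^ (0 : ℤ) * t ^ (1 : ℤ) := by simp
    have a2 : fLoc Q (Y γ) (m + 1) * Q ^ 2 / fLoc Q (Y γ) m = Q ^ (2 : ℤ) * t ^ (1 : ℤ) := by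
      rw [mul_div_right_comm, ← ht, mul_comm, zpow_one]; rfl
    have a3 : fLoc Q (Y γ) m / fLoc Q (Y γ) (m + 1) = Q ^ (0 : ℤ) * t ^ (-1 : ℤ) := by simp [hl']
    have a4 : fLoc Q (Y γ) m / (fLoc Q (Y γ) (m + 1) * Q ^ 2) = Q ^ (-2 : ℤ) * t ^ (-1 : ℤ) := by
      rw [← inv_div, a2, mul_inv, ← zpow_neg, ← zpow_neg]
    have b1 : fAmp hε Q (low Q⁻¹ m (Y γ)) (m + 1) C₀ = C₀ * (((Y γ (m + 1))⁻¹ * Q : Lˣ) : L) *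
        thetaU hε (Q ^ (-1 : ℤ) * t ^ (1 : ℤ)) := by
      rw [fAmp_eq, fRat_low_pred, low_succ, hr, mul_inv, inv_inv]
      congr 2
      exact Additive.ofMul.injective
        (by simp only [ofMul_mul, ofMul_inv, ofMul_pow, ofMul_zpow]; abel)
    have b2 : fAmp hε Q (low Q⁻¹ (m + 1) (low Q⁻¹ m (Y γ))) (m + 1) C₀ =
        C₀ * (((Y γ (m + 1))⁻¹ : Lˣ) : L) * thetaU hε (Q ^ (1 : ℤ) * t ^ (1 : ℤ)) := by
      rw [fAmp_eq, fRat_low_self, fRat_low_pred, low_self, low_succ, hr, inv_inv,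
        inv_mul_cancel_right]
      congr 2
      exact Additive.ofMul.injective
        (by simp only [ofMul_mul, ofMul_inv, ofMul_pow, ofMul_zpow]; abel)
    have b3 : fAmp hε Q (Y γ) (m + 1) C₀ =
        C₀ * (((Y γ (m + 1))⁻¹ : Lˣ) : L) * thetaU hε (Q ^ (1 : ℤ) * t ^ (1 : ℤ)) := by
      rw [fAmp_eq, hr, zpow_one, zpow_one]
    have b4 : fAmp hε Q (low Q⁻¹ m (low Q⁻¹ (m + 1) (Y γ))) (m + 1) C₀ =
        C₀ * (((Y γ (m + 1))⁻¹ : Lˣ) : L) * thetaU hε (Q ^ (1 : ℤ) * t ^ (1 : ℤ)) := by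
      rw [fAmp_eq, fRat_low_pred, fRat_low_self, low_succ, low_self, hr, inv_inv,
        mul_inv_cancel_right]
      congr 2
      exact Additive.ofMul.injective
        (by simp only [ofMul_mul, ofMul_inv, ofMul_pow, ofMul_zpow]; abel)
    have b5 : fAmp hε Q (low Q⁻¹ (m + 1) (Y γ)) (m + 1) C₀ =
        C₀ * (((Y γ (m + 1))⁻¹ * Q⁻¹ : Lˣ) : L) * thetaU hε (Q ^ (3 : ℤ) * t ^ (1 : ℤ)) := by
      rw [fAmp_eq, fRat_low_self, low_self, hr, mul_inv, inv_inv]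
      congr 2
      exact Additive.ofMul.injective
        (by simp only [ofMul_mul, ofMul_inv, ofMul_pow, ofMul_zpow]; abel)
    have b6 : ∀ Z, fAmp hε Q (low Q⁻¹ (m + 1) Z) m C₀ = fAmp hε Q Z m C₀ := fun Z =>
      fAmp_low_of_ne _ _ _ _ _ (by omega) (by omega)
    have key := serre_f_pred_identity hε Q t (H := fun u => E.eval u) (hH t)
    rw [← a1] at key
    rw [b6, b6, b6, b1, b2, b3, b4, b5, a2, a3, a4]
    simp only [Units.val_mul]
    linear_combination (fAmp hε Q (Y γ) m C₀ * C₀ ^ 2 * (((Y γ (m + 1))⁻¹ : Lˣ) : L) ^ 2) * key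

end Serre

/-! ### Laurent series in `z` with `p = ε` -/

section LaurentEval

variable {L : Type*} [CommRing L] {ε : L} {M : ℕ} (hε : ε ^ M = 0)

theorem single_pow_eq_zero (hε : ε ^ M = 0) :
    (HahnSeries.single (-1) ε : LaurentSeries L) ^ M = 0 := by
  rw [HahnSeries.single_pow, hε, map_zero]

/-- Evaluation of a power series at `ε / z`. -/
def evalNeg : PowerSeries L →+* LaurentSeries L :=
  truncEval HahnSeries.C (HahnSeries.single (-1) ε) (fun _ => Commute.all _ _) M
    (single_pow_eq_zero hε)

/-- The Laurent series `f(z) g(ε / z)`. -/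
def pairLaurent (f g : PowerSeries L) : LaurentSeries L :=
  HahnSeries.ofPowerSeries ℤ L f * evalNeg hε g

theorem pairLaurent_mul (f g f' g' : PowerSeries L) :
    pairLaurent hε f g * pairLaurent hε f' g' = pairLaurent hε (f * f') (g * g') := by
  rw [pairLaurent, pairLaurent, pairLaurent, map_mul, map_mul, mul_mul_mul_comm]

theorem coeff_ofPowerSeries_int (f : PowerSeries L) (r : ℤ) :
    (HahnSeries.ofPowerSeries ℤ L f).coeff r = if 0 ≤ r then PowerSeries.coeff r.toNat f else 0 := by
  rw [PowerSeries.coeff_coe]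
  by_cases h : 0 ≤ r
  · rw [if_neg (by omega), if_pos h]
    congr 2
    omega
  · rw [if_pos (by omega), if_neg h]

theorem coeff_mul_single_sub {x : LaurentSeries L} {a r : ℤ} (b : L) :
    (x * HahnSeries.single a b).coeff r = x.coeff (r - a) * b := by
  have h := HahnSeries.coeff_mul_single_add (r := b) (x := x) (a := r - a) (b := a)
  rwa [sub_add_cancel] at h

theorem coeff_pairLaurent (f g : PowerSeries L) (r : ℤ) :
    (pairLaurent hε f g).coeff r = pairCoeff M ε f g r := by
  rw [pairLaurent, evalNeg, truncEval_apply, Finset.mul_sum, HahnSeries.coeff_sum, pairCoeff]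
  refine Finset.sum_congr rfl fun k _ => ?_
  rw [HahnSeries.single_pow, HahnSeries.C_apply, HahnSeries.single_mul_single,
    coeff_mul_single_sub, coeff_ofPowerSeries_int]
  have h : r - (0 + k • (-1 : ℤ)) = r + k := by
    rw [zero_add, nsmul_eq_mul, mul_neg_one, sub_neg_eq_add]
  rw [h]
  split_ifs
  · rw [mul_assoc]
  · rw [zero_mul]

theorem evalNeg_C (a : L) : evalNeg hε (PowerSeries.C a) = HahnSeries.C a := truncEval_C _ _ _ _ _ a

theorem evalNeg_X : evalNeg hε PowerSeries.X = HahnSeries.single (-1) ε := truncEval_X _ _ _ _ _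

/-- The coefficients of a product with a power series. -/
theorem exists_sum_eq_coeff_mul (s : PowerSeries L) (F : LaurentSeries L) (a : ℤ) :
    ∃ T₀ : Finset ℕ, ∀ T, T₀ ⊆ T → ∑ m ∈ T, PowerSeries.coeff m s * F.coeff (a - m) =
      (HahnSeries.ofPowerSeries ℤ L s * F).coeff a := by
  classical
  refine ⟨(Finset.antidiagonal (HahnSeries.ofPowerSeries ℤ L s).isPWO_support F.isPWO_support
    a).image fun p => p.1.toNat, fun T hT => ?_⟩
  rw [HahnSeries.coeff_mul, ← Finset.sum_subset hT]
  · symm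
    refine Finset.sum_bij (fun p _ => p.1.toNat) (fun p hp => Finset.mem_image_of_mem _ hp)
      (fun p hp p' hp' h => ?_) (fun m hm => ?_) (fun p hp => ?_)
    · rw [Finset.mem_antidiagonal] at hp hp'
      have h1 : 0 ≤ p.1 := by
        by_contra hc
        exact hp.1 (by rw [coeff_ofPowerSeries_int, if_neg hc])
      have h2 : 0 ≤ p'.1 := by
        by_contra hc
        exact hp'.1 (by rw [coeff_ofPowerSeries_int, if_neg hc])
      have h3 := hp.2.2
      have h4 := hp'.2.2
      exact Prod.ext (by omega) (by omega)
    · obtain ⟨p, hp, rfl⟩ := Finset.mem_image.mp hm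
      exact ⟨p, hp, rfl⟩
    · rw [Finset.mem_antidiagonal] at hp
      have h1 : 0 ≤ p.1 := by
        by_contra hc
        exact hp.1 (by rw [coeff_ofPowerSeries_int, if_neg hc])
      rw [coeff_ofPowerSeries_int, if_pos h1]
      congr 2
      have := hp.2.2
      omega
  · intro m _ hm
    by_contra hne
    refine hm (Finset.mem_image.mpr ⟨((m : ℤ), a - m), ?_, by simp⟩)
    rw [Finset.mem_antidiagonal]
    refine ⟨?_, ?_, by ring⟩
    · change (HahnSeries.ofPowerSeries ℤ L s).coeff (m : ℤ) ≠ 0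
      rw [coeff_ofPowerSeries_int, if_pos (by omega), Int.toNat_natCast]
      exact left_ne_zero_of_mul hne
    · exact right_ne_zero_of_mul hne

/-- Evaluation of a polynomial at `u / z`. -/
def polyNeg (u : L) : Polynomial L →+* LaurentSeries L :=
  Polynomial.eval₂RingHom HahnSeries.C (HahnSeries.single (-1) u)

theorem coeff_polyNeg_mul (P : Polynomial L) (u : L) (F : LaurentSeries L) (a : ℤ) {T : Finset ℕ}
    (hT : P.support ⊆ T) :
    (polyNeg u P * F).coeff a = ∑ m ∈ T, P.coeff m * u ^ m * F.coeff (a + m) := by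
  rw [polyNeg, Polynomial.coe_eval₂RingHom, Polynomial.eval₂_eq_sum, Polynomial.sum,
    Finset.sum_mul, HahnSeries.coeff_sum, ← Finset.sum_subset hT]
  · refine Finset.sum_congr rfl fun m _ => ?_
    rw [HahnSeries.single_pow, HahnSeries.C_apply, HahnSeries.single_mul_single, mul_comm,
      coeff_mul_single_sub, mul_comm]
    congr 2
    rw [zero_add, nsmul_eq_mul, mul_neg_one, sub_neg_eq_add]
  · intro m _ hm
    rw [Polynomial.notMem_support_iff.mp hm, zero_mul, zero_mul]

/-- The `ε` in the coefficients combines with `u / z` to `ε / z`. In this way a structure function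
evaluated at `u / z` supplies the half of a theta function in powers of `ε / z`. -/
theorem polyNeg_gPoly (u a : L) : polyNeg u (gPoly M ε (ε * a)) =
    evalNeg hε (qprod M (PowerSeries.C ε) (PowerSeries.C (a * u) * PowerSeries.X)) := by
  have e : evalNeg hε (PowerSeries.C (a * u) * PowerSeries.X) =
      polyNeg u (Polynomial.C (ε * a) * Polynomial.X) := by
    rw [map_mul, evalNeg_C, evalNeg_X, polyNeg, Polynomial.coe_eval₂RingHom, Polynomial.eval₂_mul,
      Polynomial.eval₂_C, Polynomial.eval₂_X, HahnSeries.C_apply, HahnSeries.C_apply,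
      HahnSeries.single_mul_single, HahnSeries.single_mul_single]
    congr 1
    ring
  rw [gPoly, map_qprod, map_qprod, evalNeg_C, e, polyNeg, Polynomial.coe_eval₂RingHom,
    Polynomial.eval₂_C]

theorem isUnit_gSeries (n : ℕ) (ε : L) (u : Lˣ) : IsUnit (gSeries n ε u) := by
  rw [gSeries, qprod]
  refine IsUnit.prod_iff.mpr fun i _ => ?_
  rw [PowerSeries.isUnit_iff_constantCoeff]
  simp

theorem rescale_gSeries (n : ℕ) (ε : L) (u v : Lˣ) :
    PowerSeries.rescale (v : L) (gSeries n ε u) = gSeries n ε (v * u) := by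
  have hC : ∀ a : L, PowerSeries.rescale (v : L) (PowerSeries.C a) = PowerSeries.C a := fun a => by
    ext i
    rw [PowerSeries.coeff_rescale, PowerSeries.coeff_C]
    split_ifs with h
    · rw [h, pow_zero, one_mul]
    · rw [mul_zero]
  rw [gSeries, gSeries, map_qprod, map_mul, hC, hC, PowerSeries.rescale_X, ← mul_assoc, ← map_mul,
    Units.val_mul, mul_comm (u : L)]

/-- The theta function `(u z; ε)_∞ (ε / (u z); ε)_∞`. -/
def thetaLaurent (u : Lˣ) : LaurentSeries L :=
  pairLaurent hε (gSeries M ε u) (gSeries M ε u⁻¹)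

theorem isUnit_thetaLaurent (u : Lˣ) : IsUnit (thetaLaurent hε u) :=
  ((isUnit_gSeries M ε u).map _).mul ((isUnit_gSeries M ε u⁻¹).map _)

/-- The Laurent series of the eigenvalue of `k_l`. -/
def kLaurent (Q : Lˣ) (Y : ℕ → Lˣ) (l : ℕ) : LaurentSeries L :=
  pairLaurent hε (kPos Q Y M ε l) (kNeg Q Y M ε l)

theorem coeff_kLaurent (Q : Lˣ) (Y : ℕ → Lˣ) (l : ℕ) (r : ℤ) :
    (kLaurent hε Q Y l).coeff r = kAmp Q Y M ε l r := coeff_pairLaurent _ _ _ _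

theorem kPos_mul (Q : Lˣ) (Y : ℕ → Lˣ) (l : ℕ) :
    kPos Q Y M ε l * gSeries M ε (Q ^ (l + 1) / wState Q Y (l + 1)) =
      PowerSeries.C (((Y l)⁻¹ : Lˣ) : L) * gSeries M ε (Q ^ (l + 2) / wState Q Y l) := by
  rw [kPos, mul_assoc, Ring.inverse_mul_cancel _ (isUnit_gSeries _ _ _), mul_one]

theorem kNeg_mul (Q : Lˣ) (Y : ℕ → Lˣ) (l : ℕ) :
    kNeg Q Y M ε l * gSeries M ε (Q ^ (l + 1) / wState Q Y (l + 1))⁻¹ =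
      gSeries M ε (Q ^ (l + 2) / wState Q Y l)⁻¹ := by
  rw [kNeg, mul_assoc, Ring.inverse_mul_cancel _ (isUnit_gSeries _ _ _), mul_one]

theorem kLaurent_mul (Q : Lˣ) (Y : ℕ → Lˣ) (l : ℕ) :
    kLaurent hε Q Y l * thetaLaurent hε (Q ^ (l + 1) / wState Q Y (l + 1)) =
      HahnSeries.C (((Y l)⁻¹ : Lˣ) : L) * thetaLaurent hε (Q ^ (l + 2) / wState Q Y l) := by
  rw [kLaurent, thetaLaurent, pairLaurent_mul, kPos_mul, kNeg_mul, pairLaurent, thetaLaurent,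
    pairLaurent, map_mul, HahnSeries.ofPowerSeries_C, mul_assoc]

/-- The exchange of structure functions with eigenvalues of `k_l` differing by theta functions. -/
theorem polyNeg_mul_eq {F : Polynomial L} {s : PowerSeries L} {K₁ K₂ : LaurentSeries L}
    {A B ω κ a₁ b₁ a₂ b₂ : Lˣ}
    (hF : F * gPoly M ε (ε * b₁) = gPoly M ε (ε * a₁))
    (hs : s * gSeries M ε b₂ = PowerSeries.C (κ : L) * gSeries M ε a₂)
    (hK : HahnSeries.C (κ : L) * (K₂ * thetaLaurent hε A) = K₁ * thetaLaurent hε B)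
    (h₁ : a₁ * ω = B⁻¹) (h₂ : b₁ * ω = A⁻¹) (h₃ : ω⁻¹ * a₂ = A) (h₄ : ω⁻¹ * b₂ = B) :
    polyNeg (ω : L) F * K₁ =
      HahnSeries.ofPowerSeries ℤ L (PowerSeries.rescale ((ω⁻¹ : Lˣ) : L) s) * K₂ := by
  have hF' := congrArg (polyNeg (ω : L)) hF
  rw [map_mul, polyNeg_gPoly hε, polyNeg_gPoly hε, ← Units.val_mul, ← Units.val_mul, h₁, h₂] at hF'
  have hs' := congrArg (fun x => HahnSeries.ofPowerSeries ℤ L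
    (PowerSeries.rescale ((ω⁻¹ : Lˣ) : L) x)) hs
  have hC : PowerSeries.rescale ((ω⁻¹ : Lˣ) : L) (PowerSeries.C (κ : L)) = PowerSeries.C (κ : L) := by
    ext i
    rw [PowerSeries.coeff_rescale, PowerSeries.coeff_C]
    split_ifs with h
    · rw [h, pow_zero, one_mul]
    · rw [mul_zero]
  simp only [map_mul, rescale_gSeries, h₃, h₄, hC, HahnSeries.ofPowerSeries_C] at hs'
  have hu : IsUnit (HahnSeries.ofPowerSeries ℤ L (gSeries M ε B) * evalNeg hε (gSeries M ε A⁻¹)) :=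
    ((isUnit_gSeries M ε B).map _).mul ((isUnit_gSeries M ε A⁻¹).map _)
  -- `F` carries the half of the theta quotient in powers of `ε / z` and `s` the half in powers of
  -- `z`. Multiplying by one half of each of `θ(B)` and `θ(A)` restores the complete theta functions
  -- of `hK`.
  refine hu.mul_right_cancel ?_
  rw [thetaLaurent, thetaLaurent, pairLaurent, pairLaurent] at hK
  change polyNeg (ω : L) F * evalNeg hε (gSeries M ε A⁻¹) = evalNeg hε (gSeries M ε B⁻¹) at hF'
  linear_combination K₁ * HahnSeries.ofPowerSeries ℤ L (gSeries M ε B) * hF' -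
    K₂ * evalNeg hε (gSeries M ε A⁻¹) * hs' - hK

end LaurentEval

/-! ### The currents `k_l`: their commutation and a general exchange criterion. -/

section KRelations

variable {n : ℕ}

/-- The series contains only pure powers of `z` and of `p / z`, so each Laurent coefficient is one
monomial in `p`. -/
theorem kCur_eq (l : Fin (n + 1)) (r : ℤ) :
    kCur l r = PowerSeries.C (ugen (.k l (-r))) * PowerSeries.X ^ (-r).toNat := by
  ext k
  rw [PowerSeries.coeff_C_mul, PowerSeries.coeff_X_pow, kCur, laurent, PowerSeries.coeff_mk]
  have h0 : ∀ a b : ℕ, bideg a b 0 = a := fun a b => by simp [bideg]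
  have h1 : ∀ a b : ℕ, bideg a b 1 = b := fun a b => by simp [bideg]
  change (if 0 ≤ (k : ℤ) + r then kSer l (bideg ((k : ℤ) + r).toNat k) else 0) = _
  rw [kSer, h0, h1]
  by_cases hr : 0 ≤ r
  · rcases Nat.eq_zero_or_pos k with rfl | hk
    · rw [if_pos (by omega), if_pos rfl, if_pos (by omega), mul_one]
      congr 2
      omega
    · rw [if_pos (by omega), if_neg (by omega), if_neg (by omega), if_neg (by omega), mul_zero]
  · by_cases hk : (k : ℤ) = -r
    · rw [if_pos (by omega), if_neg (by omega), if_pos (by omega), if_pos (by omega), mul_one, hk]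
    · rw [if_neg (by omega : ¬ k = (-r).toNat), mul_zero]
      by_cases h : 0 ≤ (k : ℤ) + r
      · rw [if_pos h, if_neg (by omega), if_neg (by omega)]
      · rw [if_neg h]

theorem coeff_kCur_eq_zero (l : Fin (n + 1)) {r : ℤ} {k : ℕ} (h : (k : ℤ) + r < 0) :
    PowerSeries.coeff k (kCur l r) = 0 := by
  rw [kCur_eq, PowerSeries.coeff_C_mul, PowerSeries.coeff_X_pow, if_neg (by omega), mul_zero]

/-- Here finiteness comes from the current rather than the structure function: the coefficient of
`z^{-m}` in `k_l` is divisible by `p ^ m`. -/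
theorem finite_of_kCur (S : ℕ → PowerSeries (UDyn n)) (l : Fin (n + 1)) (a : ℤ) (k : ℕ) :
    {m : ℕ | PowerSeries.coeff k (S m * kCur l (a - m)) ≠ 0}.Finite := by
  refine (Set.finite_Iic (k + a.toNat)).subset fun m hm => ?_
  by_contra h
  rw [Set.mem_Iic, not_le] at h
  exact hm (coeff_mul_eq_zero_of_right (fun i hi => coeff_kCur_eq_zero l (by omega)) _)

variable {L : Type*} [CommRing L] [Algebra ℂ L] {ε : L} {M : ℕ} {hε : ε ^ M = 0}
  {φ : UDyn n →ₐ[ℂ] Module.End L ((Wt (n + 1) × Wt (n + 1)) × ℤ → L)} {ħ : ℂ} {Q : Lˣ}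
  {Y : Wt (n + 1) × Wt (n + 1) → ℕ → Lˣ} {C₀ : L} (hL : LevelZero hε φ ħ Q Y C₀)

include hL in
-- The `k_l` shift weights without altering the state, so they act by commuting eigenvalues.
-- Structure functions evaluating to `1` leave only the term `m = 0`.
theorem LevelZero.exchange_kk (j l : Fin (n + 1)) {S₁ S₂ : SF} (h₁ : sfEval hε S₁ = 1)
    (h₂ : sfEval hε S₂ = 1) (a b : ℤ) : repEval hε φ (exchange uWt uDeg UInv S₁ S₂
      (kCur j) (kCur l) (kCur l) (kCur j) a b) = 0 := by
  refine (hL.k j).repEval_exchange hL.cHalf (hL.k l) (hL.k l) (hL.k j) (add_comm _ _) rfl _ _ a b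
    (finite_of_kCur _ l b) (finite_of_kCur _ j a) fun γ => ⟨{0}, fun T hT => ?_⟩
  rw [h₁, h₂, ← Finset.sum_subset hT, ← Finset.sum_subset hT]
  · simp only [hL.state_k, Finset.sum_singleton, Nat.cast_zero, add_zero, sub_zero]
    ring
  · intro m _ hm
    rw [PowerSeries.coeff_one, if_neg (by simpa using hm), zero_mul, zero_mul]
  · intro m _ hm
    rw [PowerSeries.coeff_one, if_neg (by simpa using hm), zero_mul, zero_mul]

/-- Both nomes evaluate to `ε`, so each denominator equals the numerator of the other ratio. -/
theorem sfEval_ratio_eq {a b a' b' P P' : SF} (hP : sp ∣ P) (hP₁ : sfEval hε P = PowerSeries.C ε)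
    (hP' : sp ∣ P') (hP₁' : sfEval hε P' = PowerSeries.C ε) (ha : sfEval hε a = sfEval hε b')
    (hb : sfEval hε b = sfEval hε a') : sfEval hε (ratio a b P * ratio a' b' P') = 1 := by
  have h1 := congrArg (sfEval hε) (sdiv_mul_self (qPoch (a * sx) P) (constantCoeff_qPoch_sx b P))
  have h2 := congrArg (sfEval hε) (sdiv_mul_self (qPoch (a' * sx) P')
    (constantCoeff_qPoch_sx b' P'))
  rw [map_mul] at h1 h2
  have e1 : sfEval hε (qPoch (b * sx) P) = sfEval hε (qPoch (a' * sx) P') := by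
    rw [sfEval_qPoch hε _ hP hP₁, sfEval_qPoch hε _ hP' hP₁', map_mul, map_mul, hb]
  have e2 : sfEval hε (qPoch (a * sx) P) = sfEval hε (qPoch (b' * sx) P') := by
    rw [sfEval_qPoch hε _ hP hP₁, sfEval_qPoch hε _ hP' hP₁', map_mul, map_mul, ha]
  rw [map_mul]
  refine ((isUnit_of_constantCoeff (constantCoeff_qPoch_sx b' P')).map
    (sfEval hε)).mul_right_cancel ?_
  change sfEval hε (sdiv _ _) * sfEval hε (sdiv _ _) * _ = _
  rw [mul_assoc, h2, ← e1, h1, e2, one_mul]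

include hL in
theorem LevelZero.kk (l : Fin (n + 1)) (a b : ℤ) : repEval hε φ (exchange uWt uDeg UInv
    (rhoPP ħ (n + 1)) (rhoPP ħ (n + 1)) (kCur l) (kCur l) (kCur l) (kCur l) a b) = 0 :=
  hL.exchange_kk l l (sfEval_rhoPP hε ħ _) (sfEval_rhoPP hε ħ _) a b

include hL in
theorem LevelZero.kk_lt (j l : Fin (n + 1)) (a b : ℤ) : repEval hε φ (exchange uWt uDeg UInv
    (rhoPP ħ (n + 1) * ratio spStar (spStar * sq ħ 2) spStar * ratio (sp * sq ħ 2) sp sp)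
    (rhoPP ħ (n + 1) * ratio (sq ħ (-2)) 1 spStar * ratio 1 (sq ħ (-2)) sp)
    (kCur j) (kCur l) (kCur l) (kCur j) a b) = 0 := by
  refine hL.exchange_kk j l ?_ ?_ a b
  · rw [mul_assoc, map_mul, sfEval_rhoPP, one_mul]
    refine sfEval_ratio_eq sp_dvd_spStar (sfEval_spStar hε) dvd_rfl (sfEval_sp hε) ?_ ?_
    · rw [sfEval_spStar, sfEval_sp]
    · rw [map_mul, map_mul, sfEval_spStar, sfEval_sp]
  · rw [mul_assoc, map_mul, sfEval_rhoPP, one_mul]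
    exact sfEval_ratio_eq sp_dvd_spStar (sfEval_spStar hε) dvd_rfl (sfEval_sp hε) rfl rfl

include hL in
/-- A criterion for an exchange relation between `k_l` and a delta function current. -/
theorem LevelZero.exchange_k (l : Fin (n + 1)) {E : ℤ → PowerSeries (UDyn n)}
    {wE : Wt (n + 1) × Wt (n + 1)} {α : Wt (n + 1) × Wt (n + 1) → L}
    {ω : Wt (n + 1) × Wt (n + 1) → Lˣ} (hE : IsDelta hε φ E wE α ω)
    (hα : ∀ γ, α (γ - uWt (.k l 0)) = α γ) (hω : ∀ γ, ω (γ - uWt (.k l 0)) = ω γ)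
    {S₁ S₂ : SF} (hS : SuppLe 0 S₁) {F : Polynomial L} (hF : (F : PowerSeries L) = sfEval hε S₁)
    (h : ∀ γ, polyNeg (ω γ : L) F * kLaurent hε Q (Y γ) l =
      HahnSeries.ofPowerSeries ℤ L (PowerSeries.rescale (((ω γ)⁻¹ : Lˣ) : L) (sfEval hε S₂)) *
        kLaurent hε Q (Y (γ - wE)) l) (a b : ℤ) :
    repEval hε φ (exchange uWt uDeg UInv S₁ S₂ (kCur l) E E (kCur l) a b) = 0 := by
  classical
  refine (hL.k l).repEval_exchange hL.cHalf hE hE (hL.k l) (add_comm _ _) rfl _ _ a b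
    (finite_of_suppLe hS _ _) (finite_of_kCur _ l a) fun γ => ?_
  obtain ⟨T₀, hT₀⟩ := exists_sum_eq_coeff_mul
    (PowerSeries.rescale (((ω γ)⁻¹ : Lˣ) : L) (sfEval hε S₂)) (kLaurent hε Q (Y (γ - wE)) l) a
  refine ⟨T₀ ∪ F.support, fun T hT => ?_⟩
  have h1 := hT₀ T (Finset.subset_union_left.trans hT)
  rw [← h γ, coeff_polyNeg_mul F _ _ a (Finset.subset_union_right.trans hT)] at h1
  simp only [coeff_kLaurent, PowerSeries.coeff_rescale] at h1
  have h2 := congrArg (α γ * ((ω γ ^ (-b) : Lˣ) : L) * ·) h1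
  simp only [Finset.mul_sum] at h2
  simp only [← hF, Polynomial.coeff_coe, hα, hω, zpow_shift_add, zpow_shift_sub]
  refine (Finset.sum_congr rfl fun m _ => ?_).trans
    (h2.symm.trans (Finset.sum_congr rfl fun m _ => ?_))
  · ring
  · ring

end KRelations

/-! ### The change of the eigenvalue of `k_l` under a step. -/

section KExchange

variable {L : Type*} [CommRing L] {ε : L} {M : ℕ} (hε : ε ^ M = 0) (Q R : Lˣ) (Y : ℕ → Lˣ) (j : ℕ)

/-- The eigenvalue of `k_j` involves the partial products `j` and `j + 1`; only the second one
moves, and it occurs in the denominator. -/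
theorem kLaurent_low_self :
    HahnSeries.C ((R⁻¹ : Lˣ) : L) * (kLaurent hε Q (low R j Y) j *
        thetaLaurent hε (Q ^ (j + 1) / (wState Q Y (j + 1) * R⁻¹ ^ 2))) =
      kLaurent hε Q Y j * thetaLaurent hε (Q ^ (j + 1) / wState Q Y (j + 1)) := by
  have h := kLaurent_mul hε Q (low R j Y) j
  rw [wState_low, wState_low, if_pos rfl, if_neg (by omega), low_self] at h
  rw [h, kLaurent_mul, ← mul_assoc, ← map_mul, ← Units.val_mul, mul_inv, inv_inv,
    mul_comm (Y j)⁻¹, inv_mul_cancel_left]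

/-- For `k_{j+1}` the moved partial product occurs in the numerator. The unchanged denominator is a
unit and is cancelled. -/
theorem kLaurent_low_succ :
    HahnSeries.C (R : L) * (kLaurent hε Q (low R j Y) (j + 1) *
        thetaLaurent hε (Q ^ (j + 3) / wState Q Y (j + 1))) =
      kLaurent hε Q Y (j + 1) * thetaLaurent hε (Q ^ (j + 3) / (wState Q Y (j + 1) * R⁻¹ ^ 2)) := by
  have h := kLaurent_mul hε Q (low R j Y) (j + 1)
  have h' := kLaurent_mul hε Q Y (j + 1)
  rw [wState_low, wState_low, if_pos rfl, if_neg (by omega), low_succ] at h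
  have hR : (HahnSeries.C (R : L) : LaurentSeries L) * HahnSeries.C (((Y (j + 1) * R)⁻¹ : Lˣ) : L) =
      HahnSeries.C (((Y (j + 1))⁻¹ : Lˣ) : L) := by
    rw [← map_mul, ← Units.val_mul, mul_inv, mul_comm, inv_mul_cancel_right]
  refine (isUnit_thetaLaurent hε (Q ^ (j + 1 + 1) / wState Q Y (j + 1 + 1))).mul_right_cancel ?_
  change HahnSeries.C (R : L) * (_ * thetaLaurent hε (Q ^ (j + 1 + 2) / wState Q Y (j + 1))) * _ =
    _ * thetaLaurent hε (Q ^ (j + 1 + 2) / _) * _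
  linear_combination HahnSeries.C (R : L) *
    thetaLaurent hε (Q ^ (j + 1 + 2) / wState Q Y (j + 1)) * h +
    thetaLaurent hε (Q ^ (j + 1 + 2) / wState Q Y (j + 1)) *
      thetaLaurent hε (Q ^ (j + 1 + 2) / (wState Q Y (j + 1) * R⁻¹ ^ 2)) * hR -
    thetaLaurent hε (Q ^ (j + 1 + 2) / (wState Q Y (j + 1) * R⁻¹ ^ 2)) * h'

theorem kAmp_low_of_ne {l : ℕ} (h : l ≠ j) (h' : l ≠ j + 1) (r : ℤ) :
    kAmp Q (low R j Y) M ε l r = kAmp Q Y M ε l r := by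
  rw [kAmp, kAmp, kPos, kPos, kNeg, kNeg, wState_low, wState_low, if_neg h', if_neg (by omega),
    low_of_ne R Y h h']

end KExchange

/-! ### Exchange of `k_l` with `e_j` and `f_j`. -/

section KCurrents

variable {n : ℕ} {L : Type*} [CommRing L] [Algebra ℂ L] {ε : L} {M : ℕ} {hε : ε ^ M = 0}
  {φ : UDyn n →ₐ[ℂ] Module.End L ((Wt (n + 1) × Wt (n + 1)) × ℤ → L)} {ħ : ℂ} {Q : Lˣ}
  {Y : Wt (n + 1) × Wt (n + 1) → ℕ → Lˣ} {C₀ : L} (hL : LevelZero hε φ ħ Q Y C₀)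

theorem ratio_polynomial {P a b : SF} (hP : sp ∣ P) (hP' : sfEval hε P = PowerSeries.C ε)
    {S : SF} (hSeq : S = ratio (P * a) (P * b) P) (hS : SuppLe 0 S) {a₁ b₁ : Lˣ}
    (ha : sfEval hε a = PowerSeries.C (a₁ : L)) (hb : sfEval hε b = PowerSeries.C (b₁ : L)) :
    ∃ F : Polynomial L, (F : PowerSeries L) = sfEval hε S ∧
      F * gPoly M ε (ε * b₁) = gPoly M ε (ε * a₁) := by
  obtain ⟨F, hF⟩ := exists_polynomial hε hS
  refine ⟨F, hF, ?_⟩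
  rw [← Polynomial.coe_inj, Polynomial.coe_mul, coe_gPoly, coe_gPoly, hF, hSeq]
  exact sfEval_ratio_mul hε hP hP' (by rw [map_mul, hP', ha, map_mul])
    (by rw [map_mul, hP', hb, map_mul])

theorem sfEval_mul_ratio {P a b S : SF} (hP : sp ∣ P) (hP' : sfEval hε P = PowerSeries.C ε)
    {a₂ b₂ κ : Lˣ} (ha : sfEval hε a = PowerSeries.C (a₂ : L))
    (hb : sfEval hε b = PowerSeries.C (b₂ : L)) (hS : sfEval hε S = PowerSeries.C (κ : L)) :
    sfEval hε (S * ratio a b P) * gSeries M ε b₂ = PowerSeries.C (κ : L) * gSeries M ε a₂ := by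
  rw [map_mul, hS, mul_assoc]
  congr 1
  exact sfEval_ratio_mul hε hP hP' ha hb

include hL

theorem LevelZero.ke_far (j : Fin n) (l : Fin (n + 1)) (h : l ≠ j.castSucc) (h' : l ≠ j.succ)
    (a b : ℤ) : repEval hε φ (kCur l a * eCur j b - eCur j b * kCur l a) = 0 := by
  refine (hL.k l).repEval_commutator (hL.e j) a b fun γ => ?_
  simp only [hL.state_e, hL.state_k]
  rw [kAmp_low_of_ne Q _ (Y γ) (j : ℕ) (l := (l : ℕ)) (fun hc => h (Fin.ext hc))
    (fun hc => h' (Fin.ext hc)), mul_comm]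

theorem LevelZero.kf_far (j : Fin n) (l : Fin (n + 1)) (h : l ≠ j.castSucc) (h' : l ≠ j.succ)
    (a b : ℤ) : repEval hε φ (kCur l a * fCur j b - fCur j b * kCur l a) = 0 := by
  refine (hL.k l).repEval_commutator (hL.f j) a b fun γ => ?_
  simp only [hL.state_f, hL.state_k]
  rw [kAmp_low_of_ne Q _ (Y γ) (j : ℕ) (l := (l : ℕ)) (fun hc => h (Fin.ext hc))
    (fun hc => h' (Fin.ext hc)), mul_comm]

theorem LevelZero.sfEval_sc_mul_sq (c : ℤ) {a : ℂ} (k : ℤ) (ha : a = k) :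
    sfEval hε (sc c * sq ħ a) = PowerSeries.C ((Q ^ k : Lˣ) : L) := by
  rw [map_mul, sfEval_sc, one_mul, hL.sfEval_sq k ha]

theorem LevelZero.ke (j : Fin n) (a b : ℤ) : repEval hε φ (exchange uWt uDeg UInv
      (ratio (spStar * sc 1 * sq ħ (2 - node j)) (spStar * sc 1 * sq ħ (-node j)) spStar)
      (sq ħ (-1) * ratio (sc (-1) * sq ħ (node j)) (sc (-1) * sq ħ (-2 + node j)) spStar)
      (kCur j.castSucc) (eCur j) (eCur j) (kCur j.castSucc) a b) = 0 := by
  have hS : SuppLe 0 (ratio (spStar * sc 1 * sq ħ (2 - node j)) (spStar * sc 1 * sq ħ (-node j))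
      spStar) := by
    refine suppLe_ratio ?_ ?_ suppLe_spStar <;> rw [mul_assoc spStar] <;>
      exact suppLe_mul_sx suppLe_spStar_mul_sx ((suppLe_C _).mul (suppLe_C _))
  -- Since `node j` is `j + 1`, the exponents `2 - node j` and `-node j` are the integers `1 - j`
  -- and `-1 - j`; the factors `q^{±c}` evaluate to `1`.
  obtain ⟨F, hF, hF'⟩ := ratio_polynomial sp_dvd_spStar (sfEval_spStar hε)
    (by rw [mul_assoc, mul_assoc]) hS (hL.sfEval_sc_mul_sq 1 (a := 2 - node j) (1 - j)
      (by rw [node]; push_cast; ring)) (hL.sfEval_sc_mul_sq 1 (a := -node j) (-1 - j)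
      (by rw [node]; push_cast; ring))
  have hs := sfEval_mul_ratio (hε := hε) sp_dvd_spStar (sfEval_spStar hε)
    (hL.sfEval_sc_mul_sq (-1) (a := node j) (j + 1) (by rw [node]; push_cast; ring))
    (hL.sfEval_sc_mul_sq (-1) (a := -2 + node j) (j - 1) (by rw [node]; push_cast; ring))
    (hL.sfEval_sq (a := -1) (-1) (by norm_num))
  refine hL.exchange_k j.castSucc (hL.e j) (fun γ => by simp only [hL.state_k])
    (fun γ => by simp only [hL.state_k]) hS hF (fun γ => ?_) a b
  rw [hL.state_e]
  have hK := kLaurent_low_self hε Q Q (Y γ) j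
  rw [← zpow_neg_one] at hK
  -- Four monomial conditions remain. They hold because the shifts by `q^j` in the relation align
  -- the theta factors of `k_j` with the support of `e_j`.
  refine polyNeg_mul_eq hε hF' hs hK ?_ ?_ ?_ ?_ <;>
  · rw [eLoc]
    exact Additive.ofMul.injective (by
      simp only [ofMul_mul, ofMul_inv, ofMul_pow, ofMul_zpow, ofMul_div, sub_zsmul, add_zsmul, add_nsmul,
        natCast_zsmul, neg_zsmul]
      abel)

theorem LevelZero.ke_succ (j : Fin n) (a b : ℤ) : repEval hε φ (exchange uWt uDeg UInv
      (ratio (spStar * sc 1 * sq ħ (-2 - node j)) (spStar * sc 1 * sq ħ (-node j)) spStar)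
      (sq ħ 1 * ratio (sc (-1) * sq ħ (node j)) (sc (-1) * sq ħ (2 + node j)) spStar)
      (kCur j.succ) (eCur j) (eCur j) (kCur j.succ) a b) = 0 := by
  have hS : SuppLe 0 (ratio (spStar * sc 1 * sq ħ (-2 - node j)) (spStar * sc 1 * sq ħ (-node j))
      spStar) := by
    refine suppLe_ratio ?_ ?_ suppLe_spStar <;> rw [mul_assoc spStar] <;>
      exact suppLe_mul_sx suppLe_spStar_mul_sx ((suppLe_C _).mul (suppLe_C _))
  obtain ⟨F, hF, hF'⟩ := ratio_polynomial sp_dvd_spStar (sfEval_spStar hε)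
    (by rw [mul_assoc, mul_assoc]) hS (hL.sfEval_sc_mul_sq 1 (a := -2 - node j) (-3 - j)
      (by rw [node]; push_cast; ring)) (hL.sfEval_sc_mul_sq 1 (a := -node j) (-1 - j)
      (by rw [node]; push_cast; ring))
  have hs := sfEval_mul_ratio (hε := hε) sp_dvd_spStar (sfEval_spStar hε)
    (hL.sfEval_sc_mul_sq (-1) (a := node j) (j + 1) (by rw [node]; push_cast; ring))
    (hL.sfEval_sc_mul_sq (-1) (a := 2 + node j) (j + 3) (by rw [node]; push_cast; ring))
    (hL.sfEval_sq (a := 1) 1 (by norm_num))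
  refine hL.exchange_k j.succ (hL.e j) (fun γ => by simp only [hL.state_k])
    (fun γ => by simp only [hL.state_k]) hS hF (fun γ => ?_) a b
  rw [hL.state_e]
  have hK := kLaurent_low_succ hε Q Q (Y γ) j
  rw [← zpow_one (Q : Lˣ), zpow_one] at hK
  rw [zpow_one] at hs
  refine polyNeg_mul_eq hε hF' hs hK ?_ ?_ ?_ ?_ <;>
  · rw [eLoc]
    exact Additive.ofMul.injective (by
      simp only [ofMul_mul, ofMul_inv, ofMul_pow, ofMul_zpow, ofMul_div, sub_zsmul, add_zsmul, add_nsmul,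
        natCast_zsmul, neg_zsmul]
      abel)

theorem LevelZero.kf (j : Fin n) (a b : ℤ) : repEval hε φ (exchange uWt uDeg UInv
      (ratio (sp * sq ħ (-node j)) (sp * sq ħ (2 - node j)) sp)
      (sq ħ 1 * ratio (sq ħ (-2 + node j)) (sq ħ (node j)) sp)
      (kCur j.castSucc) (fCur j) (fCur j) (kCur j.castSucc) a b) = 0 := by
  have hS : SuppLe 0 (ratio (sp * sq ħ (-node j)) (sp * sq ħ (2 - node j)) sp) :=
    suppLe_ratio (suppLe_mul_sx suppLe_sp_mul_sx (suppLe_sq _ _))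
      (suppLe_mul_sx suppLe_sp_mul_sx (suppLe_sq _ _)) suppLe_sp
  obtain ⟨F, hF, hF'⟩ := ratio_polynomial dvd_rfl (sfEval_sp hε) rfl hS
    (hL.sfEval_sq (a := -node j) (-1 - j) (by rw [node]; push_cast; ring))
    (hL.sfEval_sq (a := 2 - node j) (1 - j) (by rw [node]; push_cast; ring))
  have hs := sfEval_mul_ratio (hε := hε) dvd_rfl (sfEval_sp hε)
    (hL.sfEval_sq (a := -2 + node j) (j - 1) (by rw [node]; push_cast; ring))
    (hL.sfEval_sq (a := node j) (j + 1) (by rw [node]; push_cast; ring))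
    (hL.sfEval_sq (a := 1) 1 (by norm_num))
  refine hL.exchange_k j.castSucc (hL.f j) (fun γ => by simp only [hL.state_k])
    (fun γ => by simp only [hL.state_k]) hS hF (fun γ => ?_) a b
  rw [hL.state_f]
  have hK := kLaurent_low_self hε Q Q⁻¹ (Y γ) j
  rw [zpow_one] at hs
  rw [inv_inv] at hK
  refine polyNeg_mul_eq hε hF' hs hK ?_ ?_ ?_ ?_ <;>
  · rw [fLoc]
    exact Additive.ofMul.injective (by
      simp only [ofMul_mul, ofMul_inv, ofMul_pow, ofMul_zpow, ofMul_div, sub_zsmul, add_zsmul, add_nsmul,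
        natCast_zsmul, neg_zsmul]
      abel)

theorem LevelZero.kf_succ (j : Fin n) (a b : ℤ) : repEval hε φ (exchange uWt uDeg UInv
      (ratio (sp * sq ħ (-node j)) (sp * sq ħ (-2 - node j)) sp)
      (sq ħ (-1) * ratio (sq ħ (2 + node j)) (sq ħ (node j)) sp)
      (kCur j.succ) (fCur j) (fCur j) (kCur j.succ) a b) = 0 := by
  have hS : SuppLe 0 (ratio (sp * sq ħ (-node j)) (sp * sq ħ (-2 - node j)) sp) :=
    suppLe_ratio (suppLe_mul_sx suppLe_sp_mul_sx (suppLe_sq _ _))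
      (suppLe_mul_sx suppLe_sp_mul_sx (suppLe_sq _ _)) suppLe_sp
  obtain ⟨F, hF, hF'⟩ := ratio_polynomial dvd_rfl (sfEval_sp hε) rfl hS
    (hL.sfEval_sq (a := -node j) (-1 - j) (by rw [node]; push_cast; ring))
    (hL.sfEval_sq (a := -2 - node j) (-3 - j) (by rw [node]; push_cast; ring))
  have hs := sfEval_mul_ratio (hε := hε) dvd_rfl (sfEval_sp hε)
    (hL.sfEval_sq (a := 2 + node j) (j + 3) (by rw [node]; push_cast; ring))
    (hL.sfEval_sq (a := node j) (j + 1) (by rw [node]; push_cast; ring))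
    (hL.sfEval_sq (a := -1) (-1) (by norm_num))
  refine hL.exchange_k j.succ (hL.f j) (fun γ => by simp only [hL.state_k])
    (fun γ => by simp only [hL.state_k]) hS hF (fun γ => ?_) a b
  rw [hL.state_f]
  have hK := kLaurent_low_succ hε Q Q⁻¹ (Y γ) j
  rw [zpow_neg_one] at hs
  refine polyNeg_mul_eq hε hF' hs hK ?_ ?_ ?_ ?_ <;>
  · rw [fLoc]
    exact Additive.ofMul.injective (by
      simp only [ofMul_mul, ofMul_inv, ofMul_pow, ofMul_zpow, ofMul_div, sub_zsmul, add_zsmul, add_nsmul,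
        natCast_zsmul, neg_zsmul]
      abel)

end KCurrents

/-! ### Partial fractions of ratios of theta functions -/

section PartialFractions

open LaurentPolynomial

variable {L : Type*} [CommRing L]

/-- The element `z` of the ring of Laurent series. -/
def zUnit (L : Type*) [CommRing L] : (LaurentSeries L)ˣ where
  val := HahnSeries.single 1 1
  inv := HahnSeries.single (-1) 1
  val_inv := by
    rw [HahnSeries.single_mul_single, mul_one, add_neg_cancel]
    rfl
  inv_val := by
    rw [HahnSeries.single_mul_single, mul_one, neg_add_cancel]
    rfl

theorem zUnit_zpow (k : ℤ) :
    ((zUnit L ^ k : (LaurentSeries L)ˣ) : LaurentSeries L) = HahnSeries.single k 1 := by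
  have h : ∀ m : ℕ, ((zUnit L ^ m : (LaurentSeries L)ˣ) : LaurentSeries L) =
      HahnSeries.single (m : ℤ) 1 := fun m => by
    rw [Units.val_pow_eq_pow_val]
    change (HahnSeries.single (1 : ℤ) (1 : L)) ^ m = _
    rw [HahnSeries.single_pow, one_pow, nsmul_eq_mul, mul_one]
  have h' : ∀ m : ℕ, (((zUnit L)⁻¹ ^ m : (LaurentSeries L)ˣ) : LaurentSeries L) =
      HahnSeries.single (-(m : ℤ)) 1 := fun m => by
    rw [Units.val_pow_eq_pow_val]
    change (HahnSeries.single (-1 : ℤ) (1 : L)) ^ m = _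
    rw [HahnSeries.single_pow, one_pow, nsmul_eq_mul, mul_neg_one]
  obtain ⟨m, rfl | rfl⟩ := k.eq_nat_or_neg
  · rw [zpow_natCast, h]
  · rw [zpow_neg, zpow_natCast, ← inv_pow, h']

/-- Laurent polynomials as Laurent series in the variable. -/
def expandZero : L[T;T⁻¹] →+* LaurentSeries L := eval₂ HahnSeries.C (zUnit L)

/-- Laurent polynomials as Laurent series in the inverse of the variable. -/
def expandInfty : L[T;T⁻¹] →+* LaurentSeries L := eval₂ HahnSeries.C (zUnit L)⁻¹

/-- The value of a Laurent polynomial at a unit. -/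
def evalUnit (x : Lˣ) : L[T;T⁻¹] →+* L := eval₂ (RingHom.id L) x

theorem expandZero_T (k : ℤ) : expandZero (T k : L[T;T⁻¹]) = HahnSeries.single k 1 := by
  rw [expandZero, eval₂_T, zUnit_zpow]

theorem expandInfty_T (k : ℤ) : expandInfty (T k : L[T;T⁻¹]) = HahnSeries.single (-k) 1 := by
  rw [expandInfty, eval₂_T, inv_zpow, ← zpow_neg, zUnit_zpow]

theorem expandZero_C (a : L) : expandZero (C a) = HahnSeries.C a := eval₂_C _ _ a

theorem expandInfty_C (a : L) : expandInfty (C a) = HahnSeries.C a := eval₂_C _ _ a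

theorem evalUnit_C (x : Lˣ) (a : L) : evalUnit x (C a) = a := eval₂_C _ _ a

theorem evalUnit_T (x : Lˣ) (k : ℤ) : evalUnit x (T k) = ((x ^ k : Lˣ) : L) := eval₂_T _ _ k

/-- The Laurent series `1 / (1 - u z)`. -/
def geom (u : L) : LaurentSeries L := HahnSeries.ofPowerSeries ℤ L (PowerSeries.mk fun m => u ^ m)

theorem coeff_geom (u : L) (r : ℤ) : (geom u).coeff r = if 0 ≤ r then u ^ r.toNat else 0 := by
  rw [geom, coeff_ofPowerSeries_int, PowerSeries.coeff_mk]

theorem geom_eq (u : L) : geom u = 1 + HahnSeries.single 1 u * geom u := by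
  ext r
  have h1 : (1 : LaurentSeries L).coeff r = if r = 0 then 1 else 0 := by
    rw [HahnSeries.coeff_one]
    split_ifs <;> rfl
  rw [HahnSeries.coeff_add, mul_comm, coeff_mul_single_sub, h1, coeff_geom, coeff_geom]
  rcases lt_trichotomy r 0 with h | rfl | h
  · rw [if_neg (by omega), if_neg (by omega), if_neg (by omega), zero_mul, zero_add]
  · rw [if_pos le_rfl, if_pos rfl, if_neg (by omega), zero_mul, add_zero, Int.toNat_zero, pow_zero]
  · rw [if_pos (by omega), if_neg (by omega), if_pos (by omega), zero_add, ← pow_succ]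
    congr 1
    omega

theorem mul_geom (u : L) : (1 - HahnSeries.single 1 u) * geom u = 1 := by
  linear_combination geom_eq u

/-- The sum of the expansions of `P(z) / (1 - u z)` at `0` and of `-P(z) / (1 - u z)` at `∞`. -/
theorem coeff_add_coeff (P : L[T;T⁻¹]) (u : Lˣ) (r : ℤ) :
    (expandZero P * geom (u : L)).coeff r +
      (expandInfty P * (HahnSeries.single 1 ((u⁻¹ : Lˣ) : L) * geom ((u⁻¹ : Lˣ) : L))).coeff (-r) =
    ((u ^ r : Lˣ) : L) * evalUnit u⁻¹ P := by
  induction P using LaurentPolynomial.induction_on' with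
  | add p q hp hq =>
    rw [map_add, map_add, map_add, add_mul, add_mul, HahnSeries.coeff_add, HahnSeries.coeff_add,
      mul_add, ← hp, ← hq]
    ring
  | C_mul_T k a =>
    have key : ∀ m : ℤ, 0 ≤ m → ∀ x : Lˣ, (x : L) ^ m.toNat = ((x ^ m : Lˣ) : L) := fun m hm x => by
      rw [← Units.val_pow_eq_pow_val, ← zpow_natCast, Int.toNat_of_nonneg hm]
    rw [map_mul, map_mul, map_mul, expandZero_C, expandInfty_C, expandZero_T, expandInfty_T,
      evalUnit_C, evalUnit_T, HahnSeries.C_apply, HahnSeries.single_mul_single, ← mul_assoc,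
      HahnSeries.single_mul_single, HahnSeries.single_mul_single, mul_comm, coeff_mul_single_sub,
      mul_comm, mul_comm _ (geom _), coeff_mul_single_sub, coeff_geom, coeff_geom]
    rw [inv_zpow, mul_left_comm _ a, ← zpow_neg]
    -- For each exponent exactly one of the two expansions contributes, and either one gives the
    -- same monomial: together they form a delta function.
    by_cases h : k ≤ r
    · rw [if_pos (by omega), if_neg (by omega), key _ (by omega), ← Units.val_mul, ← zpow_add]
      have e : r - (0 + k) = r + -k := by ring
      rw [e]
      ring
    · rw [if_neg (by omega), if_pos (by omega), key _ (by omega), ← Units.val_mul, ← zpow_add,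
        mul_left_comm, ← Units.val_mul, inv_zpow, ← zpow_neg, ← zpow_sub_one]
      have e : -(-r - (0 + -k + 1)) - 1 = r + -k := by ring
      rw [e]
      ring

variable {ε : L} {M : ℕ} (hε : ε ^ M = 0)

theorem T_C_pow_eq_zero (hε : ε ^ M = 0) : (C ε : L[T;T⁻¹]) ^ M = 0 := by
  rw [← map_pow, hε, map_zero]

/-- The unit `(ε a T; ε)_∞ (ε / (a T); ε)_∞`. -/
def gLaurent (a : Lˣ) : (L[T;T⁻¹])ˣ :=
  (isUnit_qprod (T_C_pow_eq_zero hε) (C (a : L) * T 1)).unit *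
    (isUnit_qprod (T_C_pow_eq_zero hε) (C ((a⁻¹ : Lˣ) : L) * T (-1))).unit

theorem coe_gLaurent (a : Lˣ) : (gLaurent hε a : L[T;T⁻¹]) =
    qprod M (C ε) (C ε * (C (a : L) * T 1)) * qprod M (C ε) (C ε * (C ((a⁻¹ : Lˣ) : L) * T (-1))) :=
  rfl

theorem evalUnit_gLaurent (x a : Lˣ) :
    evalUnit x (gLaurent hε a : L[T;T⁻¹]) = (gTheta hε (a * x) : L) := by
  rw [coe_gLaurent, map_mul, map_qprod, map_qprod, gTheta, Units.val_mul, coe_gPoch, coe_gPoch]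
  simp only [map_mul, evalUnit_C, evalUnit_T, zpow_one, mul_inv, zpow_neg, Units.val_mul]

theorem evalNeg_gSeries (u : L) : evalNeg hε (qprod M (PowerSeries.C ε)
    (PowerSeries.C u * PowerSeries.X)) =
    qprod M (HahnSeries.C ε) (HahnSeries.C ε * (HahnSeries.C u * HahnSeries.single (-1) 1)) := by
  have e : (HahnSeries.single (-1) ε : LaurentSeries L) =
      HahnSeries.C ε * HahnSeries.single (-1) 1 := by
    rw [HahnSeries.C_apply, HahnSeries.single_mul_single, zero_add, mul_one]
  rw [map_qprod, map_mul, evalNeg_C, evalNeg_C, evalNeg_X, e, mul_left_comm]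

theorem thetaLaurent_eq (u : Lˣ) : thetaLaurent hε u =
    (1 - HahnSeries.single 1 (u : L)) *
      (qprod M (HahnSeries.C ε) (HahnSeries.C ε * (HahnSeries.C (u : L) * HahnSeries.single 1 1)) *
        qprod M (HahnSeries.C ε)
          (HahnSeries.C ε * (HahnSeries.C ((u⁻¹ : Lˣ) : L) * HahnSeries.single (-1) 1))) := by
  have e : (HahnSeries.single 1 (u : L) : LaurentSeries L) =
      HahnSeries.C (u : L) * HahnSeries.single 1 1 := by
    rw [HahnSeries.C_apply, HahnSeries.single_mul_single, zero_add, mul_one]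
  have hC : (HahnSeries.C ε : LaurentSeries L) ^ M = 0 := by rw [← map_pow, hε, map_zero]
  rw [thetaLaurent, pairLaurent, gSeries, gSeries, evalNeg_gSeries, map_qprod, map_mul,
    HahnSeries.ofPowerSeries_C, HahnSeries.ofPowerSeries_C, HahnSeries.ofPowerSeries_X,
    qprod_eq hC, ← e, mul_assoc]

theorem expandZero_gLaurent (u : Lˣ) : thetaLaurent hε u =
    (1 - HahnSeries.single 1 (u : L)) * expandZero (gLaurent hε u : L[T;T⁻¹]) := by
  rw [thetaLaurent_eq, coe_gLaurent, map_mul, map_qprod, map_qprod]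
  simp only [map_mul, expandZero_C, expandZero_T]

/-- Passing to the inverse variable exchanges the two invertible halves of a theta function. The
same unit therefore serves at zero and infinity, and only the elementary factor changes. -/
theorem expandInfty_gLaurent (u : Lˣ) : thetaLaurent hε u⁻¹ =
    (1 - HahnSeries.single 1 ((u⁻¹ : Lˣ) : L)) * expandInfty (gLaurent hε u : L[T;T⁻¹]) := by
  rw [thetaLaurent_eq, coe_gLaurent, map_mul, map_qprod, map_qprod]
  simp only [map_mul, expandInfty_C, expandInfty_T, inv_inv, neg_neg]
  ring

/-- The difference of the expansions of `C θ(c z) θ(c' z) / (θ(s z) θ(Q² s z))` at `0` and `∞`. -/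
theorem theta_partial_fractions {Ψ Ψ' : LaurentSeries L} (Q s c c' μ : Lˣ) (C₁ : L)
    (hμ : μ * (Q ^ 2 * s ^ 2) = c * c')
    (hΨ : Ψ * (thetaLaurent hε s * thetaLaurent hε (Q ^ 2 * s)) =
      HahnSeries.C C₁ * (thetaLaurent hε c * thetaLaurent hε c'))
    (hΨ' : Ψ' * (thetaLaurent hε s⁻¹ * thetaLaurent hε (Q ^ 2 * s)⁻¹) =
      HahnSeries.C C₁ * (thetaLaurent hε c⁻¹ * thetaLaurent hε c'⁻¹)) (r : ℤ) :
    (1 - (Q : L) ^ 2) * ((μ : L) * Ψ'.coeff (-r) - Ψ.coeff r) *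
        ((gTheta hε 1 : L) * (gTheta hε (Q ^ 2) : L)) =
      C₁ * ((Q : L) ^ 2 * ((((Q ^ 2 * s) ^ r : Lˣ) : L) *
          (thetaU hε (c / (Q ^ 2 * s)) * thetaU hε (c' / (Q ^ 2 * s)))) -
        ((s ^ r : Lˣ) : L) * (thetaU hε (c / s) * thetaU hε (c' / s))) := by
  obtain ⟨u, hu⟩ : ∃ u, u = Q ^ 2 * s := ⟨_, rfl⟩
  rw [← hu] at hΨ hΨ' ⊢
  -- Since `ε` is nilpotent, the invertible parts of all four theta functions are Laurent
  -- polynomials. They are collected in `P`, so that only `(1 - s z)(1 - u z)` is left in the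
  -- denominator.
  obtain ⟨P, hP⟩ : ∃ P : L[T;T⁻¹], P = C C₁ * ((1 - C (c : L) * T 1) * (1 - C (c' : L) * T 1)) *
    ((gLaurent hε c * gLaurent hε c' * (gLaurent hε s * gLaurent hε u)⁻¹ : (L[T;T⁻¹])ˣ) :
      L[T;T⁻¹]) := ⟨_, rfl⟩
  have hP' : P * ((gLaurent hε s : L[T;T⁻¹]) * (gLaurent hε u : L[T;T⁻¹])) =
      C C₁ * ((1 - C (c : L) * T 1) * (1 - C (c' : L) * T 1)) *
        ((gLaurent hε c : L[T;T⁻¹]) * (gLaurent hε c' : L[T;T⁻¹])) := by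
    rw [hP, mul_assoc, ← Units.val_mul, ← Units.val_mul, ← Units.val_mul, inv_mul_cancel_right]
  have hs1 : ∀ a : L, (HahnSeries.single 1 a : LaurentSeries L) =
      HahnSeries.C a * HahnSeries.single 1 1 := fun a => by
    rw [HahnSeries.C_apply, HahnSeries.single_mul_single, zero_add, mul_one]
  have hval : ∀ x : Lˣ, evalUnit x P * ((gTheta hε (s * x) : L) * (gTheta hε (u * x) : L)) =
      C₁ * (thetaU hε (c * x) * thetaU hε (c' * x)) := fun x => by
    have h := congrArg (evalUnit x) hP'
    simp only [map_mul, map_sub, map_one, evalUnit_C, evalUnit_T, evalUnit_gLaurent, zpow_one] at h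
    rw [h, thetaU, thetaU, Units.val_mul, Units.val_mul]
    ring
  have h0 : Ψ * ((1 - HahnSeries.single 1 (s : L)) * (1 - HahnSeries.single 1 (u : L))) =
      expandZero P := by
    have h := congrArg expandZero hP'
    simp only [map_mul, map_sub, map_one, expandZero_C, expandZero_T] at h
    simp only [expandZero_gLaurent] at hΨ
    refine ((gLaurent hε s * gLaurent hε u).isUnit.map (expandZero (L := L))).mul_right_cancel ?_
    rw [Units.val_mul, map_mul]
    rw [hs1 c, hs1 c'] at hΨ
    linear_combination hΨ - h
  have hinf : Ψ' * ((1 - HahnSeries.single 1 ((s⁻¹ : Lˣ) : L)) *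
        (1 - HahnSeries.single 1 ((u⁻¹ : Lˣ) : L))) =
      HahnSeries.single 2 (((c⁻¹ * c'⁻¹ : Lˣ)) : L) * expandInfty P := by
    have h := congrArg expandInfty hP'
    simp only [map_mul, map_sub, map_one, expandInfty_C, expandInfty_T] at h
    simp only [expandInfty_gLaurent] at hΨ'
    refine ((gLaurent hε s * gLaurent hε u).isUnit.map (expandInfty (L := L))).mul_right_cancel ?_
    rw [Units.val_mul, map_mul]
    have hx : ∀ x : Lˣ, (HahnSeries.single 1 ((x⁻¹ : Lˣ) : L) : LaurentSeries L) *
        (1 - HahnSeries.C (x : L) * HahnSeries.single (-1) 1) =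
        -(1 - HahnSeries.single 1 ((x⁻¹ : Lˣ) : L) : LaurentSeries L) := fun x => by
      rw [mul_sub, HahnSeries.C_apply, HahnSeries.single_mul_single, HahnSeries.single_mul_single,
        mul_one, mul_one, Units.inv_mul, zero_add, add_neg_cancel, neg_sub]
      rfl
    have h2 : (HahnSeries.single 2 (((c⁻¹ * c'⁻¹ : Lˣ)) : L) : LaurentSeries L) =
        HahnSeries.single 1 ((c⁻¹ : Lˣ) : L) * HahnSeries.single 1 ((c'⁻¹ : Lˣ) : L) := by
      rw [HahnSeries.single_mul_single, Units.val_mul]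
      rfl
    rw [h2]
    have hc := hx c
    have hc' := hx c'
    linear_combination hΨ' - HahnSeries.single 1 ((c⁻¹ : Lˣ) : L) *
      HahnSeries.single 1 ((c'⁻¹ : Lˣ) : L) * h +
      HahnSeries.C C₁ * expandInfty (gLaurent hε c : L[T;T⁻¹]) *
        expandInfty (gLaurent hε c' : L[T;T⁻¹]) *
        ((1 - HahnSeries.single 1 ((c⁻¹ : Lˣ) : L)) * hc' -
          HahnSeries.single 1 ((c'⁻¹ : Lˣ) : L) *
            (1 - HahnSeries.C (c' : L) * HahnSeries.single (-1) 1) * hc)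
  have hcC : ∀ (a : L) (F : LaurentSeries L) (k : ℤ), (HahnSeries.C a * F).coeff k =
      a * F.coeff k := fun a F k => by
    rw [HahnSeries.C_apply, mul_comm, coeff_mul_single_sub, sub_zero, mul_comm]
  -- With `x = s z` this is `(1 - Q²) / ((1 - x)(1 - Q² x)) = 1 / (1 - x) - Q² / (1 - Q² x)`.
  have hzero : HahnSeries.C (1 - (Q : L) ^ 2) * Ψ = expandZero P * geom (s : L) -
      HahnSeries.C ((Q : L) ^ 2) * (expandZero P * geom (u : L)) := by
    have g1 := mul_geom (s : L)
    have g2 := mul_geom (u : L)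
    have e : (HahnSeries.single 1 (u : L) : LaurentSeries L) =
        HahnSeries.C ((Q : L) ^ 2) * HahnSeries.single 1 (s : L) := by
      rw [HahnSeries.C_apply, HahnSeries.single_mul_single, zero_add, hu, Units.val_mul,
        Units.val_pow_eq_pow_val]
    rw [← h0, map_sub, map_one]
    rw [e] at g2 ⊢
    generalize (HahnSeries.single 1 (s : L) : LaurentSeries L) = x at *
    generalize (HahnSeries.C ((Q : L) ^ 2) : LaurentSeries L) = y at *
    generalize geom (s : L) = g at *
    generalize geom (u : L) = g' at *
    linear_combination (-Ψ * (1 - y * x)) * g1 + y * Ψ * (1 - x) * g2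
  -- The same partial fractions at infinity. Rewriting the four elementary factors in the inverse
  -- variable creates a monomial, which `hμ` absorbs into `μ`.
  have hinfty : HahnSeries.C (1 - (Q : L) ^ 2) * (HahnSeries.C (μ : L) * Ψ') =
      HahnSeries.C ((Q : L) ^ 2) * (expandInfty P *
        (HahnSeries.single 1 ((u⁻¹ : Lˣ) : L) * geom ((u⁻¹ : Lˣ) : L))) -
      expandInfty P * (HahnSeries.single 1 ((s⁻¹ : Lˣ) : L) * geom ((s⁻¹ : Lˣ) : L)) := by
    have g1 := mul_geom ((s⁻¹ : Lˣ) : L)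
    have g2 := mul_geom ((u⁻¹ : Lˣ) : L)
    have e : (HahnSeries.single 1 ((s⁻¹ : Lˣ) : L) : LaurentSeries L) =
        HahnSeries.C ((Q : L) ^ 2) * HahnSeries.single 1 ((u⁻¹ : Lˣ) : L) := by
      rw [HahnSeries.C_apply, HahnSeries.single_mul_single, zero_add, hu,
        ← Units.val_pow_eq_pow_val, ← Units.val_mul, mul_inv, mul_inv_cancel_left]
    have e2 : HahnSeries.C (μ : L) * (HahnSeries.single 2 (((c⁻¹ * c'⁻¹ : Lˣ)) : L)) =
        (HahnSeries.single 1 ((s⁻¹ : Lˣ) : L) * HahnSeries.single 1 ((u⁻¹ : Lˣ) : L) :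
          LaurentSeries L) := by
      rw [HahnSeries.C_apply, HahnSeries.single_mul_single, HahnSeries.single_mul_single,
        zero_add, ← Units.val_mul, ← Units.val_mul, ← mul_inv, ← hμ, hu, mul_inv,
        mul_inv_cancel_left]
      congr 2
      rw [← mul_inv, pow_two s, mul_left_comm]
    have h3 := congrArg (HahnSeries.C (μ : L) * ·) hinf
    simp only [← mul_assoc (HahnSeries.C (μ : L)), e2] at h3
    rw [map_sub, map_one]
    rw [e] at g1 h3 ⊢
    generalize (HahnSeries.single 1 ((u⁻¹ : Lˣ) : L) : LaurentSeries L) = x at *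
    generalize (HahnSeries.C ((Q : L) ^ 2) : LaurentSeries L) = y at *
    generalize geom ((s⁻¹ : Lˣ) : L) = g at *
    generalize geom ((u⁻¹ : Lˣ) : L) = g' at *
    generalize expandInfty P = p at *
    generalize HahnSeries.C (μ : L) * Ψ' = F at *
    have key : F = y * x * x * p * g * g' := by
      linear_combination g * g' * h3 - F * (1 - x) * g' * g1 - F * g2
    rw [key]
    linear_combination y * x * p * g' * g1 - y * x * p * g * g2
  have z1 := congrArg (fun F : LaurentSeries L => F.coeff r) hzero
  have z2 := congrArg (fun F : LaurentSeries L => F.coeff (-r)) hinfty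
  simp only [HahnSeries.coeff_sub, hcC] at z1 z2
  -- At each pole the two expansions join to a complete delta function and `P` is replaced by its
  -- value there, at `s⁻¹` or `u⁻¹`.
  have c1 := coeff_add_coeff P s r
  have c2 := coeff_add_coeff P u r
  have v1 := hval s⁻¹
  have v2 := hval u⁻¹
  have w1 : u * s⁻¹ = Q ^ 2 := by rw [hu, mul_inv_cancel_right]
  have w2 : gTheta hε (s * u⁻¹) = gTheta hε (Q ^ 2) := by
    rw [← w1, gTheta, gTheta, mul_comm, mul_inv, mul_inv, inv_inv, inv_inv, mul_comm u⁻¹ s, mul_comm s⁻¹ u]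
  rw [mul_inv_cancel, w1] at v1
  rw [mul_inv_cancel, w2] at v2
  rw [div_eq_mul_inv, div_eq_mul_inv, div_eq_mul_inv, div_eq_mul_inv]
  linear_combination ((gTheta hε 1 : L) * (gTheta hε (Q ^ 2) : L)) *
    (z2 - z1 - c1 + (Q : L) ^ 2 * c2) - ((s ^ r : Lˣ) : L) * v1 +
    (Q : L) ^ 2 * ((u ^ r : Lˣ) : L) * v2

end PartialFractions

/-! ### The series `k_j(z) k_{j+1}(z)⁻¹` -/

section PairSeries

variable {L : Type*} [CommRing L] {ε : L} {M : ℕ} (hε : ε ^ M = 0)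

/-- Evaluation of a power series in `X u` and `X v` at `X u = z`, `X v = ε / z`. -/
def laurentEval {u v : Fin 2} (huv : u ≠ v) : MvPowerSeries (Fin 2) L →+* LaurentSeries L :=
  (truncEval (HahnSeries.ofPowerSeries ℤ L) (HahnSeries.single (-1) ε) (fun _ => Commute.all _ _) M
    (single_pow_eq_zero hε)).comp (iterHom L huv)

theorem coeff_laurentEval {u v : Fin 2} (huv : u ≠ v) (F : MvPowerSeries (Fin 2) L) (r : ℤ) :
    (laurentEval hε huv F).coeff r = ∑ k ∈ Finset.range M, if 0 ≤ r + k then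
      MvPowerSeries.coeff (Finsupp.single u (r + k).toNat + Finsupp.single v k) F * ε ^ k else 0 := by
  rw [laurentEval, RingHom.comp_apply, truncEval_apply, HahnSeries.coeff_sum]
  refine Finset.sum_congr rfl fun k _ => ?_
  have h : r - k • (-1 : ℤ) = r + k := by
    rw [nsmul_eq_mul, mul_neg_one, sub_neg_eq_add]
  rw [HahnSeries.single_pow, coeff_mul_single_sub, coeff_ofPowerSeries_int, h]
  split_ifs
  · rw [coeff_coeff_iterHom]
  · rw [zero_mul]

/-- The reduction of `f(X 0) g(X 1)` modulo `X 0 X 1 = ε`. -/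
def pairMv (n : ℕ) (ε : L) (f g : PowerSeries L) : MvPowerSeries (Fin 2) L := fun d =>
  if d 1 = 0 then ∑ k ∈ Finset.range n,
    PowerSeries.coeff (d 0 + k) f * PowerSeries.coeff k g * ε ^ k
  else if d 0 = 0 then ∑ k ∈ Finset.range n,
    PowerSeries.coeff k f * PowerSeries.coeff (d 1 + k) g * ε ^ k
  else 0

/-- Without mixed monomials a Laurent coefficient is carried by a single pure monomial. The
hypotheses say that this monomial already contains the whole sum over powers of `X 0 X 1 = ε`. -/
theorem laurentEval_eq_pairLaurent {u v : Fin 2} (huv : u ≠ v) {F : MvPowerSeries (Fin 2) L}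
    {f g : PowerSeries L}
    (h₁ : ∀ a, MvPowerSeries.coeff (Finsupp.single u a + Finsupp.single v 0) F =
      ∑ k ∈ Finset.range M, PowerSeries.coeff (a + k) f * PowerSeries.coeff k g * ε ^ k)
    (h₂ : ∀ b, MvPowerSeries.coeff (Finsupp.single u 0 + Finsupp.single v (b + 1)) F =
      ∑ k ∈ Finset.range M, PowerSeries.coeff k f * PowerSeries.coeff (b + 1 + k) g * ε ^ k)
    (h₃ : ∀ a b, MvPowerSeries.coeff (Finsupp.single u (a + 1) + Finsupp.single v (b + 1)) F = 0) :
    laurentEval hε huv F = pairLaurent hε f g := by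
  have hz : ∀ m, M ≤ m → ε ^ m = 0 := fun m hm => by
    rw [← Nat.sub_add_cancel hm, pow_add, hε, mul_zero]
  ext r
  rw [coeff_laurentEval, coeff_pairLaurent, pairCoeff]
  rcases Nat.eq_zero_or_pos M with rfl | hM
  · rw [Finset.range_zero, Finset.sum_empty, Finset.sum_empty]
  obtain ⟨m, rfl | rfl⟩ := r.eq_nat_or_neg
  · rw [Finset.sum_eq_single 0]
    · rw [if_pos (by omega), Nat.cast_zero, add_zero, Int.toNat_natCast, h₁, pow_zero, mul_one]
      refine Finset.sum_congr rfl fun k _ => ?_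
      rw [if_pos (by omega), ← Nat.cast_add, Int.toNat_natCast]
    · intro k _ hk
      obtain ⟨b, rfl⟩ := Nat.exists_eq_succ_of_ne_zero hk
      have e : ((m : ℤ) + (b + 1 : ℕ)).toNat = m + b + 1 := by omega
      rw [if_pos (by omega), Nat.succ_eq_add_one, e, h₃, zero_mul]
    · intro h
      exact absurd (Finset.mem_range.mpr hM) h
  · rcases m with _ | b
    · rw [Finset.sum_eq_single 0]
      · rw [if_pos (by omega), Nat.cast_zero, add_zero, neg_zero, Int.toNat_zero, h₁, pow_zero,
          mul_one]
        refine Finset.sum_congr rfl fun k _ => ?_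
        rw [if_pos (by omega), zero_add, zero_add, Int.toNat_natCast]
      · intro k _ hk
        obtain ⟨b, rfl⟩ := Nat.exists_eq_succ_of_ne_zero hk
        have e : (-((0 : ℕ) : ℤ) + (b + 1 : ℕ)).toNat = b + 1 := by omega
        rw [if_pos (by omega), Nat.succ_eq_add_one, e, h₃, zero_mul]
      · intro h
        exact absurd (Finset.mem_range.mpr hM) h
    have e₁ : ∑ k ∈ Finset.range M, (if 0 ≤ -((b + 1 : ℕ) : ℤ) + k then
        MvPowerSeries.coeff (Finsupp.single u (-((b + 1 : ℕ) : ℤ) + k).toNat +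
          Finsupp.single v k) F * ε ^ k else 0) =
        MvPowerSeries.coeff (Finsupp.single u 0 + Finsupp.single v (b + 1)) F * ε ^ (b + 1) := by
      rw [Finset.sum_eq_single (b + 1)]
      · rw [if_pos (by omega), neg_add_cancel, Int.toNat_zero]
      · intro k _ hk
        split_ifs with h
        · obtain ⟨c, rfl⟩ : ∃ c, k = b + 1 + (c + 1) := ⟨k - (b + 2), by omega⟩
          have e : (-((b + 1 : ℕ) : ℤ) + (b + 1 + (c + 1) : ℕ)).toNat = c + 1 := by omega
          rw [e, ← add_assoc, h₃, zero_mul]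
        · rfl
      · intro h
        rw [Finset.mem_range, not_lt] at h
        rw [hz _ h, mul_zero, ite_self]
    -- For the exponent `-(b + 1)` the sum is prolonged by terms with `ε ^ k = 0`, which leaves room
    -- for shifting the index by `b + 1`.
    have e₂ : ∑ k ∈ Finset.range M, (if 0 ≤ -((b + 1 : ℕ) : ℤ) + k then
        PowerSeries.coeff (-((b + 1 : ℕ) : ℤ) + k).toNat f * PowerSeries.coeff k g * ε ^ k else 0) =
        ∑ k ∈ Finset.range (b + 1 + M), (if 0 ≤ -((b + 1 : ℕ) : ℤ) + k then
        PowerSeries.coeff (-((b + 1 : ℕ) : ℤ) + k).toNat f * PowerSeries.coeff k g * ε ^ k else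
          0) := by
      refine Finset.sum_subset (Finset.range_mono (by omega)) fun k _ hk => ?_
      rw [Finset.mem_range, not_lt] at hk
      rw [hz _ hk, mul_zero, ite_self]
    rw [e₁, e₂, h₂, Finset.sum_range_add,
      Finset.sum_eq_zero (s := Finset.range (b + 1)), zero_add, Finset.sum_mul]
    · refine Finset.sum_congr rfl fun k _ => ?_
      have e : (-((b + 1 : ℕ) : ℤ) + (b + 1 + k : ℕ)).toNat = k := by omega
      rw [if_pos (by omega), e, pow_add]
      ring
    · intro k hk
      rw [Finset.mem_range] at hk
      rw [if_neg (by omega)]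

theorem laurentEval_pairMv (f g : PowerSeries L) :
    laurentEval hε (u := 0) (v := 1) (by decide) (pairMv M ε f g) = pairLaurent hε f g := by
  refine laurentEval_eq_pairLaurent hε _ (fun a => ?_) (fun b => ?_) fun a b => ?_ <;>
  · change pairMv M ε f g _ = _
    simp [pairMv]

/-- Exchanging the variables exchanges the halves in `z` and `ε / z`; in this form the series enters
`k⁻`. -/
theorem laurentEval_pairMv_swap (f g : PowerSeries L) :
    laurentEval hε (u := 1) (v := 0) (by decide) (pairMv M ε f g) = pairLaurent hε g f := by
  refine laurentEval_eq_pairLaurent hε _ (fun a => ?_) (fun b => ?_) fun a b => ?_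
  · change pairMv M ε f g _ = _
    rcases a with _ | a <;> simp [pairMv, mul_comm]
  · change pairMv M ε f g _ = _
    simp [pairMv, mul_comm]
  · change pairMv M ε f g _ = _
    simp [pairMv]

theorem isUnit_sum_pow {c : ℕ → L} (h : IsUnit (c 0)) (hε : ε ^ M = 0) :
    IsUnit (∑ k ∈ Finset.range M, c k * ε ^ k) := by
  rcases M with _ | M
  · have := subsingleton_of_zero_eq_one (show (0 : L) = 1 by rw [← hε, pow_zero])
    exact isUnit_of_subsingleton _
  · rw [Finset.sum_range_succ', pow_zero, mul_one]
    refine IsNilpotent.isUnit_add_right_of_commute ?_ h (Commute.all _ _)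
    have e : ∑ k ∈ Finset.range M, c (k + 1) * ε ^ (k + 1) =
        ε * ∑ k ∈ Finset.range M, c (k + 1) * ε ^ k := by
      rw [Finset.mul_sum]
      exact Finset.sum_congr rfl fun k _ => by ring
    rw [e]
    exact (Commute.all _ _).isNilpotent_mul_right ⟨_, hε⟩

variable (Q : Lˣ) (Y : ℕ → Lˣ) (l : ℕ)

/-- The eigenvalue of `k_l` as a power series in `z` and `p / z`. -/
def kMv (n : ℕ) (ε : L) : MvPowerSeries (Fin 2) L := pairMv n ε (kPos Q Y n ε l) (kNeg Q Y n ε l)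

theorem constantCoeff_gSeries (u : Lˣ) : PowerSeries.constantCoeff (gSeries M ε u) = 1 := by
  rw [gSeries, qprod, map_prod]
  exact Finset.prod_eq_one fun i _ => by simp

/-- The sum is `Y_l⁻¹` plus a nilpotent. This is what makes `k_{l,0}` act invertibly. -/
theorem isUnit_coeff_kMv (hε : ε ^ M = 0) :
    IsUnit (∑ k ∈ Finset.range M, PowerSeries.coeff k (kPos Q Y M ε l) *
      PowerSeries.coeff k (kNeg Q Y M ε l) * ε ^ k) := by
  refine isUnit_sum_pow (c := fun k => PowerSeries.coeff k (kPos Q Y M ε l) *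
      PowerSeries.coeff k (kNeg Q Y M ε l)) ?_ hε
  have h1 := congrArg PowerSeries.constantCoeff (kPos_mul (ε := ε) (M := M) Q Y l)
  have h2 := congrArg PowerSeries.constantCoeff (kNeg_mul (ε := ε) (M := M) Q Y l)
  simp only [map_mul, constantCoeff_gSeries, mul_one, PowerSeries.constantCoeff_C] at h1 h2
  rw [PowerSeries.coeff_zero_eq_constantCoeff_apply, PowerSeries.coeff_zero_eq_constantCoeff_apply,
    h1, h2, mul_one]
  exact Units.isUnit _

theorem isUnit_kMv (hε : ε ^ M = 0) : IsUnit (kMv Q Y l M ε) := by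
  rw [MvPowerSeries.isUnit_iff_constantCoeff, ← MvPowerSeries.coeff_zero_eq_constantCoeff_apply]
  have h := isUnit_coeff_kMv Q Y l hε
  change IsUnit (kMv Q Y l M ε 0)
  simpa [kMv, pairMv] using h

/-- The ratio of the eigenvalues of `k_j` and `k_{j+1}`. -/
def psiMv (n : ℕ) (ε : L) : MvPowerSeries (Fin 2) L :=
  kMv Q Y l n ε * Ring.inverse (kMv Q Y (l + 1) n ε)

theorem psiMv_mul (hε : ε ^ M = 0) : psiMv Q Y l M ε * kMv Q Y (l + 1) M ε = kMv Q Y l M ε := by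
  rw [psiMv, mul_assoc, Ring.inverse_mul_cancel _ (isUnit_kMv Q Y (l + 1) hε), mul_one]

/-- The partial product `l + 1` stands in the denominator of the eigenvalue of `k_l` and in the
numerator of that of `k_{l+1}`. The quotient thus has two theta denominators with arguments of ratio
`Q²`, the situation of `theta_partial_fractions`. -/
theorem laurentEval_psiMv : laurentEval hε (u := 0) (v := 1) (by decide) (psiMv Q Y l M ε) *
      (thetaLaurent hε (Q ^ (l + 1) / wState Q Y (l + 1)) *
        thetaLaurent hε (Q ^ 2 * (Q ^ (l + 1) / wState Q Y (l + 1)))) =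
      HahnSeries.C (Y (l + 1) * (((Y l)⁻¹ : Lˣ) : L)) *
        (thetaLaurent hε (Q ^ (l + 2) / wState Q Y l) *
          thetaLaurent hε (Q ^ (l + 2) / wState Q Y (l + 2))) := by
  have h0 := congrArg (laurentEval hε (u := 0) (v := 1) (by decide)) (psiMv_mul Q Y l hε)
  rw [map_mul, kMv, kMv, laurentEval_pairMv, laurentEval_pairMv] at h0
  have h1 := kLaurent_mul hε Q Y l
  have h2 := kLaurent_mul hε Q Y (l + 1)
  rw [kLaurent] at h1 h2
  have e : Q ^ 2 * (Q ^ (l + 1) / wState Q Y (l + 1)) = Q ^ (l + 1 + 2) / wState Q Y (l + 1) :=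
    Additive.ofMul.injective (by
      simp only [ofMul_mul, ofMul_pow, ofMul_div, add_nsmul]
      abel)
  have hC : (HahnSeries.C ((Y (l + 1) : Lˣ) : L) : LaurentSeries L) *
      HahnSeries.C (((Y (l + 1))⁻¹ : Lˣ) : L) = 1 := by
    rw [← map_mul, Units.mul_inv, map_one]
  rw [e, map_mul]
  linear_combination (-laurentEval hε (u := 0) (v := 1) (by decide) (psiMv Q Y l M ε) *
      thetaLaurent hε (Q ^ (l + 1) / wState Q Y (l + 1)) *
      thetaLaurent hε (Q ^ (l + 1 + 2) / wState Q Y (l + 1))) * hC -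
    HahnSeries.C ((Y (l + 1) : Lˣ) : L) * laurentEval hε (u := 0) (v := 1) (by decide)
      (psiMv Q Y l M ε) * thetaLaurent hε (Q ^ (l + 1) / wState Q Y (l + 1)) * h2 +
    HahnSeries.C ((Y (l + 1) : Lˣ) : L) * thetaLaurent hε (Q ^ (l + 1) / wState Q Y (l + 1)) *
      thetaLaurent hε (Q ^ (l + 1 + 1) / wState Q Y (l + 1 + 1)) * h0 +
    HahnSeries.C ((Y (l + 1) : Lˣ) : L) *
      thetaLaurent hε (Q ^ (l + 1 + 1) / wState Q Y (l + 1 + 1)) * h1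

theorem kLaurent_swap_mul : pairLaurent hε (kNeg Q Y M ε l) (kPos Q Y M ε l) *
      thetaLaurent hε (Q ^ (l + 1) / wState Q Y (l + 1))⁻¹ =
    HahnSeries.C (((Y l)⁻¹ : Lˣ) : L) * thetaLaurent hε (Q ^ (l + 2) / wState Q Y l)⁻¹ := by
  rw [thetaLaurent, pairLaurent_mul, inv_inv, kPos_mul, kNeg_mul, pairLaurent, thetaLaurent,
    pairLaurent, map_mul, evalNeg_C, inv_inv, mul_left_comm]

theorem laurentEval_psiMv_swap : laurentEval hε (u := 1) (v := 0) (by decide) (psiMv Q Y l M ε) *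
      (thetaLaurent hε (Q ^ (l + 1) / wState Q Y (l + 1))⁻¹ *
        thetaLaurent hε (Q ^ 2 * (Q ^ (l + 1) / wState Q Y (l + 1)))⁻¹) =
      HahnSeries.C (Y (l + 1) * (((Y l)⁻¹ : Lˣ) : L)) *
        (thetaLaurent hε (Q ^ (l + 2) / wState Q Y l)⁻¹ *
          thetaLaurent hε (Q ^ (l + 2) / wState Q Y (l + 2))⁻¹) := by
  have h0 := congrArg (laurentEval hε (u := 1) (v := 0) (by decide)) (psiMv_mul Q Y l hε)
  rw [map_mul, kMv, kMv, laurentEval_pairMv_swap, laurentEval_pairMv_swap] at h0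
  have h1 := kLaurent_swap_mul hε Q Y l
  have h2 := kLaurent_swap_mul hε Q Y (l + 1)
  have e : Q ^ 2 * (Q ^ (l + 1) / wState Q Y (l + 1)) = Q ^ (l + 1 + 2) / wState Q Y (l + 1) :=
    Additive.ofMul.injective (by
      simp only [ofMul_mul, ofMul_pow, ofMul_div, add_nsmul]
      abel)
  have hC : (HahnSeries.C ((Y (l + 1) : Lˣ) : L) : LaurentSeries L) *
      HahnSeries.C (((Y (l + 1))⁻¹ : Lˣ) : L) = 1 := by
    rw [← map_mul, Units.mul_inv, map_one]
  rw [e, map_mul]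
  linear_combination (-laurentEval hε (u := 1) (v := 0) (by decide) (psiMv Q Y l M ε) *
      thetaLaurent hε (Q ^ (l + 1) / wState Q Y (l + 1))⁻¹ *
      thetaLaurent hε (Q ^ (l + 1 + 2) / wState Q Y (l + 1))⁻¹) * hC -
    HahnSeries.C ((Y (l + 1) : Lˣ) : L) * laurentEval hε (u := 1) (v := 0) (by decide)
      (psiMv Q Y l M ε) * thetaLaurent hε (Q ^ (l + 1) / wState Q Y (l + 1))⁻¹ * h2 +
    HahnSeries.C ((Y (l + 1) : Lˣ) : L) * thetaLaurent hε (Q ^ (l + 1) / wState Q Y (l + 1))⁻¹ *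
      thetaLaurent hε (Q ^ (l + 1 + 1) / wState Q Y (l + 1 + 1))⁻¹ * h0 +
    HahnSeries.C ((Y (l + 1) : Lˣ) : L) *
      thetaLaurent hε (Q ^ (l + 1 + 1) / wState Q Y (l + 1 + 1))⁻¹ * h1

end PairSeries

/-! ### Two-variable series of weighted shift operators. -/

section OpSeries

variable {W L : Type*} [AddCommGroup W] [CommRing L]

/-- The series whose coefficient at `d` acts by the coefficient of `κ` and by a shift. -/
def opMv (κ : W → MvPowerSeries (Fin 2) L) (w : W) :
    MvPowerSeries (Fin 2) (Module.End L (W × ℤ → L)) := fun d =>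
  op (fun γ => MvPowerSeries.coeff d (κ γ)) w ((d 1 : ℤ) - d 0)

theorem coeff_opMv (κ : W → MvPowerSeries (Fin 2) L) (w : W) (d : Fin 2 →₀ ℕ) :
    MvPowerSeries.coeff d (opMv κ w) =
      op (fun γ => MvPowerSeries.coeff d (κ γ)) w ((d 1 : ℤ) - d 0) := rfl

theorem opMv_mul (κ κ' : W → MvPowerSeries (Fin 2) L) (w w' : W) :
    opMv κ w * opMv κ' w' = opMv (fun γ => κ γ * κ' (γ - w)) (w + w') := by
  classical
  ext1 d
  rw [MvPowerSeries.coeff_mul, coeff_opMv]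
  simp only [MvPowerSeries.coeff_mul]
  rw [← op_sum]
  refine Finset.sum_congr rfl fun p hp => ?_
  have hp' : p.1 + p.2 = d := Finset.HasAntidiagonal.mem_antidiagonal.mp hp
  have h0 := DFunLike.congr_fun hp' 0
  have h1 := DFunLike.congr_fun hp' 1
  simp only [Finsupp.add_apply] at h0 h1
  rw [coeff_opMv, coeff_opMv, op_mul_op]
  exact op_congr (fun _ => rfl) rfl (by omega)

theorem opMv_one : opMv (fun _ => (1 : MvPowerSeries (Fin 2) L)) (0 : W) = 1 := by
  classical
  ext1 d
  rw [coeff_opMv, MvPowerSeries.coeff_one]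
  simp only [MvPowerSeries.coeff_one]
  split_ifs with h
  · rw [h, one_eq_op]
    rfl
  · exact op_zero _ _

end OpSeries

/-! ### Laurent coefficients of operator series. -/

section RepSeries

variable {n : ℕ} {L : Type*} [CommRing L] [Algebra ℂ L] {ε : L} {M : ℕ} (hε : ε ^ M = 0)
  (φ : UDyn n →ₐ[ℂ] Module.End L ((Wt (n + 1) × Wt (n + 1)) × ℤ → L))

theorem repEval_eq_op {G : PowerSeries (UDyn n)} {w : Wt (n + 1) × Wt (n + 1)} {m : ℤ}
    {c : ℕ → Wt (n + 1) × Wt (n + 1) → L} (h : ∀ k, φ (PowerSeries.coeff k G) = op (c k) w m) :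
    repEval hε φ G = op (fun γ => ∑ k ∈ Finset.range M, c k γ * ε ^ k) w m := by
  rw [repEval_apply, ← op_sum]
  refine Finset.sum_congr rfl fun k _ => ?_
  rw [← Algebra.commutes, h, algebraMap_mul_op]
  exact op_congr (fun γ => mul_comm _ _) rfl rfl

variable {φ} {F : MvPowerSeries (Fin 2) (UDyn n)}
  {κ : Wt (n + 1) × Wt (n + 1) → MvPowerSeries (Fin 2) L} {w : Wt (n + 1) × Wt (n + 1)}
  (hF : MvPowerSeries.map φ.toRingHom F = opMv κ w)
include hF

theorem rep_coeff (d : Fin 2 →₀ ℕ) : φ (MvPowerSeries.coeff d F) =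
    op (fun γ => MvPowerSeries.coeff d (κ γ)) w ((d 1 : ℤ) - d 0) := by
  rw [← coeff_opMv, ← hF]
  rfl

theorem repEval_laurent (r : ℤ) : repEval hε φ (laurent F r) =
    op (fun γ => (laurentEval hε (u := 0) (v := 1) (by decide) (κ γ)).coeff r) w (-r) := by
  simp only [coeff_laurentEval]
  refine (repEval_eq_op hε φ (c := fun k γ => if 0 ≤ r + k then MvPowerSeries.coeff
    (Finsupp.single 0 (r + k).toNat + Finsupp.single 1 k) (κ γ) else 0) fun k => ?_).trans
    (op_congr (fun γ => Finset.sum_congr rfl fun k _ => by rw [ite_mul, zero_mul]) rfl rfl)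
  rw [laurent, PowerSeries.coeff_mk]
  split_ifs with h h' h'
  · rw [rep_coeff hF, add_comm (k : ℤ) r]
    refine op_congr (fun _ => rfl) rfl ?_
    simp only [bideg, Finsupp.add_apply, Finsupp.single_apply]
    simp
    omega
  · omega
  · omega
  · rw [map_zero]
    exact (op_zero _ _).symm

/-- Here `X 0 = p u` and `X 1 = u⁻¹`, so the natural expansion variable is `u⁻¹`: the variables are
swapped and the exponent changes sign. -/
theorem repEval_laurentMinus (r : ℤ) : repEval hε φ (laurentMinus F r) =
    op (fun γ => (laurentEval hε (u := 1) (v := 0) (by decide) (κ γ)).coeff (-r)) w (-r) := by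
  simp only [coeff_laurentEval]
  refine (repEval_eq_op hε φ (c := fun k γ => if 0 ≤ -r + k then MvPowerSeries.coeff
    (Finsupp.single 1 (-r + k).toNat + Finsupp.single 0 k) (κ γ) else 0) fun k => ?_).trans
    (op_congr (fun γ => Finset.sum_congr rfl fun k _ => by rw [ite_mul, zero_mul]) rfl rfl)
  have e : (k : ℤ) - r = -r + k := by ring
  rw [laurentMinus, PowerSeries.coeff_mk, e]
  split_ifs with h
  · rw [rep_coeff hF, add_comm (Finsupp.single 1 _)]
    refine op_congr (fun _ => rfl) rfl ?_
    simp only [bideg, Finsupp.add_apply, Finsupp.single_apply]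
    simp
    omega
  · rw [map_zero]
    exact (op_zero _ _).symm

end RepSeries

/-! ### The commutator of `e_j` and `f_j`. -/

section EF

variable {n : ℕ} {L : Type*} [CommRing L] [Algebra ℂ L] {ε : L} {M : ℕ} {hε : ε ^ M = 0}
  {φ : UDyn n →ₐ[ℂ] Module.End L ((Wt (n + 1) × Wt (n + 1)) × ℤ → L)} {ħ : ℂ} {Q : Lˣ}
  {Y : Wt (n + 1) × Wt (n + 1) → ℕ → Lˣ} {C₀ : L} (hL : LevelZero hε φ ħ Q Y C₀)
  (hser : ∀ l : Fin (n + 1), MvPowerSeries.map φ.toRingHom (kSer l) =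
    opMv (fun γ => kMv Q (Y γ) l M ε) (uWt (.k l 0)))

include hL hser in
-- The formal inverse of `k_{j+1}` is not computed. Its image is a right inverse, the series of
-- inverse eigenvalues is a left inverse, and so the two agree.
theorem LevelZero.map_psiSer (j : Fin n) : MvPowerSeries.map φ.toRingHom (psiSer j) =
    opMv (fun γ => psiMv Q (Y γ) j M ε) (uWt (.k j.castSucc 0) - uWt (.k j.succ 0)) := by
  have hk : ∀ γ, Y (γ + uWt (.k j.succ 0)) = Y γ := fun γ => by
    rw [← hL.state_k j.succ (γ + _), add_sub_cancel_right]
  have hmul : MvPowerSeries.map φ.toRingHom (kSer j.succ) * MvPowerSeries.map φ.toRingHom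
      (MvPowerSeries.invOfUnit (kSer j.succ) (ukZero j.succ)) = 1 := by
    rw [← map_mul, MvPowerSeries.mul_invOfUnit, map_one]
    rw [← MvPowerSeries.coeff_zero_eq_constantCoeff_apply]
    change kSer j.succ 0 = _
    simp [kSer, ukZero]
  have hinv : opMv (fun γ => Ring.inverse (kMv Q (Y γ) (j + 1) M ε)) (-uWt (.k j.succ 0)) *
      MvPowerSeries.map φ.toRingHom (kSer j.succ) = 1 := by
    rw [hser, opMv_mul, neg_add_cancel, ← opMv_one]
    congr 1
    funext γ
    rw [sub_neg_eq_add, hk]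
    exact Ring.inverse_mul_cancel _ (isUnit_kMv Q (Y γ) (j + 1) hε)
  rw [psiSer, map_mul, ← left_inv_eq_right_inv hinv hmul, hser, opMv_mul, sub_eq_add_neg]
  congr 1
  funext γ
  simp only [hL.state_k]
  rfl

variable (hh : ∀ (l : Fin (n + 1)) (k : ℤ), repEval hε φ (qTwoH ħ k l) =
    op (fun γ => ((Y γ l ^ (2 * k) : Lˣ) : L)) 0 0)

theorem repEval_uc (hc : φ (dyn uWt uDeg UInv .cHalf) = 1) (k : ℤ) :
    repEval hε φ (uc k) = 1 := by
  rw [uc, repEval_C, rep_dynC_zpow φ hc]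

include hL hser in
theorem LevelZero.repEval_psiPlus (j : Fin n) (r : ℤ) : repEval hε φ (psiPlus j r) =
    op (fun γ => (laurentEval hε (u := 0) (v := 1) (by decide) (psiMv Q (Y γ) j M ε)).coeff r)
      (uWt (.k j.castSucc 0) - uWt (.k j.succ 0)) (-r) :=
  repEval_laurent hε (hL.map_psiSer hser j) r

include hL hser hh in
-- The factors `q^{2h}` around the series leave the state unchanged and contribute `Y_j² /
-- Y_{j+1}²`, which is the multiplier `μ` in the partial fraction identity.
theorem LevelZero.repEval_psiMinus (j : Fin n) (r : ℤ) : repEval hε φ (psiMinus ħ j r) =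
    op (fun γ => (((Y γ j) ^ 2 / (Y γ (j + 1)) ^ 2 : Lˣ) : L) *
      (laurentEval hε (u := 1) (v := 0) (by decide) (psiMv Q (Y γ) j M ε)).coeff (-r))
      (uWt (.k j.castSucc 0) - uWt (.k j.succ 0)) (-r) := by
  have h1 := hh j.castSucc 1
  have h2 := hh j.succ (-1)
  rw [Int.cast_one] at h1
  rw [Int.cast_neg, Int.cast_one] at h2
  have hs : ∀ γ, Y (γ - (uWt (.k j.castSucc 0) - uWt (.k j.succ 0))) = Y γ := fun γ => by
    rw [sub_sub_eq_add_sub, hL.state_k, ← hL.state_k j.succ (γ + _), add_sub_cancel_right]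
  rw [psiMinus, map_mul, map_mul, map_mul, repEval_uc hL.cHalf, one_mul, h1, h2,
    repEval_laurentMinus hε (hL.map_psiSer hser j), op_mul_op, op_mul_op]
  refine op_congr (fun γ => ?_) (by rw [zero_add, add_zero]) (by ring)
  rw [sub_zero, zero_add, hs, div_eq_mul_inv, Units.val_mul]
  have e1 : Y γ (j.castSucc : ℕ) ^ (2 * 1 : ℤ) = Y γ j ^ 2 := by
    rw [mul_one]
    exact zpow_ofNat _ 2
  have e2 : Y γ (j.succ : ℕ) ^ (2 * -1 : ℤ) = (Y γ (j + 1) ^ 2)⁻¹ := by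
    rw [mul_neg_one, zpow_neg]
    congr 1
  rw [e1, e2]
  ring

include hL hser hh in
-- The left side is a difference of two delta functions with products of theta amplitudes, the right
-- side a difference of two expansions of one theta quotient. Partial fractions match them, and
-- `hC₀` adjusts the scalar.
theorem LevelZero.ef (hq : qpow ħ 1 - qpow ħ (-1) ≠ 0)
    (hC₀ : C₀ * ((Q : L) - ((Q⁻¹ : Lˣ) : L)) * (1 - (Q : L) ^ 2) *
      ((gTheta hε 1 : L) * (gTheta hε (Q ^ 2) : L)) = Q)
    (hQ : IsUnit (1 - (Q : L) ^ 2)) (j : Fin n) (a b : ℤ) :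
    repEval hε φ (eCur j a * fCur j b - fCur j b * eCur j a - efRhs ħ j a b) = 0 := by
  have hd : algebraMap ℂ L (qpow ħ 1 - qpow ħ (-1))⁻¹ * ((Q : L) - ((Q⁻¹ : Lˣ) : L)) = 1 := by
    have h1 := hL.qpow_int 1
    have h2 := hL.qpow_int (-1)
    rw [zpow_one, Int.cast_one] at h1
    rw [zpow_neg_one, Int.cast_neg, Int.cast_one] at h2
    rw [← h1, ← h2, ← map_sub, ← map_mul, inv_mul_cancel₀ hq, map_one]
  have hk : algebraMap ℂ L (qpow ħ (-node j * (a + b))) =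
      ((Q ^ (-((j : ℤ) + 1) * (a + b)) : Lˣ) : L) := by
    rw [← hL.qpow_int]
    congr 2
    rw [node]
    push_cast
    ring
  -- Both `k_j k_{j+1}⁻¹` and `e_j f_j` have weight `-α_j` in each component.
  have hw : uWt (.k j.castSucc 0) - uWt (.k j.succ 0) =
      uWt (.e j 0) + uWt (.f j 0) := by
    refine Prod.ext ?_ ?_ <;> simp [uWt, simpleRoot, sub_eq_neg_add, add_comm]
  have hkap : repEval hε φ (sfCoeff uWt uDeg UInv (kappa ħ) 0) = 1 := by
    rw [repEval_sfCoeff hε φ hL.cHalf, sfEval_kappa, PowerSeries.coeff_one, if_pos rfl, map_one]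
  rw [efRhs, map_sub, map_sub, map_mul, map_mul, repEval_smul, map_mul, hkap, one_mul, repEval_smul,
    map_sub, map_mul, map_mul, repEval_uc hL.cHalf, repEval_uc hL.cHalf, one_mul, one_mul,
    hL.repEval_psiPlus hser, hL.repEval_psiMinus hser hh, hL.e j, hL.f j, op_mul_op, op_mul_op, hw,
    add_comm (uWt (.f j 0)), op_sub, smul_op, smul_op]
  have hdeg : 0 - a + (0 - b) = -(a + b) := by ring
  have hdeg' : 0 - b + (0 - a) = -(a + b) := by ring
  rw [hdeg, hdeg', op_sub, op_sub]
  refine (op_congr (fun γ => ?_) rfl rfl).trans (op_zero (uWt (.e j 0) + uWt (.f j 0)) (-(a + b)))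
  simp only [Pi.sub_apply, Pi.zero_apply, hL.state_e, hL.state_f, hk]
  obtain ⟨y, hy⟩ : ∃ y, y = Y γ := ⟨_, rfl⟩
  rw [← hy]
  have key := theta_partial_fractions hε Q (Q ^ ((j : ℕ) + 1) / wState Q y (j + 1))
    (Q ^ ((j : ℕ) + 2) / wState Q y j) (Q ^ ((j : ℕ) + 2) / wState Q y (j + 2))
    (y j ^ 2 / y (j + 1) ^ 2) (y (j + 1) * (((y j)⁻¹ : Lˣ) : L)) (by
      rw [show wState Q y ((j : ℕ) + 2) = wState Q y (j + 1) * y (j + 1) ^ 2 * Q⁻¹ from rfl,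
        show wState Q y ((j : ℕ) + 1) = wState Q y j * y j ^ 2 * Q⁻¹ from rfl]
      exact Additive.ofMul.injective (by
        simp only [ofMul_mul, ofMul_pow, ofMul_div, ofMul_inv, add_nsmul]
        abel)) (laurentEval_psiMv hε Q y j) (laurentEval_psiMv_swap hε Q y j) (a + b)
  have e1 : Q ^ ((j : ℕ) + 2) / wState Q y j / (Q ^ 2 * (Q ^ ((j : ℕ) + 1) / wState Q y (j + 1))) =
      Q⁻¹ * fRat Q y j := Additive.ofMul.injective (by
    simp only [fRat, ofMul_mul, ofMul_pow, ofMul_div, ofMul_inv, add_nsmul]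
    abel)
  have e2 : Q ^ ((j : ℕ) + 2) / wState Q y (j + 2) /
      (Q ^ 2 * (Q ^ ((j : ℕ) + 1) / wState Q y (j + 1))) = Q⁻¹ * eRat Q y j :=
    Additive.ofMul.injective (by
      simp only [eRat, ofMul_mul, ofMul_pow, ofMul_div, ofMul_inv, add_nsmul]
      abel)
  have e3 : Q ^ ((j : ℕ) + 2) / wState Q y j / (Q ^ ((j : ℕ) + 1) / wState Q y (j + 1)) =
      Q * fRat Q y j := Additive.ofMul.injective (by
    simp only [fRat, ofMul_mul, ofMul_pow, ofMul_div, add_nsmul]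
    abel)
  have e4 : Q ^ ((j : ℕ) + 2) / wState Q y (j + 2) / (Q ^ ((j : ℕ) + 1) / wState Q y (j + 1)) =
      Q * eRat Q y j := Additive.ofMul.injective (by
    simp only [eRat, ofMul_mul, ofMul_pow, ofMul_div, add_nsmul]
    abel)
  have e5 : Q * (fRat Q y j * Q⁻¹ ^ 2) = Q⁻¹ * fRat Q y j := Additive.ofMul.injective (by
    simp only [ofMul_mul, ofMul_pow, ofMul_inv]
    abel)
  have e6 : Q⁻¹ * (eRat Q y j * Q⁻¹⁻¹ ^ 2) = Q * eRat Q y j := Additive.ofMul.injective (by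
    simp only [ofMul_mul, ofMul_pow, ofMul_inv]
    abel)
  -- The second factor of a product is read in the stepped state, so both supports coincide: at
  -- `eLoc` for `e f` and at `fLoc` for `f e`. Hence only `a + b` matters.
  have w1 : Q ^ (-((j : ℤ) + 1) * (a + b)) *
      (Q ^ 2 * (Q ^ ((j : ℕ) + 1) / wState Q y (j + 1))) ^ (a + b) =
      eLoc Q y j ^ (-a) * (fLoc Q y j * Q⁻¹ ^ 2) ^ (-b) := by
    rw [eLoc, fLoc, ← zpow_add, ← neg_add, zpow_neg, ← inv_zpow, zpow_mul, ← mul_zpow]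
    congr 1
    exact Additive.ofMul.injective (by
      simp only [ofMul_mul, ofMul_pow, ofMul_div, ofMul_inv, ofMul_zpow, add_nsmul, neg_zsmul,
        add_zsmul, natCast_zsmul]
      abel)
  have w2 : Q ^ (-((j : ℤ) + 1) * (a + b)) *
      (Q ^ ((j : ℕ) + 1) / wState Q y (j + 1)) ^ (a + b) =
      fLoc Q y j ^ (-b) * (eLoc Q y j * Q⁻¹⁻¹ ^ 2) ^ (-a) := by
    have h : eLoc Q y j * Q⁻¹⁻¹ ^ 2 = fLoc Q y j := Additive.ofMul.injective (by
      simp only [eLoc, fLoc, ofMul_mul, ofMul_pow, ofMul_inv]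
      abel)
    rw [h, fLoc, ← zpow_add, add_comm, ← neg_add, zpow_neg, ← inv_zpow, add_comm b, zpow_mul,
      ← mul_zpow]
    congr 1
    exact Additive.ofMul.injective (by
      simp only [ofMul_mul, ofMul_pow, ofMul_div, ofMul_inv, ofMul_zpow, add_nsmul, neg_zsmul,
        add_zsmul, natCast_zsmul]
      abel)
  rw [e1, e2, e3, e4] at key
  rw [eAmp_eq, eAmp_eq, fAmp_eq, fAmp_eq, eRat_low_self, fRat_low_self, eLoc_low_self,
    fLoc_low_self, low_self, low_succ, e5, e6, mul_inv, inv_inv]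
  have w1' := congrArg (Units.val : Lˣ → L) w1
  have w2' := congrArg (Units.val : Lˣ → L) w2
  rw [Units.val_mul, Units.val_mul] at w1' w2'
  have hQi : (Q : L) * ((Q⁻¹ : Lˣ) : L) = 1 := Units.mul_inv Q
  have hunit : IsUnit ((1 - (Q : L) ^ 2) * ((gTheta hε 1 : L) * (gTheta hε (Q ^ 2) : L)) *
      ((Q : L) - ((Q⁻¹ : Lˣ) : L))) :=
    (hQ.mul ((Units.isUnit _).mul (Units.isUnit _))).mul (.of_mul_eq_one_right _ hd)
  -- Multiplying by the invertible constants of `hC₀` and of the partial fraction identity removes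
  -- all denominators.
  refine hunit.mul_left_cancel ?_
  rw [mul_zero]
  simp only [Units.val_mul] at *
  generalize (laurentEval hε _ (psiMv Q y j M ε)).coeff (-(a + b)) = B at *
  generalize (laurentEval hε _ (psiMv Q y j M ε)).coeff (a + b) = A at *
  generalize thetaU hε (Q⁻¹ * fRat Q y j) = θ₁ at *
  generalize thetaU hε (Q⁻¹ * eRat Q y j) = θ₂ at *
  generalize thetaU hε (Q * fRat Q y j) = θ₃ at *
  generalize thetaU hε (Q * eRat Q y j) = θ₄ at *
  generalize ((y j ^ 2 / y (j + 1) ^ 2 : Lˣ) : L) = μ at *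
  generalize algebraMap ℂ L (qpow ħ 1 - qpow ħ (-1))⁻¹ = d at *
  generalize ((gTheta hε 1 : L) * (gTheta hε (Q ^ 2) : L)) = g at *
  generalize ((eLoc Q y j ^ (-a) : Lˣ) : L) = E₁ at *
  generalize (((fLoc Q y j * Q⁻¹ ^ 2) ^ (-b) : Lˣ) : L) = F₁ at *
  generalize (((eLoc Q y j * Q⁻¹⁻¹ ^ 2) ^ (-a) : Lˣ) : L) = E₂ at *
  generalize ((fLoc Q y j ^ (-b) : Lˣ) : L) = F₂ at *
  generalize ((Q ^ (-((j : ℤ) + 1) * (a + b)) : Lˣ) : L) = K at *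
  linear_combination ((y (j + 1) : L) * (((y j)⁻¹ : Lˣ) : L) * ((Q : L) * θ₂ * θ₁ * E₁ * F₁ -
      ((Q⁻¹ : Lˣ) : L) * θ₃ * θ₄ * E₂ * F₂)) * hC₀ -
    K * (1 - (Q : L) ^ 2) * g * (μ * B - A) * hd - K * key -
    (y (j + 1) : L) * (((y j)⁻¹ : Lˣ) : L) * (Q : L) ^ 2 * θ₁ * θ₂ * w1' +
    (y (j + 1) : L) * (((y j)⁻¹ : Lˣ) : L) * θ₃ * θ₄ * w2' -
    (y (j + 1) : L) * (((y j)⁻¹ : Lˣ) : L) * θ₃ * θ₄ * E₂ * F₂ * hQi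

end EF

/-! ### The level zero representation -/

section Construction

variable (n M : ℕ) (ħ : ℂ)

/-- The coefficient ring of the representation. -/
abbrev RepRing : Type := TruncRing (FF (n + 1)) M

/-- The coordinate vector at `l`. -/
def coordVec (l : ℕ) (i : Fin (n + 1)) : ℂ := if (i : ℕ) = l then 1 else 0

variable {n} in
theorem unitVec_eq (l : Fin (n + 1)) : unitVec l = coordVec n l := by
  funext i
  rw [unitVec, coordVec, Pi.single_apply]
  exact if_congr Fin.ext_iff rfl rfl

theorem map_coe_zpow {K R : Type*} [Field K] [CommRing R] (f : K →+* R) (x : Kˣ) (k : ℤ) :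
    f ((x : K) ^ k) = ((Units.map f.toMonoidHom x ^ k : Rˣ) : R) := by
  rw [← map_zpow, ← Units.val_zpow_eq_zpow_val]
  rfl

/-- `q` in the coefficient ring. -/
def qUnit : (RepRing n M)ˣ :=
  Units.map (algebraMap ℂ (RepRing n M)).toMonoidHom (Units.mk0 (qpow ħ 1) (Complex.exp_ne_zero _))

theorem qpow_intCast (k : ℤ) : qpow ħ k = qpow ħ 1 ^ k := by
  rw [qpow, qpow, ← Complex.exp_int_mul, mul_one, mul_comm]

theorem qUnit_zpow (k : ℤ) : algebraMap ℂ (RepRing n M) (qpow ħ k) = ((qUnit n M ħ ^ k :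
    (RepRing n M)ˣ) : RepRing n M) := by
  rw [qpow_intCast]
  exact map_coe_zpow (algebraMap ℂ (RepRing n M)) (Units.mk0 (qpow ħ 1) (Complex.exp_ne_zero _)) k

/-- The value of `q ^ h` at the weight `γ`. -/
def stateUnit (γ : Wt (n + 1) × Wt (n + 1)) (l : ℕ) : (RepRing n M)ˣ :=
  Units.map (algebraMap (FF (n + 1)) (RepRing n M)).toMonoidHom
    (Units.mk0 (Mero.shift γ (expFn ħ (coordVec n l) (-coordVec n l)))
      ((map_ne_zero _).mpr (expFn_ne_zero _ _ _)))

theorem coe_stateUnit (γ : Wt (n + 1) × Wt (n + 1)) (l : ℕ) :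
    (stateUnit n M ħ γ l : RepRing n M) = algebraMap (FF (n + 1)) (RepRing n M)
      (Mero.shift γ (expFn ħ (coordVec n l) (-coordVec n l))) := rfl

/-- The exponential defining the state is an eigenvector of shifts, so a generator multiplies it by
a power of `q` read off from its weight. -/
theorem stateUnit_sub (γ w : Wt (n + 1) × Wt (n + 1)) (l : ℕ) (k : ℤ)
    (h : pairing (coordVec n l) (-coordVec n l) (-w) = k) :
    stateUnit n M ħ (γ - w) l = stateUnit n M ħ γ l * qUnit n M ħ ^ k := by
  refine Units.ext ?_
  rw [Units.val_mul, coe_stateUnit, coe_stateUnit, sub_eq_add_neg, ← Mero.shift_shift, shift_expFn,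
    h, map_mul, Mero.shift_const, map_mul, ← IsScalarTower.algebraMap_apply, qUnit_zpow, mul_comm]

theorem sum_coordVec_mul (l : ℕ) (x : Fin (n + 1) → ℂ) (j : Fin (n + 1)) (h : (j : ℕ) = l) :
    ∑ i, coordVec n l i * x i = x j := by
  rw [Finset.sum_eq_single j]
  · rw [coordVec, if_pos h, one_mul]
  · intro i _ hi
    rw [coordVec, if_neg (fun hc => hi (Fin.ext (hc.trans h.symm))), zero_mul]
  · intro hj
    exact absurd (Finset.mem_univ j) hj

/-- States are indexed by all natural numbers; beyond the last coordinate both sides are zero. -/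
theorem sum_coordVec_simpleRoot (l : ℕ) (j : Fin n) :
    ∑ i, coordVec n l i * (simpleRoot j : Fin (n + 1) → ℂ) i =
      ((if l = j then 1 else 0) - (if l = j + 1 then 1 else 0) : ℤ) := by
  have hs : ∀ i, (simpleRoot j : Fin (n + 1) → ℂ) i =
      (if i = j.castSucc then 1 else 0) - (if i = j.succ then 1 else 0) := fun i => by
    change ((if i = j.castSucc then (1 : ℂ) else 0) - 1 / _) -
      ((if i = j.succ then (1 : ℂ) else 0) - 1 / _) = _
    ring
  by_cases hl : l < n + 1
  · rw [sum_coordVec_mul n l _ ⟨l, hl⟩ rfl, hs]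
    simp only [Fin.ext_iff, Fin.val_castSucc, Fin.val_succ]
    push_cast
    rfl
  · have h1 : l ≠ j := by omega
    have h2 : l ≠ j + 1 := by omega
    rw [if_neg h1, if_neg h2, Finset.sum_eq_zero]
    · simp
    · intro i _
      rw [coordVec, if_neg (by omega), zero_mul]

theorem stateUnit_e (j : Fin n) (γ : Wt (n + 1) × Wt (n + 1)) :
    stateUnit n M ħ (γ - uWt (.e j 0)) = low (qUnit n M ħ) j (stateUnit n M ħ γ) := by
  funext l
  rw [stateUnit_sub n M ħ γ _ l (-((if l = j then 1 else 0) - (if l = j + 1 then 1 else 0) : ℤ))]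
  · rw [low]
    by_cases h : l = j
    · have h' : l ≠ j + 1 := by omega
      rw [if_pos h, if_pos h, if_neg h', sub_zero, zpow_neg_one]
    · by_cases h' : l = j + 1
      · rw [if_neg h, if_neg h, if_pos h', if_pos h', zero_sub, neg_neg, zpow_one]
      · rw [if_neg h, if_neg h, if_neg h', if_neg h', sub_zero, neg_zero, zpow_zero, mul_one]
  · have hs := sum_coordVec_simpleRoot n l j
    have e : pairing (coordVec n l) (-coordVec n l) (-uWt (.e j 0)) =
        -∑ i, coordVec n l i * (simpleRoot j : Fin (n + 1) → ℂ) i := by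
      simp [pairing, uWt]
    rw [e, hs, Int.cast_neg]

theorem stateUnit_f (j : Fin n) (γ : Wt (n + 1) × Wt (n + 1)) :
    stateUnit n M ħ (γ - uWt (.f j 0)) = low (qUnit n M ħ)⁻¹ j (stateUnit n M ħ γ) := by
  funext l
  rw [stateUnit_sub n M ħ γ _ l ((if l = j then 1 else 0) - (if l = j + 1 then 1 else 0) : ℤ)]
  · rw [low]
    by_cases h : l = j
    · have h' : l ≠ j + 1 := by omega
      rw [if_pos h, if_pos h, if_neg h', sub_zero, zpow_one, inv_inv]
    · by_cases h' : l = j + 1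
      · rw [if_neg h, if_neg h, if_pos h', if_pos h', zero_sub, zpow_neg_one]
      · rw [if_neg h, if_neg h, if_neg h', if_neg h', sub_zero, zpow_zero, mul_one]
  · rw [← sum_coordVec_simpleRoot n l j]
    simp [pairing, uWt]

/-- The state depends only on `h = (P + h) - P`, so the diagonal weights of the `k_l` leave it
fixed. -/
theorem stateUnit_diag (v : Wt (n + 1)) (γ : Wt (n + 1) × Wt (n + 1)) :
    stateUnit n M ħ (γ - (v, v)) = stateUnit n M ħ γ := by
  funext l
  rw [stateUnit_sub n M ħ γ _ l 0 (by simp [pairing]), zpow_zero, mul_one]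

theorem expFn_zpow {N : ℕ} (X Y : Fin N → ℂ) (k : ℤ) :
    expFn ħ ((k : ℂ) • X) ((k : ℂ) • Y) = expFn ħ X Y ^ k := by
  have hnat : ∀ m : ℕ, expFn ħ ((m : ℂ) • X) ((m : ℂ) • Y) = expFn ħ X Y ^ m := fun m => by
    induction m with
    | zero => rw [Nat.cast_zero, zero_smul, zero_smul, expFn_zero, pow_zero]
    | succ m ih => rw [pow_succ, ← ih, expFn_add, Nat.cast_succ, add_smul, add_smul, one_smul,
        one_smul]
  obtain ⟨m, rfl | rfl⟩ := k.eq_nat_or_neg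
  · rw [zpow_natCast, Int.cast_natCast, hnat]
  · rw [zpow_neg, zpow_natCast, ← hnat, Int.cast_neg, Int.cast_natCast]
    refine eq_inv_of_mul_eq_one_left ?_
    rw [expFn_add, ← add_smul, ← add_smul, neg_add_cancel, zero_smul, zero_smul, expFn_zero]

variable {n}

/-- The coefficients of the operators by which the generators act. -/
def levelZeroCoeff (C₀ : RepRing n M) :
    UGen n → Wt (n + 1) × Wt (n + 1) → RepRing n M
  | .e j m => fun γ => eAmp (truncX_pow_self (FF (n + 1)) M) (qUnit n M ħ) (stateUnit n M ħ γ) j *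
      ((eLoc (qUnit n M ħ) (stateUnit n M ħ γ) j ^ m : (RepRing n M)ˣ) : RepRing n M)
  | .f j m => fun γ => fAmp (truncX_pow_self (FF (n + 1)) M) (qUnit n M ħ) (stateUnit n M ħ γ) j C₀ *
      ((fLoc (qUnit n M ħ) (stateUnit n M ħ γ) j ^ m : (RepRing n M)ˣ) : RepRing n M)
  | .k l m => fun γ => MvPowerSeries.coeff (bideg (-m).toNat m.toNat)
      (kMv (qUnit n M ħ) (stateUnit n M ħ γ) l M (truncX _ M))
  | .kZeroInv l => fun γ => Ring.inverse (MvPowerSeries.coeff (bideg 0 0)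
      (kMv (qUnit n M ħ) (stateUnit n M ħ γ) l M (truncX _ M)))

theorem uInv_wt (x y : UGen n) (h : UInv x y) : uWt x + uWt y = 0 := by
  rcases h with l | l
  · exact Prod.ext (neg_add_cancel _) (neg_add_cancel _)
  · exact Prod.ext (add_neg_cancel _) (add_neg_cancel _)

theorem uInv_deg (x y : UGen n) (h : UInv x y) : uDeg x + uDeg y = 0 := by
  rcases h with l | l <;> rfl

theorem levelZeroCoeff_inv (C₀ : RepRing n M) (x y : UGen n) (h : UInv x y)
    (γ : Wt (n + 1) × Wt (n + 1)) :
    levelZeroCoeff M ħ C₀ x γ * levelZeroCoeff M ħ C₀ y (γ - uWt x) = 1 := by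
  have hu : ∀ (l : ℕ) γ, IsUnit (MvPowerSeries.coeff (bideg 0 0)
      (kMv (qUnit n M ħ) (stateUnit n M ħ γ) l M (truncX _ M))) := fun l γ => by
    have h := MvPowerSeries.isUnit_iff_constantCoeff.mp
      (isUnit_kMv (qUnit n M ħ) (stateUnit n M ħ γ) l (truncX_pow_self (FF (n + 1)) M))
    rw [← MvPowerSeries.coeff_zero_eq_constantCoeff_apply] at h
    rwa [bideg, Finsupp.single_zero, Finsupp.single_zero, add_zero]
  rcases h with l | l
  · change MvPowerSeries.coeff (bideg 0 0) _ * Ring.inverse (MvPowerSeries.coeff (bideg 0 0)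
      (kMv _ (stateUnit n M ħ (γ - (-epsBar l, -epsBar l))) _ _ _)) = 1
    rw [stateUnit_diag]
    exact Ring.mul_inverse_cancel _ (hu l γ)
  · change Ring.inverse (MvPowerSeries.coeff (bideg 0 0) _) * MvPowerSeries.coeff (bideg 0 0)
      (kMv _ (stateUnit n M ħ (γ - (epsBar l, epsBar l))) _ _ _) = 1
    rw [stateUnit_diag]
    exact Ring.inverse_mul_cancel _ (hu l γ)

/-- The level zero representation. -/
def levelZeroRep (C₀ : RepRing n M) :
    UDyn n →ₐ[ℂ] Module.End (RepRing n M) ((Wt (n + 1) × Wt (n + 1)) × ℤ → RepRing n M) :=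
  dynRep (levelZeroCoeff M ħ C₀) uInv_wt uInv_deg (levelZeroCoeff_inv M ħ C₀)

theorem levelZeroRep_dyn (C₀ : RepRing n M) (x : DynGen (n + 1) (UGen n)) :
    levelZeroRep M ħ C₀ (dyn uWt uDeg UInv x) = repGen uWt uDeg (levelZeroCoeff M ħ C₀) x :=
  dynLift_dyn _ _ _ _ _ _

theorem map_kSer (C₀ : RepRing n M) (l : Fin (n + 1)) :
    MvPowerSeries.map (levelZeroRep M ħ C₀).toRingHom (kSer l) =
      opMv (fun γ => kMv (qUnit n M ħ) (stateUnit n M ħ γ) l M (truncX _ M)) (uWt (.k l 0)) := by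
  ext1 d
  rw [coeff_opMv, MvPowerSeries.coeff_map]
  change levelZeroRep M ħ C₀ (kSer l d) = _
  have hd : d = bideg (d 0) (d 1) := exp_fin_two (by decide) d
  rw [kSer]
  split_ifs with h1 h0
  · rw [ugen, levelZeroRep_dyn]
    refine op_congr (fun γ => ?_) rfl ?_
    · have h2 : (-(-(d 0 : ℤ))).toNat = d 0 := by omega
      have h3 : (-(d 0 : ℤ)).toNat = 0 := by omega
      have e : bideg (-(-(d 0 : ℤ))).toNat (-(d 0 : ℤ)).toNat = d := by
        rw [h2, h3, ← h1]
        exact hd.symm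
      exact congrArg (fun d => MvPowerSeries.coeff d (kMv _ _ _ _ _)) e
    · rw [h1]
      change -(d 0 : ℤ) = _
      simp
  · rw [ugen, levelZeroRep_dyn]
    refine op_congr (fun γ => ?_) rfl ?_
    · have h2 : (-(d 1 : ℤ)).toNat = 0 := by omega
      have h3 : (d 1 : ℤ).toNat = d 1 := by omega
      have e : bideg (-(d 1 : ℤ)).toNat (d 1 : ℤ).toNat = d := by
        rw [h2, h3, ← h0]
        exact hd.symm
      exact congrArg (fun d => MvPowerSeries.coeff d (kMv _ _ _ _ _)) e
    · rw [h0]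
      change (d 1 : ℤ) = _
      simp
  · refine (map_zero (levelZeroRep M ħ C₀)).trans
      ((op_zero (L := RepRing n M) (uWt (.k l 0)) ((d 1 : ℤ) - d 0)).symm.trans ?_)
    refine op_congr (fun γ => ?_) rfl rfl
    exact ((if_neg h1).trans (if_neg h0)).symm

theorem repEval_qTwoH (C₀ : RepRing n M) (l : Fin (n + 1)) (k : ℤ) :
    repEval (truncX_pow_self (FF (n + 1)) M) (levelZeroRep M ħ C₀) (qTwoH ħ k l) =
      op (fun γ => ((stateUnit n M ħ γ l ^ (2 * k) : (RepRing n M)ˣ) : RepRing n M)) 0 0 := by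
  rw [qTwoH, repEval_C, dynFn_apply, levelZeroRep_dyn]
  change op (fun γ => algebraMap (FF (n + 1)) (RepRing n M) (Mero.shift γ (expFn ħ _ _))) 0 0 = _
  refine op_congr (fun γ => ?_) rfl rfl
  have e : expFn ħ ((2 * (k : ℂ)) • unitVec l) (-((2 * (k : ℂ)) • unitVec l)) =
      expFn ħ (coordVec n l) (-coordVec n l) ^ (2 * k) := by
    rw [← expFn_zpow, unitVec_eq, smul_neg]
    push_cast
    rfl
  rw [e, map_zpow₀]
  exact map_coe_zpow (algebraMap (FF (n + 1)) (RepRing n M))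
    (Units.mk0 (Mero.shift γ (expFn ħ (coordVec n l) (-coordVec n l))) _) (2 * k)

theorem levelZero_levelZeroRep (C₀ : RepRing n M) :
    LevelZero (truncX_pow_self (FF (n + 1)) M) (levelZeroRep M ħ C₀) ħ (qUnit n M ħ)
      (stateUnit n M ħ) C₀ where
  cHalf := levelZeroRep_dyn M ħ C₀ .cHalf
  qpow_int := qUnit_zpow n M ħ
  e j r := by
    rw [eCur, repEval_C, ugen, levelZeroRep_dyn]
    exact op_congr (fun γ => rfl) rfl (zero_sub r).symm
  f j r := by
    rw [fCur, repEval_C, ugen, levelZeroRep_dyn]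
    exact op_congr (fun γ => rfl) rfl (zero_sub r).symm
  k l r := by
    rw [kCur, repEval_laurent _ (map_kSer M ħ C₀ l)]
    refine op_congr (fun γ => ?_) rfl (zero_sub r).symm
    rw [kMv, laurentEval_pairMv, coeff_pairLaurent]
    rfl
  state_e := stateUnit_e n M ħ
  state_f := stateUnit_f n M ħ
  state_k l γ := stateUnit_diag n M ħ _ γ

theorem qpow_sub_ne_zero (hq : ∀ m : ℕ, 0 < m → qpow ħ m ≠ 1) : qpow ħ 1 - qpow ħ (-1) ≠ 0 := by
  intro h
  refine hq 2 two_pos ?_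
  have h1 : qpow ħ (1 + 1) = qpow ħ 1 * qpow ħ 1 := by
    rw [qpow, qpow, ← Complex.exp_add, mul_add]
  have h2 : qpow ħ (-1 + 1) = qpow ħ (-1) * qpow ħ 1 := by
    rw [qpow, qpow, qpow, ← Complex.exp_add, mul_add]
  rw [Nat.cast_ofNat, ← one_add_one_eq_two, h1]
  nth_rewrite 1 [sub_eq_zero.mp h]
  rw [← h2, neg_add_cancel, qpow, mul_zero, Complex.exp_zero]

theorem isUnit_one_sub_qUnit_sq (hq : ∀ m : ℕ, 0 < m → qpow ħ m ≠ 1) :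
    IsUnit (1 - (qUnit n M ħ : RepRing n M) ^ 2) := by
  have h := qUnit_zpow n M ħ 2
  rw [show (qUnit n M ħ : (RepRing n M)ˣ) ^ (2 : ℤ) = qUnit n M ħ ^ 2 from zpow_ofNat _ 2,
    Units.val_pow_eq_pow_val] at h
  rw [← h, ← map_one (algebraMap ℂ (RepRing n M)), ← map_sub]
  refine (IsUnit.mk0 _ (sub_ne_zero.mpr (Ne.symm ?_))).map _
  have := hq 2 two_pos
  exact_mod_cast this

/-- The theta constants are units because `ε` is nilpotent, and `q² ≠ 1` makes `q - q⁻¹` and `1 -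
q²` invertible constants. -/
theorem exists_normalization (hq : ∀ m : ℕ, 0 < m → qpow ħ m ≠ 1) : ∃ C₀ : RepRing n M,
    C₀ * ((qUnit n M ħ : RepRing n M) - (((qUnit n M ħ)⁻¹ : (RepRing n M)ˣ) : RepRing n M)) *
      (1 - (qUnit n M ħ : RepRing n M) ^ 2) *
      ((gTheta (truncX_pow_self (FF (n + 1)) M) 1 : RepRing n M) *
        (gTheta (truncX_pow_self (FF (n + 1)) M) (qUnit n M ħ ^ 2) : RepRing n M)) =
      qUnit n M ħ := by
  have h₁ : IsUnit ((qUnit n M ħ : RepRing n M) -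
      (((qUnit n M ħ)⁻¹ : (RepRing n M)ˣ) : RepRing n M)) := by
    have h1 := qUnit_zpow n M ħ 1
    have h2 := qUnit_zpow n M ħ (-1)
    rw [zpow_one, Int.cast_one] at h1
    rw [zpow_neg_one, Int.cast_neg, Int.cast_one] at h2
    rw [← h1, ← h2, ← map_sub]
    exact (IsUnit.mk0 _ (qpow_sub_ne_zero ħ hq)).map _
  obtain ⟨u, hu⟩ := (h₁.mul (isUnit_one_sub_qUnit_sq M ħ hq)).mul
    ((Units.isUnit (gTheta (truncX_pow_self (FF (n + 1)) M) 1)).mul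
      (Units.isUnit (gTheta (truncX_pow_self (FF (n + 1)) M) (qUnit n M ħ ^ 2))))
  refine ⟨qUnit n M ħ * ((u⁻¹ : (RepRing n M)ˣ) : RepRing n M), ?_⟩
  rw [mul_assoc, mul_assoc, ← mul_assoc (_ - _), ← hu, mul_assoc, Units.inv_mul, mul_one]

/-- The level zero representation with truncation order `k + 1` satisfies all relations, while `p ^
k` acts by the nonzero scalar `ε ^ k`. -/
theorem uRels_p_pow_ne_zero (hq : ∀ m : ℕ, 0 < m → qpow ħ m ≠ 1) (k : ℕ) :
    TopAlg.p uWt uDeg UInv (uRels n ħ) ^ k ≠ 0 := by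
  obtain ⟨C₀, hC₀⟩ := exists_normalization (n := n) (k + 1) ħ hq
  have hL := levelZero_levelZeroRep (k + 1) ħ C₀
  refine TopAlg.p_pow_ne_zero _ k (levelZeroRep (k + 1) ħ C₀).toRingHom
    (algebraMap (RepRing n (k + 1)) _ (truncX _ (k + 1))) (commute_algebraMap_op _)
    (algebraMap_pow_eq_zero _ (truncX_pow_self _ _)) (fun h => ?_) fun r hr => ?_
  · rw [← map_pow, algebraMap_eq_op] at h
    have h1 := congrFun (LinearMap.congr_fun h fun _ => 1) 0
    rw [op_apply, mul_one] at h1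
    exact truncX_pow_ne_zero _ _ h1
  change repEval (truncX_pow_self (FF (n + 1)) (k + 1)) _ r = 0
  rcases hr with ⟨l, a, b⟩ | ⟨j, l, h, a, b⟩ | ⟨j, a, b⟩ | ⟨j, a, b⟩ | ⟨j, l, h, h', a, b⟩ |
    ⟨j, a, b⟩ | ⟨j, a, b⟩ | ⟨j, l, h, h', a, b⟩ | ⟨j, a, b⟩ | ⟨i, j, h, a, b⟩ | ⟨i, j, h, a, b⟩ |
    ⟨j, a, b⟩ | ⟨i, j, h, a, b⟩ | ⟨i, j, h, a, b⟩ | ⟨i, j, h, a, b⟩ | ⟨j, a, b⟩ |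
    ⟨i, j, h, a, b, c⟩ | ⟨i, j, h, a, b, c⟩
  · exact hL.kk l a b
  · exact hL.kk_lt j l a b
  · exact hL.ke j a b
  · exact hL.ke_succ j a b
  · exact hL.ke_far j l h h' a b
  · exact hL.kf j a b
  · exact hL.kf_succ j a b
  · exact hL.kf_far j l h h' a b
  · exact hL.ee j a b
  · exact hL.ee_succ i j h a b
  · exact hL.ee_far i j h a b
  · exact hL.ff j a b
  · exact hL.ff_succ i j h a b
  · exact hL.ff_far i j h a b
  · exact hL.ef_ne i j h a b
  · exact hL.ef (map_kSer _ _ _) (repEval_qTwoH _ _ _) (qpow_sub_ne_zero ħ hq) hC₀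
      (isUnit_one_sub_qUnit_sq _ ħ hq) j a b
  · rw [map_add, hL.serre_e_term i j h, hL.serre_e_term i j h, add_zero]
  · rw [map_add, hL.serre_f_term i j h, hL.serre_f_term i j h, add_zero]

end Construction

end EllQG
end

/-! ### The topological `𝓗`-algebra structures on both elliptic algebras. -/

theorem mainTheorem10 (n : ℕ) (hn : 1 ≤ n) (ħ : ℂ)
    (hq : ∀ m : ℕ, 0 < m → EllQG.qpow ħ m ≠ 1) :
    (∃ S : EllQG.HAlgebra (EllQG.Wt (n + 1)) (EllQG.Uqp n ħ) (EllQG.TopAlg.p _ _ _ _),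
      (∀ α β, S.comp α β = EllQG.TopAlg.weightSpace _ _ _ _ ħ α β) ∧
      (∀ f, S.μl f = EllQG.TopAlg.left _ _ _ _ f) ∧
      (∀ f, S.μr f = EllQG.TopAlg.right _ _ _ _ f)) ∧
    (∃ S : EllQG.HAlgebra (EllQG.Wt (n + 1)) (EllQG.Eqp (n + 1) ħ) (EllQG.TopAlg.p _ _ _ _),
      (∀ α β, S.comp α β = EllQG.TopAlg.weightSpace _ _ _ _ ħ α β) ∧
      (∀ f, S.μl f = EllQG.TopAlg.left _ _ _ _ f) ∧
      (∀ f, S.μr f = EllQG.TopAlg.right _ _ _ _ f) ∧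
      (∀ (i j : Fin (n + 1)) (m : ℤ),
        EllQG.TopAlg.gen EllQG.lWt EllQG.lDeg EllQG.lInv (EllQG.eRels (n + 1) ħ)
          (.gen ⟨i, j, m⟩) ∈ S.comp (-EllQG.epsBar i) (-EllQG.epsBar j))) := by
  have hħ : ħ ≠ 0 := by
    rintro rfl
    exact hq 1 one_pos (by simp [EllQG.qpow])
  refine ⟨EllQG.TopAlg.exists_hAlgebra (EllQG.uRels n ħ) hħ EllQG.uInv_wt
    (EllQG.uRels_p_pow_ne_zero ħ hq), ?_⟩
  -- No pair of generators of `E` is declared inverse, so the balance of weights is vacuous.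
  obtain ⟨S, hS, hl, hr⟩ := EllQG.TopAlg.exists_hAlgebra (EllQG.eRels (n + 1) ħ) hħ
    (fun _ _ h => h.elim) (EllQG.eRels_p_pow_ne_zero _ _)
  refine ⟨S, hS, hl, hr, fun i j m => ?_⟩
  rw [hS]
  exact EllQG.lGen_mem_weightSpace (n + 1) ħ i j m
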